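/- All graphs are finite undirected multigraphs, possibly with self-loops. A *cycle* is a sequence of distinct vertices that is a vertex with a self-loop (length $1$), two vertices joined by a double edge (length $2$), or at least three vertices, each adjacent to the next and the last adjacent to the first; its *length* is its number of vertices. $\text{girth}(H)$ is the least length of a cycle of $H$, and $\infty$ if $H$ has no cycle. $G-S$ is the graph induced on $V\setminus S$. $\text{reduce}(G)$ is the graph obtained by exhaustively applying the following rules to $G$ (where a self-loop contributes $2$ to the degree of its vertex): delete a vertex of degree at most $1$; if a vertex of degree exactly $2$ is not incident to a self-loop, delete it and connect its two (not necessarily distinct) neighbors by a new edge; if an edge (possibly a self-loop) has multiplicity larger than $2$, reduce its multiplicity to $2$. Statement. There is a deterministic algorithm that, given a multigraph $G=(V,E)$ with $V \neq \emptyset$ in which every edge has multiplicity at most $2$ (by its adjacency lists, in random access memory) and two integers $k>0$ and $g>6$, runs in time $k^{O(1)}\cdot|V|$, that is, performs at most $C\,k^{C}\,|V|$ elementary steps for a constant $C$ that depends on none of $G$, $k$, $g$, and either finds $k$ vertex-disjoint cycles in $G$, or finds a (possibly empty) set $S\subseteq V$ such that $|S|<gk$ and $\text{girth}(\text{reduce}(G-S))>g$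 (for every order in which the rules are applied). -/

import Mathlib

/-! ### Finite multigraphs -/

/-- A finite undirected multigraph with vertices in `α`: a finite vertex set together with a
multiplicity for every unordered pair of vertices. The multiplicity of the diagonal pair `s(v, v)`
is the number of self-loops at `v`. -/
structure Multigraph (α : Type*) where
  /-- The vertex set. -/
  verts : Finset α
  /-- The multiplicity of an edge; it is zero for pairs that are not edges. -/
  mult : Sym2 α → ℕ
  /-- The ends of an edge are vertices. -/
  mem_verts : ∀ e, mult e ≠ 0 → ∀ v ∈ e, v ∈ verts

namespace Multigraph

variable {α : Type*}

/-- The degree of `v`: the number of edges incident to `v`, a self-loop counted twice. -/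
def degree (G : Multigraph α) (v : α) : ℕ :=
  (∑ u ∈ G.verts, G.mult s(v, u)) + G.mult s(v, v)

/-- The graph `G - S`. -/
def deleteVerts [DecidableEq α] (G : Multigraph α) (S : Finset α) : Multigraph α where
  verts := G.verts \ S
  mult e := if ∀ v ∈ S, v ∉ e then G.mult e else 0
  mem_verts e he v hv := by
    split_ifs at he with h
    · exact Finset.mem_sdiff.2 ⟨G.mem_verts e he v hv, fun hS => h v hS hv⟩
    · exact absurd rfl he

/-- A list of distinct vertices is (the vertex sequence of) a cycle: a vertex with a self-loop,
two vertices joined by a (at least) double edge, or at least three vertices, each adjacent to the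
next one and the last one adjacent to the first one. The length of the cycle is its number of
vertices, that is, the length of the list. -/
def IsCycle (G : Multigraph α) : List α → Prop
  | [] => False
  | [v] => 1 ≤ G.mult s(v, v)
  | [u, v] => u ≠ v ∧ 2 ≤ G.mult s(u, v)
  | u :: v :: w :: l => (u :: v :: w :: l).Nodup ∧
      (u :: v :: w :: (l ++ [u])).IsChain (fun a b => 1 ≤ G.mult s(a, b))

/-- The girth: the least length of a cycle, and `⊤` if there is no cycle. -/
noncomputable def girth (G : Multigraph α) : ℕ∞ :=
  ⨅ (c : List α) (_ : G.IsCycle c), (c.length : ℕ∞)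

/-- One application of one of the three reduction rules turns `G` into `H`. -/
inductive ReduceStep [DecidableEq α] (G H : Multigraph α) : Prop
  /-- Delete a vertex of degree at most 1. -/
  | degLeOne (v : α) (hv : v ∈ G.verts) (hdeg : G.degree v ≤ 1)
      (hH : H = G.deleteVerts {v}) : ReduceStep G H
  /-- Delete a vertex `v` of degree exactly 2 that is not incident to a self-loop, and connect its
  two (possibly equal) neighbours `x` and `y` by a new edge. -/
  | degTwo (v x y : α) (hv : v ∈ G.verts) (hdeg : G.degree v = 2) (hloop : G.mult s(v, v) = 0)
      (hnbrs : ∀ u, G.mult s(v, u) = (if u = x then 1 else 0) + (if u = y then 1 else 0))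
      (hverts : H.verts = G.verts \ {v})
      (hmult : ∀ e, H.mult e = (G.deleteVerts {v}).mult e + if e = s(x, y) then 1 else 0) :
      ReduceStep G H
  /-- Reduce the multiplicity of an edge (possibly a self-loop) of multiplicity larger than 2
  to 2. -/
  | multi (e : Sym2 α) (he : 2 < G.mult e) (hverts : H.verts = G.verts)
      (hmult : ∀ f, H.mult f = if f = e then 2 else G.mult f) : ReduceStep G H

/-- `H` is a result `reduce(G)` of exhaustively applying the three reduction rules to `G`. -/
def IsReduce [DecidableEq α] (G H : Multigraph α) : Prop :=
  Relation.ReflTransGen ReduceStep G H ∧ ∀ K : Multigraph α, ¬ ReduceStep H K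

/-- Every exhaustive application of the rules comes to an end, so a reduced graph exists. -/
theorem exists_isReduce [DecidableEq α] (G : Multigraph α) :
    ∃ H : Multigraph α, G.IsReduce H := by
  let f : Multigraph α → ℕ ×ₗ ℕ :=
    fun G => toLex (G.verts.card, ∑ e ∈ G.verts.sym2, G.mult e)
  have key : ∀ G H : Multigraph α, ReduceStep G H → f H < f G := by
    intro G H h
    have hcard : ∀ v ∈ G.verts, (G.verts \ {v}).card < G.verts.card := fun v hv =>
      Finset.card_lt_card (Finset.sdiff_singleton_eq_erase v G.verts ▸ Finset.erase_ssubset hv)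
    cases h with
    | degLeOne v hv hdeg hH =>
      subst hH
      exact Prod.Lex.toLex_lt_toLex.2 (Or.inl (hcard v hv))
    | degTwo v x y hv hdeg hloop hnbrs hverts hmult =>
      refine Prod.Lex.toLex_lt_toLex.2 (Or.inl ?_)
      simpa only [hverts] using hcard v hv
    | multi e he hverts hmult =>
      refine Prod.Lex.toLex_lt_toLex.2 (Or.inr ⟨by simp only [hverts], ?_⟩)
      simp only [hverts]
      refine Finset.sum_lt_sum (fun i _ => ?_) ⟨e, ?_, ?_⟩
      · rw [hmult]
        split_ifs with h
        · subst h
          exact he.le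
        · exact le_rfl
      · exact Finset.mem_sym2_iff.2 (G.mem_verts e (by omega))
      · rw [hmult, if_pos rfl]
        exact he
  induction hn : f G using WellFoundedLT.induction generalizing G with
  | ind a ih =>
    by_cases h : ∃ K, ReduceStep G K
    · obtain ⟨K, hK⟩ := h
      obtain ⟨H, hKH, hH⟩ := ih (f K) (hn ▸ key G K hK) K rfl
      exact ⟨H, Relation.ReflTransGen.head hK hKH, hH⟩
    · exact ⟨G, Relation.ReflTransGen.refl, fun K hK => h ⟨K, hK⟩⟩

end Multigraph

/-! ### A random access machine

A deterministic random access machine with finitely many registers and finitely many arrays of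
natural numbers (those that occur in the program), indirect addressing, and structured programs.
The only arithmetic is to add or subtract 1, so after `t` steps no stored number exceeds the
largest number in the input and the program by more than `t`: charging one unit for every
elementary operation is realistic. -/

namespace RAM

/-- The memory: the registers, and the arrays. -/
structure Mem where
  /-- The content of register `x`. -/
  var : ℕ → ℕ
  /-- The content of cell `i` of array `a`. -/
  arr : ℕ → ℕ → ℕ

/-- Expressions: constants, registers, array cells, successor and (truncated) predecessor. -/
inductive Expr where
  | const (c : ℕ)
  | var (x : ℕ)
  | get (a : ℕ) (i : Expr)
  | succ (e : Expr)
  | pred (e : Expr)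

/-- The value of an expression. -/
def Expr.eval (s : Mem) : Expr → ℕ
  | .const c => c
  | .var x => s.var x
  | .get a i => s.arr a (i.eval s)
  | .succ e => e.eval s + 1
  | .pred e => e.eval s - 1

/-- The time to evaluate an expression: the number of operations in it. -/
def Expr.cost : Expr → ℕ
  | .const _ => 1
  | .var _ => 1
  | .get _ i => i.cost + 1
  | .succ e => e.cost + 1
  | .pred e => e.cost + 1

/-- Tests. -/
inductive Test where
  | lt (e f : Expr)
  | eq (e f : Expr)

/-- The test succeeds. -/
def Test.Holds (s : Mem) : Test → Prop
  | .lt e f => e.eval s < f.eval s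
  | .eq e f => e.eval s = f.eval s

/-- The time to evaluate a test. -/
def Test.cost : Test → ℕ
  | .lt e f => e.cost + f.cost + 1
  | .eq e f => e.cost + f.cost + 1

/-- Programs. -/
inductive Prog where
  | skip
  | assign (x : ℕ) (e : Expr)
  | store (a : ℕ) (i e : Expr)
  | seq (p q : Prog)
  | ite (b : Test) (p q : Prog)
  | while (b : Test) (p : Prog)

/-- Write `m` into register `x`. -/
def Mem.setVar (s : Mem) (x m : ℕ) : Mem :=
  { s with var := Function.update s.var x m }

/-- Write `m` into cell `i` of array `a`. -/
def Mem.setArr (s : Mem) (a i m : ℕ) : Mem :=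
  { s with arr := Function.update s.arr a (Function.update (s.arr a) i m) }

/-- `Exec p s t s'`: started on memory `s`, the program `p` halts after exactly `t` steps, and the
memory is then `s'`. -/
inductive Exec : Prog → Mem → ℕ → Mem → Prop
  | skip (s : Mem) : Exec .skip s 1 s
  | assign (s : Mem) (x : ℕ) (e : Expr) :
      Exec (.assign x e) s (e.cost + 1) (s.setVar x (e.eval s))
  | store (s : Mem) (a : ℕ) (i e : Expr) :
      Exec (.store a i e) s (i.cost + e.cost + 1) (s.setArr a (i.eval s) (e.eval s))
  | seq {p q : Prog} {s s' s'' : Mem} {t t' : ℕ} (hp : Exec p s t s') (hq : Exec q s' t' s'') :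
      Exec (.seq p q) s (t + t') s''
  | iteTrue {b : Test} {p q : Prog} {s s' : Mem} {t : ℕ} (hb : b.Holds s) (hp : Exec p s t s') :
      Exec (.ite b p q) s (b.cost + t) s'
  | iteFalse {b : Test} {p q : Prog} {s s' : Mem} {t : ℕ} (hb : ¬ b.Holds s)
      (hq : Exec q s t s') : Exec (.ite b p q) s (b.cost + t) s'
  | whileTrue {b : Test} {p : Prog} {s s' s'' : Mem} {t t' : ℕ} (hb : b.Holds s)
      (hp : Exec p s t s') (hw : Exec (.while b p) s' t' s'') :
      Exec (.while b p) s (b.cost + t + t') s''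
  | whileFalse {b : Test} {p : Prog} {s : Mem} (hb : ¬ b.Holds s) :
      Exec (.while b p) s b.cost s

/-- The list of the entries `i, …, j - 1` of an array. -/
def slice (a : ℕ → ℕ) (i j : ℕ) : List ℕ := (List.range' i (j - i)).map a

/-- The initial memory `s` holds the numbers `n`, `k`, `g` in registers 0, 1, 2 and the adjacency
lists of the multigraph `G` with vertices `0, …, n - 1`: the lists are stored one after the other
(each in an arbitrary order) in array 1, array 0 tells where they start, and `u` occurs in the list
of `v` as often as there are edges between `v` and `u`. All the other memory is zero. -/
structure IsInput (s : Mem) (n k g : ℕ) (G : Multigraph ℕ) : Prop where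
  var_zero : s.var 0 = n
  var_one : s.var 1 = k
  var_two : s.var 2 = g
  var_rest : ∀ x, 3 ≤ x → s.var x = 0
  start_zero : s.arr 0 0 = 0
  start_mono : ∀ v < n, s.arr 0 v ≤ s.arr 0 (v + 1)
  start_rest : ∀ i, n < i → s.arr 0 i = 0
  adj : ∀ v < n, ∀ u, (slice (s.arr 1) (s.arr 0 v) (s.arr 0 (v + 1))).count u = G.mult s(v, u)
  adj_rest : ∀ i, s.arr 0 n ≤ i → s.arr 1 i = 0
  arr_rest : ∀ a, 2 ≤ a → ∀ i, s.arr a i = 0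

/-- The `i`-th vertex list in the output: array 2 tells where the lists start, array 3 holds the
lists one after the other. -/
def outList (s : Mem) (i : ℕ) : List ℕ := slice (s.arr 3) (s.arr 2 i) (s.arr 2 (i + 1))

/-- The vertex set in the output: its elements are the first entries of array 3, and register 1
holds their number. -/
def outSet (s : Mem) : Finset ℕ := (slice (s.arr 3) 0 (s.var 1)).toFinset

/-- The answer in the memory `s` is a family of `k` vertex-disjoint cycles of `G`, announced by a 1
in register 0. -/
def AnswersCycles (s : Mem) (k : ℕ) (G : Multigraph ℕ) : Prop :=
  s.var 0 = 1 ∧ (∀ i < k, G.IsCycle (outList s i)) ∧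
    ∀ i < k, ∀ j < k, i ≠ j → (outList s i).Disjoint (outList s j)

/-- The answer in the memory `s` is a set `S` of fewer than `g * k` vertices of `G` such that
`reduce(G - S)` has girth larger than `g`, whatever the order in which the rules are applied,
announced by a 0 in register 0. -/
def AnswersSet (s : Mem) (k g : ℕ) (G : Multigraph ℕ) : Prop :=
  s.var 0 = 0 ∧ outSet s ⊆ G.verts ∧ (outSet s).card < g * k ∧
    ∀ H : Multigraph ℕ, (G.deleteVerts (outSet s)).IsReduce H → (g : ℕ∞) < H.girth

end RAM

/-! ### Confluence of the reduction rules. -/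

namespace Multigraph

/-! Cycles are collected greedily in reduced graphs. The vertices of a reduced graph are vertices of
`G`, and its edges stand for paths of `G` through suppressed vertices, so a cycle of a reduced graph
lifts to a cycle of `G` (`IsArcCycle.isCycle`). When the vertices of that cycle are deleted from the
reduced graph, the paths of the remaining edges avoid its lift (`Paths.kill_cycle`); hence cycles
found one after another are disjoint in `G`. Elimination commutes with deleting vertices that
survive it (`elimSteps_deleteVerts`), so the current graph always arises by the rules from `G - S`,
where `S` consists of the vertices deleted as cycle vertices. If every cycle has length at most `g`
in its reduced graph and fewer than `k` are found before none is left, then `|S| ≤ g(k - 1)` and the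
reduced graph has girth above `g`. This does not depend on the order of the rules: a graph with a
loop or a multiple edge keeps one forever (`Bad.step`), and without them the vertex rules are
locally confluent (`Elim.diamond`, `IsReduce.girth_lt`).

The difficulty is to look for a cycle of length at most `g` in nearly linear time. A first phase
prepares a small set `F`. In a reduced graph every vertex has a loop or at least three arcs, so
breadth first search, whose queue keeps doubling, closes a cycle of length at most `2 log n + 2`
(`Search.exists_cycle`). Either `k` disjoint cycles arise, or after fewer than `k` deletions the
graph reduces to nothing. In the latter case the deleted vertices form a set `F` with at most `f =
(2 log n + 2) k` elements, outside of which no vertex set spans more edges than it has vertices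
(`Sparse`).

The second phase starts again from `G` with `F` marked; marks move to a neighbour under suppression.
A table of edges without cycles of length at most `g` is filled edge by edge, each insertion being
tested by a search along the table. If there is no short cycle, at most `f^2` vertices outside `F`
have two edges to `F`, since two such vertices with the same neighbours lie on a cycle of length 4;
and at most `f^2` arcs join neighbours of `F`, since two of them with the same ends in `F` yield a
cycle of length at most 6. The edges that witness this fit into a table of size `O(f^4)`. Sparsity
and minimum degree three then bound the whole reduced graph by `f + 7 f^2` vertices
(`card_le_of_sparse`), and all its edges can be inserted. So either an insertion fails and shows a
short cycle, or the girth exceeds `g`.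

Finally `G` may have too many edges. Adjacency lists that start beyond position `64 k n` are not
read. If one is omitted, the part read contains a subgraph of minimum degree at least `24 k + 3`
(`exists_dense`). The cycles of the breadth first search are thin: a vertex has at most 6 neighbours
on one of them, so a deletion costs it at most 24 arcs, and the first phase cannot exhaust the graph
before it has found `k` cycles. The time is `O(k^2 n)` for all that is linear and `O(k f^12)` for
the tables; as `(log n)^12 = O(n)`, the sum is `O(k^13 n)`. -/

theorem ext_of {α : Type*} {G H : Multigraph α} (hv : G.verts = H.verts)
    (hm : ∀ e, G.mult e = H.mult e) : G = H := by
  cases G; cases H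
  obtain rfl : _ = _ := hv
  obtain rfl : _ = _ := funext hm
  rfl

/-- Eliminating the vertex `v`, whose incident edges lead to the multiset `l` of at most two other
vertices: delete `v` and, if there are two neighbours, connect them by a new edge. -/
structure Elim (G H : Multigraph ℕ) (v : ℕ) (l : Multiset ℕ) : Prop where
  mem : v ∈ G.verts
  notMem : v ∉ l
  card_le : l.card ≤ 2
  nbrs : ∀ u, G.mult s(v, u) = l.count u
  verts : H.verts = G.verts.erase v
  mult : ∀ e, H.mult e = (if v ∈ e then 0 else G.mult e) + if e.toMultiset = l then 1 else 0

/-- Covers both vertex rules. The multiplicity rule may be left out: a graph to which it applies can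
no longer reach girth above 2. -/
def ElimStep (G H : Multigraph ℕ) : Prop := ∃ v l, Elim G H v l

theorem toMultiset_mk (x y : ℕ) : (s(x, y) : Sym2 ℕ).toMultiset = {x, y} := rfl

theorem toMultiset_inj {e f : Sym2 ℕ} : e.toMultiset = f.toMultiset ↔ e = f := by
  constructor
  · intro h
    induction e with | _ a b
    induction f with | _ c d
    rw [toMultiset_mk, toMultiset_mk] at h
    rw [Sym2.eq_iff]
    by_cases hac : a = c
    · subst hac
      left
      have := (Multiset.cons_inj_right a).1 h
      simpa using this
    · have ha : a ∈ ({c, d} : Multiset ℕ) := by rw [← h]; simp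
      have had : a = d := by simpa [hac] using ha
      subst had
      have h2 : ({a, b} : Multiset ℕ) = {a, c} := by rw [h]; exact Multiset.pair_comm c a
      have := (Multiset.cons_inj_right a).1 h2
      right
      exact ⟨rfl, by simpa using this⟩
  · rintro rfl
    rfl

namespace Elim

variable {G H H' : Multigraph ℕ} {v w : ℕ} {l l' : Multiset ℕ}

theorem subset_verts (h : Elim G H v l) : ∀ u ∈ l, u ∈ G.verts := fun u hu =>
  G.mem_verts s(v, u) (by rw [h.nbrs]; exact (Multiset.count_pos.2 hu).ne') u (by simp)

theorem degree_eq (h : Elim G H v l) : G.degree v = l.card := by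
  have h0 : l.count v = 0 := Multiset.count_eq_zero.2 h.notMem
  simp only [degree, h.nbrs, h0, add_zero]
  exact Multiset.sum_count_eq_card h.subset_verts

theorem reduceStep (h : Elim G H v l) : ReduceStep G H := by
  have hd : ∀ e : Sym2 ℕ, (G.deleteVerts {v}).mult e = if v ∈ e then 0 else G.mult e := fun e => by
    simp only [deleteVerts, Finset.mem_singleton, forall_eq]
    split_ifs <;> simp_all
  by_cases hc : l.card ≤ 1
  · refine .degLeOne v h.mem (h.degree_eq.trans_le hc) (ext_of ?_ fun e => ?_)
    · rw [h.verts]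
      exact (Finset.sdiff_singleton_eq_erase _ _).symm
    · rw [h.mult, hd, if_neg (c := e.toMultiset = l), add_zero]
      rintro rfl
      rw [Sym2.card_toMultiset] at hc
      omega
  · have h2 : l.card = 2 := le_antisymm h.card_le (by omega)
    obtain ⟨x, y, rfl⟩ := Multiset.card_eq_two.1 h2
    refine .degTwo v x y h.mem (h.degree_eq.trans h2) ?_ (fun u => ?_) ?_ fun e => ?_
    · rw [h.nbrs]
      exact Multiset.count_eq_zero.2 h.notMem
    · rw [h.nbrs, Multiset.insert_eq_cons, Multiset.count_cons, Multiset.count_singleton, add_comm]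
    · rw [h.verts, Finset.sdiff_singleton_eq_erase]
    · rw [h.mult, hd]
      congr 2
      rw [← toMultiset_mk, toMultiset_inj]

theorem unique (h : Elim G H v l) (h' : Elim G H' v l') : H = H' := by
  obtain rfl : l = l' := Multiset.ext' fun u => by rw [← h.nbrs, h'.nbrs]
  exact ext_of (by rw [h.verts, h'.verts]) fun e => by rw [h.mult, h'.mult]

end Elim

open Classical in
/-- The result of eliminating `v`. -/
noncomputable def elim (G : Multigraph ℕ) (v : ℕ) (l : Multiset ℕ) : Multigraph ℕ where
  verts := G.verts.erase v
  mult e := (if v ∈ e then 0 else G.mult e) +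
    -- The second condition makes `mem_verts` hold for arbitrary `l`; it is automatic in the setting
    -- of `elim_spec`.
    if e.toMultiset = l ∧ ∀ u ∈ e, u ∈ G.verts.erase v then 1 else 0
  mem_verts e he u hu := by
    by_cases h : e.toMultiset = l ∧ ∀ u ∈ e, u ∈ G.verts.erase v
    · exact h.2 u hu
    · rw [if_neg h, add_zero] at he
      split_ifs at he with hv
      · exact absurd rfl he
      · exact Finset.mem_erase.2 ⟨fun h => hv (h ▸ hu), G.mem_verts e he u hu⟩

theorem elim_spec {G : Multigraph ℕ} {v : ℕ} {l : Multiset ℕ} (mem : v ∈ G.verts)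
    (notMem : v ∉ l) (card_le : l.card ≤ 2) (nbrs : ∀ u, G.mult s(v, u) = l.count u) :
    Elim G (G.elim v l) v l := by
  refine ⟨mem, notMem, card_le, nbrs, rfl, fun e => ?_⟩
  have key : (e.toMultiset = l ∧ ∀ u ∈ e, u ∈ G.verts.erase v) ↔ e.toMultiset = l := by
    refine and_iff_left_of_imp ?_
    rintro rfl u hu
    refine Finset.mem_erase.2 ⟨?_, ?_⟩
    · rintro rfl
      exact notMem (Sym2.mem_toMultiset.2 hu)
    · refine G.mem_verts s(v, u) ?_ u (by simp)
      rw [nbrs]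
      exact (Multiset.count_pos.2 (Sym2.mem_toMultiset.2 hu)).ne'
  simp only [elim, key]

theorem exists_nbrs {G : Multigraph ℕ} {v : ℕ} :
    ∃ l : Multiset ℕ, (∀ u, G.mult s(v, u) = l.count u) ∧
      l.card + G.mult s(v, v) = G.degree v := by
  refine ⟨∑ u ∈ G.verts, G.mult s(v, u) • {u}, fun u => ?_, ?_⟩
  · rw [Multiset.count_sum']
    simp only [Multiset.count_nsmul, Multiset.count_singleton, mul_ite, mul_one, mul_zero]
    rw [Finset.sum_ite_eq]
    split_ifs with h
    · rfl
    · by_contra h'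
      exact h (G.mem_verts _ h' u (by simp))
  · simp [degree]

/-- `G` has a self-loop or a multiple edge. -/
def Bad (G : Multigraph ℕ) : Prop := ∃ e, 2 ≤ G.mult e ∨ e.IsDiag ∧ 1 ≤ G.mult e

theorem mult_le_degree {G : Multigraph ℕ} {u v : ℕ} : G.mult s(v, u) ≤ G.degree v := by
  by_cases h : u ∈ G.verts
  · exact (Finset.single_le_sum (f := fun u => G.mult s(v, u)) (fun _ _ => Nat.zero_le _) h).trans
      (Nat.le_add_right _ _)
  · have : G.mult s(v, u) = 0 := by
      by_contra h'
      exact h (G.mem_verts _ h' u (by simp))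
    omega

theorem mult_loop_le_degree {G : Multigraph ℕ} {v : ℕ} : 2 * G.mult s(v, v) ≤ G.degree v := by
  by_cases h : v ∈ G.verts
  · have := Finset.single_le_sum (f := fun u => G.mult s(v, u)) (fun _ _ => Nat.zero_le _) h
    simp only [degree]
    omega
  · have : G.mult s(v, v) = 0 := by
      by_contra h'
      exact h (G.mem_verts _ h' v (by simp))
    omega

/-- A vertex of degree at most 1 lies on no loop or multiple edge. Suppressing a vertex whose two
edges are parallel creates a loop. Capping a multiplicity leaves a double edge. -/
theorem Bad.step {G H : Multigraph ℕ} (hG : G.Bad) (h : ReduceStep G H) : H.Bad := by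
  obtain ⟨e, he⟩ := hG
  have hpos : G.mult e ≠ 0 := by omega
  cases h with
  | degLeOne v hv hdeg hH =>
    have hve : v ∉ e := fun hve => by
      obtain ⟨u, rfl⟩ := hve
      rcases he with he | ⟨hd, he⟩
      · exact absurd (he.trans mult_le_degree) (by omega)
      · obtain rfl : v = u := by simpa using hd
        have := mult_loop_le_degree (G := G) (v := v)
        omega
    refine ⟨e, ?_⟩
    have : H.mult e = G.mult e := by
      subst hH
      simp [deleteVerts, hve]
    rwa [this]
  | degTwo v x y hv hdeg hloop hnbrs hverts hmult =>
    by_cases hve : v ∈ e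
    · obtain ⟨u, rfl⟩ := hve
      have hxy : x = u ∧ y = u := by
        rcases he with he | ⟨hd, he⟩
        · rw [hnbrs] at he
          split_ifs at he <;> simp_all
        · obtain rfl : v = u := by simpa using hd
          omega
      refine ⟨s(x, y), .inr ⟨by simp [hxy], ?_⟩⟩
      rw [hmult]
      simp
    · refine ⟨e, ?_⟩
      have : G.mult e ≤ H.mult e := by
        rw [hmult]
        simp [deleteVerts, hve]
      rcases he with he | ⟨hd, he⟩
      · exact .inl (he.trans this)
      · exact .inr ⟨hd, he.trans this⟩
  | multi f hf hverts hmult =>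
    refine ⟨e, ?_⟩
    rw [hmult]
    split_ifs
    · exact .inl le_rfl
    · exact he

theorem Bad.steps {G H : Multigraph ℕ} (hG : G.Bad) (h : Relation.ReflTransGen ReduceStep G H) :
    H.Bad := by
  induction h with
  | refl => exact hG
  | tail _ h ih => exact ih.step h

theorem Bad.girth_le {G : Multigraph ℕ} (hG : G.Bad) : G.girth ≤ 2 := by
  obtain ⟨e, he⟩ := hG
  induction e with | _ u v
  by_cases huv : u = v
  · subst huv
    have : G.IsCycle [u] := by
      show 1 ≤ G.mult s(u, u)
      omega
    refine (iInf₂_le [u] this).trans ?_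
    norm_num
  · have : G.IsCycle [u, v] := ⟨huv, by simpa [huv] using he⟩
    exact iInf₂_le [u, v] this

/-- Without multiple edges only the vertex rules apply, and without loops the degree is the size of
the multiset of neighbours. -/
theorem ReduceStep.elimStep {G H : Multigraph ℕ} (hG : ¬ G.Bad) (h : ReduceStep G H) :
    ElimStep G H := by
  cases h with
  | degLeOne v hv hdeg hH =>
    obtain ⟨l, hl, hc⟩ := exists_nbrs (G := G) (v := v)
    have hloop := mult_loop_le_degree (G := G) (v := v)
    have hcl : l.card ≤ 1 := by omega
    refine ⟨v, l, hv, ?_, by omega, hl, ?_, fun e => ?_⟩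
    · rw [← Multiset.count_eq_zero, ← hl]
      omega
    · rw [hH]
      exact Finset.sdiff_singleton_eq_erase _ _
    · subst hH
      rw [if_neg (c := e.toMultiset = l), add_zero]
      · simp only [deleteVerts, Finset.mem_singleton, forall_eq]
        split_ifs <;> simp_all
      · rintro rfl
        rw [Sym2.card_toMultiset] at hcl
        omega
  | degTwo v x y hv hdeg hloop hnbrs hverts hmult =>
    have hc : ∀ u, G.mult s(v, u) = ({x, y} : Multiset ℕ).count u := fun u => by
      rw [hnbrs, Multiset.insert_eq_cons, Multiset.count_cons, Multiset.count_singleton, add_comm]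
    refine ⟨v, {x, y}, hv, ?_, by simp, hc, ?_, fun e => ?_⟩
    · rw [← Multiset.count_eq_zero, ← hc, hloop]
    · rw [hverts, Finset.sdiff_singleton_eq_erase]
    · rw [hmult]
      congr 1
      · simp only [deleteVerts, Finset.mem_singleton, forall_eq]
        split_ifs <;> simp_all
      · congr 1
        rw [← toMultiset_mk, toMultiset_inj]
  | multi e he hverts hmult => exact absurd ⟨e, .inl he.le⟩ hG

theorem ElimStep.reduceStep {G H : Multigraph ℕ} (h : ElimStep G H) : ReduceStep G H := by
  obtain ⟨v, l, h⟩ := h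
  exact h.reduceStep

theorem Elim.nbrs_of_notMem {G H : Multigraph ℕ} {v w : ℕ} {l l' : Multiset ℕ}
    (h : Elim G H v l) (h' : ∀ u, G.mult s(w, u) = l'.count u) (hwl : w ∉ l) (hvl : v ∉ l') (u : ℕ)
    (hvw : v ≠ w) : H.mult s(w, u) = l'.count u := by
  rw [h.mult, if_neg (c := _ = l), add_zero]
  · split_ifs with hv
    · have : v = u := by simpa [hvw] using hv
      rw [← this, Multiset.count_eq_zero.2 hvl]
    · exact h' u
  · rintro rfl
    simp [toMultiset_mk] at hwl

/-- If `v` and `w` are not adjacent, the eliminations do not interact. If they are, they are joined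
by a single edge, and in either order the remaining neighbour of `v` and the remaining neighbour of
`w`, if both exist, end up joined. -/
theorem Elim.diamond {G H₁ H₂ : Multigraph ℕ} {v w : ℕ} {l l' : Multiset ℕ} (hG : ¬ G.Bad)
    (h₁ : Elim G H₁ v l) (h₂ : Elim G H₂ w l') (hvw : v ≠ w) :
    ∃ K, ElimStep H₁ K ∧ ElimStep H₂ K := by
  have hcnt : l.count w = l'.count v := by rw [← h₁.nbrs, ← h₂.nbrs, Sym2.eq_swap]
  have hw₁ : w ∈ H₁.verts := by rw [h₁.verts]; exact Finset.mem_erase.2 ⟨hvw.symm, h₂.mem⟩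
  have hv₂ : v ∈ H₂.verts := by rw [h₂.verts]; exact Finset.mem_erase.2 ⟨hvw, h₁.mem⟩
  by_cases hwl : w ∈ l
  · have hvl : v ∈ l' := by
      rw [← Multiset.count_pos, ← hcnt, Multiset.count_pos]
      exact hwl
    -- Once `v` is gone, `w` has inherited the other neighbour of `v` in place of `v`. As the graph
    -- is not bad, `w` occurs only once in `l`, and `w` does not become its own neighbour.
    have key : ∀ {H : Multigraph ℕ} {v w : ℕ} {l l' : Multiset ℕ}, Elim G H v l →
        v ≠ w → w ∈ l → v ∈ l' → w ∉ l' → l'.card ≤ 2 → (∀ u, G.mult s(w, u) = l'.count u) →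
        w ∈ H.verts → Elim H (H.elim w (l'.erase v + l.erase w)) w (l'.erase v + l.erase w) := by
      intro H v w l l' h hvw hwl hvl hwl' hc hn hm
      have c1 := Multiset.card_erase_of_mem hwl
      have c2 := Multiset.card_erase_of_mem hvl
      have c3 := h.card_le
      have hle : ∀ u, G.mult s(w, u) ≤ 1 := fun u => by
        by_contra hlt
        exact hG ⟨s(w, u), .inl (by omega)⟩
      have hle' : ∀ u, G.mult s(v, u) ≤ 1 := fun u => by
        by_contra hlt
        exact hG ⟨s(v, u), .inl (by omega)⟩
      have hw1 : (l.erase w).count w = 0 := by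
        rw [Multiset.count_erase_self]
        have := hle' w
        rw [h.nbrs] at this
        omega
      have hv1 : (l'.erase v).count v = 0 := by
        rw [Multiset.count_erase_self]
        have := hle v
        rw [hn] at this
        omega
      refine elim_spec hm ?_ ?_ fun u => ?_
      · rw [← Multiset.count_eq_zero, Multiset.count_add, hw1, Multiset.count_erase_of_ne hvw.symm,
          Multiset.count_eq_zero.2 hwl']
      · rw [Multiset.card_add, c1, c2]
        have := Multiset.card_pos_iff_exists_mem.2 ⟨_, hwl⟩
        have := Multiset.card_pos_iff_exists_mem.2 ⟨_, hvl⟩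
        simp only [Nat.pred_eq_sub_one]
        omega
      · rw [h.mult, Multiset.count_add]
        by_cases huv : u = v
        · subst huv
          have : (l.erase w).count u = 0 := by
            rw [Multiset.count_erase_of_ne hvw, Multiset.count_eq_zero.2 h.notMem]
          rw [hv1, this, if_pos (by simp), if_neg]
          intro he
          apply h.notMem
          rw [← he, toMultiset_mk]
          simp
        · rw [if_neg (by simp [hvw, Ne.symm huv]), hn, Multiset.count_erase_of_ne huv]
          congr 1
          have : (s(w, u) : Sym2 ℕ).toMultiset = l ↔ l.erase w = {u} := by
            rw [toMultiset_mk]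
            constructor
            · rintro rfl
              exact Multiset.erase_cons_head _ _
            · intro he
              rw [← Multiset.cons_erase hwl, he]
              rfl
          simp only [this]
          have hc1 : (l.erase w).card ≤ 1 := by
            rw [c1]
            simp only [Nat.pred_eq_sub_one]
            omega
          rcases Nat.le_one_iff_eq_zero_or_eq_one.1 hc1 with h0 | h1
          · rw [Multiset.card_eq_zero.1 h0]
            simp
          · obtain ⟨z, hz⟩ := Multiset.card_eq_one.1 h1
            rw [hz, Multiset.count_singleton]
            simp [eq_comm]
    have k₁ := key h₁ hvw hwl hvl h₂.notMem h₂.card_le h₂.nbrs hw₁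
    have k₂ := key h₂ hvw.symm hvl hwl h₁.notMem h₁.card_le h₁.nbrs hv₂
    refine ⟨_, ⟨_, _, k₁⟩, ?_⟩
    have : H₁.elim w (l'.erase v + l.erase w) = H₂.elim v (l.erase w + l'.erase v) := by
      refine ext_of ?_ fun e => ?_
      · rw [k₁.verts, k₂.verts, h₁.verts, h₂.verts, Finset.erase_right_comm]
      · rw [k₁.mult, k₂.mult, h₁.mult, h₂.mult, add_comm (l.erase w)]
        congr 1
        by_cases hve : v ∈ e <;> by_cases hwe : w ∈ e <;> simp only [hve, hwe, if_true, if_false]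
        · rw [if_neg]
          rintro rfl
          exact hwe (Sym2.mem_toMultiset.1 hwl)
        · rw [if_neg]
          rintro rfl
          exact hve (Sym2.mem_toMultiset.1 hvl)
        · rw [if_neg, if_neg]
          · rintro rfl
            exact hve (Sym2.mem_toMultiset.1 hvl)
          · rintro rfl
            exact hwe (Sym2.mem_toMultiset.1 hwl)
    rw [this]
    exact ⟨_, _, k₂⟩
  · have hvl : v ∉ l' := by
      rw [← Multiset.count_eq_zero, ← hcnt, Multiset.count_eq_zero]
      exact hwl
    have k₁ := elim_spec hw₁ h₂.notMem h₂.card_le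
      (fun u => h₁.nbrs_of_notMem h₂.nbrs hwl hvl u hvw)
    have k₂ := elim_spec hv₂ h₁.notMem h₁.card_le
      (fun u => h₂.nbrs_of_notMem h₁.nbrs hvl hwl u hvw.symm)
    refine ⟨_, ⟨_, _, k₁⟩, ?_⟩
    have : H₁.elim w l' = H₂.elim v l := by
      refine ext_of ?_ fun e => ?_
      · rw [k₁.verts, k₂.verts, h₁.verts, h₂.verts, Finset.erase_right_comm]
      · rw [k₁.mult, k₂.mult, h₁.mult, h₂.mult]
        have a1 : v ∈ e → e.toMultiset ≠ l := by
          rintro hve rfl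
          exact h₁.notMem (Sym2.mem_toMultiset.2 hve)
        have a2 : w ∈ e → e.toMultiset ≠ l' := by
          rintro hve rfl
          exact h₂.notMem (Sym2.mem_toMultiset.2 hve)
        have a3 : w ∈ e → e.toMultiset ≠ l := by
          rintro hve rfl
          exact hwl (Sym2.mem_toMultiset.2 hve)
        have a4 : v ∈ e → e.toMultiset ≠ l' := by
          rintro hve rfl
          exact hvl (Sym2.mem_toMultiset.2 hve)
        by_cases hve : v ∈ e <;> by_cases hwe : w ∈ e <;> simp [*]
        omega
    rw [this]
    exact ⟨_, _, k₂⟩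

theorem ReduceStep.measure_lt {G H : Multigraph ℕ} (h : ReduceStep G H) :
    toLex (H.verts.card, ∑ e ∈ H.verts.sym2, H.mult e) <
      toLex (G.verts.card, ∑ e ∈ G.verts.sym2, G.mult e) := by
  have hcard : ∀ v ∈ G.verts, (G.verts \ {v}).card < G.verts.card := fun v hv =>
    Finset.card_lt_card (Finset.sdiff_singleton_eq_erase v G.verts ▸ Finset.erase_ssubset hv)
  cases h with
  | degLeOne v hv hdeg hH =>
    subst hH
    exact Prod.Lex.toLex_lt_toLex.2 (Or.inl (hcard v hv))
  | degTwo v x y hv hdeg hloop hnbrs hverts hmult =>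
    refine Prod.Lex.toLex_lt_toLex.2 (Or.inl ?_)
    simpa only [hverts] using hcard v hv
  | multi e he hverts hmult =>
    refine Prod.Lex.toLex_lt_toLex.2 (Or.inr ⟨by simp only [hverts], ?_⟩)
    simp only [hverts]
    refine Finset.sum_lt_sum (fun i _ => ?_) ⟨e, ?_, ?_⟩
    · rw [hmult]
      split_ifs with h
      · subst h
        exact he.le
      · exact le_rfl
    · exact Finset.mem_sym2_iff.2 (G.mem_verts e (by omega))
    · rw [hmult, if_pos rfl]
      exact he

/-- Whether the girth of the reduced graph exceeds `g ≥ 2` does not depend on the order in which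
the rules are applied. -/
theorem IsReduce.girth_lt {G H₁ H₂ : Multigraph ℕ} {g : ℕ} (hg : 2 ≤ g) (h₁ : G.IsReduce H₁)
    (h₂ : G.IsReduce H₂) (h : (g : ℕ∞) < H₁.girth) : (g : ℕ∞) < H₂.girth := by
  induction hn : toLex (G.verts.card, ∑ e ∈ G.verts.sym2, G.mult e) using
    WellFoundedLT.induction generalizing G H₁ H₂ with
  | ind a ih =>
    -- Otherwise `H₁` would be bad as well, and its girth would be at most 2.
    have hG : ¬ G.Bad := fun hG => by
      have h2 := (hG.steps h₁.1).girth_le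
      have : (2 : ℕ∞) ≤ g := by exact_mod_cast hg
      exact absurd (h.trans_le (h2.trans this)) (lt_irrefl _)
    obtain ⟨s₁, n₁⟩ := h₁
    obtain ⟨s₂, n₂⟩ := h₂
    rcases Relation.ReflTransGen.cases_head s₁ with rfl | ⟨G₁, t₁, r₁⟩
    · rcases Relation.ReflTransGen.cases_head s₂ with rfl | ⟨G₂, t₂, r₂⟩
      · exact h
      · exact absurd t₂ (n₁ _)
    · rcases Relation.ReflTransGen.cases_head s₂ with rfl | ⟨G₂, t₂, r₂⟩
      · exact absurd t₁ (n₂ _)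
      · obtain ⟨v, l, e₁⟩ := t₁.elimStep hG
        obtain ⟨w, l', e₂⟩ := t₂.elimStep hG
        by_cases hvw : v = w
        · subst hvw
          obtain rfl := e₁.unique e₂
          exact ih _ (hn ▸ t₁.measure_lt) ⟨r₁, n₁⟩ ⟨r₂, n₂⟩ h rfl
        -- Newman's argument: a reduced form of the common successor `K` inherits the large girth
        -- from `H₁` by induction at `G₁`, and passes it on to `H₂` by induction at `G₂`.
        · obtain ⟨K, k₁, k₂⟩ := e₁.diamond hG e₂ hvw
          obtain ⟨H, hH⟩ := exists_isReduce K
          have hHg : (g : ℕ∞) < H.girth := ih _ (hn ▸ t₁.measure_lt) ⟨r₁, n₁⟩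
            ⟨Relation.ReflTransGen.head k₁.reduceStep hH.1, hH.2⟩ h rfl
          exact ih _ (hn ▸ t₂.measure_lt)
            ⟨Relation.ReflTransGen.head k₂.reduceStep hH.1, hH.2⟩ ⟨r₂, n₂⟩ hHg rfl

theorem deleteVerts_mult_eq (G : Multigraph ℕ) (S : Finset ℕ) (e : Sym2 ℕ) :
    (G.deleteVerts S).mult e = if ∀ v ∈ S, v ∉ e then G.mult e else 0 := rfl

/-- The vertex `v` merely loses its neighbours in `C`; a suppression may thereby turn into the
deletion of a vertex of degree at most 1. -/
theorem Elim.deleteVerts {G H : Multigraph ℕ} {v : ℕ} {l : Multiset ℕ} (h : Elim G H v l)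
    {C : Finset ℕ} (hv : v ∉ C) :
    Elim (G.deleteVerts C) (H.deleteVerts C) v (l.filter (· ∉ C)) := by
  refine ⟨Finset.mem_sdiff.2 ⟨h.mem, hv⟩, fun hm => h.notMem (Multiset.mem_of_mem_filter hm),
    (Multiset.card_le_card (Multiset.filter_le _ _)).trans h.card_le, fun u => ?_, ?_, fun e => ?_⟩
  · rw [deleteVerts_mult_eq, Multiset.count_filter, h.nbrs]
    by_cases hu : u ∈ C
    · simp only [hu, not_true, if_false]
      refine if_neg fun h' => ?_
      exact h' u hu (by simp)
    · simp only [hu, not_false_eq_true, if_true]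
      refine if_pos ?_
      intro w hw hm
      rcases Sym2.mem_iff.1 hm with rfl | rfl
      · exact hv hw
      · exact hu hw
  · ext w
    simp only [Multigraph.deleteVerts, h.verts, Finset.mem_sdiff, Finset.mem_erase]
    tauto
  · rw [deleteVerts_mult_eq, deleteVerts_mult_eq, h.mult]
    by_cases hC : ∀ w ∈ C, w ∉ e
    · simp only [if_pos hC]
      have : e.toMultiset = l ↔ e.toMultiset = l.filter (· ∉ C) := ?_
      · simp only [this]
      constructor
      · rintro rfl
        symm
        rw [Multiset.filter_eq_self]
        exact fun a ha hc => hC a hc (Sym2.mem_toMultiset.1 ha)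
      · intro he
        have hc := congrArg Multiset.card he
        rw [Sym2.card_toMultiset] at hc
        rw [he]
        exact Multiset.eq_of_le_of_card_le (Multiset.filter_le _ _) (h.card_le.trans hc.le)
    · simp only [if_neg hC]
      rw [if_neg (c := _ = Multiset.filter _ _), ite_self]
      · intro he
        push Not at hC
        obtain ⟨w, hw, hwe⟩ := hC
        have := Sym2.mem_toMultiset.2 hwe
        rw [he, Multiset.mem_filter] at this
        exact this.2 hw

theorem ElimStep.verts_subset {G H : Multigraph ℕ} (h : ElimStep G H) : H.verts ⊆ G.verts := by
  obtain ⟨v, l, h⟩ := h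
  rw [h.verts]
  exact Finset.erase_subset _ _

/-- Vertices chosen in a reduced graph may thus be deleted from the original graph beforehand. This
is what makes the cycle vertices found in successive reduced graphs one set `S` for the original
graph. -/
theorem elimSteps_deleteVerts {G H : Multigraph ℕ} (h : Relation.ReflTransGen ElimStep G H)
    {C : Finset ℕ} (hC : C ⊆ H.verts) :
    Relation.ReflTransGen ElimStep (G.deleteVerts C) (H.deleteVerts C) := by
  induction h with
  | refl => exact .refl
  | tail _ h ih =>
    refine (ih (hC.trans h.verts_subset)).tail ?_
    obtain ⟨v, l, h⟩ := h
    refine ⟨v, _, h.deleteVerts fun hv => ?_⟩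
    have := hC hv
    rw [h.verts] at this
    simp at this

theorem deleteVerts_deleteVerts (G : Multigraph ℕ) (S C : Finset ℕ) :
    (G.deleteVerts S).deleteVerts C = G.deleteVerts (S ∪ C) := by
  refine ext_of ?_ fun e => ?_
  · exact sdiff_sdiff_left
  · simp only [deleteVerts_mult_eq, Finset.mem_union]
    split_ifs <;> first | rfl | (exfalso; grind)

theorem deleteVerts_empty (G : Multigraph ℕ) : G.deleteVerts ∅ = G :=
  ext_of (by simp [deleteVerts]) fun e => by simp [deleteVerts]

/-! ### Sparse vertex sets -/

/-- The number of edges inside `X`. -/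
def edgesIn (G : Multigraph ℕ) (X : Finset ℕ) : ℕ := ∑ e ∈ X.sym2, G.mult e

/-- No set of vertices avoiding `F` spans more edges than it has vertices. -/
def Sparse (G : Multigraph ℕ) (F : Finset ℕ) : Prop :=
  ∀ X ⊆ G.verts, Disjoint X F → G.edgesIn X ≤ X.card

theorem edgesIn_insert (G : Multigraph ℕ) {v : ℕ} {X : Finset ℕ} (hv : v ∉ X) :
    G.edgesIn (insert v X) = G.edgesIn X + ∑ u ∈ X, G.mult s(v, u) + G.mult s(v, v) := by
  unfold edgesIn
  rw [Finset.sym2_insert, Finset.sum_union, Finset.sum_image, Finset.sum_insert hv]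
  · omega
  · intro a _ b _ hab
    rcases Sym2.eq_iff.1 hab with h | h
    · exact h.2
    · exact h.2.trans h.1
  · rw [Finset.disjoint_left]
    intro e he he'
    obtain ⟨u, _, rfl⟩ := Finset.mem_image.1 he
    exact hv (Finset.mk_mem_sym2_iff.1 he').1

theorem Elim.sum_le {G H : Multigraph ℕ} {v : ℕ} {l : Multiset ℕ} (h : Elim G H v l)
    (X : Finset ℕ) : ∑ u ∈ X, G.mult s(v, u) ≤ l.card := by
  simp only [h.nbrs]
  calc ∑ u ∈ X, l.count u ≤ ∑ u ∈ X ∪ l.toFinset, l.count u :=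
        Finset.sum_le_sum_of_subset Finset.subset_union_left
    _ = l.card := Multiset.sum_count_eq_card fun a ha => by simp [ha]

theorem Elim.sum_eq {G H : Multigraph ℕ} {v : ℕ} {l : Multiset ℕ} (h : Elim G H v l)
    {X : Finset ℕ} (hX : ∀ u ∈ l, u ∈ X) : ∑ u ∈ X, G.mult s(v, u) = l.card := by
  simp only [h.nbrs]
  exact Multiset.sum_count_eq_card hX

theorem Elim.sum_lt {G H : Multigraph ℕ} {v : ℕ} {l : Multiset ℕ} (h : Elim G H v l)
    {X : Finset ℕ} {u : ℕ} (hu : u ∈ l) (huX : u ∉ X) : ∑ u ∈ X, G.mult s(v, u) < l.card := by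
  have := h.sum_le (insert u X)
  rw [Finset.sum_insert huX, h.nbrs] at this
  have := Multiset.count_pos.2 hu
  omega

theorem Elim.edgesIn_eq {G H : Multigraph ℕ} {v : ℕ} {l : Multiset ℕ} (h : Elim G H v l)
    {X : Finset ℕ} (hv : v ∉ X) :
    H.edgesIn X = G.edgesIn X + if l.card = 2 ∧ ∀ u ∈ l, u ∈ X then 1 else 0 := by
  unfold edgesIn
  simp only [h.mult]
  rw [Finset.sum_add_distrib]
  congr 1
  · refine Finset.sum_congr rfl fun e he => if_neg fun hve => hv ?_
    exact Finset.mem_sym2_iff.1 he v hve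
  · split_ifs with hl
    · obtain ⟨x, y, rfl⟩ := Multiset.card_eq_two.1 hl.1
      simp only [← toMultiset_mk, toMultiset_inj]
      rw [Finset.sum_ite_eq', if_pos]
      exact Finset.mk_mem_sym2_iff.2 ⟨hl.2 x (by simp), hl.2 y (by simp)⟩
    · refine Finset.sum_eq_zero fun e he => if_neg ?_
      rintro rfl
      exact hl ⟨Sym2.card_toMultiset e, fun u hu =>
        Finset.mem_sym2_iff.1 he u (Sym2.mem_toMultiset.1 hu)⟩

/-- A set that contains the new edge can be enlarged by `v`: this adds two old edges and one vertex,
which pays for the new edge. That fails only if `v` is in `F`, and then one end of the new edge has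
to be in `F'`. -/
theorem Elim.sparse {G H : Multigraph ℕ} {v : ℕ} {l : Multiset ℕ} (h : Elim G H v l)
    {F F' : Finset ℕ} (hF : F.erase v ⊆ F') (hl : v ∈ F → l.card = 2 → ∃ u ∈ l, u ∈ F')
    (hG : G.Sparse F) : H.Sparse F' := by
  intro X hX hXF
  have hvX : v ∉ X := fun hv => by
    have := hX hv
    rw [h.verts] at this
    simp at this
  have hXG : X ⊆ G.verts := hX.trans (by rw [h.verts]; exact Finset.erase_subset _ _)
  have hXF0 : Disjoint X F := by
    rw [Finset.disjoint_left] at hXF ⊢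
    exact fun a ha haF => hXF ha (hF (Finset.mem_erase.2 ⟨fun h => hvX (h ▸ ha), haF⟩))
  rw [h.edgesIn_eq hvX]
  split_ifs with hc
  · have hvF : v ∉ F := fun hvF => by
      obtain ⟨u, hu, huF⟩ := hl hvF hc.1
      exact Finset.disjoint_left.1 hXF (hc.2 u hu) huF
    have := hG (insert v X) (Finset.insert_subset h.mem hXG) (by simp [hvF, hXF0])
    rw [edgesIn_insert _ hvX, Finset.card_insert_of_notMem hvX, h.sum_eq hc.2] at this
    omega
  · exact hG X hXG hXF0

/-- Putting `v` back adds one vertex and at most one edge on balance: either two edges replace the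
new edge, or at most one edge at `v` lies inside the set. -/
theorem Elim.sparse_of {G H : Multigraph ℕ} {v : ℕ} {l : Multiset ℕ} (h : Elim G H v l)
    (hH : H.Sparse ∅) : G.Sparse ∅ := by
  intro X hX _
  by_cases hv : v ∈ X
  · have hX' : X.erase v ⊆ H.verts := by
      rw [h.verts]
      exact Finset.erase_subset_erase _ hX
    have h1 := hH _ hX' (by simp)
    rw [h.edgesIn_eq (Finset.notMem_erase v X)] at h1
    rw [← Finset.insert_erase hv, edgesIn_insert _ (Finset.notMem_erase v X), h.nbrs v,
      Multiset.count_eq_zero.2 h.notMem, Finset.card_insert_of_notMem (Finset.notMem_erase v X)]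
    have hs := h.sum_le (X.erase v)
    have hc := h.card_le
    split_ifs at h1 with hl
    · omega
    · have : ∑ u ∈ X.erase v, G.mult s(v, u) ≤ 1 := by
        by_cases hc2 : l.card = 2
        · simp only [hc2, true_and] at hl
          push Not at hl
          obtain ⟨u, hu, huX⟩ := hl
          have := h.sum_lt hu huX
          omega
        · omega
      omega
  · have hX' : X ⊆ H.verts := by
      rw [h.verts]
      exact fun a ha => Finset.mem_erase.2 ⟨fun h => hv (h ▸ ha), hX ha⟩
    have h1 := hH _ hX' (by simp)
    rw [h.edgesIn_eq hv] at h1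
    omega

/-- Applied to an empty `H`: a graph that can be eliminated completely is sparse. -/
theorem sparse_of_elimSteps {G H : Multigraph ℕ} (h : Relation.ReflTransGen ElimStep G H)
    (hH : H.Sparse ∅) : G.Sparse ∅ := by
  induction h using Relation.ReflTransGen.head_induction_on with
  | refl => exact hH
  | head h _ ih =>
    obtain ⟨v, l, h⟩ := h
    exact h.sparse_of ih

theorem edgesIn_deleteVerts (G : Multigraph ℕ) {S X : Finset ℕ} (h : Disjoint X S) :
    (G.deleteVerts S).edgesIn X = G.edgesIn X := by
  refine Finset.sum_congr rfl fun e he => ?_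
  rw [deleteVerts_mult_eq, if_pos]
  intro v hv hve
  exact Finset.disjoint_left.1 h (Finset.mem_sym2_iff.1 he v hve) hv

theorem Sparse.of_deleteVerts {G : Multigraph ℕ} {S : Finset ℕ}
    (h : (G.deleteVerts S).Sparse ∅) : G.Sparse S := by
  intro X hX hXS
  have := h X (fun a ha => Finset.mem_sdiff.2 ⟨hX ha, Finset.disjoint_left.1 hXS ha⟩) (by simp)
  rwa [edgesIn_deleteVerts _ hXS] at this

theorem Sparse.deleteVerts {G : Multigraph ℕ} {F : Finset ℕ} (h : G.Sparse F) (S : Finset ℕ) :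
    (G.deleteVerts S).Sparse F := by
  intro X hX hXF
  have hXS : Disjoint X S := Finset.disjoint_left.2 fun a ha => (Finset.mem_sdiff.1 (hX ha)).2
  rw [edgesIn_deleteVerts _ hXS]
  exact h X (hX.trans Finset.sdiff_subset) hXF

end Multigraph

/-! ### Program logic: running times, frames and rules for loops. -/

namespace RAM

infixr:60 " ;; " => Prog.seq

/-- Some execution of `P` from `s` ends, and its time and final memory satisfy `Q`. -/
def Run (P : Prog) (s : Mem) (Q : ℕ → Mem → Prop) : Prop := ∃ t s', Exec P s t s' ∧ Q t s'

/-- The registers written by a program. -/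
def Prog.wv : Prog → ℕ → Bool
  | .skip, _ => false
  | .assign x _, y => x == y
  | .store _ _ _, _ => false
  | .seq p q, y => p.wv y || q.wv y
  | .ite _ p q, y => p.wv y || q.wv y
  | .while _ p, y => p.wv y

/-- The arrays written by a program. -/
def Prog.wa : Prog → ℕ → Bool
  | .skip, _ => false
  | .assign _ _, _ => false
  | .store a _ _, y => a == y
  | .seq p q, y => p.wa y || q.wa y
  | .ite _ p q, y => p.wa y || q.wa y
  | .while _ p, y => p.wa y

/-- The memories differ at most in what `P` writes. -/
structure Framed (P : Prog) (s s' : Mem) : Prop where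
  var : ∀ x, P.wv x = false → s'.var x = s.var x
  arr : ∀ a, P.wa a = false → s'.arr a = s.arr a

theorem Framed.refl (P : Prog) (s : Mem) : Framed P s s := ⟨fun _ _ => rfl, fun _ _ => rfl⟩

theorem Framed.trans {P : Prog} {s s' s'' : Mem} (h : Framed P s s') (h' : Framed P s' s'') :
    Framed P s s'' :=
  ⟨fun x hx => (h'.var x hx).trans (h.var x hx), fun a ha => (h'.arr a ha).trans (h.arr a ha)⟩

@[simp] theorem setVar_var (s : Mem) (x m y : ℕ) :
    (s.setVar x m).var y = if y = x then m else s.var y := by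
  simp [Mem.setVar, Function.update_apply]

@[simp] theorem setVar_arr (s : Mem) (x m : ℕ) : (s.setVar x m).arr = s.arr := rfl

@[simp] theorem setArr_var (s : Mem) (a i m : ℕ) : (s.setArr a i m).var = s.var := rfl

@[simp] theorem setArr_arr (s : Mem) (a i m b : ℕ) :
    (s.setArr a i m).arr b = if b = a then Function.update (s.arr a) i m else s.arr b := by
  by_cases h : b = a
  · subst h
    simp [Mem.setArr]
  · simp [Mem.setArr, h]

theorem Exec.framed {P : Prog} {s s' : Mem} {t : ℕ} (h : Exec P s t s') : Framed P s s' := by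
  induction h with
  | skip s => exact .refl _ _
  | assign s x e =>
    refine ⟨fun y hy => ?_, fun a _ => rfl⟩
    have : x ≠ y := by simpa [Prog.wv] using hy
    simp [this.symm]
  | store s a i e =>
    refine ⟨fun y hy => rfl, fun b hb => ?_⟩
    have : a ≠ b := by simpa [Prog.wa] using hb
    simp [this.symm]
  | seq _ _ ih ih' =>
    refine ⟨fun y hy => ?_, fun b hb => ?_⟩
    · simp only [Prog.wv, Bool.or_eq_false_iff] at hy
      exact (ih'.var y hy.2).trans (ih.var y hy.1)
    · simp only [Prog.wa, Bool.or_eq_false_iff] at hb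
      exact (ih'.arr b hb.2).trans (ih.arr b hb.1)
  | iteTrue _ _ ih =>
    refine ⟨fun y hy => ?_, fun b hb => ?_⟩
    · simp only [Prog.wv, Bool.or_eq_false_iff] at hy
      exact ih.var y hy.1
    · simp only [Prog.wa, Bool.or_eq_false_iff] at hb
      exact ih.arr b hb.1
  | iteFalse _ _ ih =>
    refine ⟨fun y hy => ?_, fun b hb => ?_⟩
    · simp only [Prog.wv, Bool.or_eq_false_iff] at hy
      exact ih.var y hy.2
    · simp only [Prog.wa, Bool.or_eq_false_iff] at hb
      exact ih.arr b hb.2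
  | whileTrue _ _ _ ih ih' => exact ⟨fun y hy => (ih'.var y hy).trans (ih.var y hy),
      fun b hb => (ih'.arr b hb).trans (ih.arr b hb)⟩
  | whileFalse _ => exact .refl _ _

/-- The frame comes for free, so that postconditions only have to speak of the memory that a program
writes. -/
theorem Run.mono {P : Prog} {s : Mem} {Q Q' : ℕ → Mem → Prop} (h : Run P s Q)
    (hQ : ∀ t s', Framed P s s' → Q t s' → Q' t s') : Run P s Q' := by
  obtain ⟨t, s', he, hq⟩ := h
  exact ⟨t, s', he, hQ t s' he.framed hq⟩

@[simp] theorem run_skip (s : Mem) (Q : ℕ → Mem → Prop) : Run .skip s Q ↔ Q 1 s := by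
  constructor
  · rintro ⟨_, _, ⟨⟩, h⟩
    exact h
  · exact fun h => ⟨_, _, .skip s, h⟩

@[simp] theorem run_assign (x : ℕ) (e : Expr) (s : Mem) (Q : ℕ → Mem → Prop) :
    Run (.assign x e) s Q ↔ Q (e.cost + 1) (s.setVar x (e.eval s)) := by
  constructor
  · rintro ⟨_, _, ⟨⟩, h⟩
    exact h
  · exact fun h => ⟨_, _, .assign s x e, h⟩

@[simp] theorem run_store (a : ℕ) (i e : Expr) (s : Mem) (Q : ℕ → Mem → Prop) :
    Run (.store a i e) s Q ↔ Q (i.cost + e.cost + 1) (s.setArr a (i.eval s) (e.eval s)) := by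
  constructor
  · rintro ⟨_, _, ⟨⟩, h⟩
    exact h
  · exact fun h => ⟨_, _, .store s a i e, h⟩

theorem run_seq {p q : Prog} {s : Mem} {Q : ℕ → Mem → Prop} :
    Run (p ;; q) s Q ↔ Run p s fun t s' => Run q s' fun t' s'' => Q (t + t') s'' := by
  constructor
  · rintro ⟨_, _, hx, h⟩
    cases hx with
    | seq hp hq => exact ⟨_, _, hp, _, _, hq, h⟩
  · rintro ⟨_, _, hp, _, _, hq, h⟩
    exact ⟨_, _, .seq hp hq, h⟩

theorem run_ite {b : Test} {p q : Prog} {s : Mem} {Q : ℕ → Mem → Prop} :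
    Run (.ite b p q) s Q ↔ (b.Holds s → Run p s fun t s' => Q (b.cost + t) s') ∧
      (¬ b.Holds s → Run q s fun t s' => Q (b.cost + t) s') := by
  constructor
  · rintro ⟨_, _, hx, h⟩
    cases hx with
    | iteTrue hb hp => exact ⟨fun _ => ⟨_, _, hp, h⟩, fun hn => absurd hb hn⟩
    | iteFalse hb hp => exact ⟨fun hn => absurd hn hb, fun _ => ⟨_, _, hp, h⟩⟩
  · rintro ⟨h1, h2⟩
    by_cases hb : b.Holds s
    · obtain ⟨_, _, hp, h⟩ := h1 hb
      exact ⟨_, _, .iteTrue hb hp, h⟩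
    · obtain ⟨_, _, hp, h⟩ := h2 hb
      exact ⟨_, _, .iteFalse hb hp, h⟩

attribute [simp] Test.Holds Expr.eval Expr.cost Test.cost

/-- The rule for loops, with a potential `φ` that pays for the running time. -/
theorem Run.while {b : Test} {p : Prog} {s : Mem} {φ : ℕ} (I : ℕ → Mem → Prop) (h0 : I φ s)
    (hbody : ∀ φ s₁, I φ s₁ → Framed p s s₁ → b.Holds s₁ →
      Run p s₁ fun t s₂ => ∃ φ', I φ' s₂ ∧ b.cost + t + φ' ≤ φ)
    {Q : ℕ → Mem → Prop}
    (hpost : ∀ t φ' s', I φ' s' → Framed p s s' → ¬ b.Holds s' → t + φ' ≤ φ + b.cost → Q t s') :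
    Run (.while b p) s Q := by
  -- Each round costs at least one step, so the potential decreases strictly and the loop ends.
  have hc : 1 ≤ b.cost := by cases b <;> simp
  suffices h : ∀ φ₁ s₁, I φ₁ s₁ → Framed p s s₁ →
      ∃ t φ' s', Exec (.while b p) s₁ t s' ∧ I φ' s' ∧ Framed p s s' ∧ ¬ b.Holds s' ∧
        t + φ' ≤ φ₁ + b.cost by
    obtain ⟨t, φ', s', he, hi, hf, hn, ht⟩ := h φ s h0 (.refl _ _)
    exact ⟨t, s', he, hpost t φ' s' hi hf hn ht⟩
  intro φ₁
  induction φ₁ using Nat.strong_induction_on with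
  | _ φ₁ ih =>
    intro s₁ hi hf
    by_cases hb : b.Holds s₁
    · obtain ⟨t, s₂, he, φ', hi', hφ⟩ := hbody φ₁ s₁ hi hf hb
      obtain ⟨t', φ'', s', he', hi'', hf', hn, ht⟩ := ih φ' (by omega) s₂ hi' (hf.trans he.framed)
      exact ⟨_, φ'', s', .whileTrue hb he he', hi'', hf', hn, by omega⟩
    · exact ⟨_, φ₁, s₁, .whileFalse hb, hi, hf, hb, by omega⟩

/-- `for` loops: repeat `p` while register `x` is smaller than register `y`. -/
def Prog.for (x y : ℕ) (p : Prog) : Prog :=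
  .while (.lt (.var x) (.var y)) (p ;; .assign x (.succ (.var x)))

/-- A round costs 6 steps besides the body, 3 for the test and 3 for the increment; the final 3 are
the last test. -/
theorem Run.for {x y : ℕ} {p : Prog} {s : Mem} {φ N : ℕ} (I : ℕ → ℕ → Mem → Prop)
    (hx : p.wv x = false) (hy : p.wv y = false) (hxy : x ≠ y) (hN : s.var y = N)
    (hle : s.var x ≤ N) (h0 : I (s.var x) φ s)
    (hbody : ∀ i φ s₁, I i φ s₁ → Framed (Prog.for x y p) s s₁ → s₁.var x = i → i < N →
      Run p s₁ fun t s₂ => ∃ φ', I (i + 1) φ' (s₂.setVar x (i + 1)) ∧ t + 6 + φ' ≤ φ)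
    {Q : ℕ → Mem → Prop}
    (hpost : ∀ t φ' s', I N φ' s' → Framed (Prog.for x y p) s s' → s'.var x = N →
      t + φ' ≤ φ + 3 → Q t s') :
    Run (Prog.for x y p) s Q := by
  have hxy' : (x == y) = false := by simpa using hxy
  refine Run.while (φ := φ) (fun φ s₁ => I (s₁.var x) φ s₁ ∧ s₁.var x ≤ N) ⟨h0, hle⟩ ?_ ?_
  · rintro φ s₁ ⟨hi, hle⟩ hf hb
    have hyN : s₁.var y = N := by
      rw [hf.var y (by simp [Prog.wv, hy, hxy'])]
      exact hN
    have hlt : s₁.var x < N := by simpa [hyN] using hb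
    rw [run_seq]
    refine (hbody _ φ s₁ hi ⟨hf.var, hf.arr⟩ rfl hlt).mono fun t s₂ hf₂ h => ?_
    obtain ⟨φ', hI, ht⟩ := h
    rw [run_assign]
    have hx2 : s₂.var x = s₁.var x := hf₂.var x hx
    refine ⟨φ', ⟨?_, ?_⟩, ?_⟩
    · simpa [hx2] using hI
    · simp [hx2]
      omega
    · simp
      omega
  · rintro t φ' s' ⟨hi, hle⟩ hf hb ht
    have hyN : s'.var y = N := by
      rw [hf.var y (by simp [Prog.wv, hy, hxy'])]
      exact hN
    have : s'.var x = N := by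
      have : ¬ s'.var x < N := by simpa [hyN] using hb
      omega
    exact hpost t φ' s' (this ▸ hi) ⟨hf.var, hf.arr⟩ this (by simpa using ht)

/-- `for` loops whose body takes time at most `c`. -/
theorem Run.forBound {x y : ℕ} {p : Prog} {s : Mem} {N : ℕ} (c : ℕ) (I : ℕ → Mem → Prop)
    (hx : p.wv x = false) (hy : p.wv y = false) (hxy : x ≠ y) (hN : s.var y = N)
    (hle : s.var x ≤ N) (h0 : I (s.var x) s)
    (hbody : ∀ i s₁, I i s₁ → Framed (Prog.for x y p) s s₁ → s₁.var x = i → i < N →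
      Run p s₁ fun t s₂ => I (i + 1) (s₂.setVar x (i + 1)) ∧ t ≤ c)
    {Q : ℕ → Mem → Prop}
    (hpost : ∀ t s', I N s' → Framed (Prog.for x y p) s s' → s'.var x = N →
      t ≤ (c + 6) * N + 3 → Q t s') :
    Run (Prog.for x y p) s Q := by
  refine Run.for (φ := (c + 6) * (N - s.var x)) (fun i φ s => I i s ∧ φ = (c + 6) * (N - i))
    hx hy hxy hN hle ⟨h0, rfl⟩ ?_ ?_
  · rintro i φ s₁ ⟨hi, rfl⟩ hf hx hlt
    refine (hbody i s₁ hi hf hx hlt).mono fun t s₂ _ h => ?_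
    refine ⟨_, ⟨h.1, rfl⟩, ?_⟩
    obtain ⟨d, rfl⟩ : ∃ d, N = i + 1 + d := ⟨N - i - 1, by omega⟩
    have e1 : i + 1 + d - (i + 1) = d := by omega
    have e2 : i + 1 + d - i = d + 1 := by omega
    rw [e1, e2, Nat.mul_succ]
    have := h.2
    omega
  · rintro t φ' s' ⟨hi, rfl⟩ hf hx ht
    refine hpost t s' hi hf hx ?_
    have : (c + 6) * (N - s.var x) ≤ (c + 6) * N := Nat.mul_le_mul_left _ (Nat.sub_le _ _)
    omega

/-- The linked list that starts at `i` (`0` is the end, `a + 1` stands for the entry `a`). -/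
def LinkedList (next : ℕ → ℕ) : ℕ → List ℕ → Prop
  | i, [] => i = 0
  | i, a :: l => i = a + 1 ∧ LinkedList next (next a) l

/-- Run through the linked list that starts at `e`, with the links in array `nx`. -/
def Prog.each (x nx : ℕ) (e : Expr) (p : Prog) : Prog :=
  .assign x e ;; .while (.lt (.const 0) (.var x)) (p ;; .assign x (.get nx (.pred (.var x))))

/-- The body does not write the links, so the list is the one at the start. A round costs 7 steps
besides the body, 3 for the test and 4 for following the link. -/
theorem Run.each {x nx : ℕ} {e : Expr} {p : Prog} {s : Mem} {φ : ℕ} {l : List ℕ}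
    (I : List ℕ → ℕ → Mem → Prop) (hx : p.wv x = false) (hnx : p.wa nx = false)
    (hl : LinkedList (s.arr nx) (e.eval s) l) (h0 : I l φ (s.setVar x (e.eval s)))
    (hbody : ∀ a r φ s₁, I (a :: r) φ s₁ → Framed (Prog.each x nx e p) s s₁ → s₁.var x = a + 1 →
      (∃ d, l = d ++ a :: r) →
      Run p s₁ fun t s₂ => ∃ φ', I r φ' (s₂.setVar x (s.arr nx a)) ∧ t + 7 + φ' ≤ φ)
    {Q : ℕ → Mem → Prop}
    (hpost : ∀ t φ' s', I [] φ' s' → Framed (Prog.each x nx e p) s s' →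
      t + φ' ≤ φ + e.cost + 4 → Q t s') :
    Run (Prog.each x nx e p) s Q := by
  have hframe : ∀ s₁, Framed (p ;; .assign x (.get nx (.pred (.var x)))) (s.setVar x (e.eval s)) s₁ →
      Framed (Prog.each x nx e p) s s₁ := by
    refine fun s₁ hf => ⟨fun y hy => ?_, fun b hb => ?_⟩
    · simp only [Prog.each, Prog.wv, Bool.or_eq_false_iff, beq_eq_false_iff_ne] at hy
      rw [hf.var y (by simp [Prog.wv, hy])]
      simp [Ne.symm hy.1]
    · simp only [Prog.each, Prog.wa, Bool.or_eq_false_iff] at hb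
      rw [hf.arr b (by simp [Prog.wa, hb])]
      simp
  unfold Prog.each
  rw [run_seq, run_assign]
  refine Run.while (φ := φ) (fun φ s₁ => ∃ r, (∃ d, l = d ++ r) ∧ I r φ s₁ ∧
    LinkedList (s.arr nx) (s₁.var x) r ∧ s₁.arr nx = s.arr nx)
    ⟨l, ⟨[], rfl⟩, h0, by simpa using hl, rfl⟩ ?_ ?_
  · rintro φ s₁ ⟨r, ⟨d, hd⟩, hi, hr, hn⟩ hf hb
    cases r with
    | nil => simp [LinkedList] at hr; simp [hr] at hb
    | cons a r =>
      have hfr := hframe s₁ hf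
      obtain ⟨h1, h2⟩ := hr
      rw [run_seq]
      refine (hbody a r φ s₁ hi hfr h1 ⟨d, hd⟩).mono fun t s₂ hf₂ h => ?_
      obtain ⟨φ', hI, ht⟩ := h
      rw [run_assign]
      have e1 : s₂.var x = a + 1 := by rw [hf₂.var x hx, h1]
      have e2 : s₂.arr nx = s.arr nx := by rw [hf₂.arr nx hnx, hn]
      refine ⟨φ', ⟨r, ⟨d ++ [a], by simp [hd]⟩, ?_, ?_, ?_⟩, ?_⟩
      · simpa [e1, e2] using hI
      · simpa [e1, e2] using h2
      · simp [e2]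
      · simp
        omega
  · rintro t φ' s' ⟨r, _, hi, hr, hn⟩ hf hb ht
    cases r with
    | nil =>
      refine hpost _ φ' s' hi (hframe s' hf) ?_
      simp at ht
      omega
    | cons a r => simp [LinkedList] at hr; simp [hr.1] at hb

theorem Run.eachBound {x nx : ℕ} {e : Expr} {p : Prog} {s : Mem} {l : List ℕ} (c : ℕ)
    (I : List ℕ → Mem → Prop) (hx : p.wv x = false) (hnx : p.wa nx = false)
    (hl : LinkedList (s.arr nx) (e.eval s) l) (h0 : I l (s.setVar x (e.eval s)))
    (hbody : ∀ a r s₁, I (a :: r) s₁ → Framed (Prog.each x nx e p) s s₁ → s₁.var x = a + 1 →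
      (∃ d, l = d ++ a :: r) →
      Run p s₁ fun t s₂ => I r (s₂.setVar x (s.arr nx a)) ∧ t ≤ c)
    {Q : ℕ → Mem → Prop}
    (hpost : ∀ t s', I [] s' → Framed (Prog.each x nx e p) s s' →
      t ≤ (c + 7) * l.length + e.cost + 4 → Q t s') :
    Run (Prog.each x nx e p) s Q := by
  refine Run.each (φ := (c + 7) * l.length) (fun r φ s => I r s ∧ φ = (c + 7) * r.length)
    hx hnx hl ⟨h0, rfl⟩ ?_ ?_
  · rintro a r φ s₁ ⟨hi, rfl⟩ hf hx hd
    refine (hbody a r s₁ hi hf hx hd).mono fun t s₂ _ h => ⟨_, ⟨h.1, rfl⟩, ?_⟩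
    have := h.2
    simp only [List.length_cons, Nat.mul_succ]
    omega
  · rintro t φ' s' ⟨hi, rfl⟩ hf ht
    exact hpost t s' hi hf (by simpa using ht)

/-- Set the cells `0, …, var y - 1` of array `a` to the value of a constant. -/
def fill (x y a c : ℕ) : Prog :=
  .assign x (.const 0) ;; Prog.for x y (.store a (.var x) (.const c))

theorem run_fill {x y a c : ℕ} (hxy : x ≠ y) (s : Mem) :
    Run (fill x y a c) s fun t s' => t ≤ 9 * s.var y + 5 ∧
      (∀ i, s'.arr a i = if i < s.var y then c else s.arr a i) := by
  unfold fill
  rw [run_seq, run_assign]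
  refine Run.forBound 3 (N := s.var y)
    (fun i s' => ∀ j, s'.arr a j = if j < i then c else s.arr a j) rfl rfl hxy ?_ ?_ ?_ ?_ ?_
  · simp [hxy.symm]
  · simp
  · simp
  · intro i s₁ hI hf hx hi
    rw [run_store]
    refine ⟨fun j => ?_, by simp⟩
    simp only [setVar_arr, setArr_arr, if_true, Expr.eval, hx, Function.update_apply, hI]
    split_ifs <;> omega
  · intro t s' hI _ _ ht
    refine ⟨?_, hI⟩
    simp
    omega

end RAM

/-! ### Multigraphs as sets of paired arcs: deletion and suppression. -/

/-- Every element cancels with its image modulo 2. -/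
theorem even_card_of_involution {S : Finset ℕ} {f : ℕ → ℕ} (hf : ∀ a ∈ S, f a ∈ S)
    (hff : ∀ a ∈ S, f (f a) = a) (hne : ∀ a ∈ S, f a ≠ a) : Even S.card := by
  have : ∑ a ∈ S, (1 : ZMod 2) = 0 :=
    Finset.sum_involution (fun a _ => f a) (fun a _ => by decide) (fun a ha _ => hne a ha)
      (fun a ha => hf a ha) (fun a ha => hff a ha)
  rw [Finset.sum_const, nsmul_eq_mul, mul_one] at this
  exact (ZMod.natCast_eq_zero_iff_even).1 this

/-- A multigraph given by arcs: every edge consists of two arcs, which are exchanged by `tw`, and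
`own a` is the vertex at which the arc `a` starts. -/
structure ArcGraph where
  A : Finset ℕ
  L : Finset ℕ
  own : ℕ → ℕ
  tw : ℕ → ℕ
  own_mem : ∀ a ∈ L, own a ∈ A
  tw_mem : ∀ a ∈ L, tw a ∈ L
  tw_tw : ∀ a ∈ L, tw (tw a) = a
  tw_ne : ∀ a ∈ L, tw a ≠ a

namespace ArcGraph

theorem ext_of {X Y : ArcGraph} (hA : X.A = Y.A) (hL : X.L = Y.L) (ho : X.own = Y.own)
    (ht : X.tw = Y.tw) : X = Y := by
  cases X; cases Y
  subst hA hL ho ht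
  rfl

variable (X : ArcGraph)

def arcsAt (v : ℕ) : Finset ℕ := X.L.filter fun a => X.own a = v

def deg (v : ℕ) : ℕ := (X.arcsAt v).card

/-- The target of an arc. -/
def tgt (a : ℕ) : ℕ := X.own (X.tw a)

def arcsOf (e : Sym2 ℕ) : Finset ℕ := X.L.filter fun a => s(X.own a, X.tgt a) = e

variable {X}

theorem mem_arcsAt {v a : ℕ} : a ∈ X.arcsAt v ↔ a ∈ X.L ∧ X.own a = v := by
  simp [arcsAt]

theorem mem_arcsOf {e : Sym2 ℕ} {a : ℕ} : a ∈ X.arcsOf e ↔ a ∈ X.L ∧ s(X.own a, X.tgt a) = e := by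
  simp [arcsOf]

theorem tgt_mem {a : ℕ} (ha : a ∈ X.L) : X.tgt a ∈ X.A := X.own_mem _ (X.tw_mem _ ha)

theorem tgt_tw {a : ℕ} (ha : a ∈ X.L) : X.tgt (X.tw a) = X.own a := by
  rw [tgt, X.tw_tw a ha]

theorem tw_inj {a b : ℕ} (ha : a ∈ X.L) (hb : b ∈ X.L) (h : X.tw a = X.tw b) : a = b := by
  rw [← X.tw_tw a ha, h, X.tw_tw b hb]

theorem even_card_arcsOf (e : Sym2 ℕ) : Even (X.arcsOf e).card := by
  refine even_card_of_involution (f := X.tw) (fun a ha => ?_) (fun a ha => ?_) fun a ha => ?_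
  · rw [mem_arcsOf] at ha ⊢
    refine ⟨X.tw_mem a ha.1, ?_⟩
    rw [tgt_tw ha.1, ← ha.2, Sym2.eq_swap]
    rfl
  · exact X.tw_tw a (mem_arcsOf.1 ha).1
  · exact X.tw_ne a (mem_arcsOf.1 ha).1

variable (X) in
/-- The multigraph. -/
def mg : Multigraph ℕ where
  verts := X.A
  -- Both arcs of an edge, also of a loop, have the same unordered pair of ends, so the division is
  -- exact.
  mult e := (X.arcsOf e).card / 2
  mem_verts e he v hv := by
    have : (X.arcsOf e).card ≠ 0 := by
      intro h
      simp [h] at he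
    obtain ⟨a, ha⟩ := Finset.card_ne_zero.1 this
    obtain ⟨haL, rfl⟩ := mem_arcsOf.1 ha
    rcases Sym2.mem_iff.1 hv with rfl | rfl
    · exact X.own_mem a haL
    · exact tgt_mem haL

theorem two_mul_mult (e : Sym2 ℕ) : 2 * X.mg.mult e = (X.arcsOf e).card :=
  Nat.two_mul_div_two_of_even (even_card_arcsOf e)

theorem mult_pos {a : ℕ} (ha : a ∈ X.L) : 1 ≤ X.mg.mult s(X.own a, X.tgt a) := by
  have h := two_mul_mult (X := X) s(X.own a, X.tgt a)
  have : 0 < (X.arcsOf s(X.own a, X.tgt a)).card :=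
    Finset.card_pos.2 ⟨a, mem_arcsOf.2 ⟨ha, rfl⟩⟩
  omega

theorem exists_arc {u v : ℕ} (h : X.mg.mult s(u, v) ≠ 0) :
    ∃ a ∈ X.L, X.own a = u ∧ X.tgt a = v := by
  have h2 := two_mul_mult (X := X) s(u, v)
  obtain ⟨a, ha⟩ := Finset.card_ne_zero.1 (show (X.arcsOf s(u, v)).card ≠ 0 by omega)
  obtain ⟨ha, he⟩ := mem_arcsOf.1 ha
  rcases Sym2.eq_iff.1 he with h | h
  · exact ⟨a, ha, h⟩
  · exact ⟨X.tw a, X.tw_mem a ha, h.2, (tgt_tw ha).trans h.1⟩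

/-- A single edge has only two arcs, and here are three. -/
theorem two_le_mult {a b : ℕ} (ha : a ∈ X.L) (hb : b ∈ X.L) (hab : b ≠ a) (hab' : b ≠ X.tw a)
    (h : s(X.own b, X.tgt b) = s(X.own a, X.tgt a)) : 2 ≤ X.mg.mult s(X.own a, X.tgt a) := by
  have h2 := two_mul_mult (X := X) s(X.own a, X.tgt a)
  have h3 : ({a, X.tw a, b} : Finset ℕ) ⊆ X.arcsOf s(X.own a, X.tgt a) := by
    intro c hc
    simp only [Finset.mem_insert, Finset.mem_singleton] at hc
    rcases hc with rfl | rfl | rfl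
    · exact mem_arcsOf.2 ⟨ha, rfl⟩
    · refine mem_arcsOf.2 ⟨X.tw_mem a ha, ?_⟩
      rw [tgt_tw ha, Sym2.eq_swap]
      rfl
    · exact mem_arcsOf.2 ⟨hb, h⟩
  have h4 := Finset.card_le_card h3
  rw [Finset.card_insert_of_notMem (by simp [(X.tw_ne a ha).symm, hab.symm]),
    Finset.card_insert_of_notMem (by simpa using hab'.symm), Finset.card_singleton] at h4
  omega

theorem exists_two_arcs {u v : ℕ} (h : 2 ≤ X.mg.mult s(u, v)) :
    ∃ a ∈ X.L, ∃ b ∈ X.L, a ≠ b ∧ X.own a = u ∧ X.tgt a = v ∧ X.own b = u ∧ X.tgt b = v := by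
  have h2 := two_mul_mult (X := X) s(u, v)
  obtain ⟨a, ha, hau, hav⟩ := exists_arc (X := X) (u := u) (v := v) (by omega)
  have h3 : 0 < ((X.arcsOf s(u, v)) \ {a, X.tw a}).card := by
    have h4 := Finset.le_card_sdiff {a, X.tw a} (X.arcsOf s(u, v))
    have h5 := Finset.card_le_two (a := a) (b := X.tw a)
    omega
  obtain ⟨b, hb⟩ := Finset.card_pos.1 h3
  simp only [Finset.mem_sdiff, Finset.mem_insert, Finset.mem_singleton, not_or, mem_arcsOf] at hb
  obtain ⟨⟨hb, he⟩, hba, hbt⟩ := hb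
  rcases Sym2.eq_iff.1 he with h | h
  · exact ⟨a, ha, b, hb, Ne.symm hba, hau, hav, h.1, h.2⟩
  · refine ⟨a, ha, X.tw b, X.tw_mem b hb, ?_, hau, hav, h.2, (tgt_tw hb).trans h.1⟩
    rintro rfl
    exact hbt (X.tw_tw b hb).symm

/-- The multiset of the neighbours of a vertex. -/
def nbrs (X : ArcGraph) (v : ℕ) : Multiset ℕ := (X.arcsAt v).val.map X.tgt

theorem card_nbrs (v : ℕ) : (X.nbrs v).card = X.deg v := Multiset.card_map _ _

theorem count_nbrs (v u : ℕ) :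
    (X.nbrs v).count u = ((X.arcsAt v).filter fun a => X.tgt a = u).card := by
  rw [nbrs, Multiset.count_map]
  simp only [eq_comm]
  rfl

theorem mem_nbrs {v u : ℕ} : u ∈ X.nbrs v ↔ ∃ a ∈ X.L, X.own a = v ∧ X.tgt a = u := by
  simp [nbrs, mem_arcsAt, and_assoc]

/-- At a vertex without loops, every incident edge has exactly one arc that starts there. A loop
would be counted twice on the right. -/
theorem mult_eq_count {v : ℕ} (hv : v ∉ X.nbrs v) (u : ℕ) :
    X.mg.mult s(v, u) = (X.nbrs v).count u := by
  have h2 := two_mul_mult (X := X) s(v, u)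
  by_cases huv : u = v
  · subst huv
    rw [Multiset.count_eq_zero.2 hv]
    by_contra h
    exact hv (mem_nbrs.2 (exists_arc h))
  rw [count_nbrs]
  have h3 : X.arcsOf s(v, u) = ((X.arcsAt v).filter fun a => X.tgt a = u) ∪
      ((X.arcsAt v).filter fun a => X.tgt a = u).image X.tw := by
    ext a
    simp only [mem_arcsOf, Finset.mem_union, Finset.mem_image, Finset.mem_filter, mem_arcsAt]
    constructor
    · rintro ⟨ha, he⟩
      rcases Sym2.eq_iff.1 he with h | h
      · exact .inl ⟨⟨ha, h.1⟩, h.2⟩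
      · exact .inr ⟨X.tw a, ⟨⟨X.tw_mem a ha, h.2⟩, (tgt_tw ha).trans h.1⟩, X.tw_tw a ha⟩
    · rintro (⟨⟨ha, rfl⟩, rfl⟩ | ⟨b, ⟨⟨ha, rfl⟩, rfl⟩, rfl⟩)
      · exact ⟨ha, rfl⟩
      · refine ⟨X.tw_mem b ha, ?_⟩
        rw [tgt_tw ha, Sym2.eq_swap]
        rfl
  rw [h3, Finset.card_union_of_disjoint, Finset.card_image_of_injOn] at h2
  · omega
  · intro a ha b hb h
    simp only [Finset.coe_filter, mem_arcsAt, Set.mem_ofPred_eq] at ha hb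
    exact tw_inj ha.1.1 hb.1.1 h
  · rw [Finset.disjoint_left]
    intro a ha hb
    simp only [Finset.mem_image, Finset.mem_filter, mem_arcsAt] at ha hb
    obtain ⟨b, ⟨⟨hb, hbv⟩, hbu⟩, rfl⟩ := hb
    exact huv (hbu.symm.trans ha.1.2)

/-- Delete the vertices in `C`. -/
def kill (X : ArcGraph) (C : Finset ℕ) : ArcGraph where
  A := X.A \ C
  L := X.L.filter fun a => X.own a ∉ C ∧ X.tgt a ∉ C
  own := X.own
  tw := X.tw
  own_mem a ha := by
    simp only [Finset.mem_filter] at ha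
    exact Finset.mem_sdiff.2 ⟨X.own_mem a ha.1, ha.2.1⟩
  tw_mem a ha := by
    simp only [Finset.mem_filter] at ha ⊢
    exact ⟨X.tw_mem a ha.1, ha.2.2, by rw [tgt_tw ha.1]; exact ha.2.1⟩
  tw_tw a ha := X.tw_tw a (Finset.mem_filter.1 ha).1
  tw_ne a ha := X.tw_ne a (Finset.mem_filter.1 ha).1

theorem mem_kill_L {C : Finset ℕ} {a : ℕ} :
    a ∈ (X.kill C).L ↔ a ∈ X.L ∧ X.own a ∉ C ∧ X.tgt a ∉ C := by
  simp [kill]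

theorem mg_kill (X : ArcGraph) (C : Finset ℕ) : (X.kill C).mg = X.mg.deleteVerts C := by
  refine Multigraph.ext_of rfl fun e => ?_
  rw [Multigraph.deleteVerts_mult_eq]
  have h : (X.kill C).arcsOf e = if ∀ v ∈ C, v ∉ e then X.arcsOf e else ∅ := by
    ext a
    rw [mem_arcsOf, mem_kill_L]
    show (_ ∧ s(X.own a, X.tgt a) = e) ↔ _
    split_ifs with hC
    · rw [mem_arcsOf]
      refine ⟨fun h => ⟨h.1.1, h.2⟩, fun h => ⟨⟨h.1, fun hc => ?_, fun hc => ?_⟩, h.2⟩⟩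
      · exact hC _ hc (by simp [← h.2])
      · exact hC _ hc (by simp [← h.2])
    · simp only [Finset.notMem_empty, iff_false]
      rintro ⟨⟨h1, h2, h3⟩, rfl⟩
      refine hC fun v hv hve => ?_
      rcases Sym2.mem_iff.1 hve with rfl | rfl
      · exact h2 hv
      · exact h3 hv
  show ((X.kill C).arcsOf e).card / 2 = _
  rw [h]
  split_ifs
  · rfl
  · simp

theorem kill_kill (X : ArcGraph) (C C' : Finset ℕ) : (X.kill C).kill C' = X.kill (C ∪ C') := by
  refine ext_of ?_ ?_ rfl rfl
  · exact sdiff_sdiff_left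
  · ext a
    rw [mem_kill_L, mem_kill_L, mem_kill_L, Finset.mem_union, Finset.mem_union]
    show ((_ ∧ _) ∧ X.own a ∉ C' ∧ X.tgt a ∉ C') ↔ _
    tauto

theorem elimStep_kill {v : ℕ} (hv : v ∈ X.A) (hd : X.deg v ≤ 1) :
    Multigraph.ElimStep X.mg (X.kill {v}).mg := by
  have hloop : v ∉ X.nbrs v := by
    rw [mem_nbrs]
    rintro ⟨a, ha, hav, hat⟩
    have : ({a, X.tw a} : Finset ℕ) ⊆ X.arcsAt v := by
      intro b hb
      simp only [Finset.mem_insert, Finset.mem_singleton] at hb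
      rcases hb with rfl | rfl
      · exact mem_arcsAt.2 ⟨ha, hav⟩
      · exact mem_arcsAt.2 ⟨X.tw_mem a ha, hat⟩
    have := Finset.card_le_card this
    rw [Finset.card_pair (X.tw_ne a ha).symm] at this
    unfold deg at hd
    omega
  refine ⟨v, X.nbrs v, hv, hloop, ?_, mult_eq_count hloop, ?_, fun e => ?_⟩
  · rw [card_nbrs]
    omega
  · exact Finset.sdiff_singleton_eq_erase _ _
  · rw [mg_kill, Multigraph.deleteVerts_mult_eq, if_neg (c := e.toMultiset = _), add_zero]
    · simp only [Finset.mem_singleton, forall_eq]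
      split_ifs <;> simp_all
    · intro h
      have := congrArg Multiset.card h
      rw [Sym2.card_toMultiset, card_nbrs] at this
      omega

/-- The data for suppressing a vertex `v` with exactly two arcs `p` and `q`, not forming a loop. -/
structure CanSuppress (X : ArcGraph) (v p q : ℕ) : Prop where
  mem : v ∈ X.A
  arcs : X.arcsAt v = {p, q}
  ne : p ≠ q
  tw_ne : X.tw p ≠ q

namespace CanSuppress

variable {v p q : ℕ}

theorem mem_left (h : X.CanSuppress v p q) : p ∈ X.L ∧ X.own p = v :=
  mem_arcsAt.1 (by rw [h.arcs]; simp)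

theorem mem_right (h : X.CanSuppress v p q) : q ∈ X.L ∧ X.own q = v :=
  mem_arcsAt.1 (by rw [h.arcs]; simp)

theorem eq_or (h : X.CanSuppress v p q) {a : ℕ} (ha : a ∈ X.L) (hv : X.own a = v) :
    a = p ∨ a = q := by
  have : a ∈ X.arcsAt v := mem_arcsAt.2 ⟨ha, hv⟩
  rw [h.arcs] at this
  simpa using this

theorem tgt_ne (h : X.CanSuppress v p q) : X.tgt p ≠ v ∧ X.tgt q ≠ v := by
  obtain ⟨hp, hpv⟩ := h.mem_left
  obtain ⟨hq, hqv⟩ := h.mem_right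
  constructor
  · intro ht
    rcases h.eq_or (X.tw_mem p hp) ht with h1 | h1
    · exact X.tw_ne p hp h1
    · exact h.tw_ne h1
  · intro ht
    rcases h.eq_or (X.tw_mem q hq) ht with h1 | h1
    · exact h.tw_ne (by rw [← h1, X.tw_tw q hq])
    · exact X.tw_ne q hq h1

theorem facts (h : X.CanSuppress v p q) : X.tw p ≠ p ∧ X.tw p ≠ q ∧ X.tw q ≠ p ∧ X.tw q ≠ q ∧
    X.tw p ≠ X.tw q := by
  obtain ⟨hp, hpv⟩ := h.mem_left
  obtain ⟨hq, hqv⟩ := h.mem_right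
  exact ⟨X.tw_ne p hp, h.tw_ne, fun h1 => h.tw_ne (by rw [← h1, X.tw_tw q hq]), X.tw_ne q hq,
    fun h1 => h.ne (tw_inj hp hq h1)⟩

end CanSuppress

/-- The new twins when a vertex with arcs `p` and `q` is suppressed. -/
def newTw (tw : ℕ → ℕ) (p q : ℕ) : ℕ → ℕ :=
  Function.update (Function.update tw (tw p) (tw q)) (tw q) (tw p)

theorem newTw_left {p q : ℕ} {tw : ℕ → ℕ} (h : tw p ≠ tw q) : newTw tw p q (tw p) = tw q := by
  simp [newTw, h]

theorem newTw_right {p q : ℕ} {tw : ℕ → ℕ} : newTw tw p q (tw q) = tw p := by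
  simp [newTw]

theorem newTw_of_ne {p q a : ℕ} {tw : ℕ → ℕ} (hp : a ≠ tw p) (hq : a ≠ tw q) :
    newTw tw p q a = tw a := by
  simp [newTw, hp, hq]

/-- Suppress a vertex of degree two. -/
def suppress (X : ArcGraph) {v p q : ℕ} (h : X.CanSuppress v p q) : ArcGraph where
  A := X.A.erase v
  -- The arcs `tw p` and `tw q` survive and form the new edge; no new arc is ever needed, so the
  -- arrays keep their size.
  L := X.L \ {p, q}
  own := X.own
  tw := newTw X.tw p q
  own_mem a ha := by
    simp only [Finset.mem_sdiff, Finset.mem_insert, Finset.mem_singleton] at ha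
    exact Finset.mem_erase.2 ⟨fun hv => ha.2 (h.eq_or ha.1 hv), X.own_mem a ha.1⟩
  tw_mem a ha := by
    obtain ⟨h1, h2, h3, h4, h5⟩ := h.facts
    simp only [Finset.mem_sdiff, Finset.mem_insert, Finset.mem_singleton, not_or] at ha ⊢
    by_cases hp : a = X.tw p
    · subst hp
      rw [newTw_left h5]
      exact ⟨X.tw_mem q h.mem_right.1, h3, h4⟩
    by_cases hq : a = X.tw q
    · subst hq
      rw [newTw_right]
      exact ⟨X.tw_mem p h.mem_left.1, h1, h2⟩
    rw [newTw_of_ne hp hq]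
    refine ⟨X.tw_mem a ha.1, fun h => hp ?_, fun h => hq ?_⟩
    · rw [← h, X.tw_tw a ha.1]
    · rw [← h, X.tw_tw a ha.1]
  tw_tw a ha := by
    obtain ⟨h1, h2, h3, h4, h5⟩ := h.facts
    simp only [Finset.mem_sdiff, Finset.mem_insert, Finset.mem_singleton, not_or] at ha
    by_cases hp : a = X.tw p
    · subst hp
      rw [newTw_left h5, newTw_right]
    by_cases hq : a = X.tw q
    · subst hq
      rw [newTw_right, newTw_left h5]
    rw [newTw_of_ne hp hq, newTw_of_ne, X.tw_tw a ha.1]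
    · exact fun h' => ha.2.1 (tw_inj ha.1 h.mem_left.1 h')
    · exact fun h' => ha.2.2 (tw_inj ha.1 h.mem_right.1 h')
  tw_ne a ha := by
    obtain ⟨h1, h2, h3, h4, h5⟩ := h.facts
    simp only [Finset.mem_sdiff, Finset.mem_insert, Finset.mem_singleton, not_or] at ha
    by_cases hp : a = X.tw p
    · subst hp
      rw [newTw_left h5]
      exact h5.symm
    by_cases hq : a = X.tw q
    · subst hq
      rw [newTw_right]
      exact h5
    rw [newTw_of_ne hp hq]
    exact X.tw_ne a ha.1

theorem mem_suppress_L {v p q a : ℕ} {h : X.CanSuppress v p q} :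
    a ∈ (X.suppress h).L ↔ a ∈ X.L ∧ a ≠ p ∧ a ≠ q := by
  simp [suppress]

theorem nbrs_eq {v p q : ℕ} (h : X.CanSuppress v p q) : X.nbrs v = {X.tgt p, X.tgt q} := by
  rw [nbrs, h.arcs]
  rw [Finset.insert_val_of_notMem (by simpa using h.ne)]
  rfl

/-- Edges without the four arcs `p`, `q` and their twins are untouched. The edges at `v` disappear,
and the two surviving arcs add one to the multiplicity of the pair of neighbours. -/
theorem elim_suppress {v p q : ℕ} (h : X.CanSuppress v p q) :
    Multigraph.Elim X.mg (X.suppress h).mg v (X.nbrs v) := by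
  obtain ⟨hp, hpv⟩ := h.mem_left
  obtain ⟨hq, hqv⟩ := h.mem_right
  obtain ⟨f1, f2, f3, f4, f5⟩ := h.facts
  have hloop : v ∉ X.nbrs v := by
    rw [nbrs_eq h]
    simp [h.tgt_ne.1.symm, h.tgt_ne.2.symm]
  refine ⟨h.mem, hloop, ?_, mult_eq_count hloop, rfl, fun e => ?_⟩
  · rw [nbrs_eq h]
    simp
  · have hR : X.arcsOf e = (if v ∈ e then X.arcsOf e else
        (X.L \ {p, q, X.tw p, X.tw q}).filter fun a => s(X.own a, X.tgt a) = e) := by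
      split_ifs with hve
      · rfl
      · ext a
        simp only [mem_arcsOf, Finset.mem_filter, Finset.mem_sdiff, Finset.mem_insert,
          Finset.mem_singleton, not_or]
        refine ⟨fun ⟨ha, he⟩ => ⟨⟨ha, ?_⟩, he⟩, fun h => ⟨h.1.1, h.2⟩⟩
        refine ⟨?_, ?_, ?_, ?_⟩ <;> rintro rfl <;> apply hve <;> rw [← he]
        · simp [hpv]
        · simp [hqv]
        · simp [tgt_tw hp, hpv]
        · simp [tgt_tw hq, hqv]
    have hL : (X.suppress h).arcsOf e =
        ((X.L \ {p, q, X.tw p, X.tw q}).filter fun a => s(X.own a, X.tgt a) = e) ∪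
          if s(X.tgt p, X.tgt q) = e then {X.tw p, X.tw q} else ∅ := by
      ext a
      rw [mem_arcsOf, mem_suppress_L, Finset.mem_union]
      simp only [Finset.mem_filter, Finset.mem_sdiff, Finset.mem_insert, Finset.mem_singleton,
        not_or]
      show (_ ∧ s(X.own a, X.own (newTw X.tw p q a)) = e) ↔ _
      by_cases hap : a = X.tw p
      · subst hap
        rw [newTw_left f5]
        have : (X.tw p ∈ if s(X.tgt p, X.tgt q) = e then ({X.tw p, X.tw q} : Finset ℕ) else ∅) ↔
            s(X.tgt p, X.tgt q) = e := by split_ifs <;> simp_all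
        rw [this]
        show (_ ∧ s(X.tgt p, X.tgt q) = e) ↔ _
        simp [X.tw_mem p hp, f1, f2]
      by_cases haq : a = X.tw q
      · subst haq
        rw [newTw_right]
        have : (X.tw q ∈ if s(X.tgt p, X.tgt q) = e then ({X.tw p, X.tw q} : Finset ℕ) else ∅) ↔
            s(X.tgt p, X.tgt q) = e := by split_ifs <;> simp_all
        rw [this]
        show (_ ∧ s(X.tgt q, X.tgt p) = e) ↔ _
        rw [Sym2.eq_swap]
        simp [X.tw_mem q hq, f3, f4]
      rw [newTw_of_ne hap haq]
      have : (a ∉ if s(X.tgt p, X.tgt q) = e then ({X.tw p, X.tw q} : Finset ℕ) else ∅) := by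
        split_ifs <;> simp_all
      simp only [this, or_false, hap, haq, not_false_eq_true, and_true]
      rfl
    have hdis : Disjoint ((X.L \ {p, q, X.tw p, X.tw q}).filter fun a => s(X.own a, X.tgt a) = e)
        (if s(X.tgt p, X.tgt q) = e then {X.tw p, X.tw q} else ∅) := by
      rw [Finset.disjoint_left]
      intro a ha hb
      simp only [Finset.mem_filter, Finset.mem_sdiff, Finset.mem_insert, Finset.mem_singleton,
        not_or] at ha
      split_ifs at hb
      · simp only [Finset.mem_insert, Finset.mem_singleton] at hb
        tauto
      · simp at hb
    have hc := congrArg Finset.card hL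
    rw [Finset.card_union_of_disjoint hdis, ← two_mul_mult] at hc
    have hind : (e.toMultiset = X.nbrs v) ↔ s(X.tgt p, X.tgt q) = e := by
      rw [nbrs_eq h, ← Multigraph.toMultiset_mk, Multigraph.toMultiset_inj, eq_comm]
    have h2 := two_mul_mult (X := X) e
    simp only [hind]
    by_cases hve : v ∈ e
    · have h0 : ((X.L \ {p, q, X.tw p, X.tw q}).filter fun a => s(X.own a, X.tgt a) = e) = ∅ := by
        refine Finset.filter_eq_empty_iff.2 fun a ha he => ?_
        simp only [Finset.mem_sdiff, Finset.mem_insert, Finset.mem_singleton, not_or] at ha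
        rw [← he, Sym2.mem_iff] at hve
        rcases hve with hv | hv
        · rcases h.eq_or ha.1 hv.symm with h1 | h1
          · exact ha.2.1 h1
          · exact ha.2.2.1 h1
        · rcases h.eq_or (X.tw_mem a ha.1) hv.symm with h1 | h1
          · exact ha.2.2.2.1 (by rw [← h1, X.tw_tw a ha.1])
          · exact ha.2.2.2.2 (by rw [← h1, X.tw_tw a ha.1])
      rw [h0] at hc
      rw [if_pos hve]
      split_ifs at hc ⊢
      · rw [Finset.card_pair f5, Finset.card_empty] at hc
        omega
      · rw [Finset.card_empty] at hc
        omega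
    · rw [if_neg hve] at hR ⊢
      rw [hR] at h2
      split_ifs at hc ⊢
      · rw [Finset.card_pair f5] at hc
        omega
      · rw [Finset.card_empty] at hc
        omega

end ArcGraph

/-! ### Paths through suppressed vertices -/

/-- `l` are the arcs that follow the arc `a` on the path through suppressed vertices that ends with
(the reverse of) the arc `t`. A suppressed vertex has two arcs, which are paired by `mate`, where
`mate b = 0` means that `b` is not paired, and `mate b = c + 1` that `b` is paired with `c`. -/
def Seg (otw mate : ℕ → ℕ) : ℕ → List ℕ → ℕ → Prop
  | a, [], t => t = otw a
  | a, b :: l, t => mate (otw a) = b + 1 ∧ Seg otw mate b l t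

/-- The reversal of arcs and the pairing of arcs, on the arcs smaller than `m`. -/
structure Pairing (m : ℕ) (own otw mate : ℕ → ℕ) : Prop where
  otw_lt : ∀ a < m, otw a < m
  otw_otw : ∀ a < m, otw (otw a) = a
  otw_ne : ∀ a < m, otw a ≠ a
  mate_lt : ∀ a < m, ∀ b, mate a = b + 1 → b < m
  mate_ne : ∀ a < m, ∀ b, mate a = b + 1 → b ≠ a
  mate_own : ∀ a < m, ∀ b, mate a = b + 1 → own b = own a
  mate_symm : ∀ a < m, ∀ b, mate a = b + 1 → mate b = a + 1
  mate_uniq : ∀ a < m, ∀ b < m, mate a ≠ 0 → mate b ≠ 0 → own a = own b → a = b ∨ mate a = b + 1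

namespace Seg

variable {m : ℕ} {own otw mate : ℕ → ℕ}

theorem append {a b t t' : ℕ} {l l' : List ℕ} (h : Seg otw mate a l t) (hb : mate t = b + 1)
    (h' : Seg otw mate b l' t') : Seg otw mate a (l ++ b :: l') t' := by
  induction l generalizing a with
  | nil =>
    obtain rfl : t = otw a := h
    exact ⟨hb, h'⟩
  | cons c l ih => exact ⟨h.1, ih h.2⟩

theorem lt (hP : Pairing m own otw mate) {a t : ℕ} {l : List ℕ} (ha : a < m)
    (h : Seg otw mate a l t) : (∀ b ∈ l, b < m ∧ mate b ≠ 0) ∧ t < m := by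
  induction l generalizing a with
  | nil =>
    obtain rfl : t = otw a := h
    exact ⟨by simp, hP.otw_lt a ha⟩
  | cons c l ih =>
    have hc := hP.mate_lt _ (hP.otw_lt a ha) _ h.1
    obtain ⟨h1, h2⟩ := ih hc h.2
    refine ⟨fun b hb => ?_, h2⟩
    rcases List.mem_cons.1 hb with rfl | hb
    · exact ⟨hc, by rw [hP.mate_symm _ (hP.otw_lt a ha) _ h.1]; omega⟩
    · exact h1 b hb

theorem det {a t t' : ℕ} {l l' : List ℕ} (h : Seg otw mate a l t) (h' : Seg otw mate a l' t')
    (ht : mate t = 0) (ht' : mate t' = 0) : l = l' ∧ t = t' := by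
  induction l generalizing a l' with
  | nil =>
    obtain rfl : t = otw a := h
    cases l' with
    | nil => exact ⟨rfl, Eq.symm h'⟩
    | cons c l' => rw [h'.1] at ht; omega
  | cons b l ih =>
    cases l' with
    | nil =>
      obtain rfl : t' = otw a := h'
      rw [h.1] at ht'
      omega
    | cons c l' =>
      obtain rfl : b = c := by have := h.1.symm.trans h'.1; omega
      obtain ⟨rfl, rfl⟩ := ih h.2 h'.2
      exact ⟨rfl, rfl⟩

theorem suffix {a b t : ℕ} {l : List ℕ} (h : Seg otw mate a l t) (hb : b ∈ l) :
    ∃ l', Seg otw mate b l' t ∧ l'.length < l.length := by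
  induction l generalizing a with
  | nil => simp at hb
  | cons c l ih =>
    rcases List.mem_cons.1 hb with rfl | hb
    · exact ⟨l, h.2, by simp⟩
    · obtain ⟨l', h1, h2⟩ := ih h.2 hb
      exact ⟨l', h1, by simp; omega⟩

/-- A path can be run backwards: reversal and pairing are both symmetric, so from the mate of an
inner arc one returns to the first arc. -/
theorem back (hP : Pairing m own otw mate) {a b t : ℕ} {l : List ℕ} (ha : a < m)
    (h : Seg otw mate a l t) (hb : b ∈ l) :
    ∃ x l', mate b = x + 1 ∧ Seg otw mate x l' a := by
  induction l generalizing a with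
  | nil => simp at hb
  | cons c l ih =>
    have hs := hP.mate_symm _ (hP.otw_lt a ha) _ h.1
    have hr : Seg otw mate (otw a) [] a := (hP.otw_otw a ha).symm
    rcases List.mem_cons.1 hb with rfl | hb
    · exact ⟨otw a, [], hs, hr⟩
    · obtain ⟨x, l', h1, h2⟩ := ih (hP.mate_lt _ (hP.otw_lt a ha) _ h.1) h.2 hb
      exact ⟨x, _, h1, h2.append hs hr⟩

/-- An inner vertex determines the path it lies on. -/
theorem eq_or_eq (hP : Pairing m own otw mate) {a b t c d t' : ℕ} {l l' : List ℕ} (ha : a < m)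
    (hc : c < m) (h : Seg otw mate a l t) (h' : Seg otw mate c l' t') (ma : mate a = 0)
    (mc : mate c = 0) (mt' : mate t' = 0) (hb : b ∈ l) (hd : d ∈ l')
    (ho : own b = own d) : (a = c ∧ b = d) ∨ a = t' := by
  obtain ⟨x, r, hx, hr⟩ := h.back hP ha hb
  obtain ⟨y, r', hy, hr'⟩ := h'.back hP hc hd
  have hbm := (h.lt hP ha).1 b hb
  have hdm := (h'.lt hP hc).1 d hd
  -- The two arcs at the common inner vertex are equal or paired. Accordingly the two paths run
  -- through it in the same or in opposite directions, and they are traced to the same unpaired arc.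
  rcases hP.mate_uniq b hbm.1 d hdm.1 hbm.2 hdm.2 ho with rfl | hbd
  · left
    obtain rfl : x = y := by omega
    exact ⟨(hr.det hr' ma mc).2, rfl⟩
  · right
    obtain rfl : x = d := by omega
    obtain ⟨r2, hr2, _⟩ := h'.suffix hd
    exact (hr.det hr2 ma mt').2

/-- A vertex passed twice in the same direction would make the rest of the path a proper part of
itself; passed in opposite directions it would force `a = t`. -/
theorem nodup (hP : Pairing m own otw mate) {a t : ℕ} {l : List ℕ} (ha : a < m)
    (h : Seg otw mate a l t) (ma : mate a = 0) (mt : mate t = 0) (hat : a ≠ t) :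
    (l.map own).Nodup := by
  suffices H : ∀ r a', (∃ d, l = d ++ r) → Seg otw mate a' r t → (r.map own).Nodup from
    H l a ⟨[], rfl⟩ h
  intro r
  induction r with
  | nil => simp
  | cons b r ih =>
    rintro a' ⟨d, hd⟩ hs
    rw [List.map_cons, List.nodup_cons]
    refine ⟨fun hm => ?_, ih b ⟨d ++ [b], by simp [hd]⟩ hs.2⟩
    obtain ⟨c, hc, hbc⟩ := List.mem_map.1 hm
    rcases eq_or_eq hP ha ha h h ma ma mt (b := b) (d := c) (by simp [hd]) (by simp [hd, hc])
      hbc.symm with ⟨_, rfl⟩ | h1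
    · obtain ⟨l', h1, h2⟩ := hs.2.suffix hc
      have := (h1.det hs.2 mt mt).1
      subst this
      omega
    · exact hat h1

/-- Consecutive arcs of a walk. -/
theorem isChain (hP : Pairing m own otw mate) {a t c : ℕ} {l r : List ℕ} (ha : a < m)
    (h : Seg otw mate a l t) (hc : own t = own c)
    (hr : (c :: r).IsChain fun x y => x < m ∧ own (otw x) = own y) :
    ((a :: l) ++ c :: r).IsChain fun x y => x < m ∧ own (otw x) = own y := by
  induction l generalizing a with
  | nil =>
    obtain rfl : t = otw a := h
    exact List.isChain_cons_cons.2 ⟨⟨ha, hc⟩, hr⟩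
  | cons b l ih =>
    have hb := hP.mate_lt _ (hP.otw_lt a ha) _ h.1
    exact List.isChain_cons_cons.2 ⟨⟨ha, (hP.mate_own _ (hP.otw_lt a ha) _ h.1).symm⟩, ih hb h.2⟩

theorem congr {mate' : ℕ → ℕ} {a t : ℕ} {l : List ℕ} (h : Seg otw mate a l t)
    (hm : ∀ b, mate b ≠ 0 → mate' b = mate b) : Seg otw mate' a l t := by
  induction l generalizing a with
  | nil => exact h
  | cons b l ih => exact ⟨by rw [hm _ (by rw [h.1]; omega)]; exact h.1, ih h.2⟩

end Seg

namespace ArcGraph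

/-- The paths in the original graph that the edges of `X` stand for: their inner vertices are
neither in `X` nor in `U`. -/
structure Paths (X : ArcGraph) (m : ℕ) (otw mate : ℕ → ℕ) (U : ℕ → Prop) : Prop where
  pairing : Pairing m X.own otw mate
  lt : ∀ a ∈ X.L, a < m
  mate_L : ∀ a ∈ X.L, mate a = 0
  mate_A : ∀ a < m, mate a ≠ 0 → X.own a ∉ X.A
  seg : ∀ a ∈ X.L, ∃ l, Seg otw mate a l (X.tw a) ∧ ∀ b ∈ l, ¬ U (X.own b)
  disj : ∀ v ∈ X.A, ¬ U v

variable {X : ArcGraph} {m : ℕ} {otw mate : ℕ → ℕ} {U : ℕ → Prop}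

theorem Paths.kill (h : X.Paths m otw mate U) (C : Finset ℕ) : (X.kill C).Paths m otw mate U where
  pairing := h.pairing
  lt a ha := h.lt a (mem_kill_L.1 ha).1
  mate_L a ha := h.mate_L a (mem_kill_L.1 ha).1
  mate_A a ha hm hA := h.mate_A a ha hm (Finset.mem_sdiff.1 hA).1
  seg a ha := h.seg a (mem_kill_L.1 ha).1
  disj v hv := h.disj v (Finset.mem_sdiff.1 hv).1

/-- The new pairing when a vertex with arcs `p` and `q` is suppressed. -/
def newMate (mate : ℕ → ℕ) (p q : ℕ) : ℕ → ℕ :=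
  Function.update (Function.update mate p (q + 1)) q (p + 1)

/-- The path of `tw p` ends with `p`, which is now paired with `q`, where the path of `q` takes
over. Old pairs are unchanged, so all other paths remain. -/
theorem Paths.suppress (h : X.Paths m otw mate U) {v p q : ℕ} (hs : X.CanSuppress v p q) :
    (X.suppress hs).Paths m otw (newMate mate p q) U := by
  obtain ⟨hp, hpv⟩ := hs.mem_left
  obtain ⟨hq, hqv⟩ := hs.mem_right
  obtain ⟨f1, f2, f3, f4, f5⟩ := hs.facts
  have hP := h.pairing
  have mp := h.mate_L p hp
  have mq := h.mate_L q hq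
  have np : newMate mate p q p = q + 1 := by simp [newMate, hs.ne]
  have nq : newMate mate p q q = p + 1 := by simp [newMate]
  have no : ∀ a, a ≠ p → a ≠ q → newMate mate p q a = mate a := fun a h1 h2 => by
    simp [newMate, h1, h2]
  have nv : ∀ a < m, mate a ≠ 0 → X.own a ≠ v := fun a ha hm hv =>
    h.mate_A a ha hm (hv ▸ hs.mem)
  have ne : ∀ b, mate b ≠ 0 → newMate mate p q b = mate b := fun b hb =>
    no b (fun h => hb (h ▸ mp)) (fun h => hb (h ▸ mq))
  have cases3 : ∀ a, a = p ∨ a = q ∨ (a ≠ p ∧ a ≠ q) := fun a => by tauto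
  refine ⟨⟨hP.otw_lt, hP.otw_otw, hP.otw_ne, ?_, ?_, ?_, ?_, ?_⟩, ?_, ?_, ?_, ?_, ?_⟩
  · intro a ha b hb
    rcases cases3 a with rfl | rfl | ⟨h1, h2⟩
    · rw [np] at hb
      obtain rfl : q = b := by omega
      exact h.lt _ hq
    · rw [nq] at hb
      obtain rfl : p = b := by omega
      exact h.lt _ hp
    · rw [no a h1 h2] at hb
      exact hP.mate_lt a ha b hb
  · intro a ha b hb
    rcases cases3 a with rfl | rfl | ⟨h1, h2⟩
    · rw [np] at hb
      obtain rfl : q = b := by omega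
      exact hs.ne.symm
    · rw [nq] at hb
      obtain rfl : p = b := by omega
      exact hs.ne
    · rw [no a h1 h2] at hb
      exact hP.mate_ne a ha b hb
  · intro a ha b hb
    show X.own b = X.own a
    rcases cases3 a with rfl | rfl | ⟨h1, h2⟩
    · rw [np] at hb
      obtain rfl : q = b := by omega
      rw [hpv, hqv]
    · rw [nq] at hb
      obtain rfl : p = b := by omega
      rw [hpv, hqv]
    · rw [no a h1 h2] at hb
      exact hP.mate_own a ha b hb
  · intro a ha b hb
    rcases cases3 a with rfl | rfl | ⟨h1, h2⟩
    · rw [np] at hb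
      obtain rfl : q = b := by omega
      exact nq
    · rw [nq] at hb
      obtain rfl : p = b := by omega
      exact np
    · rw [no a h1 h2] at hb
      have := hP.mate_symm a ha b hb
      rw [ne b (by omega), this]
  · intro a ha b hb ma mb (hab : X.own a = X.own b)
    rcases cases3 a with rfl | rfl | ⟨h1, h2⟩
    · rcases cases3 b with rfl | rfl | ⟨h3, h4⟩
      · exact .inl rfl
      · exact .inr np
      · rw [no b h3 h4] at mb
        exact absurd (hab.symm.trans hpv) (nv b hb mb)
    · rcases cases3 b with rfl | rfl | ⟨h3, h4⟩
      · exact .inr nq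
      · exact .inl rfl
      · rw [no b h3 h4] at mb
        exact absurd (hab.symm.trans hqv) (nv b hb mb)
    · rw [no a h1 h2] at ma ⊢
      rcases cases3 b with rfl | rfl | ⟨h3, h4⟩
      · exact absurd (hab.trans hpv) (nv a ha ma)
      · exact absurd (hab.trans hqv) (nv a ha ma)
      · rw [no b h3 h4] at mb
        exact hP.mate_uniq a ha b hb ma mb hab
  · exact fun a ha => h.lt a (mem_suppress_L.1 ha).1
  · intro a ha
    obtain ⟨ha, h1, h2⟩ := mem_suppress_L.1 ha
    rw [no a h1 h2]
    exact h.mate_L a ha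
  · intro a ha hm hA
    obtain ⟨h3, h4⟩ := Finset.mem_erase.1 hA
    rcases cases3 a with rfl | rfl | ⟨h1, h2⟩
    · exact h3 hpv
    · exact h3 hqv
    · rw [no a h1 h2] at hm
      exact h.mate_A a ha hm h4
  · intro a ha
    obtain ⟨ha, h1, h2⟩ := mem_suppress_L.1 ha
    show ∃ l, Seg otw _ a l (newTw X.tw p q a) ∧ _
    have hvU := h.disj v hs.mem
    by_cases hap : a = X.tw p
    · subst hap
      rw [newTw_left f5]
      obtain ⟨l, hl, hlU⟩ := h.seg _ (X.tw_mem p hp)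
      rw [X.tw_tw p hp] at hl
      obtain ⟨l', hl', hlU'⟩ := h.seg q hq
      refine ⟨_, (hl.congr ne).append np (hl'.congr ne), fun b hb => ?_⟩
      rcases List.mem_append.1 hb with hb | hb
      · exact hlU b hb
      · rcases List.mem_cons.1 hb with rfl | hb
        · show ¬ U (X.own _)
          rwa [hqv]
        · exact hlU' b hb
    by_cases haq : a = X.tw q
    · subst haq
      rw [newTw_right]
      obtain ⟨l, hl, hlU⟩ := h.seg _ (X.tw_mem q hq)
      rw [X.tw_tw q hq] at hl
      obtain ⟨l', hl', hlU'⟩ := h.seg p hp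
      refine ⟨_, (hl.congr ne).append nq (hl'.congr ne), fun b hb => ?_⟩
      rcases List.mem_append.1 hb with hb | hb
      · exact hlU b hb
      · rcases List.mem_cons.1 hb with rfl | hb
        · show ¬ U (X.own _)
          rwa [hpv]
        · exact hlU' b hb
    rw [newTw_of_ne hap haq]
    obtain ⟨l, hl, hlU⟩ := h.seg a ha
    exact ⟨l, hl.congr ne, hlU⟩
  · exact fun v hv => h.disj v (Finset.mem_of_mem_erase hv)

/-! ### Cycles -/

/-- The list of the arcs of a cycle, in order. -/
structure IsArcCycle (X : ArcGraph) (B : List ℕ) : Prop where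
  mem : ∀ b ∈ B, b ∈ X.L
  chain : ∀ b ∈ B.head?, (B ++ [b]).IsChain fun x y => X.tgt x = X.own y
  ne_nil : B ≠ []
  nodup : (B.map X.own).Nodup
  tw_notMem : ∀ b ∈ B, X.tw b ∉ B

/-- `lf` gives the arcs of the path that an edge stands for. -/
def LiftFun (X : ArcGraph) (otw mate : ℕ → ℕ) (U : ℕ → Prop) (lf : ℕ → List ℕ) : Prop :=
  ∀ a ∈ X.L, Seg otw mate a (lf a) (X.tw a) ∧ ∀ b ∈ lf a, ¬ U (X.own b)

theorem Paths.exists_liftFun (h : X.Paths m otw mate U) : ∃ lf, X.LiftFun otw mate U lf := by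
  choose! lf hlf using h.seg
  exact ⟨lf, hlf⟩

variable {lf : ℕ → List ℕ}

/-- The original arcs of a list of arcs. -/
def expand (lf : ℕ → List ℕ) (B : List ℕ) : List ℕ := B.flatMap fun a => a :: lf a

theorem mem_expand {B : List ℕ} {c : ℕ} : c ∈ expand lf B ↔ ∃ b ∈ B, c = b ∨ c ∈ lf b := by
  simp [expand]

theorem Paths.expand_lt (h : X.Paths m otw mate U) (hlf : X.LiftFun otw mate U lf) {B : List ℕ}
    (hB : ∀ b ∈ B, b ∈ X.L) : ∀ c ∈ expand lf B, c < m := by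
  intro c hc
  obtain ⟨b, hb, rfl | hc⟩ := mem_expand.1 hc
  · exact h.lt _ (hB _ hb)
  · exact ((hlf b (hB b hb)).1.lt h.pairing (h.lt b (hB b hb))).1 c hc |>.1

theorem Paths.inner_notMem (h : X.Paths m otw mate U) (hlf : X.LiftFun otw mate U lf) {b c : ℕ}
    (hb : b ∈ X.L) (hc : c ∈ lf b) : X.own c ∉ X.A := by
  have := ((hlf b hb).1.lt h.pairing (h.lt b hb)).1 c hc
  exact h.mate_A c this.1 this.2

/-- Inner vertices are not vertices of `X`, and by `Seg.eq_or_eq` the paths of two arcs share an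
inner vertex only if the arcs are equal or twins. A cycle contains no arc together with its twin. -/
theorem Paths.expand_nodup (h : X.Paths m otw mate U) (hlf : X.LiftFun otw mate U lf)
    {B : List ℕ} (hB : ∀ b ∈ B, b ∈ X.L) (hn : (B.map X.own).Nodup)
    (htw : ∀ b ∈ B, X.tw b ∉ B) : ((expand lf B).map X.own).Nodup := by
  induction B with
  | nil => simp [expand]
  | cons a B ih =>
    have ha := hB a (by simp)
    rw [List.map_cons, List.nodup_cons] at hn
    have hih := ih (fun b hb => hB b (by simp [hb])) hn.2
      (fun b hb hm => htw b (by simp [hb]) (by simp [hm]))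
    have hexp : expand lf (a :: B) = (a :: lf a) ++ expand lf B := by simp [expand]
    rw [hexp, List.map_append, List.nodup_append]
    refine ⟨?_, hih, ?_⟩
    · rw [List.map_cons, List.nodup_cons]
      refine ⟨fun hm => ?_, (hlf a ha).1.nodup h.pairing (h.lt a ha) (h.mate_L a ha)
        (h.mate_L _ (X.tw_mem a ha)) (X.tw_ne a ha).symm⟩
      obtain ⟨c, hc, hca⟩ := List.mem_map.1 hm
      exact h.inner_notMem hlf ha hc (hca ▸ X.own_mem a ha)
    · intro x hx y hy
      rintro rfl
      obtain ⟨c, hc, rfl⟩ := List.mem_map.1 hx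
      obtain ⟨d, hd, hdc⟩ := List.mem_map.1 hy
      obtain ⟨b, hb, hd⟩ := mem_expand.1 hd
      have hbL := hB b (by simp [hb])
      rcases List.mem_cons.1 hc with rfl | hc
      · rcases hd with rfl | hd
        · exact hn.1 (hdc ▸ List.mem_map_of_mem hb)
        · exact h.inner_notMem hlf hbL hd (hdc ▸ X.own_mem _ ha)
      · rcases hd with rfl | hd
        · exact h.inner_notMem hlf ha hc (hdc ▸ X.own_mem _ hbL)
        · rcases Seg.eq_or_eq h.pairing (h.lt a ha) (h.lt b hbL) (hlf a ha).1 (hlf b hbL).1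
            (h.mate_L a ha) (h.mate_L b hbL) (h.mate_L _ (X.tw_mem b hbL)) hc hd hdc.symm with
            ⟨rfl, _⟩ | rfl
          · exact hn.1 (List.mem_map_of_mem hb)
          · exact htw b (by simp [hb]) (by simp)

theorem Paths.expand_chain (h : X.Paths m otw mate U) (hlf : X.LiftFun otw mate U lf)
    {B : List ℕ} (hB : ∀ b ∈ B, b ∈ X.L) {c : ℕ}
    (hch : (B ++ [c]).IsChain fun x y => X.tgt x = X.own y) :
    (expand lf B ++ [c]).IsChain fun x y => x < m ∧ X.own (otw x) = X.own y := by
  induction B with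
  | nil => simp [expand]
  | cons a B ih =>
    have hexp : expand lf (a :: B) = (a :: lf a) ++ expand lf B := by simp [expand]
    rw [hexp, List.append_assoc]
    have ha := hB a (by simp)
    have hih := ih (fun b hb => hB b (by simp [hb])) (by
      rw [List.cons_append] at hch
      exact hch.tail)
    cases B with
    | nil =>
      simp only [List.cons_append, List.nil_append, List.isChain_cons_cons] at hch
      exact (hlf a ha).1.isChain h.pairing (h.lt a ha) hch.1 hih
    | cons b B =>
      simp only [List.cons_append, List.isChain_cons_cons] at hch
      have : expand lf (b :: B) ++ [c] = b :: (lf b ++ expand lf B ++ [c]) := by simp [expand]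
      rw [this] at hih ⊢
      exact (hlf a ha).1.isChain h.pairing (h.lt a ha) hch.1 hih

/-- `G` contains the edges given by the original arcs. -/
structure IsPart (G : Multigraph ℕ) (m : ℕ) (own otw : ℕ → ℕ) : Prop where
  one_le : ∀ a < m, 1 ≤ G.mult s(own a, own (otw a))
  two_le : ∀ a < m, ∀ b < m, b ≠ a → b ≠ otw a → s(own b, own (otw b)) = s(own a, own (otw a)) →
    2 ≤ G.mult s(own a, own (otw a))

/-- Only length two needs more than a closed walk with distinct vertices: the walk must not return
along the same edge. -/
theorem isCycle_of_arcs {G : Multigraph ℕ} {own : ℕ → ℕ} (hG : IsPart G m own otw) {W : List ℕ}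
    (hW : ∀ w ∈ W, w < m) (hne : W ≠ []) (hn : (W.map own).Nodup)
    (hch : ∀ w ∈ W.head?, (W ++ [w]).IsChain fun x y => x < m ∧ own (otw x) = own y)
    (h2 : ∀ a b, W = [a, b] → b ≠ otw a) : G.IsCycle (W.map own) := by
  match W, hne with
  | [a], _ =>
    have h := hch a (by simp)
    simp only [List.cons_append, List.nil_append, List.isChain_cons_cons] at h
    show 1 ≤ G.mult s(own a, own a)
    have := hG.one_le a h.1.1
    rwa [h.1.2] at this
  | [a, b], _ =>
    have h := hch a (by simp)
    simp only [List.cons_append, List.nil_append, List.isChain_cons_cons] at h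
    have hne : own a ≠ own b := by simpa using hn
    refine ⟨hne, ?_⟩
    have := hG.two_le a h.1.1 b h.2.1.1 (fun h => hne (by rw [h])) (h2 a b rfl)
      (by rw [h.1.2, h.2.1.2, Sym2.eq_swap])
    rwa [h.1.2] at this
  | a :: b :: c :: l, _ =>
    have h := hch a (by simp)
    refine ⟨hn, ?_⟩
    have h' : ((a :: b :: c :: l) ++ [a]).map own =
      own a :: own b :: own c :: (l.map own ++ [own a]) := by simp
    rw [← h', List.isChain_map]
    refine h.imp fun x y hxy => ?_
    rw [← hxy.2]
    exact hG.one_le x hxy.1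

/-- A cycle of `X` yields a cycle of the original graph. -/
theorem IsArcCycle.isCycle {G : Multigraph ℕ} (h : X.Paths m otw mate U)
    (hlf : X.LiftFun otw mate U lf) (hG : IsPart G m X.own otw) {B : List ℕ}
    (hB : X.IsArcCycle B) : G.IsCycle ((expand lf B).map X.own) := by
  have hP := h.pairing
  refine isCycle_of_arcs hG (h.expand_lt hlf hB.mem) ?_
    (h.expand_nodup hlf hB.mem hB.nodup hB.tw_notMem) ?_ ?_
  · obtain ⟨b, hb⟩ := List.exists_mem_of_ne_nil _ hB.ne_nil
    exact List.ne_nil_of_mem (mem_expand.2 ⟨b, hb, .inl rfl⟩)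
  · intro w hw
    refine h.expand_chain hlf hB.mem ?_
    match B, hB.ne_nil with
    | b :: B, _ =>
      obtain rfl : b = w := by simpa [expand] using hw
      exact hB.chain b (by simp)
  -- Two original arcs arise in two ways. Either one arc of `X` has one inner vertex, and an arc is
  -- never paired with itself; or two arcs have no inner vertices, and then `otw c` is the twin of
  -- `c`, which is not on the cycle.
  · intro a b hab
    match B, hB.ne_nil with
    | [c], _ =>
      have hcL := hB.mem c (by simp)
      have : c :: lf c = [a, b] := by simpa [expand] using hab
      obtain ⟨rfl, hl⟩ := List.cons_eq_cons.1 this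
      have hs := (hlf c hcL).1
      rw [hl] at hs
      exact hP.mate_ne _ (hP.otw_lt c (h.lt c hcL)) _ hs.1
    | [c, d], _ =>
      have hcL := hB.mem c (by simp)
      have h1 : c :: (lf c ++ d :: lf d) = [a, b] := by simpa [expand] using hab
      obtain ⟨rfl, hl⟩ := List.cons_eq_cons.1 h1
      cases hlc : lf c with
      | nil =>
        rw [hlc, List.nil_append] at hl
        obtain ⟨rfl, _⟩ := List.cons_eq_cons.1 hl
        have hs : X.tw c = otw c := by
          have := (hlf c hcL).1
          rwa [hlc] at this
        rw [← hs]
        rintro rfl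
        exact hB.tw_notMem c (by simp) (by simp)
      | cons e r =>
        rw [hlc] at hl
        have := congrArg List.length hl
        simp at this
    | c :: d :: e :: B, _ =>
      have := congrArg List.length hab
      simp [expand] at this
      omega

/-- After deleting the vertices of a cycle, the remaining paths avoid its lift. -/
theorem Paths.kill_cycle (h : X.Paths m otw mate U) (hlf : X.LiftFun otw mate U lf) {B : List ℕ}
    (hB : ∀ b ∈ B, b ∈ X.L) :
    (X.kill (B.map X.own).toFinset).Paths m otw mate
      fun v => U v ∨ v ∈ (expand lf B).map X.own := by
  have hk := h.kill (B.map X.own).toFinset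
  refine ⟨hk.pairing, hk.lt, hk.mate_L, hk.mate_A, fun a ha => ?_, fun v hv => ?_⟩
  · obtain ⟨haL, ha1, ha2⟩ := mem_kill_L.1 ha
    refine ⟨lf a, (hlf a haL).1, fun c hc => ?_⟩
    show ¬ (U (X.own c) ∨ X.own c ∈ (expand lf B).map X.own)
    rintro (hU | hm)
    · exact (hlf a haL).2 c hc hU
    · obtain ⟨d, hd, hdc⟩ := List.mem_map.1 hm
      obtain ⟨b, hb, hd⟩ := mem_expand.1 hd
      have hbL := hB b hb
      rcases hd with rfl | hd
      · exact h.inner_notMem hlf haL hc (hdc ▸ X.own_mem _ hbL)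
      · rcases Seg.eq_or_eq h.pairing (h.lt a haL) (h.lt b hbL) (hlf a haL).1 (hlf b hbL).1
            (h.mate_L a haL) (h.mate_L b hbL) (h.mate_L _ (X.tw_mem b hbL)) hc hd hdc.symm with
            ⟨rfl, _⟩ | rfl
        · exact ha1 (by simpa using ⟨_, hb, rfl⟩)
        · refine ha2 ?_
          rw [tgt_tw hbL]
          simpa using ⟨_, hb, rfl⟩
  · obtain ⟨hv, hvB⟩ := Finset.mem_sdiff.1 hv
    rintro (hU | hm)
    · exact h.disj v hv hU
    · obtain ⟨d, hd, rfl⟩ := List.mem_map.1 hm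
      obtain ⟨b, hb, rfl | hd⟩ := mem_expand.1 hd
      · exact hvB (by simpa using ⟨_, hb, rfl⟩)
      · exact h.inner_notMem hlf (hB b hb) hd hv

theorem Paths.expand_not (h : X.Paths m otw mate U) (hlf : X.LiftFun otw mate U lf) {B : List ℕ}
    (hB : ∀ b ∈ B, b ∈ X.L) : ∀ v ∈ (expand lf B).map X.own, ¬ U v := by
  intro v hv
  obtain ⟨d, hd, rfl⟩ := List.mem_map.1 hv
  obtain ⟨b, hb, rfl | hd⟩ := mem_expand.1 hd
  · exact h.disj _ (X.own_mem _ (hB _ hb))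
  · exact (hlf b (hB b hb)).2 d hd

/-! ### Dense parts -/

/-- A set of vertices each of which has at least `D` original arcs into the set. -/
def Dense (X : ArcGraph) (otw : ℕ → ℕ) (D : ℕ) : Prop :=
  ∃ Q ⊆ X.A, Q.Nonempty ∧ ∀ q ∈ Q,
    D ≤ (X.L.filter fun a => X.own a = q ∧ X.tw a = otw a ∧ X.tgt a ∈ Q).card

theorem Dense.le_deg {D : ℕ} {Q : Finset ℕ} {q : ℕ}
    (h : D ≤ (X.L.filter fun a => X.own a = q ∧ X.tw a = otw a ∧ X.tgt a ∈ Q).card) :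
    D ≤ X.deg q := by
  refine h.trans (Finset.card_le_card fun a ha => ?_)
  simp only [Finset.mem_filter] at ha
  exact mem_arcsAt.2 ⟨ha.1, ha.2.1⟩

theorem Dense.kill_of_deg {D : ℕ} (h : X.Dense otw D) {v : ℕ} (hv : X.deg v < D) :
    (X.kill {v}).Dense otw D := by
  obtain ⟨Q, hQ, hne, hd⟩ := h
  have hvQ : v ∉ Q := fun h => absurd (Dense.le_deg (hd v h)) (by omega)
  refine ⟨Q, fun q hq => Finset.mem_sdiff.2 ⟨hQ hq, ?_⟩, hne, fun q hq => (hd q hq).trans ?_⟩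
  · rw [Finset.mem_singleton]
    rintro rfl
    exact hvQ hq
  · refine Finset.card_le_card fun a ha => ?_
    simp only [Finset.mem_filter] at ha
    rw [Finset.mem_filter, mem_kill_L]
    refine ⟨⟨ha.1, ?_, ?_⟩, ha.2⟩
    · rw [Finset.mem_singleton, ha.2.1]
      rintro rfl
      exact hvQ hq
    · rw [Finset.mem_singleton]
      intro h
      exact hvQ (h ▸ ha.2.2.2)

/-- As `D ≥ 3`, the suppressed vertex lies outside the dense set, and an arc inside the set keeps
its twin. -/
theorem Dense.suppress {D : ℕ} (h : X.Dense otw D) (hD : 3 ≤ D) {v p q : ℕ}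
    (hs : X.CanSuppress v p q) : (X.suppress hs).Dense otw D := by
  obtain ⟨Q, hQ, hne, hd⟩ := h
  have hdeg : X.deg v = 2 := by
    rw [deg, hs.arcs, Finset.card_pair hs.ne]
  have hvQ : v ∉ Q := fun h => absurd (Dense.le_deg (hd v h)) (by omega)
  refine ⟨Q, fun x hx => Finset.mem_erase.2 ⟨?_, hQ hx⟩, hne, fun x hx => (hd x hx).trans ?_⟩
  · rintro rfl
    exact hvQ hx
  · refine Finset.card_le_card fun a ha => ?_
    simp only [Finset.mem_filter] at ha
    obtain ⟨haL, hax, hat, haQ⟩ := ha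
    have e : (X.suppress hs).tw a = X.tw a := by
      refine newTw_of_ne ?_ ?_
      · rintro rfl
        rw [tgt_tw hs.mem_left.1, hs.mem_left.2] at haQ
        exact hvQ haQ
      · rintro rfl
        rw [tgt_tw hs.mem_right.1, hs.mem_right.2] at haQ
        exact hvQ haQ
    rw [Finset.mem_filter, mem_suppress_L]
    refine ⟨⟨haL, ?_, ?_⟩, hax, ?_, ?_⟩
    · rintro rfl
      exact hvQ (hs.mem_left.2 ▸ hax ▸ hx)
    · rintro rfl
      exact hvQ (hs.mem_right.2 ▸ hax ▸ hx)
    · rw [e, hat]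
    · show X.own ((X.suppress hs).tw a) ∈ Q
      rw [e]
      exact haQ

/-- Every vertex has at most 6 neighbours in `C`. -/
def Thin (X : ArcGraph) (C : Finset ℕ) : Prop :=
  ∀ q, ∃ T : Finset ℕ, T.card ≤ 6 ∧ ∀ a ∈ X.L, X.own a = q → X.tgt a ∈ C → X.tgt a ∈ T

/-- A vertex loses at most `6 * 4` arcs: it has at most 6 neighbours in `C`, and at most 4 original
arcs lead from it to each of them. -/
theorem Dense.kill {D : ℕ} (h : X.Dense otw (D + 24)) (hD : 0 < D) {C : Finset ℕ} (hC : X.Thin C)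
    (hm : ∀ u v, (X.L.filter fun a => X.own a = u ∧ X.own (otw a) = v).card ≤ 4) :
    (X.kill C).Dense otw D := by
  obtain ⟨Q, hQ, hne, hd⟩ := h
  have key : ∀ q, (X.L.filter fun a => X.own a = q ∧ X.tw a = otw a ∧ X.tgt a ∈ C).card ≤ 24 := by
    intro q
    obtain ⟨T, hT, hTm⟩ := hC q
    calc _ ≤ (T.biUnion fun c => X.L.filter fun a => X.own a = q ∧ X.own (otw a) = c).card := by
          refine Finset.card_le_card fun a ha => ?_
          simp only [Finset.mem_filter] at ha
          simp only [Finset.mem_biUnion, Finset.mem_filter]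
          refine ⟨X.tgt a, hTm a ha.1 ha.2.1 ha.2.2.2, ha.1, ha.2.1, ?_⟩
          rw [← ha.2.2.1]
          rfl
      _ ≤ T.card * 4 := Finset.card_biUnion_le_card_mul _ _ _ fun c _ => hm q c
      _ ≤ 24 := by omega
  have key2 : ∀ q ∈ Q,
      D ≤ (X.L.filter fun a => X.own a = q ∧ X.tw a = otw a ∧ X.tgt a ∈ Q \ C).card := by
    intro q hq
    have h1 := hd q hq
    have h2 : (X.L.filter fun a => X.own a = q ∧ X.tw a = otw a ∧ X.tgt a ∈ Q) ⊆
        (X.L.filter fun a => X.own a = q ∧ X.tw a = otw a ∧ X.tgt a ∈ Q \ C) ∪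
        (X.L.filter fun a => X.own a = q ∧ X.tw a = otw a ∧ X.tgt a ∈ C) := by
      intro a ha
      simp only [Finset.mem_filter, Finset.mem_union, Finset.mem_sdiff] at ha ⊢
      tauto
    have h3 := (Finset.card_le_card h2).trans (Finset.card_union_le _ _)
    have := key q
    omega
  refine ⟨Q \ C, Finset.sdiff_subset_sdiff hQ le_rfl, ?_, fun q hq => ?_⟩
  · obtain ⟨q, hq⟩ := hne
    have := key2 q hq
    obtain ⟨a, ha⟩ := Finset.card_pos.1 (hD.trans_le this)
    simp only [Finset.mem_filter] at ha
    exact ⟨_, ha.2.2.2⟩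
  · refine (key2 q (Finset.mem_sdiff.1 hq).1).trans (Finset.card_le_card fun a ha => ?_)
    simp only [Finset.mem_filter] at ha
    rw [Finset.mem_filter, mem_kill_L]
    refine ⟨⟨ha.1, ?_, (Finset.mem_sdiff.1 ha.2.2.2).2⟩, ha.2⟩
    rw [ha.2.1]
    exact (Finset.mem_sdiff.1 hq).2

/-- A graph with many edges has a dense part. -/
theorem exists_dense {D : ℕ} (h : 2 * D * X.A.card < X.L.card) (htw : ∀ a ∈ X.L, X.tw a = otw a) :
    X.Dense otw D := by
  let e : Finset ℕ → Finset ℕ := fun Q => X.L.filter fun a => X.own a ∈ Q ∧ X.tgt a ∈ Q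
  have hA : (X.A.powerset.filter fun Q => 2 * D * Q.card < (e Q).card).Nonempty := by
    refine ⟨X.A, Finset.mem_filter.2 ⟨Finset.mem_powerset_self _, ?_⟩⟩
    have : e X.A = X.L := Finset.filter_true_of_mem fun a ha => ⟨X.own_mem a ha, tgt_mem ha⟩
    rwa [this]
  -- In a smallest set with more than `2 * D` arcs per vertex every vertex has at least `D` arcs
  -- into the set: otherwise it could be dropped together with fewer than `2 * D` arcs.
  obtain ⟨Q, hQ, hmin⟩ := Finset.exists_min_image _ Finset.card hA
  simp only [Finset.mem_filter, Finset.mem_powerset] at hQ hmin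
  refine ⟨Q, hQ.1, ?_, fun q hq => ?_⟩
  · rw [Finset.nonempty_iff_ne_empty]
    rintro rfl
    simp [e] at hQ
  · by_contra hlt
    have h1 : e Q ⊆ e (Q.erase q) ∪ ((e Q).filter fun a => X.own a = q) ∪
        ((e Q).filter fun a => X.own a = q).image X.tw := by
      intro a ha
      simp only [e, Finset.mem_filter] at ha
      simp only [e, Finset.mem_union, Finset.mem_filter, Finset.mem_image, Finset.mem_erase]
      by_cases h1 : X.own a = q
      · exact .inl (.inr ⟨ha, h1⟩)
      by_cases h2 : X.tgt a = q
      · refine .inr ⟨X.tw a, ⟨⟨X.tw_mem a ha.1, ha.2.2, ?_⟩, h2⟩, X.tw_tw a ha.1⟩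
        rw [tgt_tw ha.1]
        exact ha.2.1
      · exact .inl (.inl ⟨ha.1, ⟨h1, ha.2.1⟩, h2, ha.2.2⟩)
    have h2 := Finset.card_le_card h1
    have h3 : ((e Q).filter fun a => X.own a = q).card < D := by
      refine (Finset.card_le_card fun a ha => ?_).trans_lt (not_le.1 hlt)
      simp only [e, Finset.mem_filter] at ha ⊢
      exact ⟨ha.1.1, ha.2, htw a ha.1.1, ha.1.2.2⟩
    have h4 := Finset.card_union_le (e (Q.erase q) ∪ ((e Q).filter fun a => X.own a = q))
      (((e Q).filter fun a => X.own a = q).image X.tw)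
    have h5 := Finset.card_union_le (e (Q.erase q)) ((e Q).filter fun a => X.own a = q)
    have h6 : (((e Q).filter fun a => X.own a = q).image X.tw).card ≤ _ := Finset.card_image_le
    have h7 : Q.card = (Q.erase q).card + 1 := by
      rw [Finset.card_erase_of_mem hq]
      have := Finset.card_pos.2 ⟨q, hq⟩
      omega
    have h8 : 2 * D * (Q.erase q).card < (e (Q.erase q)).card := by
      have h9 := hQ.2
      rw [h7, Nat.mul_succ] at h9
      omega
    have := hmin (Q.erase q) ⟨(Finset.erase_subset _ _).trans hQ.1, h8⟩
    omega

end ArcGraph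

/-! ### Arc graphs in memory, and the deletion of a vertex. -/

namespace RAM

open ArcGraph

/-- The arcs of the original graph with vertices `0, …, n - 1` and arcs `0, …, m - 1`. -/
structure Net where
  n : ℕ
  m : ℕ
  own : ℕ → ℕ
  otw : ℕ → ℕ
  adj : ℕ → List ℕ
  own_lt : ∀ a < m, own a < n
  adj_nodup : ∀ v < n, (adj v).Nodup
  mem_adj : ∀ v < n, ∀ a, a ∈ adj v ↔ a < m ∧ own a = v

theorem Net.sum_length (N : Net) : ∑ v ∈ Finset.range N.n, (N.adj v).length = N.m := by
  have h := Finset.card_eq_sum_card_fiberwise (f := N.own) (s := Finset.range N.m)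
    (t := Finset.range N.n) (fun a ha => by
      simp only [Finset.coe_range, Set.mem_Iio] at ha ⊢
      exact N.own_lt a ha)
  rw [Finset.card_range] at h
  rw [h]
  refine Finset.sum_congr rfl fun v hv => ?_
  have hv := Finset.mem_range.1 hv
  rw [← List.toFinset_card_of_nodup (N.adj_nodup v hv)]
  congr 1
  ext a
  rw [List.mem_toFinset, N.mem_adj v hv, Finset.mem_filter, Finset.mem_range]

/-- The memory holds the arcs `N`: the number of vertices is in register 0, array 4 holds the
starting points, array 5 the reversed arcs, and arrays 6 and 7 the linked lists of the arcs at the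
vertices. -/
structure Static (s : Mem) (N : Net) : Prop where
  n : s.var 0 = N.n
  own : s.arr 4 = N.own
  otw : s.arr 5 = N.otw
  list : ∀ v < N.n, LinkedList (s.arr 7) (s.arr 6 v) (N.adj v)

theorem Static.of_framed {s s' : Mem} {N : Net} (h : Static s N) {P : Prog} (hf : Framed P s s')
    (h0 : P.wv 0 = false) (h4 : P.wa 4 = false) (h5 : P.wa 5 = false) (h6 : P.wa 6 = false)
    (h7 : P.wa 7 = false) : Static s' N :=
  ⟨(hf.var 0 h0).trans h.n, (hf.arr 4 h4).trans h.own, (hf.arr 5 h5).trans h.otw, by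
    rw [hf.arr 6 h6, hf.arr 7 h7]
    exact h.list⟩

/-- The memory holds the current graph `X`: array 8 holds the twins, array 9 marks dead arcs,
array 10 marks the vertices that are alive, and array 11 holds the degrees (more than the degree
for a vertex with a loop, and at least 3 for a dead vertex). -/
structure Rep (s : Mem) (N : Net) (X : ArcGraph) : Prop where
  own : X.own = N.own
  A_lt : ∀ v ∈ X.A, v < N.n
  L_lt : ∀ a ∈ X.L, a < N.m
  alive : ∀ v < N.n, s.arr 10 v ≠ 0 ↔ v ∈ X.A
  live : ∀ a < N.m, N.own a ∈ X.A → (s.arr 9 a = 0 ↔ a ∈ X.L)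
  tw : ∀ a ∈ X.L, s.arr 8 a = X.tw a
  deg_dead : ∀ v < N.n, v ∉ X.A → 3 ≤ s.arr 11 v
  deg_eq : ∀ v ∈ X.A, v ∉ X.nbrs v → s.arr 11 v = X.deg v
  deg_loop : ∀ v ∈ X.A, v ∈ X.nbrs v → X.deg v + 1 ≤ s.arr 11 v

theorem Rep.congr {s s' : Mem} {N : Net} {X : ArcGraph} (h : Rep s N X)
    (h8 : s'.arr 8 = s.arr 8) (h9 : s'.arr 9 = s.arr 9) (h10 : s'.arr 10 = s.arr 10)
    (h11 : s'.arr 11 = s.arr 11) : Rep s' N X := by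
  refine ⟨h.own, h.A_lt, h.L_lt, ?_, ?_, ?_, ?_, ?_, ?_⟩
  · rw [h10]; exact h.alive
  · rw [h9]; exact h.live
  · rw [h8]; exact h.tw
  · rw [h11]; exact h.deg_dead
  · rw [h11]; exact h.deg_eq
  · rw [h11]; exact h.deg_loop

theorem Rep.mem_adj {s : Mem} {N : Net} {X : ArcGraph} (h : Rep s N X) {v a : ℕ} (hv : v < N.n) :
    a ∈ N.adj v ↔ a < N.m ∧ X.own a = v := by
  rw [N.mem_adj v hv, h.own]

theorem Rep.arcsAt_eq {s : Mem} {N : Net} {X : ArcGraph} (h : Rep s N X) {v : ℕ} (hv : v < N.n) :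
    X.arcsAt v = ((N.adj v).filter (· ∈ X.L)).toFinset := by
  ext a
  simp only [mem_arcsAt, List.mem_toFinset, List.mem_filter, decide_eq_true_eq, h.mem_adj hv]
  exact ⟨fun ⟨h1, h2⟩ => ⟨⟨h.L_lt a h1, h2⟩, h1⟩, fun ⟨⟨_, h2⟩, h1⟩ => ⟨h1, h2⟩⟩

/-- Delete the vertex in register 20. -/
def killProg : Prog :=
  Prog.each 21 7 (.get 6 (.var 20))
    (.ite (.eq (.get 9 (.pred (.var 21))) (.const 0))
      (.assign 22 (.get 8 (.pred (.var 21))) ;;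
        -- Only the twin gets a mark; the arcs at a dead vertex itself are not inspected any more.
        .store 9 (.var 22) (.const 1) ;;
        .store 11 (.get 4 (.var 22)) (.pred (.get 11 (.get 4 (.var 22)))))
      .skip) ;;
  .store 10 (.var 20) (.const 0) ;; .store 11 (.var 20) (.const 3)

/-- The arcs that `v` loses are the twins of the arcs from `c` to `v`. -/
theorem deg_kill_singleton {X : ArcGraph} {c v : ℕ} (hv : v ≠ c) :
    (X.kill {c}).deg v + ((X.arcsAt c).filter fun a => X.tgt a = v).card = X.deg v := by
  have h1 : X.arcsAt v = (X.kill {c}).arcsAt v ∪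
      ((X.arcsAt c).filter fun a => X.tgt a = v).image X.tw := by
    ext a
    simp only [Finset.mem_union, mem_arcsAt, mem_kill_L, Finset.mem_singleton, Finset.mem_image,
      Finset.mem_filter]
    constructor
    · rintro ⟨ha, rfl⟩
      by_cases hc : X.tgt a = c
      · exact .inr ⟨X.tw a, ⟨⟨X.tw_mem a ha, hc⟩, tgt_tw ha⟩, X.tw_tw a ha⟩
      · exact .inl ⟨⟨ha, hv, hc⟩, rfl⟩
    · rintro (⟨⟨ha, _, _⟩, h⟩ | ⟨b, ⟨⟨hb, rfl⟩, rfl⟩, rfl⟩)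
      · exact ⟨ha, h⟩
      · exact ⟨X.tw_mem b hb, rfl⟩
  unfold deg
  rw [h1, Finset.card_union_of_disjoint, Finset.card_image_of_injOn]
  · intro a ha b hb h
    simp only [Finset.coe_filter, mem_arcsAt, Set.mem_ofPred_eq] at ha hb
    exact tw_inj ha.1.1 hb.1.1 h
  · rw [Finset.disjoint_left]
    intro a ha hb
    simp only [mem_arcsAt, mem_kill_L, Finset.mem_singleton, Finset.mem_image,
      Finset.mem_filter] at ha hb
    obtain ⟨b, ⟨⟨hb, hbc⟩, _⟩, rfl⟩ := hb
    exact ha.1.2.2 (by rw [tgt_tw hb, hbc])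

theorem mem_nbrs_kill {X : ArcGraph} {c v : ℕ} (hv : v ≠ c) :
    v ∈ (X.kill {c}).nbrs v ↔ v ∈ X.nbrs v := by
  rw [mem_nbrs, mem_nbrs]
  constructor
  · rintro ⟨a, ha, h1, h2⟩
    exact ⟨a, (mem_kill_L.1 ha).1, h1, h2⟩
  · rintro ⟨a, ha, h1, h2⟩
    refine ⟨a, mem_kill_L.2 ⟨ha, ?_, ?_⟩, h1, h2⟩
    · simpa [h1] using hv
    · simpa [h2] using hv

theorem run_kill {s : Mem} {N : Net} {X : ArcGraph} (hs : Static s N) (hr : Rep s N X)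
    (hc : s.var 20 ∈ X.A) :
    Run killProg s fun t s' => Rep s' N (X.kill {s.var 20}) ∧
      t ≤ 40 * (N.adj (s.var 20)).length + 40 := by
  set c := s.var 20 with hcdef
  have hcn := hr.A_lt c hc
  unfold killProg
  rw [run_seq]
  refine Run.eachBound 30 (l := N.adj c)
    -- Arcs at `c` have clauses of their own: they are marked only as twins of loops, possibly
    -- before the loop over the list reaches them.
    (fun r s₁ => ∃ d, N.adj c = d ++ r ∧
      (∀ a < N.m, N.own a ≠ c →
        (s₁.arr 9 a = 0 ↔ s.arr 9 a = 0 ∧ ∀ b ∈ d, b ∈ X.L → X.tw b ≠ a)) ∧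
      (∀ a ∈ N.adj c, s₁.arr 9 a = 0 → s.arr 9 a = 0) ∧
      (∀ a ∈ X.L, X.own a = c → X.tgt a ≠ c → s₁.arr 9 a = 0) ∧
      ∀ v < N.n, v ≠ c →
        s₁.arr 11 v = s.arr 11 v - d.countP fun b => b ∈ X.L ∧ X.tgt b = v)
    rfl rfl (hs.list c hcn) ?_ ?_ ?_
  · refine ⟨[], rfl, ?_, ?_, ?_, ?_⟩
    · simp
    · simp
    · intro a ha hac _
      have := (hr.live a (hr.L_lt a ha) (by rw [← hr.own, hac]; exact hc)).2 ha
      simpa using this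
    · simp
  · rintro a r s₁ ⟨d, hd, h1, h2, h3, h4⟩ hf hx -
    have hdis : (d ++ a :: r).Nodup := hd ▸ N.adj_nodup c hcn
    have hac : a ∈ N.adj c := by rw [hd]; simp
    obtain ⟨ham, haown⟩ := (hr.mem_adj hcn).1 hac
    have hownc : N.own a = c := by rw [← hr.own]; exact haown
    have hstat := hs.of_framed hf rfl rfl rfl rfl rfl
    have ht8 : s₁.arr 8 = s.arr 8 := hf.arr 8 rfl
    have hlive := hr.live a ham (by rw [hownc]; exact hc)
    rw [run_ite]
    constructor
    · intro hb
      have hb0 : s₁.arr 9 a = 0 := by simpa [hx] using hb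
      have haL : a ∈ X.L := hlive.1 (h2 a hac hb0)
      have htw : s₁.arr 8 a = X.tw a := by rw [ht8]; exact hr.tw a haL
      have htL := X.tw_mem a haL
      have htm := hr.L_lt _ htL
      simp only [run_seq, run_assign, run_store]
      refine ⟨⟨d ++ [a], by simp [hd], ?_, ?_, ?_, ?_⟩, by simp⟩
      · intro b hb hbc
        simp only [setVar_arr, setArr_arr, setArr_var, Expr.eval, setVar_var, hx, htw, if_true, if_false,
          Nat.reduceEqDiff, Nat.add_sub_cancel, Function.update_apply]
        by_cases hbt : b = X.tw a
        · subst hbt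
          simp only [if_true]
          refine iff_of_false (by simp) fun h => ?_
          exact h.2 a (by simp) haL rfl
        · rw [if_neg hbt, h1 b hb hbc]
          refine and_congr_right fun _ => ⟨fun h b' hb' hL => ?_, fun h b' hb' => h b' (by simp [hb'])⟩
          rcases List.mem_append.1 hb' with hb' | hb'
          · exact h b' hb' hL
          · obtain rfl : b' = a := by simpa using hb'
            exact Ne.symm hbt
      · intro b hb
        simp only [setVar_arr, setArr_arr, setArr_var, Expr.eval, setVar_var, hx, htw, if_true, if_false,
          Nat.reduceEqDiff, Nat.add_sub_cancel, Function.update_apply]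
        split_ifs
        · simp
        · exact h2 b hb
      · intro b hb hbc hbt
        simp only [setVar_arr, setArr_arr, setArr_var, Expr.eval, setVar_var, hx, htw, if_true, if_false,
          Nat.reduceEqDiff, Nat.add_sub_cancel, Function.update_apply]
        rw [if_neg]
        · exact h3 b hb hbc hbt
        · rintro rfl
          rw [tgt_tw haL] at hbt
          exact hbt haown
      · intro v hv hvc
        simp only [setVar_arr, setArr_arr, setArr_var, Expr.eval, setVar_var, hx, htw, if_true, if_false,
          Nat.reduceEqDiff, Nat.add_sub_cancel, Function.update_apply, hstat.own]
        rw [List.countP_append]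
        by_cases hvt : v = N.own (X.tw a)
        · subst hvt
          have h5 : X.tgt a = N.own (X.tw a) := by rw [← hr.own]; rfl
          rw [if_pos rfl, h4 _ hv hvc]
          simp [haL, h5]
          omega
        · have h5 : X.tgt a ≠ v := by
            intro h
            apply hvt
            rw [← h, ← hr.own]
            rfl
          rw [if_neg hvt, h4 v hv hvc]
          simp [h5]
    · intro hb
      have hb0 : s₁.arr 9 a ≠ 0 := by simpa [hx] using hb
      rw [run_skip]
      refine ⟨⟨d ++ [a], by simp [hd], ?_, ?_, ?_, ?_⟩, by simp⟩
      · intro b hb hbc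
        rw [setVar_arr, h1 b hb hbc]
        refine and_congr_right fun _ => ⟨fun h b' hb' hL => ?_, fun h b' hb' => h b' (by simp [hb'])⟩
        rcases List.mem_append.1 hb' with hb' | hb'
        · exact h b' hb' hL
        · obtain rfl : b' = a := by simpa using hb'
          rintro rfl
          refine hb0 (h3 b' hL haown ?_)
          intro h5
          apply hbc
          rw [← hr.own]
          exact h5
      · exact h2
      · exact h3
      · intro v hv hvc
        rw [setVar_arr, h4 v hv hvc, List.countP_append]
        have : List.countP (fun b => decide (b ∈ X.L ∧ X.tgt b = v)) [a] = 0 := by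
          rw [List.countP_eq_zero]
          intro b hb
          obtain rfl : b = a := by simpa using hb
          simp only [decide_eq_true_eq, not_and]
          intro hL h5
          refine hb0 (h3 b hL haown ?_)
          rw [h5]
          exact hvc
        rw [this, add_zero]
  · rintro t s₁ ⟨d, hd, h1, h2, h3, h4⟩ hf ht
    rw [List.append_nil] at hd
    subst hd
    have h20 : s₁.var 20 = c := hf.var 20 rfl
    have h8 : s₁.arr 8 = s.arr 8 := hf.arr 8 rfl
    have h10 : s₁.arr 10 = s.arr 10 := hf.arr 10 rfl
    have hcount : ∀ v, (N.adj c).countP (fun b => b ∈ X.L ∧ X.tgt b = v) =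
        ((X.arcsAt c).filter fun a => X.tgt a = v).card := fun v => by
      rw [List.countP_eq_length_filter, hr.arcsAt_eq hcn,
        ← List.toFinset_card_of_nodup ((N.adj_nodup c hcn).filter _)]
      congr 1
      ext b
      simp only [List.mem_toFinset, List.mem_filter, Finset.mem_filter, decide_eq_true_eq, and_assoc]
    have hdeg : ∀ v, v ≠ c → (X.kill {c}).deg v +
        (N.adj c).countP (fun b => b ∈ X.L ∧ X.tgt b = v) = X.deg v := fun v hv => by
      rw [hcount]
      exact deg_kill_singleton hv
    have hA : ∀ v, v ∈ (X.kill {c}).A ↔ v ∈ X.A ∧ v ≠ c := fun v => by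
      simp [ArcGraph.kill]
    simp only [run_seq, run_store]
    refine ⟨⟨hr.own, fun v hv => hr.A_lt v ((hA v).1 hv).1, fun a ha => hr.L_lt a (mem_kill_L.1 ha).1,
      fun v hv => ?_, fun a ha haA => ?_, fun a ha => ?_, fun v hv hvA => ?_, fun v hv hl => ?_,
      fun v hv hl => ?_⟩, ?_⟩
    · simp only [setArr_arr, Expr.eval, h20, Nat.reduceEqDiff, if_true, if_false,
        Function.update_apply, h10, hA]
      by_cases hvc : v = c
      · simp [hvc]
      · simp [hvc, hr.alive v hv]
    · obtain ⟨haA, hac⟩ := (hA _).1 haA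
      simp only [setArr_arr, Nat.reduceEqDiff, if_false]
      rw [h1 a ha hac, hr.live a ha haA, mem_kill_L]
      simp only [Finset.mem_singleton]
      refine and_congr_right fun haL => ?_
      rw [hr.own]
      refine ⟨fun h => ⟨hac, fun ht => ?_⟩, fun h b hb hbL htw => ?_⟩
      · refine h (X.tw a) ?_ (X.tw_mem a haL) (X.tw_tw a haL)
        rw [hr.mem_adj hcn]
        exact ⟨hr.L_lt _ (X.tw_mem a haL), ht⟩
      · apply h.2
        rw [← htw, tgt_tw hbL]
        exact ((hr.mem_adj hcn).1 hb).2
    · simp only [setArr_arr, Nat.reduceEqDiff, if_false, h8]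
      exact hr.tw a (mem_kill_L.1 ha).1
    · simp only [setArr_arr, setArr_var, Expr.eval, h20, Nat.reduceEqDiff, if_true, if_false,
        Function.update_apply]
      split_ifs with hvc
      · exact le_rfl
      · have hvX : v ∉ X.A := fun h => hvA ((hA v).2 ⟨h, hvc⟩)
        rw [h4 v hv hvc, hcount, Finset.card_eq_zero.2, Nat.sub_zero]
        · exact hr.deg_dead v hv hvX
        · refine Finset.filter_eq_empty_iff.2 fun a ha h => hvX ?_
          rw [← h]
          exact tgt_mem (mem_arcsAt.1 ha).1
    · obtain ⟨hvX, hvc⟩ := (hA v).1 hv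
      rw [mem_nbrs_kill hvc] at hl
      simp only [setArr_arr, setArr_var, Expr.eval, h20, Nat.reduceEqDiff, if_true, if_false,
        Function.update_apply, if_neg hvc]
      have := hdeg v hvc
      have := hr.deg_eq v hvX hl
      rw [h4 v (hr.A_lt v hvX) hvc]
      omega
    · obtain ⟨hvX, hvc⟩ := (hA v).1 hv
      rw [mem_nbrs_kill hvc] at hl
      simp only [setArr_arr, setArr_var, Expr.eval, h20, Nat.reduceEqDiff, if_true, if_false,
        Function.update_apply, if_neg hvc]
      have := hdeg v hvc
      have := hr.deg_loop v hvX hl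
      rw [h4 v (hr.A_lt v hvX) hvc]
      omega
    · simp only [Expr.cost] at ht ⊢
      omega

end RAM

/-! ### Exhaustive reduction in linear time. -/

namespace ArcGraph

/-- The vertex `v` can be deleted or suppressed. -/
def Red (X : ArcGraph) (v : ℕ) : Prop := v ∈ X.A ∧ v ∉ X.nbrs v ∧ X.deg v ≤ 2

theorem two_le_deg_of_loop {X : ArcGraph} {v : ℕ} (h : v ∈ X.nbrs v) : 2 ≤ X.deg v := by
  obtain ⟨a, ha, hav, hat⟩ := mem_nbrs.1 h
  have : ({a, X.tw a} : Finset ℕ) ⊆ X.arcsAt v := by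
    intro b hb
    simp only [Finset.mem_insert, Finset.mem_singleton] at hb
    rcases hb with rfl | rfl
    · exact mem_arcsAt.2 ⟨ha, hav⟩
    · exact mem_arcsAt.2 ⟨X.tw_mem a ha, hat⟩
  have := Finset.card_le_card this
  rwa [Finset.card_pair (X.tw_ne a ha).symm] at this

/-- The deletion of `c` changes the degrees of the neighbours of `c` only. -/
theorem Red.of_kill {X : ArcGraph} {c v : ℕ} (h : (X.kill {c}).Red v)
    (hc : ∀ a ∈ X.L, X.own a = c → X.tgt a ≠ v) : X.Red v := by
  obtain ⟨h1, h2, h3⟩ := h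
  obtain ⟨hA, hvc⟩ : v ∈ X.A ∧ v ≠ c := by simpa [kill] using h1
  rw [RAM.mem_nbrs_kill hvc] at h2
  refine ⟨hA, h2, ?_⟩
  have := RAM.deg_kill_singleton (X := X) hvc
  rw [Finset.card_eq_zero.2, add_zero] at this
  · omega
  · exact Finset.filter_eq_empty_iff.2 fun a ha => hc a (mem_arcsAt.1 ha).1 (mem_arcsAt.1 ha).2

variable {X : ArcGraph} {v p q : ℕ}

theorem deg_suppress (hs : X.CanSuppress v p q) {x : ℕ} (hx : x ≠ v) :
    (X.suppress hs).deg x = X.deg x := by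
  unfold deg
  congr 1
  ext a
  rw [mem_arcsAt, mem_arcsAt, mem_suppress_L]
  refine ⟨fun h => ⟨h.1.1, h.2⟩, fun h => ⟨⟨h.1, ?_, ?_⟩, h.2⟩⟩
  · rintro rfl
    exact hx (h.2.symm.trans hs.mem_left.2)
  · rintro rfl
    exact hx (h.2.symm.trans hs.mem_right.2)

theorem mem_nbrs_suppress (hs : X.CanSuppress v p q) {x : ℕ} (hx : x ≠ v) :
    x ∈ (X.suppress hs).nbrs x ↔ x ∈ X.nbrs x ∨ (x = X.tgt p ∧ x = X.tgt q) := by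
  obtain ⟨f1, f2, f3, f4, f5⟩ := hs.facts
  rw [mem_nbrs, mem_nbrs]
  constructor
  · rintro ⟨a, ha, h1, h2⟩
    obtain ⟨ha, hap, haq⟩ := mem_suppress_L.1 ha
    change X.own a = x at h1
    change X.own (newTw X.tw p q a) = x at h2
    by_cases h3 : a = X.tw p
    · subst h3
      rw [newTw_left f5] at h2
      exact .inr ⟨h1.symm, h2.symm⟩
    by_cases h4 : a = X.tw q
    · subst h4
      rw [newTw_right] at h2
      exact .inr ⟨h2.symm, h1.symm⟩
    rw [newTw_of_ne h3 h4] at h2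
    exact .inl ⟨a, ha, h1, h2⟩
  · rintro (⟨a, ha, h1, h2⟩ | ⟨h1, h2⟩)
    · refine ⟨a, mem_suppress_L.2 ⟨ha, ?_, ?_⟩, h1, ?_⟩
      · rintro rfl
        exact hx (h1.symm.trans hs.mem_left.2)
      · rintro rfl
        exact hx (h1.symm.trans hs.mem_right.2)
      · show X.own (newTw X.tw p q a) = x
        rw [newTw_of_ne]
        · exact h2
        · rintro rfl
          rw [tgt_tw hs.mem_left.1, hs.mem_left.2] at h2
          exact hx h2.symm
        · rintro rfl
          rw [tgt_tw hs.mem_right.1, hs.mem_right.2] at h2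
          exact hx h2.symm
    · refine ⟨X.tw p, mem_suppress_L.2 ⟨X.tw_mem p hs.mem_left.1, f1, f2⟩, h1.symm, ?_⟩
      show X.own (newTw X.tw p q (X.tw p)) = x
      rw [newTw_left f5]
      exact h2.symm

/-- Suppression keeps all other degrees and can only add a loop, so no vertex becomes reducible by
it. -/
theorem Red.of_suppress {hs : X.CanSuppress v p q} {x : ℕ} (h : (X.suppress hs).Red x) :
    X.Red x := by
  obtain ⟨h1, h2, h3⟩ := h
  obtain ⟨hxv, hA⟩ := Finset.mem_erase.1 h1
  rw [mem_nbrs_suppress hs hxv] at h2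
  rw [deg_suppress hs hxv] at h3
  exact ⟨hA, fun h => h2 (.inl h), h3⟩

end ArcGraph

namespace RAM

open ArcGraph

/-- A loop already gives two arcs, and the stored value exceeds the degree there; dead vertices
store at least 3. A single comparison thus decides whether a rule applies. -/
theorem Rep.lt_three {s : Mem} {N : Net} {X : ArcGraph} (h : Rep s N X) {v : ℕ} (hv : v < N.n) :
    s.arr 11 v < 3 ↔ X.Red v := by
  by_cases hA : v ∈ X.A
  · by_cases hl : v ∈ X.nbrs v
    · have h1 := h.deg_loop v hA hl
      have h2 := two_le_deg_of_loop hl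
      refine iff_of_false (by omega) fun h => h.2.1 hl
    · rw [h.deg_eq v hA hl]
      exact ⟨fun h => ⟨hA, hl, by omega⟩, fun h => Nat.lt_succ_of_le h.2.2⟩
  · have := h.deg_dead v hv hA
    exact iff_of_false (by omega) fun h => hA h.1

/-- Suppress the vertex in register 20, whose two arcs are in registers 24 and 25 (plus 1); a mark
in array 13 is passed on to a neighbour. -/
def suppressProg : Prog :=
  .assign 27 (.get 8 (.pred (.var 24))) ;; .assign 28 (.get 8 (.pred (.var 25))) ;;
  .store 8 (.var 27) (.var 28) ;; .store 8 (.var 28) (.var 27) ;;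
  .store 12 (.pred (.var 24)) (.var 25) ;; .store 12 (.pred (.var 25)) (.var 24) ;;
  .store 10 (.var 20) (.const 0) ;; .store 11 (.var 20) (.const 3) ;;
  -- If the new edge is a loop, the stored degree is raised above the true one, so that its vertex
  -- is never taken for reducible.
  .ite (.eq (.get 4 (.var 27)) (.get 4 (.var 28)))
    (.store 11 (.get 4 (.var 27)) (.succ (.get 11 (.get 4 (.var 27))))) .skip ;;
  .ite (.eq (.get 13 (.var 20)) (.const 0)) .skip (.store 13 (.get 4 (.var 27)) (.const 1))

/-- Marks are passed on to a neighbour. -/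
def newMarks (F : ℕ → ℕ) (v x : ℕ) : ℕ → ℕ := if F v = 0 then F else Function.update F x 1

theorem run_suppress {s : Mem} {N : Net} {X : ArcGraph} {v p q : ℕ} (hs : Static s N)
    (hr : Rep s N X) (h20 : s.var 20 = v) (h24 : s.var 24 = p + 1) (h25 : s.var 25 = q + 1)
    (hc : X.CanSuppress v p q) :
    Run suppressProg s fun t s' => Rep s' N (X.suppress hc) ∧
      s'.arr 12 = newMate (s.arr 12) p q ∧ s'.arr 13 = newMarks (s.arr 13) v (X.tgt p) ∧
      t ≤ 100 := by
  obtain ⟨hp, hpv⟩ := hc.mem_left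
  obtain ⟨hq, hqv⟩ := hc.mem_right
  obtain ⟨f1, f2, f3, f4, f5⟩ := hc.facts
  have tp := hr.tw p hp
  have tq := hr.tw q hq
  have hown : ∀ a, N.own (X.tw a) = X.tgt a := fun a => by rw [← hr.own]; rfl
  have hD : ∀ s' : Mem, s'.arr 8 = newTw X.tw p q ∨ s'.arr 8 = newTw (s.arr 8) p q → s'.arr 9 = s.arr 9 →
      s'.arr 10 = Function.update (s.arr 10) v 0 →
      (s'.arr 11 = if X.tgt p = X.tgt q then
        Function.update (Function.update (s.arr 11) v 3) (X.tgt p) (s.arr 11 (X.tgt p) + 1)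
        else Function.update (s.arr 11) v 3) → Rep s' N (X.suppress hc) := by
    intro s' h8 h9 h10 h11
    refine ⟨hr.own, fun x hx => hr.A_lt x (Finset.mem_of_mem_erase hx),
      fun a ha => hr.L_lt a (mem_suppress_L.1 ha).1, fun x hx => ?_, fun a ha haA => ?_,
      fun a ha => ?_, fun x hx hxA => ?_, fun x hx hl => ?_, fun x hx hl => ?_⟩
    · show _ ↔ x ∈ X.A.erase v
      rw [h10, Function.update_apply, Finset.mem_erase]
      split_ifs with h
      · simp [h]
      · simp [h, hr.alive x hx]
    · obtain ⟨h1, h2⟩ := Finset.mem_erase.1 haA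
      rw [h9, hr.live a ha h2, mem_suppress_L]
      refine ⟨fun h => ⟨h, ?_, ?_⟩, fun h => h.1⟩
      · rintro rfl
        exact h1 (by rw [← hr.own]; exact hpv)
      · rintro rfl
        exact h1 (by rw [← hr.own]; exact hqv)
    · obtain ⟨haL, hap, haq⟩ := mem_suppress_L.1 ha
      show _ = newTw X.tw p q a
      rcases h8 with h8 | h8
      · rw [h8]
      · rw [h8]
        simp only [newTw, Function.update_apply, tp, tq, hr.tw a haL]
    · rw [h11]
      have h3 : x ≠ v → 3 ≤ s.arr 11 x := fun h =>
        hr.deg_dead x hx fun hA => hxA (Finset.mem_erase.2 ⟨h, hA⟩)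
      have h4 : x ≠ X.tgt p := fun h => by
        refine hxA (Finset.mem_erase.2 ⟨?_, ?_⟩)
        · rw [h]
          exact hc.tgt_ne.1
        · rw [h]
          exact tgt_mem hp
      split_ifs
      · rw [Function.update_of_ne h4, Function.update_apply]
        split_ifs with h
        · exact le_rfl
        · exact h3 h
      · rw [Function.update_apply]
        split_ifs with h
        · exact le_rfl
        · exact h3 h
    · obtain ⟨h1, h2⟩ := Finset.mem_erase.1 hx
      rw [mem_nbrs_suppress hc h1] at hl
      rw [deg_suppress hc h1, ← hr.deg_eq x h2 fun h => hl (.inl h), h11]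
      split_ifs with h
      · rw [Function.update_of_ne, Function.update_of_ne h1]
        rintro rfl
        exact hl (.inr ⟨rfl, h⟩)
      · rw [Function.update_of_ne h1]
    · obtain ⟨h1, h2⟩ := Finset.mem_erase.1 hx
      rw [mem_nbrs_suppress hc h1] at hl
      rw [deg_suppress hc h1, h11]
      have hge : X.deg x ≤ s.arr 11 x := by
        by_cases hl' : x ∈ X.nbrs x
        · have := hr.deg_loop x h2 hl'
          omega
        · rw [hr.deg_eq x h2 hl']
      by_cases hx' : x = X.tgt p ∧ x = X.tgt q
      · rw [if_pos (hx'.1.symm.trans hx'.2), ← hx'.1, Function.update_self]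
        omega
      · have := hr.deg_loop x h2 (hl.resolve_right hx')
        split_ifs with h
        · rw [Function.update_of_ne, Function.update_of_ne h1]
          · exact this
          · rintro rfl
            exact hx' ⟨rfl, h⟩
        · rw [Function.update_of_ne h1]
          exact this
  unfold suppressProg
  simp only [run_seq, run_assign, run_store, run_ite, run_skip, setVar_var, setVar_arr, setArr_arr,
    setArr_var, Expr.eval, h20, h24, h25, Nat.add_sub_cancel, tp, tq, hs.own, Nat.reduceEqDiff, if_true,
    if_false, Test.Holds, Expr.cost, Test.cost, hown, newMarks]
  have e8 : Function.update (Function.update (s.arr 8) (X.tw p) (X.tw q)) (X.tw q) (X.tw p) =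
      newTw (s.arr 8) p q := by rw [newTw, tp, tq]
  have e12 : Function.update (Function.update (s.arr 12) p (q + 1)) q (p + 1) =
      newMate (s.arr 12) p q := rfl
  have hv' : X.tgt q ≠ v := hc.tgt_ne.2
  refine ⟨fun h1 => ⟨fun h2 => ?_, fun h2 => ?_⟩, fun h1 => ⟨fun h2 => ?_, fun h2 => ?_⟩⟩
  · refine ⟨hD _ (.inr ?_) ?_ ?_ ?_, ?_, ?_, by norm_num⟩ <;> simp [h1, h2, e8, e12, hv']
  · refine ⟨hD _ (.inr ?_) ?_ ?_ ?_, ?_, ?_, by norm_num⟩ <;> simp [h1, h2, e8, e12, hv']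
  · refine ⟨hD _ (.inr ?_) ?_ ?_ ?_, ?_, ?_, by norm_num⟩ <;> simp [h1, h2, e8, e12]
  · refine ⟨hD _ (.inr ?_) ?_ ?_ ?_, ?_, ?_, by norm_num⟩ <;> simp [h1, h2, e8, e12]

/-- Put the last two live arcs at the vertex in register 20 (plus 1) into registers 24 and 25. -/
def scanProg : Prog :=
  .assign 24 (.const 0) ;; .assign 25 (.const 0) ;;
  Prog.each 26 7 (.get 6 (.var 20))
    (.ite (.eq (.get 9 (.pred (.var 26))) (.const 0))
      (.assign 25 (.var 24) ;; .assign 24 (.var 26)) .skip)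

/-- The first two entries of a list, plus 1. -/
def firstTwo : List ℕ → ℕ × ℕ
  | [] => (0, 0)
  | [a] => (a + 1, 0)
  | a :: b :: _ => (a + 1, b + 1)

theorem run_scan {s : Mem} {N : Net} {X : ArcGraph} (hs : Static s N) (hr : Rep s N X)
    (hc : s.var 20 ∈ X.A) :
    Run scanProg s fun t s' => (∃ l : List ℕ, l.Nodup ∧ l.toFinset = X.arcsAt (s.var 20) ∧
      (s'.var 24, s'.var 25) = firstTwo l) ∧ t ≤ 20 * (N.adj (s.var 20)).length + 20 := by
  have hcn := hr.A_lt _ hc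
  unfold scanProg
  simp only [run_seq, run_assign]
  refine Run.eachBound 13 (l := N.adj (s.var 20))
    (fun r s₁ => ∃ d, N.adj (s.var 20) = d ++ r ∧
      (s₁.var 24, s₁.var 25) = firstTwo (d.filter (· ∈ X.L)).reverse)
    rfl rfl (by simpa using hs.list _ hcn) ?_ ?_ ?_
  · exact ⟨[], rfl, by simp [firstTwo]⟩
  · rintro a r s₁ ⟨d, hd, h1⟩ hf hx -
    have hac : a ∈ N.adj (s.var 20) := by rw [hd]; simp
    obtain ⟨ham, haown⟩ := (hr.mem_adj hcn).1 hac
    have h9 : s₁.arr 9 = s.arr 9 := hf.arr 9 rfl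
    have hlive := hr.live a ham (by rw [← hr.own, haown]; exact hc)
    have h24 : s₁.var 24 = (firstTwo (d.filter (· ∈ X.L)).reverse).1 := congrArg Prod.fst h1
    rw [run_ite]
    constructor
    · intro hb
      have haL : a ∈ X.L := hlive.1 (by simpa [hx, h9] using hb)
      simp only [run_seq, run_assign]
      refine ⟨⟨d ++ [a], by simp [hd], ?_⟩, by simp⟩
      simp only [setVar_var, Expr.eval, Nat.reduceEqDiff, if_false, if_true, hx, List.filter_append,
        List.reverse_append]
      have : List.filter (fun x => decide (x ∈ X.L)) [a] = [a] := by simp [haL]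
      rw [this, List.reverse_singleton, List.singleton_append]
      rw [h24]
      generalize (d.filter (· ∈ X.L)).reverse = e
      match e with
      | [] => rfl
      | [b] => rfl
      | b :: c :: e => rfl
    · intro hb
      have haL : a ∉ X.L := fun h => hb (by simpa [hx, h9] using hlive.2 h)
      rw [run_skip]
      refine ⟨⟨d ++ [a], by simp [hd], ?_⟩, by simp⟩
      simpa [haL] using h1
  · rintro t s₁ ⟨d, hd, h1⟩ hf ht
    rw [List.append_nil] at hd
    subst hd
    refine ⟨⟨_, ?_, ?_, h1⟩, ?_⟩
    · exact List.nodup_reverse.2 ((N.adj_nodup _ hcn).filter _)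
    · rw [List.toFinset_reverse, hr.arcsAt_eq hcn]
    · simp only [Expr.cost] at ht ⊢
      omega

/-- Reduce the graph exhaustively, without the rule for multiple edges. -/
def reduceProg : Prog :=
  .assign 23 (.const 0) ;;
  Prog.for 23 0 (
    .assign 20 (.var 23) ;;
    -- Deleting a vertex of degree 1 can make only its neighbour reducible, and suppression makes no
    -- vertex reducible. Hence it suffices to follow one chain of vertices.
    .while (.lt (.get 11 (.var 20)) (.const 3)) (
      scanProg ;;
      .ite (.eq (.var 25) (.const 0))
        (killProg ;; .ite (.eq (.var 24) (.const 0)) .skip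
          (.assign 20 (.get 4 (.get 8 (.pred (.var 24))))))
        suppressProg))

/-- A property of the current graph, the pairing and the marks that is invariant under
reduction. -/
structure Invariant (J : ArcGraph → (ℕ → ℕ) → (ℕ → ℕ) → Prop) : Prop where
  kill : ∀ X mate F v, J X mate F → v ∈ X.A → X.deg v ≤ 1 → J (X.kill {v}) mate F
  suppress : ∀ X mate F v p q (h : X.CanSuppress v p q), J X mate F →
    J (X.suppress h) (newMate mate p q) (newMarks F v (X.tgt p))

/-- The time that is left for the reduction. -/
def reducePot (N : Net) (A : Finset ℕ) : ℕ := ∑ v ∈ A, (100 * (N.adj v).length + 200)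

theorem reducePot_erase (N : Net) {A : Finset ℕ} {v : ℕ} (hv : v ∈ A) :
    reducePot N (A.erase v) + (100 * (N.adj v).length + 200) = reducePot N A :=
  Finset.sum_erase_add _ _ hv

theorem reducePot_le {s : Mem} {N : Net} {X : ArcGraph} (hr : Rep s N X) :
    reducePot N X.A ≤ 100 * N.m + 200 * N.n := by
  calc reducePot N X.A ≤ reducePot N (Finset.range N.n) :=
        Finset.sum_le_sum_of_subset fun v hv => Finset.mem_range.2 (hr.A_lt v hv)
    _ = _ := by
        rw [reducePot, Finset.sum_add_distrib, ← Finset.mul_sum, N.sum_length]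
        simp [mul_comm]

theorem run_reduce {s : Mem} {N : Net} {X : ArcGraph}
    {J : ArcGraph → (ℕ → ℕ) → (ℕ → ℕ) → Prop} (hJ : Invariant J) (hs : Static s N)
    (hr : Rep s N X) (hX : J X (s.arr 12) (s.arr 13)) :
    Run reduceProg s fun t s' => Static s' N ∧
      (∃ X', Rep s' N X' ∧ J X' (s'.arr 12) (s'.arr 13) ∧ ∀ v, ¬ X'.Red v) ∧
      t ≤ 300 * (N.n + N.m) + 300 := by
  unfold reduceProg
  rw [run_seq, run_assign]
  have hn := hs.n
  refine Run.for (N := N.n) (φ := reducePot N X.A + 30 * N.n)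
    (fun i φ s => Static s N ∧ ∃ X', Rep s N X' ∧ J X' (s.arr 12) (s.arr 13) ∧
      (∀ v < i, ¬ X'.Red v) ∧ φ = reducePot N X'.A + 30 * (N.n - i))
    rfl rfl (by decide) (by simpa using hn) (by simp) ?_ ?_ ?_
  · refine ⟨⟨by simpa using hn, hs.own, hs.otw, hs.list⟩, X, hr.congr rfl rfl rfl rfl, hX, ?_, ?_⟩
    · simp
    · simp
  · rintro i φ s₁ ⟨hs₁, X₁, hr₁, hX₁, hR₁, rfl⟩ hf hx hi
    rw [run_seq, run_assign]
    -- All vertices up to `i` except the current one are irreducible. Every round removes a vertex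
    -- and is paid from the summand of that vertex in the potential.
    refine Run.while (φ := reducePot N X₁.A)
      (fun φ s => Static s N ∧ ∃ X', Rep s N X' ∧ J X' (s.arr 12) (s.arr 13) ∧
        s.var 20 < N.n ∧ (∀ v ≤ i, v ≠ s.var 20 → ¬ X'.Red v) ∧ φ = reducePot N X'.A) ?_ ?_ ?_
    · refine ⟨⟨by simpa using hs₁.n, hs₁.own, hs₁.otw, hs₁.list⟩, X₁, hr₁.congr rfl rfl rfl rfl,
        hX₁, by simpa [hx] using hi, fun v hv hvi => hR₁ v ?_, rfl⟩
      simp only [Expr.eval, hx, setVar_var, if_true] at hvi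
      omega
    · rintro φ s₂ ⟨hs₂, X₂, hr₂, hX₂, hc, hR₂, rfl⟩ hf hb
      have hred : X₂.Red (s₂.var 20) := (hr₂.lt_three hc).1 (by simpa using hb)
      have hpot := reducePot_erase N hred.1
      rw [run_seq]
      refine (run_scan hs₂ hr₂ hred.1).mono fun t₁ s₃ hf₃ h => ?_
      obtain ⟨⟨l, hln, hl, h3⟩, ht₁⟩ := h
      have hs₃ := hs₂.of_framed hf₃ rfl rfl rfl rfl rfl
      have hr₃ : Rep s₃ N X₂ := hr₂.congr (hf₃.arr 8 rfl) (hf₃.arr 9 rfl) (hf₃.arr 10 rfl)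
        (hf₃.arr 11 rfl)
      have h20 : s₃.var 20 = s₂.var 20 := hf₃.var 20 rfl
      have h12 : s₃.arr 12 = s₂.arr 12 := hf₃.arr 12 rfl
      have h13 : s₃.arr 13 = s₂.arr 13 := hf₃.arr 13 rfl
      have hlen : l.length = X₂.deg (s₂.var 20) := by
        rw [deg, ← hl, List.toFinset_card_of_nodup hln]
      have hlmem : ∀ a ∈ l, a ∈ X₂.L ∧ X₂.own a = s₂.var 20 := fun a ha => by
        rw [← mem_arcsAt, ← hl]
        simpa using ha
      have hlmem' : ∀ a ∈ X₂.L, X₂.own a = s₂.var 20 → a ∈ l := fun a ha ho => by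
        have := mem_arcsAt.2 ⟨ha, ho⟩
        rw [← hl] at this
        simpa using this
      have hdeg2 := hred.2.2
      rw [run_ite]
      constructor
      · intro hb25
        have h25 : s₃.var 25 = 0 := by simpa using hb25
        have hl1 : l.length ≤ 1 := by
          match l, h3 with
          | [], _ => simp
          | [a], _ => simp
          | a :: b :: l, h3 =>
            have := congrArg Prod.snd h3
            simp [firstTwo, h25] at this
        rw [run_seq]
        refine (run_kill hs₃ hr₃ (by rw [h20]; exact hred.1)).mono fun t₂ s₄ hf₄ h => ?_
        obtain ⟨hr₄, ht₂⟩ := h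
        rw [h20] at hr₄ ht₂
        have hs₄ := hs₃.of_framed hf₄ rfl rfl rfl rfl rfl
        have hX₄ : J (X₂.kill {s₂.var 20}) (s₄.arr 12) (s₄.arr 13) := by
          rw [hf₄.arr 12 rfl, hf₄.arr 13 rfl, h12, h13]
          exact hJ.kill _ _ _ _ hX₂ hred.1 (by omega)
        have hA4 : (X₂.kill {s₂.var 20}).A = X₂.A.erase (s₂.var 20) :=
          Finset.sdiff_singleton_eq_erase _ _
        have hnew : ∀ c', (∀ a ∈ l, X₂.tgt a = c') → ∀ v ≤ i, v ≠ c' →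
            ¬ (X₂.kill {s₂.var 20}).Red v := by
          intro c' hc' v hv hvc hR
          have hvne : v ≠ s₂.var 20 := fun h => by
            have := hR.1
            rw [hA4, h] at this
            simp at this
          refine hR₂ v hv hvne (hR.of_kill fun a ha hao hat => hvc ?_)
          rw [← hat]
          exact hc' a (hlmem' a ha hao)
        have h24' : s₄.var 24 = s₃.var 24 := hf₄.var 24 rfl
        have h20' : s₄.var 20 = s₂.var 20 := (hf₄.var 20 rfl).trans h20
        rw [run_ite]
        constructor
        · intro hb24
          have h24 : s₃.var 24 = 0 := by simpa [h24'] using hb24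
          have hl0 : l = [] := by
            match l, h3 with
            | [], _ => rfl
            | a :: l, h3 =>
              have := congrArg Prod.fst h3
              cases l <;> simp [firstTwo, h24] at this
          rw [run_skip]
          refine ⟨_, ⟨hs₄, _, hr₄, hX₄, by rw [h20']; exact hc, ?_, rfl⟩, ?_⟩
          · exact hnew _ (by simp [hl0])
          · rw [hA4]
            simp
            omega
        · intro hb24
          have h24 : s₃.var 24 ≠ 0 := by simpa [h24'] using hb24
          obtain ⟨a, rfl⟩ : ∃ a, l = [a] := by
            match l, h3 with
            | [], h3 =>
              have := congrArg Prod.fst h3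
              simp [firstTwo, h24] at this
            | [a], _ => exact ⟨a, rfl⟩
          have h24a : s₃.var 24 = a + 1 := congrArg Prod.fst h3
          obtain ⟨haL, hao⟩ := hlmem a (by simp)
          have h8 : s₄.arr 8 a = X₂.tw a := by
            rw [hf₄.arr 8 rfl, hr₃.tw a haL]
          have hnext : s₄.arr 4 (s₄.arr 8 (s₄.var 24 - 1)) = X₂.tgt a := by
            rw [h24', h24a, Nat.add_sub_cancel, h8, hs₄.own, ← hr₂.own]
            rfl
          rw [run_assign]
          refine ⟨_, ⟨⟨by simpa using hs₄.n, hs₄.own, hs₄.otw, hs₄.list⟩, _,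
            hr₄.congr rfl rfl rfl rfl, hX₄, ?_, ?_, rfl⟩, ?_⟩
          · simp only [setVar_var, if_true, Expr.eval, hnext]
            exact hr₂.A_lt _ (tgt_mem haL)
          · simp only [setVar_var, if_true, Expr.eval, hnext]
            exact hnew _ (by simp)
          · rw [hA4]
            simp
            omega
      · intro hb25
        have h25 : s₃.var 25 ≠ 0 := by simpa using hb25
        obtain ⟨p, q, rfl⟩ : ∃ p q, l = [p, q] := by
          match l, h3 with
          | [], h3 =>
            have := congrArg Prod.snd h3
            simp [firstTwo, h25] at this
          | [a], h3 =>
            have := congrArg Prod.snd h3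
            simp [firstTwo, h25] at this
          | [a, b], _ => exact ⟨a, b, rfl⟩
          | a :: b :: c :: l, _ =>
            simp at hlen
            omega
        have hcs : X₂.CanSuppress (s₂.var 20) p q := by
          refine ⟨hred.1, ?_, ?_, fun h => hred.2.1 ?_⟩
          · rw [← hl]
            simp
          · simpa using hln
          · rw [mem_nbrs]
            refine ⟨p, (hlmem p (by simp)).1, (hlmem p (by simp)).2, ?_⟩
            rw [tgt, h]
            exact (hlmem q (by simp)).2
        refine (run_suppress hs₃ hr₃ h20 (congrArg Prod.fst h3) (congrArg Prod.snd h3) hcs).mono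
          fun t₂ s₄ hf₄ h => ?_
        obtain ⟨hr₄, hm, hF, ht₂⟩ := h
        refine ⟨_, ⟨hs₃.of_framed hf₄ rfl rfl rfl rfl rfl, _, hr₄, ?_, ?_, ?_, rfl⟩, ?_⟩
        · rw [hm, hF, h12, h13]
          exact hJ.suppress _ _ _ _ _ _ hcs hX₂
        · rw [hf₄.var 20 rfl, h20]
          exact hc
        · rw [hf₄.var 20 rfl, h20]
          exact fun v hv hvc hR => hR₂ v hv hvc hR.of_suppress
        · have : (X₂.suppress hcs).A = X₂.A.erase (s₂.var 20) := rfl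
          rw [this]
          simp
          omega
    · rintro t φ' s₂ ⟨hs₂, X₂, hr₂, hX₂, hc, hR₂, rfl⟩ hf hb ht
      refine ⟨_, ⟨⟨by simpa using hs₂.n, hs₂.own, hs₂.otw, hs₂.list⟩, X₂,
        hr₂.congr rfl rfl rfl rfl, hX₂, fun v hv hR => ?_, rfl⟩, ?_⟩
      · by_cases hvc : v = s₂.var 20
        · subst hvc
          have := (hr₂.lt_three hc).2 hR
          simp at hb
          omega
        · exact hR₂ v (by omega) hvc hR
      · simp at ht ⊢
        omega
  · rintro t φ' s₂ ⟨hs₂, X₂, hr₂, hX₂, hR₂, rfl⟩ hf hx ht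
    refine ⟨hs₂, ⟨X₂, hr₂, hX₂, fun v hR => hR₂ v (hr₂.A_lt v hR.1) hR⟩, ?_⟩
    have h1 := reducePot_le hr
    simp at ht ⊢
    omega

end RAM

/-! ### Writing a cycle to the output and deleting its vertices. -/

namespace RAM

open ArcGraph

theorem length_slice (f : ℕ → ℕ) (i j : ℕ) : (slice f i j).length = j - i := by
  simp [slice]

theorem slice_self (f : ℕ → ℕ) (i : ℕ) : slice f i i = [] := by simp [slice]

theorem slice_congr {f g : ℕ → ℕ} {i j : ℕ} (h : ∀ x, i ≤ x → x < j → f x = g x) :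
    slice f i j = slice g i j := by
  refine List.map_congr_left fun x hx => ?_
  rw [List.mem_range'_1] at hx
  exact h x hx.1 (by omega)

theorem slice_succ (f : ℕ → ℕ) {i j : ℕ} (h : i ≤ j) :
    slice f i (j + 1) = slice f i j ++ [f j] := by
  have : j + 1 - i = (j - i) + 1 := by omega
  rw [slice, this, List.range'_concat, List.map_append, slice]
  simp
  congr 1
  omega

theorem slice_update (f : ℕ → ℕ) (j v : ℕ) :
    slice (Function.update f j v) 0 (j + 1) = slice f 0 j ++ [v] := by
  rw [slice_succ _ (Nat.zero_le _), Function.update_self]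
  congr 1
  exact slice_congr fun x _ hx => Function.update_of_ne hx.ne _ _

theorem slice_eq_take_drop (f : ℕ → ℕ) {i j p : ℕ} (hj : j ≤ p) :
    slice f i j = ((slice f 0 p).drop i).take (j - i) := by
  refine List.ext_getElem ?_ fun x h1 h2 => ?_
  · simp [slice]
    omega
  · simp [slice]

theorem mem_slice {f : ℕ → ℕ} {i j x : ℕ} : x ∈ slice f i j ↔ ∃ y, i ≤ y ∧ y < j ∧ f y = x := by
  simp only [slice, List.mem_map, List.mem_range'_1]
  constructor
  · rintro ⟨y, ⟨h1, h2⟩, h3⟩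
    exact ⟨y, h1, by omega, h3⟩
  · rintro ⟨y, h1, h2, h3⟩
    exact ⟨y, ⟨h1, by omega⟩, h3⟩

/-- Output the inner vertices of the path that the arc in register 29 stands for. -/
def emitPath : Prog :=
  .assign 30 (.get 5 (.var 29)) ;;
  .while (.lt (.const 0) (.get 12 (.var 30)))
    (.assign 29 (.pred (.get 12 (.var 30))) ;; .store 3 (.var 7) (.get 4 (.var 29)) ;;
      .assign 7 (.succ (.var 7)) ;; .assign 30 (.get 5 (.var 29)))

theorem run_emitPath {s : Mem} {a t : ℕ} {l : List ℕ} (hl : Seg (s.arr 5) (s.arr 12) a l t)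
    (ht : s.arr 12 t = 0) (ha : s.var 29 = a) :
    Run emitPath s fun τ s' => s'.var 30 = t ∧
      slice (s'.arr 3) 0 (s'.var 7) = slice (s.arr 3) 0 (s.var 7) ++ l.map (s.arr 4) ∧
      τ ≤ 30 * l.length + 20 := by
  unfold emitPath
  rw [run_seq, run_assign]
  refine Run.while (φ := 30 * l.length) (fun φ s₁ => ∃ d r a, l = d ++ r ∧
    Seg (s.arr 5) (s.arr 12) a r t ∧ s₁.var 30 = s.arr 5 a ∧
    slice (s₁.arr 3) 0 (s₁.var 7) = slice (s.arr 3) 0 (s.var 7) ++ d.map (s.arr 4) ∧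
    φ = 30 * r.length) ⟨[], l, a, rfl, hl, by simp [ha], by simp, rfl⟩ ?_ ?_
  · rintro φ s₁ ⟨d, r, a, rfl, hr, h30, h3, rfl⟩ hf hb
    have e12 : s₁.arr 12 = s.arr 12 := hf.arr 12 rfl
    have e4 : s₁.arr 4 = s.arr 4 := hf.arr 4 rfl
    have e5 : s₁.arr 5 = s.arr 5 := hf.arr 5 rfl
    match r, hr with
    | [], hr =>
      obtain rfl : t = s.arr 5 a := hr
      simp [h30, e12, ht] at hb
    | b :: r, ⟨hm, hr⟩ =>
      simp only [run_seq, run_assign, run_store]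
      refine ⟨_, ⟨d ++ [b], r, b, by simp, hr, ?_, ?_, rfl⟩, ?_⟩
      · simp [h30, e12, hm, e5]
      · simp [slice_update, h3, h30, e12, hm, e4]
      · simp
        omega
  · rintro τ φ s₁ ⟨d, r, a, rfl, hr, h30, h3, rfl⟩ hf hb hτ
    have e12 : s₁.arr 12 = s.arr 12 := hf.arr 12 rfl
    match r, hr with
    | [], hr =>
      obtain rfl : t = s.arr 5 a := hr
      refine ⟨h30, by simpa using h3, ?_⟩
      simp at hτ ⊢
      omega
    | b :: r, ⟨hm, hr⟩ => simp [h30, e12, hm] at hb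

/-- Output the cycle through the vertex in register 5 that is given by the arcs in array 14 (plus
1), and delete its vertices. -/
def emitProg : Prog :=
  .assign 20 (.var 5) ;; .assign 31 (.const 1) ;;
  .while (.lt (.const 0) (.var 31)) (
    .assign 29 (.pred (.get 14 (.var 20))) ;;
    .store 17 (.var 8) (.var 20) ;; .assign 8 (.succ (.var 8)) ;;
    .store 3 (.var 7) (.var 20) ;; .assign 7 (.succ (.var 7)) ;;
    killProg ;; emitPath ;;
    .assign 20 (.get 4 (.var 30)) ;;
    .ite (.eq (.var 20) (.var 5)) (.assign 31 (.const 0)) .skip) ;;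
  .assign 6 (.succ (.var 6)) ;; .store 2 (.var 6) (.var 7)

theorem run_emit {s : Mem} {N : Net} {X : ArcGraph} {U : ℕ → Prop} {lf : ℕ → List ℕ} {B : List ℕ}
    (hs : Static s N) (hr : Rep s N X) (hP : X.Paths N.m N.otw (s.arr 12) U)
    (hlf : X.LiftFun N.otw (s.arr 12) U lf) (hB : X.IsArcCycle B)
    (hx : ∀ b ∈ B.head?, X.own b = s.var 5) (hpar : ∀ b ∈ B, s.arr 14 (X.own b) = b + 1) :
    Run emitProg s fun t s' => Static s' N ∧ Rep s' N (X.kill (B.map X.own).toFinset) ∧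
      slice (s'.arr 3) 0 (s'.var 7) =
        slice (s.arr 3) 0 (s.var 7) ++ (expand lf B).map X.own ∧
      slice (s'.arr 17) 0 (s'.var 8) = slice (s.arr 17) 0 (s.var 8) ++ B.map X.own ∧
      s'.var 6 = s.var 6 + 1 ∧ s'.arr 2 = Function.update (s.arr 2) (s.var 6 + 1) (s'.var 7) ∧
      t ≤ 200 * (N.n + N.m) + 200 := by
  -- The vertices of the lifted cycle are distinct, so there are at most `n` of them, and the arc
  -- lists of distinct vertices have total length at most `m`.
  have hcost : (B.map fun b => 150 + 40 * (N.adj (X.own b)).length + 30 * (lf b).length).sum ≤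
      150 * N.n + 40 * N.m := by
    have hsub : ∀ l : List ℕ, (∀ b ∈ l, b < N.m) → l.map X.own ⊆ List.range N.n := by
      intro l hl v hv
      obtain ⟨b, hb, rfl⟩ := List.mem_map.1 hv
      rw [List.mem_range, hr.own]
      exact N.own_lt b (hl b hb)
    have hn : (expand lf B).length ≤ N.n := by
      have h1 := hP.expand_nodup hlf hB.mem hB.nodup hB.tw_notMem
      have h2 := (h1.subperm (hsub _ (hP.expand_lt hlf hB.mem))).length_le
      simpa using h2
    have hm : ((B.map X.own).map fun v => (N.adj v).length).sum ≤ N.m := by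
      rw [← N.sum_length, ← List.sum_toFinset _ hB.nodup]
      refine Finset.sum_le_sum_of_subset fun v hv => ?_
      rw [Finset.mem_range, ← List.mem_range]
      exact hsub B (fun b hb => hP.lt b (hB.mem b hb)) (List.mem_toFinset.1 hv)
    have he : ∀ l : List ℕ,
        (l.map fun b => 150 + 40 * (N.adj (X.own b)).length + 30 * (lf b).length).sum ≤
          150 * (expand lf l).length + 40 * ((l.map X.own).map fun v => (N.adj v).length).sum := by
      intro l
      induction l with
      | nil => simp
      | cons a l ih =>
        simp only [expand, List.map_cons, List.sum_cons, List.flatMap_cons, List.length_append,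
          List.length_cons] at ih ⊢
        omega
    have := he B
    omega
  unfold emitProg
  simp only [run_seq, run_assign, run_store]
  refine Run.while (φ := 150 * N.n + 40 * N.m) (fun φ s₁ => Static s₁ N ∧ ∃ d r, B = d ++ r ∧
    (s₁.var 31 ≠ 0 ↔ r ≠ []) ∧ (∀ b ∈ r.head?, X.own b = s₁.var 20) ∧
    Rep s₁ N (X.kill (d.map X.own).toFinset) ∧
    slice (s₁.arr 3) 0 (s₁.var 7) = slice (s.arr 3) 0 (s.var 7) ++ (expand lf d).map X.own ∧
    slice (s₁.arr 17) 0 (s₁.var 8) = slice (s.arr 17) 0 (s.var 8) ++ d.map X.own ∧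
    (r.map fun b => 150 + 40 * (N.adj (X.own b)).length + 30 * (lf b).length).sum ≤ φ) ?_ ?_ ?_
  · refine ⟨⟨by simpa using hs.n, hs.own, hs.otw, hs.list⟩, [], B, rfl, by simpa using hB.ne_nil,
      by simpa using hx, ?_, by simp [expand], by simp, hcost⟩
    have : X.kill ([].map X.own).toFinset = X := by
      refine ext_of ?_ ?_ rfl rfl
      · simp [ArcGraph.kill]
      · simp [ArcGraph.kill]
    rw [this]
    exact hr.congr rfl rfl rfl rfl
  · rintro φ s₁ ⟨hs₁, d, r, rfl, h31, h20, hr₁, h3, h17, hφ⟩ hf hb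
    have e12 : s₁.arr 12 = s.arr 12 := hf.arr 12 rfl
    have e14 : s₁.arr 14 = s.arr 14 := hf.arr 14 rfl
    have e5 : s₁.var 5 = s.var 5 := hf.var 5 rfl
    obtain ⟨b, r, rfl⟩ : ∃ b r', r = b :: r' := by
      match r, h31 with
      | [], h31 => simp at h31; simp [h31] at hb
      | b :: r, _ => exact ⟨b, r, rfl⟩
    have h20 : s₁.var 20 = X.own b := (h20 b (by simp)).symm
    have hbL := hB.mem b (by simp)
    have hpb := hpar b (by simp)
    simp only [run_seq, run_assign, run_store]
    have hnd := hB.nodup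
    rw [List.map_append, List.map_cons, List.nodup_append] at hnd
    refine (run_kill (N := N) (X := X.kill (d.map X.own).toFinset) ?_ ?_ ?_).mono
      fun t₁ s₂ hf₂ h => ?_
    · exact ⟨by simpa using hs₁.n, hs₁.own, hs₁.otw, hs₁.list⟩
    · exact hr₁.congr rfl rfl rfl rfl
    · refine Finset.mem_sdiff.2 ⟨?_, ?_⟩
      · simp [h20, X.own_mem b hbL]
      · simp only [setVar_var, setArr_var, h20, List.mem_toFinset, Nat.reduceEqDiff, if_false]
        intro h
        exact hnd.2.2 _ h _ (by simp) rfl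
    obtain ⟨hr₂, ht₁⟩ := h
    have hs₂ : Static s₂ N := by
      refine Static.of_framed ?_ hf₂ rfl rfl rfl rfl rfl
      exact ⟨by simpa using hs₁.n, hs₁.own, hs₁.otw, hs₁.list⟩
    have f5 : s₂.arr 5 = N.otw := hs₂.otw
    have f12 : s₂.arr 12 = s.arr 12 := (hf₂.arr 12 rfl).trans e12
    have f29 : s₂.var 29 = b := by
      rw [hf₂.var 29 rfl]
      simp [h20, e14, hpb]
    have g3 : s₂.arr 3 = Function.update (s₁.arr 3) (s₁.var 7) (X.own b) := by
      rw [hf₂.arr 3 rfl]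
      simp [h20]
    have g7 : s₂.var 7 = s₁.var 7 + 1 := by
      rw [hf₂.var 7 rfl]
      simp
    have g17 : s₂.arr 17 = Function.update (s₁.arr 17) (s₁.var 8) (X.own b) := by
      rw [hf₂.arr 17 rfl]
      simp [h20]
    have g8 : s₂.var 8 = s₁.var 8 + 1 := by
      rw [hf₂.var 8 rfl]
      simp
    refine (run_emitPath (a := b) (l := lf b) (t := X.tw b) ?_ ?_ f29).mono fun t₂ s₃ hf₃ h => ?_
    · rw [f5, f12]
      exact (hlf b hbL).1
    · rw [f12]
      exact hP.mate_L _ (X.tw_mem b hbL)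
    obtain ⟨k30, k3, ht₂⟩ := h
    have k4 : s₃.arr 4 = X.own := by rw [hf₃.arr 4 rfl, hs₂.own, hr.own]
    have k5 : s₃.var 5 = s.var 5 := by
      rw [hf₃.var 5 rfl, hf₂.var 5 rfl]
      simp [e5]
    have hs₃ := hs₂.of_framed hf₃ rfl rfl rfl rfl rfl
    have hr₃ : Rep s₃ N (X.kill ((d ++ [b]).map X.own).toFinset) := by
      refine Rep.congr ?_ (hf₃.arr 8 rfl) (hf₃.arr 9 rfl) (hf₃.arr 10 rfl) (hf₃.arr 11 rfl)
      rw [kill_kill] at hr₂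
      convert hr₂ using 2
      ext x
      simp [h20]
    have k3' : slice (s₃.arr 3) 0 (s₃.var 7) =
        slice (s.arr 3) 0 (s.var 7) ++ (expand lf (d ++ [b])).map X.own := by
      rw [k3, g3, g7, slice_update, h3, hs₂.own, ← hr.own]
      simp [expand]
    have k17 : slice (s₃.arr 17) 0 (s₃.var 8) =
        slice (s.arr 17) 0 (s.var 8) ++ (d ++ [b]).map X.own := by
      rw [hf₃.arr 17 rfl, hf₃.var 8 rfl, g17, g8, slice_update, h17]
      simp
    obtain ⟨φ', rfl⟩ : ∃ φ', φ = φ' + (150 + 40 * (N.adj (X.own b)).length + 30 * (lf b).length) := by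
      refine ⟨φ - (150 + 40 * (N.adj (X.own b)).length + 30 * (lf b).length), ?_⟩
      simp only [List.map_cons, List.sum_cons] at hφ
      omega
    have hφ' : (r.map fun b => 150 + 40 * (N.adj (X.own b)).length +
        30 * (lf b).length).sum ≤ φ' := by
      simp only [List.map_cons, List.sum_cons] at hφ
      omega
    obtain ⟨h0, hh0⟩ : ∃ h0, (d ++ b :: r).head? = some h0 := by
      cases d <;> simp
    have hch := hB.chain h0 hh0
    have hx0 := hx h0 hh0
    have hnext' : ∀ c ∈ r.head?, X.own c = X.own (X.tw b) := by
      intro c hc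
      cases r with
      | nil => simp at hc
      | cons c' r =>
        obtain rfl : c' = c := by simpa using hc
        rw [List.append_assoc] at hch
        have := (List.isChain_append.1 hch).2.1
        simp only [List.cons_append, List.isChain_cons_cons] at this
        exact this.1.symm
    -- The vertices of the cycle are distinct, so the starting vertex is met again only after the
    -- last arc.
    have hnext : X.own (X.tw b) = s.var 5 ↔ r = [] := by
      constructor
      · intro h
        cases r with
        | nil => rfl
        | cons c r =>
          have h1 := hnext' c (by simp)
          rw [h, ← hx0] at h1
          exfalso
          cases d with
          | nil =>
            obtain rfl : b = h0 := by simpa using hh0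
            have := hB.nodup
            simp [h1] at this
          | cons a d =>
            obtain rfl : a = h0 := by simpa using hh0
            have := hB.nodup
            simp [h1] at this
      · rintro rfl
        rw [List.append_assoc] at hch
        have := (List.isChain_append.1 hch).2.1
        simp only [List.cons_append, List.nil_append, List.isChain_cons_cons] at this
        rw [← hx0]
        exact this.1
    simp only [setVar_var, setArr_var, h20, Nat.reduceEqDiff, if_false] at ht₁
    rw [run_ite]
    constructor
    · intro hb
      have hrnil : r = [] := hnext.1 (by simpa [k30, k4, k5] using hb)
      rw [run_assign]
      refine ⟨φ', ⟨⟨by simpa using hs₃.n, hs₃.own, hs₃.otw, hs₃.list⟩, d ++ [b], r, by simp,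
        by simp [hrnil], by simp [hrnil], hr₃.congr rfl rfl rfl rfl, k3', k17, hφ'⟩, ?_⟩
      simp
      omega
    · intro hb
      have hrnil : r ≠ [] := fun h => hb (by simpa [k30, k4, k5] using hnext.2 h)
      rw [run_skip]
      refine ⟨φ', ⟨⟨by simpa using hs₃.n, hs₃.own, hs₃.otw, hs₃.list⟩, d ++ [b], r, by simp,
        ?_, by simpa [k30, k4] using hnext', hr₃.congr rfl rfl rfl rfl, k3', k17, hφ'⟩, ?_⟩
      · have : s₃.var 31 = s₁.var 31 := by
          rw [hf₃.var 31 rfl, hf₂.var 31 rfl]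
          simp
        simp only [setVar_var, Nat.reduceEqDiff, if_false, this]
        simpa [hrnil] using h31
      · simp
        omega
  · rintro t φ s₁ ⟨hs₁, d, r, rfl, h31, h20, hr₁, h3, h17, hφ⟩ hf hb ht
    have hrnil : r = [] := by
      by_contra h
      have := h31.2 h
      simp at hb
      omega
    subst hrnil
    have e6 : s₁.var 6 = s.var 6 := hf.var 6 rfl
    have e2 : s₁.arr 2 = s.arr 2 := hf.arr 2 rfl
    rw [List.append_nil]
    refine ⟨⟨by simpa using hs₁.n, hs₁.own, hs₁.otw, hs₁.list⟩, hr₁.congr rfl rfl rfl rfl,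
      by simpa using h3, by simpa using h17, by simp [e6], by simp [e6, e2], ?_⟩
    simp at ht ⊢
    omega

end RAM

/-! ### Cycles of logarithmic length by breadth first search. -/

namespace ArcGraph

variable {X : ArcGraph}

/-- If `f` picks at every vertex but `y` of a set an arc into the set that decreases the rank, the
path that follows `f` to `y` can be closed by an arc `c` that starts at `y`. -/
theorem exists_isArcCycle {S : ℕ → Prop} {c : ℕ} {f rank : ℕ → ℕ} (hc : c ∈ X.L)
    (hS : ∀ v, S v → v ≠ X.own c →
      f v ∈ X.L ∧ X.own (f v) = v ∧ S (X.tgt (f v)) ∧ rank (X.tgt (f v)) < rank v)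
    (hx : S (X.tgt c)) (hy : S (X.own c)) (hne : X.tgt c ≠ X.own c → f (X.tgt c) ≠ X.tw c)
    (hfy : f (X.own c) = c) :
    ∃ B, X.IsArcCycle B ∧ (∀ b ∈ B.head?, X.own b = X.tgt c) ∧
      (∀ b ∈ B, f (X.own b) = b ∧ S (X.own b)) ∧ B.length ≤ rank (X.tgt c) + 1 := by
  -- Following `f` decreases the rank, so the walk visits no vertex twice and ends at the start of
  -- `c` after at most `r` arcs.
  have path : ∀ r x, S x → rank x = r → ∃ B : List ℕ,
      (∀ b ∈ B, b ∈ X.L ∧ X.own b ≠ X.own c ∧ S (X.own b) ∧ f (X.own b) = b ∧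
        rank (X.own b) ≤ r) ∧ (∀ b ∈ (B ++ [c]).head?, X.own b = x) ∧
      (B ++ [c]).IsChain (fun x y => X.tgt x = X.own y) ∧ (B.map X.own).Nodup ∧ B.length ≤ r := by
    intro r
    induction r using Nat.strong_induction_on with
    | _ r ih =>
      intro x hx hr
      by_cases hxy : x = X.own c
      · exact ⟨[], by simp, by simp [hxy], by simp, by simp, by simp⟩
      · obtain ⟨h1, h2, h3, h4⟩ := hS x hx hxy
        obtain ⟨B, b1, b2, b3, b4, b5⟩ := ih _ (hr ▸ h4) _ h3 rfl
        rw [hr] at h4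
        refine ⟨f x :: B, fun b hb => ?_, by simp [h2], ?_, ?_, by simp; omega⟩
        · rcases List.mem_cons.1 hb with rfl | hb
          · rw [h2]
            exact ⟨h1, hxy, hx, rfl, hr.le⟩
          · obtain ⟨e1, e2, e3, e4, e5⟩ := b1 b hb
            exact ⟨e1, e2, e3, e4, by omega⟩
        · rw [List.cons_append, List.isChain_cons]
          exact ⟨fun y hy => (b2 y hy).symm, b3⟩
        · rw [List.map_cons, List.nodup_cons]
          refine ⟨fun h => ?_, b4⟩
          obtain ⟨b, hb, hbx⟩ := List.mem_map.1 h
          have := (b1 b hb).2.2.2.2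
          rw [hbx, h2] at this
          omega
  obtain ⟨B, b1, b2, b3, b4, b5⟩ := path _ _ hx rfl
  have hcB : X.tw c ∉ B := fun h => by
    obtain ⟨_, e2, _, e4, _⟩ := b1 _ h
    exact hne e2 e4
  refine ⟨B ++ [c], ⟨?_, ?_, by simp, ?_, ?_⟩, b2, ?_, by simpa using b5⟩
  · intro b hb
    rcases List.mem_append.1 hb with hb | hb
    · exact (b1 b hb).1
    · rw [List.mem_singleton.1 hb]
      exact hc
  · intro b hb
    rw [List.isChain_append]
    refine ⟨b3, by simp, fun x hx y hy => ?_⟩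
    obtain rfl : c = x := by simpa using hx
    obtain rfl : b = y := by simpa using hy
    exact (b2 b hb).symm
  · rw [List.map_append, List.map_singleton, List.nodup_append]
    refine ⟨b4, by simp, ?_⟩
    rintro _ h _ h' rfl
    obtain ⟨b, hb, hbx⟩ := List.mem_map.1 h
    rw [List.mem_singleton] at h'
    exact (b1 b hb).2.1 (hbx.trans h')
  -- An arc and its twin cannot both be on the path, since the rank would have to decrease in both
  -- directions; the twin of `c` is excluded by `hne`.
  · intro b hb htb
    rcases List.mem_append.1 hb with hb | hb
    · obtain ⟨e1, e2, e3, e4, e5⟩ := b1 b hb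
      rcases List.mem_append.1 htb with htb | htb
      · obtain ⟨k1, k2, k3, k4, k5⟩ := b1 _ htb
        have h1 := (hS _ e3 e2).2.2.2
        have h2 := (hS _ k3 k2).2.2.2
        rw [e4] at h1
        rw [k4, tgt_tw e1] at h2
        change rank (X.own (X.tw b)) < _ at h1
        omega
      · rw [List.mem_singleton] at htb
        apply hcB
        rw [← htb, X.tw_tw b e1]
        exact hb
    · rw [List.mem_singleton] at hb
      subst hb
      rcases List.mem_append.1 htb with htb | htb
      · exact hcB htb
      · exact X.tw_ne _ hc (List.mem_singleton.1 htb)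
  · intro b hb
    rcases List.mem_append.1 hb with hb | hb
    · obtain ⟨e1, e2, e3, e4, e5⟩ := b1 b hb
      exact ⟨e4, e3⟩
    · rw [List.mem_singleton.1 hb]
      exact ⟨hfy, hy⟩

/-- A breadth first search: `par` holds the arcs to the parents (plus 1), `vis` the positions in
the queue (plus 1), `i` vertices have been processed, `e` vertices have been found, and the arcs in
`D` at the current vertex have been processed. -/
structure Search (X : ArcGraph) (root : ℕ) (par vis qu : ℕ → ℕ) (i e : ℕ) (D : List ℕ) :
    Prop where
  root_mem : root ∈ X.A
  vis_root : vis root = 1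
  par_root : par root = 0
  queue : ∀ j < e, qu j ∈ X.A ∧ vis (qu j) = j + 1
  pos : ∀ v ∈ X.A, vis v ≠ 0 → vis v ≤ e ∧ qu (vis v - 1) = v
  parent : ∀ v ∈ X.A, vis v ≠ 0 → v ≠ root → ∃ p ∈ X.L, par v = p + 1 ∧ X.own p = v ∧
    vis (X.tgt p) ≠ 0 ∧ 2 * vis (X.tgt p) ≤ vis v ∧
    (vis (X.tgt p) ≤ i ∨ vis (X.tgt p) = i + 1 ∧ X.tw p ∈ D)
  -- An arc that has been processed belongs to an edge of the tree: any other arc ends the search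
  -- with a cycle.
  done : ∀ a ∈ X.L, vis (X.own a) ≠ 0 → (vis (X.own a) ≤ i ∨ vis (X.own a) = i + 1 ∧ a ∈ D) →
    par (X.own a) = a + 1 ∨ vis (X.tgt a) ≠ 0 ∧ par (X.tgt a) = X.tw a + 1
  cur : ∀ a ∈ D, a ∈ X.L → vis (X.own a) = i + 1
  -- A processed vertex has at least three arcs, and all but the one to its parent have found new
  -- vertices; so each processed vertex adds at least two to the queue. This yields the factor 2 in
  -- `parent`, and with it the logarithmic depth.
  count : 2 * i + 1 + (D.filter fun a => a ∈ X.L ∧ par (X.own a) ≠ a + 1).length ≤ e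

namespace Search

variable {root i e : ℕ} {par vis qu : ℕ → ℕ} {D : List ℕ}

theorem init {root : ℕ} (h : root ∈ X.A) {par vis qu : ℕ → ℕ} (hp : par root = 0)
    (hv : ∀ v ∈ X.A, vis v = if v = root then 1 else 0) (hq : qu 0 = root) :
    X.Search root par vis qu 0 1 [] where
  root_mem := h
  vis_root := by simp [hv root h]
  par_root := hp
  queue j hj := by
    obtain rfl : j = 0 := by omega
    rw [hq]
    simp [h, hv root h]
  pos v hv' h0 := by
    rw [hv v hv'] at h0 ⊢
    by_cases hr : v = root
    · simp [hr, hq]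
    · simp [hr] at h0
  parent v hv' h0 hr := by simp [hv v hv', hr] at h0
  done a ha h0 h := by
    rcases h with h | h
    · omega
    · simp at h
  cur := by simp
  count := by simp

theorem inj (h : X.Search root par vis qu i e D) {u v : ℕ} (hu : u ∈ X.A) (hv : v ∈ X.A)
    (h0 : vis u ≠ 0) (heq : vis u = vis v) : u = v := by
  rw [← (h.pos u hu h0).2, heq, (h.pos v hv (heq ▸ h0)).2]

theorem le_card (h : X.Search root par vis qu i e D) : e ≤ X.A.card := by
  rw [← Finset.card_range e]
  refine Finset.card_le_card_of_injOn qu (fun j hj => (h.queue j (by simpa using hj)).1) ?_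
  intro j hj j' hj' heq
  have h1 := (h.queue j (by simpa using hj)).2
  have h2 := (h.queue j' (by simpa using hj')).2
  have heq : qu j = qu j' := heq
  rw [heq] at h1
  omega

/-- Skip an arc that is dead or leads to the parent. -/
theorem skip (h : X.Search root par vis qu i e D) {a : ℕ}
    (ha : a ∈ X.L → vis (X.own a) = i + 1 ∧ par (X.own a) = a + 1) :
    X.Search root par vis qu i e (D ++ [a]) where
  root_mem := h.root_mem
  vis_root := h.vis_root
  par_root := h.par_root
  queue := h.queue
  pos := h.pos
  parent v hv h0 hr := by
    obtain ⟨p, h1, h2, h3, h4, h5, h6⟩ := h.parent v hv h0 hr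
    exact ⟨p, h1, h2, h3, h4, h5, h6.imp_right fun h => ⟨h.1, by simp [h.2]⟩⟩
  done b hb h0 hd := by
    by_cases hba : b = a
    · subst hba
      exact .inl (ha hb).2
    · refine h.done b hb h0 (hd.imp_right fun h => ⟨h.1, ?_⟩)
      simpa [hba] using h.2
  cur b hb hbL := by
    rcases List.mem_append.1 hb with hb | hb
    · exact h.cur b hb hbL
    · obtain rfl : b = a := by simpa using hb
      exact (ha hbL).1
  count := by
    rw [List.filter_append]
    have : List.filter (fun a => decide (a ∈ X.L ∧ par (X.own a) ≠ a + 1)) [a] = [] := by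
      rw [List.filter_eq_nil_iff]
      intro b hb
      obtain rfl : b = a := by simpa using hb
      simpa using fun h => (ha h).2
    rw [this, List.append_nil]
    exact h.count

/-- Add the target of an arc to the tree. -/
theorem add (h : X.Search root par vis qu i e D) {a : ℕ} (haL : a ∈ X.L)
    (hv : vis (X.own a) = i + 1) (ht : vis (X.tgt a) = 0) :
    X.Search root (Function.update par (X.tgt a) (X.tw a + 1))
      (Function.update vis (X.tgt a) (e + 1)) (Function.update qu e (X.tgt a)) i (e + 1)
      (D ++ [a]) := by
  have hne : X.own a ≠ X.tgt a := fun h => by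
    rw [h] at hv
    omega
  have hup : ∀ (f : ℕ → ℕ) (x v : ℕ), vis v ≠ 0 → Function.update f (X.tgt a) x v = f v :=
    fun f x v h0 => Function.update_of_ne (by rintro rfl; exact h0 ht) _ _
  have hc := h.count
  have hroot : vis root ≠ 0 := by rw [h.vis_root]; simp
  have hown : vis (X.own a) ≠ 0 := by omega
  refine ⟨h.root_mem, ?_, ?_, fun j hj => ?_, fun v hvA h0 => ?_, fun v hvA h0 hr => ?_,
    fun b hb h0 hd => ?_, fun b hb hbL => ?_, ?_⟩
  · rw [hup _ _ _ hroot, h.vis_root]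
  · rw [hup _ _ _ hroot, h.par_root]
  · by_cases hje : j = e
    · subst hje
      simp [tgt_mem haL]
    · obtain ⟨h1, h2⟩ := h.queue j (by omega)
      rw [Function.update_of_ne hje, hup _ _ _ (by omega)]
      exact ⟨h1, h2⟩
  · by_cases hvt : v = X.tgt a
    · subst hvt
      simp
    · rw [Function.update_of_ne hvt] at h0 ⊢
      obtain ⟨h1, h2⟩ := h.pos v hvA h0
      rw [Function.update_of_ne (by omega)]
      exact ⟨by omega, h2⟩
  · by_cases hvt : v = X.tgt a
    · subst hvt
      refine ⟨X.tw a, X.tw_mem a haL, by simp, rfl, ?_⟩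
      rw [tgt_tw haL, hup _ _ _ hown, hv, X.tw_tw a haL, Function.update_self]
      exact ⟨by simp, by omega, .inr ⟨rfl, by simp⟩⟩
    · rw [Function.update_of_ne hvt] at h0 ⊢
      obtain ⟨p, h1, h2, h3, h4, h5, h6⟩ := h.parent v hvA h0 hr
      refine ⟨p, h1, h2, h3, ?_⟩
      · rw [hup _ _ _ h4, Function.update_of_ne hvt]
        exact ⟨h4, h5, h6.imp_right fun h => ⟨h.1, by simp [h.2]⟩⟩
  · have h0' : vis (X.own b) ≠ 0 := by
      intro hz
      by_cases hbt : X.own b = X.tgt a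
      · rw [hbt, Function.update_self] at hd
        omega
      · rw [Function.update_of_ne hbt] at h0
        exact h0 hz
    rw [hup _ _ _ h0'] at hd ⊢
    by_cases hba : b = a
    · subst hba
      right
      simp
    · have hd' : vis (X.own b) ≤ i ∨ vis (X.own b) = i + 1 ∧ b ∈ D :=
        hd.imp_right fun h => ⟨h.1, by simpa [hba] using h.2⟩
      refine (h.done b hb h0' hd').imp_right fun h => ?_
      rw [hup _ _ _ h.1, hup _ _ _ h.1]
      exact h
  · rw [hup _ _ _ (by
      rcases List.mem_append.1 hb with hb | hb
      · rw [h.cur b hb hbL]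
        simp
      · obtain rfl : b = a := by simpa using hb
        exact hown)]
    rcases List.mem_append.1 hb with hb | hb
    · exact h.cur b hb hbL
    · obtain rfl : b = a := by simpa using hb
      exact hv
  · rw [List.filter_append, List.length_append]
    have h1 : (D.filter fun b => decide (b ∈ X.L ∧
        Function.update par (X.tgt a) (X.tw a + 1) (X.own b) ≠ b + 1)) =
        D.filter fun b => decide (b ∈ X.L ∧ par (X.own b) ≠ b + 1) := by
      refine List.filter_congr fun b hb => decide_eq_decide.2 (and_congr_right fun hbL => ?_)
      rw [hup _ _ _ (by rw [h.cur b hb hbL]; simp)]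
    rw [h1]
    have h2 := List.length_filter_le (fun b => decide (b ∈ X.L ∧
        Function.update par (X.tgt a) (X.tw a + 1) (X.own b) ≠ b + 1)) [a]
    simp only [List.length_singleton] at h2
    omega

/-- All arcs at the current vertex have been processed. -/
theorem next (h : X.Search root par vis qu i e D) {v : ℕ} (hi : vis v = i + 1) (hv : v ∈ X.A)
    (hD : ∀ a ∈ X.L, X.own a = v → a ∈ D) (hr : ¬ X.Red v) (hnd : D.Nodup) :
    X.Search root par vis qu (i + 1) e [] where
  root_mem := h.root_mem
  vis_root := h.vis_root
  par_root := h.par_root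
  queue := h.queue
  pos := h.pos
  parent u hu h0 hr := by
    obtain ⟨p, h1, h2, h3, h4, h5, h6⟩ := h.parent u hu h0 hr
    exact ⟨p, h1, h2, h3, h4, h5, .inl (by omega)⟩
  done b hb h0 hd := by
    have hd : vis (X.own b) ≤ i + 1 := by simpa using hd
    refine h.done b hb h0 ?_
    by_cases hle : vis (X.own b) ≤ i
    · exact .inl hle
    · have hb' : vis (X.own b) = i + 1 := by omega
      exact .inr ⟨hb', hD b hb (h.inj (X.own_mem b hb) hv h0 (hb'.trans hi.symm))⟩
  cur := by simp
  count := by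
    -- A loop at `v` would be a processed arc, hence a tree edge from `v` to itself; but a parent
    -- stands earlier in the queue than its child.
    have hloop : v ∉ X.nbrs v := by
      intro hl
      obtain ⟨a, ha, hav, hat⟩ := mem_nbrs.1 hl
      have hp : ∃ p, par v = p + 1 ∧ X.tgt p = v := by
        rcases h.done a ha (by rw [hav]; omega) (.inr ⟨by rw [hav, hi], hD a ha hav⟩) with h | h
        · exact ⟨a, by rw [← h, hav], hat⟩
        · exact ⟨X.tw a, by rw [← h.2, hat], by rw [tgt_tw ha, hav]⟩
      obtain ⟨p, hp1, hp2⟩ := hp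
      have hvr : v ≠ root := by
        rintro rfl
        rw [h.par_root] at hp1
        omega
      obtain ⟨p', _, h2, _, h4, h5, _⟩ := h.parent v hv (by omega) hvr
      obtain rfl : p = p' := by omega
      rw [hp2] at h4 h5
      omega
    have hdeg : 3 ≤ X.deg v := by
      by_contra hlt
      exact hr ⟨hv, hloop, by omega⟩
    have hsub : (X.arcsAt v).erase (par v - 1) ⊆
        (D.filter fun a => a ∈ X.L ∧ par (X.own a) ≠ a + 1).toFinset := by
      intro a ha
      obtain ⟨h1, h2⟩ := Finset.mem_erase.1 ha
      obtain ⟨h2, h3⟩ := mem_arcsAt.1 h2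
      simp only [List.mem_toFinset, List.mem_filter, decide_eq_true_eq]
      exact ⟨hD a h2 h3, h2, by rw [h3]; omega⟩
    have h1 := Finset.card_le_card hsub
    rw [List.toFinset_card_of_nodup (hnd.filter _)] at h1
    have h2 := Finset.pred_card_le_card_erase (s := X.arcsAt v) (a := par v - 1)
    have h3 := h.count
    unfold deg at hdeg
    simp only [List.filter_nil, List.length_nil]
    omega

/-- The arcs on the way from a vertex to the root. -/
theorem exists_up (h : X.Search root par vis qu i e D) {v : ℕ} (hv : v ∈ X.A) (h0 : vis v ≠ 0) :
    ∃ l, RAM.LinkedList (fun a => par (X.tgt a)) (par v) l ∧ 2 ^ l.length ≤ vis v ∧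
      ((v :: l.map X.tgt).getLast (by simp) = root) ∧
      (∀ a ∈ l, a ∈ X.L ∧ par (X.own a) = a + 1 ∧ X.own a ∈ v :: l.map X.tgt ∧
        2 * vis (X.tgt a) ≤ vis (X.own a) ∧ vis (X.tgt a) ≤ i + 1) ∧
      (∀ u ∈ v :: l.map X.tgt, u ∈ X.A ∧ vis u ≠ 0 ∧ vis u ≤ vis v ∧
        (u ≠ root → ∃ a ∈ l, par u = a + 1 ∧ X.own a = u)) ∧
      (v :: l.map X.tgt).Pairwise (fun x y => vis y < vis x) ∧
      -- On the way to the root at most one vertex has a given parent `q`. This is what makes the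
      -- cycles thin.
      ∀ q, ∃ c, ∀ u ∈ v :: l.map X.tgt, ∀ p, par u = p + 1 → X.tgt p = q → u = c := by
  induction hr : vis v using Nat.strong_induction_on generalizing v with
  | _ r ih =>
    by_cases hvr : v = root
    · subst hvr
      refine ⟨[], h.par_root, by simp; omega, by simp, by simp, fun u hu => ?_, by simp,
        fun q => ⟨v, fun u hu _ _ _ => by simpa using hu⟩⟩
      obtain rfl : u = v := by simpa using hu
      exact ⟨hv, h0, by omega, fun h => absurd rfl h⟩
    · obtain ⟨p, h1, h2, h3, h4, h5, h6⟩ := h.parent v hv h0 hvr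
      obtain ⟨l, l1, l2, l3, l4, l5, l6, l7⟩ := ih _ (by omega) (tgt_mem h1) h4 rfl
      refine ⟨p :: l, ⟨h2, l1⟩, ?_, ?_, fun a ha => ?_, fun u hu => ?_, ?_,
        fun q => ?_⟩
      · rw [List.length_cons, pow_succ]
        omega
      · simpa using l3
      · rcases List.mem_cons.1 ha with rfl | ha
        · rw [h3]
          exact ⟨h1, h2, by simp, by omega, by omega⟩
        · obtain ⟨e1, e2, e3, e4, e5⟩ := l4 a ha
          exact ⟨e1, e2, List.mem_cons_of_mem _ e3, e4, e5⟩
      · rcases List.mem_cons.1 hu with rfl | hu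
        · exact ⟨hv, h0, by omega, fun _ => ⟨p, by simp, h2, h3⟩⟩
        · obtain ⟨e1, e2, e3, e4⟩ := l5 u hu
          refine ⟨e1, e2, by omega, fun hur => ?_⟩
          obtain ⟨a, ha, e⟩ := e4 hur
          exact ⟨a, by simp [ha], e⟩
      · rw [List.pairwise_cons]
        refine ⟨fun u hu => ?_, l6⟩
        have := (l5 u hu).2.2.1
        omega
      · by_cases hq : X.tgt p = q
        · refine ⟨v, fun u hu p' hp' hpq => ?_⟩
          rcases List.mem_cons.1 hu with hu | hu
          · exact hu
          · obtain ⟨e1, e2, e3, -⟩ := l5 u hu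
            have hur : u ≠ root := by
              rintro rfl
              rw [h.par_root] at hp'
              omega
            obtain ⟨p'', -, f2, -, f4, f5, -⟩ := h.parent u e1 e2 hur
            obtain rfl : p' = p'' := by omega
            rw [hpq, ← hq] at f4 f5
            omega
        · obtain ⟨c, hc⟩ := l7 q
          refine ⟨c, fun u hu p' hp' hpq => ?_⟩
          rcases List.mem_cons.1 hu with rfl | hu
          · obtain rfl : p = p' := by omega
            exact absurd hpq hq
          · exact hc u hu p' hp' hpq

end Search

/-- Turn round the pointers on the path from `y` to the root. -/
def reroot (X : ArcGraph) : (ℕ → ℕ) → ℕ → ℕ → List ℕ → ℕ → ℕ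
  | par, y, c, [] => Function.update par y c
  | par, y, c, b :: l => reroot X (Function.update par y c) (X.tgt b) (X.tw b + 1) l

theorem reroot_spec {l : List ℕ} : ∀ {par : ℕ → ℕ} {y c : ℕ}, (y :: l.map X.tgt).Nodup →
    (∀ v, v ∉ y :: l.map X.tgt → X.reroot par y c l v = par v) ∧ X.reroot par y c l y = c ∧
      ∀ b ∈ l, X.reroot par y c l (X.tgt b) = X.tw b + 1 := by
  induction l with
  | nil =>
    intro par y c _
    refine ⟨fun v hv => ?_, ?_, by simp⟩
    · exact Function.update_of_ne (by simpa using hv) _ _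
    · exact Function.update_self _ _ _
  | cons b l ih =>
    intro par y c h
    rw [List.map_cons, List.nodup_cons] at h
    obtain ⟨h1, h2, h3⟩ := ih (par := Function.update par y c) (c := X.tw b + 1) h.2
    refine ⟨fun v hv => ?_, ?_, fun d hd => ?_⟩
    · rw [List.map_cons, List.mem_cons, not_or] at hv
      rw [reroot, h1 v hv.2, Function.update_of_ne hv.1]
    · rw [reroot, h1 y h.1, Function.update_self]
    · rcases List.mem_cons.1 hd with rfl | hd
      · exact h2
      · exact h3 d hd

/-- When the pointers between `X.tgt a` and the root are turned round, the pointers lead from `X.own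
a` upwards to the other path and then down to `X.tgt a`, where the twin of `a` closes the cycle.
Both paths have logarithmic length because positions at least double from parent to child. For
thinness, let a neighbour of `q` on the cycle be processed already: it is joined to `q` by a tree
edge, so it is the parent of `q`, or on one of the two paths the only vertex with parent `q`.
Unprocessed vertices of the cycle are ends of `a`. This makes at most five. -/
theorem Search.exists_cycle {root i e : ℕ} {par vis qu : ℕ → ℕ} {D : List ℕ}
    (h : X.Search root par vis qu i e D) {a : ℕ} (ha : a ∈ X.L) (hv : vis (X.own a) = i + 1)
    (haD : a ∉ D) (hpar : par (X.own a) ≠ a + 1) (ht : vis (X.tgt a) ≠ 0) :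
    ∃ l, RAM.LinkedList (fun a => par (X.tgt a)) (par (X.tgt a)) l ∧
      (X.tgt a :: l.map X.tgt).Nodup ∧ (∀ b ∈ l, b ∈ X.L) ∧
      ∃ B, X.IsArcCycle B ∧ (∀ b ∈ B.head?, X.own b = X.own a) ∧
        (∀ b ∈ B, X.reroot par (X.tgt a) (X.tw a + 1) l (X.own b) = b + 1) ∧
        B.length ≤ 2 * Nat.log 2 X.A.card + 2 ∧ X.Thin (B.map X.own).toFinset := by
  obtain ⟨l, l1, l2, l3, l4, l5, l6, l7⟩ := h.exists_up (tgt_mem ha) ht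
  obtain ⟨k, k1, k2, k3, k4, k5, k6, k7⟩ := h.exists_up (X.own_mem a ha) (by omega)
  have hnd : (X.tgt a :: l.map X.tgt).Nodup := l6.imp fun hab => by
    rintro rfl
    omega
  refine ⟨l, l1, hnd, fun b hb => (l4 b hb).1, ?_⟩
  obtain ⟨r1, r2, r3⟩ := reroot_spec (par := par) (c := X.tw a + 1) hnd
  set par' := X.reroot par (X.tgt a) (X.tw a + 1) l with hpar'
  set Vy := X.tgt a :: l.map X.tgt with hVy
  set Vx := X.own a :: k.map X.tgt with hVx
  have hroot : root ∈ Vy := l3 ▸ List.getLast_mem _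
  have hS5 : ∀ v, v ∈ Vx ∨ v ∈ Vy → v ∈ X.A ∧ vis v ≠ 0 ∧ vis v ≤ e := by
    rintro v (hv | hv)
    · exact ⟨(k5 v hv).1, (k5 v hv).2.1, (h.pos v (k5 v hv).1 (k5 v hv).2.1).1⟩
    · exact ⟨(l5 v hv).1, (l5 v hv).2.1, (h.pos v (l5 v hv).1 (l5 v hv).2.1).1⟩
  -- Off the path `Vy` the pointers lead towards the root, so positions decrease; on `Vy` they lead
  -- away from it, so positions increase. With `e` as an upper bound for positions, the rank on `Vy`
  -- is `e - vis` and elsewhere the larger `e + vis`.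
  have key : ∀ v, v ∈ Vx ∨ v ∈ Vy → par' v ≠ 0 ∧ (v ≠ X.tgt a → ∃ b ∈ X.L, par' v = b + 1 ∧
      X.own b = v ∧ (X.tgt b ∈ Vx ∨ X.tgt b ∈ Vy) ∧
      (if X.tgt b ∈ Vy then e - vis (X.tgt b) else e + vis (X.tgt b)) <
        (if v ∈ Vy then e - vis v else e + vis v)) := by
    intro v hvS
    by_cases hvy : v ∈ Vy
    · rcases List.mem_cons.1 hvy with rfl | hvl
      · exact ⟨by rw [r2]; simp, fun h => absurd rfl h⟩
      · obtain ⟨b, hb, rfl⟩ := List.mem_map.1 hvl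
        refine ⟨by rw [r3 b hb]; simp, fun _ => ?_⟩
        obtain ⟨e1, e2, e3, e4, e5⟩ := l4 b hb
        refine ⟨X.tw b, X.tw_mem b e1, r3 b hb, rfl, ?_⟩
        rw [tgt_tw e1]
        have h1 := hS5 _ (.inr e3)
        have h2 := hS5 _ (.inr hvy)
        refine ⟨.inr e3, ?_⟩
        rw [if_pos e3, if_pos hvy]
        omega
    · have hvx := hvS.resolve_right hvy
      have hvr : v ≠ root := fun h => hvy (h ▸ hroot)
      obtain ⟨b, hb, hb1, hb2⟩ := (k5 v hvx).2.2.2 hvr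
      have hbt : X.tgt b ∈ Vx := List.mem_cons_of_mem _ (List.mem_map_of_mem hb)
      have h1 := k4 b hb
      have h2 := hS5 _ (.inl hbt)
      rw [r1 v hvy]
      refine ⟨by omega, fun _ => ⟨b, h1.1, hb1, hb2, .inl hbt, ?_⟩⟩
      rw [if_neg hvy]
      have := h1.2.2.2.1
      rw [hb2] at this
      split_ifs <;> omega
  have hcy : X.own (X.tw a) = X.tgt a := rfl
  have hcx : X.tgt (X.tw a) = X.own a := tgt_tw ha
  obtain ⟨B, b1, b2, b3, -⟩ := exists_isArcCycle (X := X) (c := X.tw a) (f := fun v => par' v - 1)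
    (S := fun v => v ∈ Vx ∨ v ∈ Vy) (rank := fun v => if v ∈ Vy then e - vis v else e + vis v)
    (X.tw_mem a ha) (fun v hvS hvy => by
      obtain ⟨b, e1, e2, e3, e4, e5⟩ := (key v hvS).2 hvy
      have : par' v - 1 = b := by omega
      simp only [this]
      exact ⟨e1, e3, e4, e5⟩)
    (by rw [hcx]; exact .inl (by simp [hVx])) (by rw [hcy]; exact .inr (by simp [hVy])) (by
      -- The new pointer at `X.own a` is not `a`. If it were one of those turned round, the twin of
      -- `a` would be the parent arc of `X.tgt a`, and `a` would have been processed.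
      rw [hcx, hcy, X.tw_tw a ha]
      intro hne heq
      by_cases hxy : X.own a ∈ Vy
      · obtain ⟨b, hb, hbx⟩ := List.mem_map.1 ((List.mem_cons.1 hxy).resolve_left hne)
        have h1 := r3 b hb
        rw [hbx] at h1
        have h2 : X.tw b = a := by omega
        obtain ⟨e1, e2, -⟩ := l4 b hb
        have h3 : X.tw a = b := by rw [← h2, X.tw_tw b e1]
        have h4 : par (X.tgt a) = b + 1 := by rw [tgt, h3, e2]
        have hyr : X.tgt a ≠ root := fun h' => by
          rw [h', h.par_root] at h4
          omega
        obtain ⟨p, p1, p2, p3, p4, p5, p6⟩ := h.parent _ (tgt_mem ha) ht hyr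
        obtain rfl : p = b := by omega
        rw [hbx, hv, h2] at p6
        rcases p6 with p6 | p6
        · omega
        · exact haD p6.2
      · have h1 := r1 _ hxy
        have h2 := (key _ (.inl (by simp [hVx] : X.own a ∈ Vx))).1
        apply hpar
        omega)
    (by rw [hcy, r2]; rfl)
  rw [hcx] at b2
  refine ⟨B, b1, b2, fun b hb => ?_, ?_, ?_⟩
  · have h1 := (b3 b hb).1
    have h2 := (key _ (b3 b hb).2).1
    omega
  · have hsub : B.map X.own ⊆ Vx ++ Vy := by
      intro v hv
      obtain ⟨b, hb, rfl⟩ := List.mem_map.1 hv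
      exact List.mem_append.2 (b3 b hb).2
    have h1 := (b1.nodup.subperm hsub).length_le
    have h2 := h.le_card
    have h3 : k.length ≤ Nat.log 2 X.A.card :=
      Nat.le_log_of_pow_le (by norm_num) (k2.trans ((hS5 _ (.inl (by simp [hVx]))).2.2.trans h2))
    have h4 : l.length ≤ Nat.log 2 X.A.card :=
      Nat.le_log_of_pow_le (by norm_num) (l2.trans ((hS5 _ (.inr (by simp [hVy]))).2.2.trans h2))
    simp only [List.length_map, List.length_append, hVx, hVy, List.length_cons] at h1
    omega
  · intro q
    obtain ⟨c, hc⟩ := k7 q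
    obtain ⟨d, hd⟩ := l7 q
    refine ⟨{X.tgt (par q - 1), c, d, X.own a, X.tgt a}, Finset.card_le_five.trans (by norm_num),
      fun g hg hgq hgC => ?_⟩
    have hgS : X.tgt g ∈ Vx ∨ X.tgt g ∈ Vy := by
      obtain ⟨b, hb, hbg⟩ := List.mem_map.1 (List.mem_toFinset.1 hgC)
      rw [← hbg]
      exact (b3 b hb).2
    obtain ⟨g1, g2, g3⟩ := hS5 _ hgS
    simp only [Finset.mem_insert, Finset.mem_singleton]
    by_cases hle : vis (X.tgt g) ≤ i
    · rcases h.done (X.tw g) (X.tw_mem g hg) g2 (.inl hle) with h1 | ⟨-, h1⟩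
      · change par (X.tgt g) = X.tw g + 1 at h1
        have h2 : X.tgt (X.tw g) = q := by rw [tgt_tw hg, hgq]
        rcases hgS with hgS | hgS
        · exact .inr (.inl (hc _ hgS _ h1 h2))
        · exact .inr (.inr (.inl (hd _ hgS _ h1 h2)))
      · rw [tgt_tw hg, hgq, X.tw_tw g hg] at h1
        left
        rw [h1]
        rfl
    · have h1 : X.tgt g = X.own a ∨ vis (X.tgt g) ≠ i + 1 := by
        by_cases h2 : vis (X.tgt g) = i + 1
        · exact .inl (h.inj g1 (X.own_mem a ha) g2 (h2.trans hv.symm))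
        · exact .inr h2
      rcases h1 with h1 | h1
      · exact .inr (.inr (.inr (.inl h1)))
      · rcases hgS with hgS | hgS
        · have := (k5 _ hgS).2.2.1
          omega
        · rcases List.mem_cons.1 hgS with h2 | h2
          · exact .inr (.inr (.inr (.inr h2)))
          · obtain ⟨b, hb, hbg⟩ := List.mem_map.1 h2
            have := (l4 b hb).2.2.2.2
            rw [hbg] at this
            omega

end ArcGraph

/-! ### The program for breadth first search. -/

namespace RAM

open ArcGraph

/-- Array 14 and register 5 describe a cycle of the current graph. -/
def HasCycle (s : Mem) (X : ArcGraph) (p : List ℕ → Prop) : Prop :=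
  ∃ B, X.IsArcCycle B ∧ (∀ b ∈ B.head?, X.own b = s.var 5) ∧
    (∀ b ∈ B, s.arr 14 (X.own b) = b + 1) ∧ p B

/-- Process the arcs at the vertex in register 20 in a breadth first search. -/
def visitProg : Prog :=
  Prog.each 37 7 (.get 6 (.var 20))
    (.ite (.eq (.var 9) (.const 0))
      (.ite (.eq (.get 9 (.pred (.var 37))) (.const 0))
        -- Only the parent arc itself is skipped; a parallel arc to the parent closes a cycle of
        -- length 2.
        (.ite (.eq (.get 14 (.var 20)) (.var 37)) .skip
          (.assign 38 (.get 4 (.get 8 (.pred (.var 37)))) ;;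
            .ite (.eq (.get 15 (.var 38)) (.const 0))
              (.store 16 (.var 36) (.var 38) ;; .assign 36 (.succ (.var 36)) ;;
                .store 15 (.var 38) (.var 36) ;;
                .store 14 (.var 38) (.succ (.get 8 (.pred (.var 37)))))
              (.assign 9 (.const 1) ;; .assign 39 (.var 37))))
        .skip)
      .skip)

/-- The arc in register 39 (plus 1) closes a cycle. -/
def Closes (s : Mem) (X : ArcGraph) (v : ℕ) : Prop :=
  ∃ root i e D a, X.Search root (s.arr 14) (s.arr 15) (s.arr 16) i e D ∧ a ∈ X.L ∧ X.own a = v ∧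
    s.arr 15 v = i + 1 ∧ a ∉ D ∧ s.arr 14 v ≠ a + 1 ∧ s.arr 15 (X.tgt a) ≠ 0 ∧ s.var 39 = a + 1

theorem Closes.congr {s s' : Mem} {X : ArcGraph} {v : ℕ} (h : Closes s X v)
    (h14 : s'.arr 14 = s.arr 14) (h15 : s'.arr 15 = s.arr 15) (h16 : s'.arr 16 = s.arr 16)
    (h39 : s'.var 39 = s.var 39) : Closes s' X v := by
  unfold Closes
  rw [h14, h15, h16, h39]
  exact h

theorem run_visit {s : Mem} {N : Net} {X : ArcGraph} {root i : ℕ} (hs : Static s N)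
    (hr : Rep s N X) (hS : X.Search root (s.arr 14) (s.arr 15) (s.arr 16) i (s.var 36) [])
    (h9 : s.var 9 = 0) (hv : s.var 20 ∈ X.A) (hvis : s.arr 15 (s.var 20) = i + 1)
    (hred : ¬ X.Red (s.var 20)) :
    Run visitProg s fun t s' =>
      (s'.var 9 = 0 ∧ X.Search root (s'.arr 14) (s'.arr 15) (s'.arr 16) (i + 1) (s'.var 36) [] ∨
        s'.var 9 ≠ 0 ∧ Closes s' X (s.var 20)) ∧
      (∀ u, s.arr 15 u ≠ 0 → s'.arr 15 u = s.arr 15 u) ∧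
      t ≤ 100 * (N.adj (s.var 20)).length + 100 := by
  have hvn := hr.A_lt _ hv
  unfold visitProg
  refine Run.eachBound 60 (l := N.adj (s.var 20))
    (fun r s₁ => ∃ d, N.adj (s.var 20) = d ++ r ∧
      (s₁.var 9 = 0 ∧ X.Search root (s₁.arr 14) (s₁.arr 15) (s₁.arr 16) i (s₁.var 36) d ∨
        s₁.var 9 ≠ 0 ∧ Closes s₁ X (s.var 20)) ∧
      (∀ u, s.arr 15 u ≠ 0 → s₁.arr 15 u = s.arr 15 u))
    rfl rfl (hs.list _ hvn) ?_ ?_ ?_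
  · exact ⟨[], rfl, .inl ⟨by simpa using h9, by simpa using hS⟩, fun u _ => rfl⟩
  · rintro a r s₁ ⟨d, hd, h1, h2⟩ hf hx -
    have hnd := N.adj_nodup _ hvn
    rw [hd] at hnd
    have had : a ∉ d := fun h => by
      rw [List.nodup_append] at hnd
      exact hnd.2.2 a h a (by simp) rfl
    have hac : a ∈ N.adj (s.var 20) := by rw [hd]; simp
    obtain ⟨ham, haown⟩ := (hr.mem_adj hvn).1 hac
    have hs₁ := hs.of_framed hf rfl rfl rfl rfl rfl
    have e8 : s₁.arr 8 = s.arr 8 := hf.arr 8 rfl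
    have e9 : s₁.arr 9 = s.arr 9 := hf.arr 9 rfl
    have e20 : s₁.var 20 = s.var 20 := hf.var 20 rfl
    have hvis₁ : s₁.arr 15 (s.var 20) = i + 1 := by rw [h2 _ (by omega), hvis]
    have hlive := hr.live a ham (by rw [← hr.own, haown]; exact hv)
    have hd' : N.adj (s.var 20) = (d ++ [a]) ++ r := by simp [hd]
    have hcl : Closes s₁ X (s.var 20) → Closes (s₁.setVar 37 (s.arr 7 a)) X (s.var 20) :=
      fun h => h.congr rfl rfl rfl (by simp)
    rw [run_ite]
    constructor
    · intro hb
      have hb : s₁.var 9 = 0 := by simpa using hb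
      have hS₁ := (h1.resolve_right fun h => h.1 hb).2
      rw [run_ite]
      constructor
      · intro hlv
        have haL : a ∈ X.L := hlive.1 (by simpa [hx, e9] using hlv)
        have htw : s₁.arr 8 a = X.tw a := by rw [e8, hr.tw a haL]
        have htgt : s₁.arr 4 (X.tw a) = X.tgt a := by rw [hs₁.own, ← hr.own]; rfl
        rw [run_ite]
        constructor
        · intro hp
          have hp : s₁.arr 14 (s.var 20) = a + 1 := by simpa [hx, e20] using hp
          rw [run_skip]
          refine ⟨⟨_, hd', .inl ⟨by simpa using hb, ?_⟩, h2⟩, by simp⟩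
          simpa using hS₁.skip fun _ => by rw [haown]; exact ⟨hvis₁, hp⟩
        · intro hp
          have hp : s₁.arr 14 (s.var 20) ≠ a + 1 := by simpa [hx, e20] using hp
          rw [run_seq, run_assign, run_ite]
          constructor
          · intro hw
            have hw : s₁.arr 15 (X.tgt a) = 0 := by simpa [hx, htw, htgt] using hw
            simp only [run_seq, run_assign, run_store]
            refine ⟨⟨_, hd', .inl ⟨by simpa using hb, ?_⟩, fun u hu => ?_⟩, by simp⟩
            · simpa [hx, htw, htgt] using hS₁.add haL (by rw [haown]; exact hvis₁) hw
            · have : u ≠ X.tgt a := by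
                rintro rfl
                rw [h2 _ hu] at hw
                exact hu hw
              simp [hx, htw, htgt, this, h2 u hu]
          · intro hw
            have hw : s₁.arr 15 (X.tgt a) ≠ 0 := by simpa [hx, htw, htgt] using hw
            simp only [run_seq, run_assign]
            refine ⟨⟨_, hd', .inr ⟨by simp, ?_⟩, fun u hu => by simpa using h2 u hu⟩, by simp⟩
            exact ⟨root, i, _, d, a, by simpa using hS₁, haL, haown, by simpa using hvis₁, had,
              by simpa using hp, by simpa using hw, by simp [hx]⟩
      · intro hlv
        have haL : a ∉ X.L := fun h => hlv (by simpa [hx, e9] using hlive.2 h)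
        rw [run_skip]
        refine ⟨⟨_, hd', .inl ⟨by simpa using hb, ?_⟩, h2⟩, by simp⟩
        simpa using hS₁.skip fun h => absurd h haL
    · intro hb
      have hb : s₁.var 9 ≠ 0 := by simpa using hb
      rw [run_skip]
      exact ⟨⟨_, hd', .inr ⟨by simpa using hb, hcl (h1.resolve_left fun h => hb h.1).2⟩, h2⟩,
        by simp⟩
  · rintro t s₁ ⟨d, hd, h1, h2⟩ hf ht
    rw [List.append_nil] at hd
    subst hd
    have h3 : s₁.arr 15 (s.var 20) = i + 1 := by rw [h2 _ (by omega), hvis]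
    refine ⟨h1.imp_left fun h => ⟨h.1, h.2.next h3 hv
      (fun a ha hav => (hr.mem_adj hvn).2 ⟨hr.L_lt a ha, hav⟩) hred (N.adj_nodup _ hvn)⟩, h2, ?_⟩
    · simp only [Expr.cost] at ht ⊢
      omega

/-- Turn round the pointers on the path to the root from the vertex in register 40, whose new
pointer is in register 41. -/
def rerootProg : Prog :=
  .assign 42 (.const 1) ;;
  .while (.lt (.const 0) (.var 42))
    (.assign 42 (.get 14 (.var 40)) ;; .store 14 (.var 40) (.var 41) ;;
      .ite (.eq (.var 42) (.const 0)) .skip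
        (.assign 41 (.succ (.get 8 (.pred (.var 42)))) ;;
          .assign 40 (.get 4 (.get 8 (.pred (.var 42))))))

theorem run_reroot {s : Mem} {N : Net} {X : ArcGraph} {l : List ℕ} (hs : Static s N)
    (hr : Rep s N X) (hl : LinkedList (fun a => s.arr 14 (X.tgt a)) (s.arr 14 (s.var 40)) l)
    (hnd : (s.var 40 :: l.map X.tgt).Nodup) (hL : ∀ b ∈ l, b ∈ X.L) :
    Run rerootProg s fun t s' => s'.arr 14 = X.reroot (s.arr 14) (s.var 40) (s.var 41) l ∧
      t ≤ 40 * l.length + 50 := by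
  unfold rerootProg
  rw [run_seq, run_assign]
  refine Run.while (φ := 40 * l.length + 40) (fun φ s₁ =>
    (s₁.var 42 = 0 ∧ φ = 0 ∧ s₁.arr 14 = X.reroot (s.arr 14) (s.var 40) (s.var 41) l) ∨
    s₁.var 42 ≠ 0 ∧ ∃ r, LinkedList (fun a => s₁.arr 14 (X.tgt a)) (s₁.arr 14 (s₁.var 40)) r ∧
      (s₁.var 40 :: r.map X.tgt).Nodup ∧ (∀ b ∈ r, b ∈ X.L) ∧ φ = 40 * r.length + 40 ∧
      X.reroot (s₁.arr 14) (s₁.var 40) (s₁.var 41) r =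
        X.reroot (s.arr 14) (s.var 40) (s.var 41) l) ?_ ?_ ?_
  · exact .inr ⟨by simp, l, by simpa using hl, by simpa using hnd, hL, rfl, by simp⟩
  · rintro φ s₁ h hf hb
    obtain ⟨-, r, hr₁, hnd₁, hL₁, rfl, h₁⟩ := h.resolve_left fun h => by simp [h.1] at hb
    have e8 : s₁.arr 8 = s.arr 8 := hf.arr 8 rfl
    have e4 : s₁.arr 4 = s.arr 4 := hf.arr 4 rfl
    simp only [run_seq, run_assign, run_store]
    match r, hr₁ with
    | [], hr₁ =>
      have hr₁ : s₁.arr 14 (s₁.var 40) = 0 := hr₁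
      rw [run_ite]
      constructor
      · intro _
        rw [run_skip]
        refine ⟨0, .inl ⟨by simp [hr₁], rfl, ?_⟩, by simp⟩
        rw [← h₁]
        simp [reroot]
      · intro h
        simp [hr₁] at h
    | b :: r, hr₁ =>
      obtain ⟨h2, h3⟩ : s₁.arr 14 (s₁.var 40) = b + 1 ∧
        LinkedList (fun a => s₁.arr 14 (X.tgt a)) (s₁.arr 14 (X.tgt b)) r := hr₁
      rw [List.map_cons, List.nodup_cons] at hnd₁
      have htw : s₁.arr 8 b = X.tw b := by rw [e8, hr.tw b (hL₁ b (by simp))]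
      have htgt : s₁.arr 4 (X.tw b) = X.tgt b := by rw [e4, hs.own, ← hr.own]; rfl
      rw [run_ite]
      constructor
      · intro h
        simp [h2] at h
      · intro _
        have hne : ∀ b' ∈ b :: r, X.tgt b' ≠ s₁.var 40 := fun b' hb' h => by
          refine hnd₁.1 ?_
          rw [← h, ← List.map_cons (f := X.tgt)]
          exact List.mem_map_of_mem hb'
        simp only [run_seq, run_assign]
        refine ⟨_, .inr ⟨by simp [h2], r, ?_, ?_, fun b' hb' => hL₁ b' (by simp [hb']), rfl, ?_⟩, ?_⟩
        · have hll : ∀ (r : List ℕ) (e : ℕ), (∀ b' ∈ r, X.tgt b' ≠ s₁.var 40) →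
              LinkedList (fun a => s₁.arr 14 (X.tgt a)) e r →
              LinkedList (fun a => Function.update (s₁.arr 14) (s₁.var 40) (s₁.var 41) (X.tgt a)) e
                r := by
            intro r
            induction r with
            | nil => exact fun e _ h => h
            | cons c r ih =>
              intro e hne h
              refine ⟨h.1, ?_⟩
              show LinkedList _ (Function.update (s₁.arr 14) (s₁.var 40) (s₁.var 41) (X.tgt c)) r
              rw [Function.update_of_ne (hne c (by simp))]
              exact ih _ (fun b' hb' => hne b' (by simp [hb'])) h.2
          have h4 := hll r _ (fun b' hb' => hne b' (by simp [hb'])) h3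
          simpa [h2, htw, htgt, hne b (by simp)] using h4
        · simpa [h2, htw, htgt] using hnd₁.2
        · rw [← h₁]
          simp [reroot, h2, htw, htgt]
        · simp
          omega
  · rintro t φ s₁ h hf hb ht
    obtain ⟨-, rfl, h₁⟩ := h.resolve_right fun h => h.1 (by simpa using hb)
    refine ⟨h₁, ?_⟩
    simp at ht ⊢
    omega

/-- Find a short cycle by breadth first search. -/
def bfsProg : Prog :=
  .assign 9 (.const 0) ;; .assign 33 (.const 0) ;; .assign 34 (.const 0) ;;
  Prog.for 33 0 (.ite (.eq (.get 10 (.var 33)) (.const 0)) .skip (.assign 34 (.succ (.var 33)))) ;;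
  .ite (.eq (.var 34) (.const 0)) .skip (
    -- The pointers in array 14 need no reset, as they are read at visited vertices only.
    fill 33 0 15 0 ;; .assign 34 (.pred (.var 34)) ;;
    .store 14 (.var 34) (.const 0) ;; .store 15 (.var 34) (.const 1) ;;
    .store 16 (.const 0) (.var 34) ;; .assign 35 (.const 0) ;; .assign 36 (.const 1) ;;
    .while (.eq (.var 9) (.const 0))
      (.assign 20 (.get 16 (.var 35)) ;; visitProg ;; .assign 35 (.succ (.var 35))) ;;
    .assign 5 (.var 20) ;; .assign 40 (.get 4 (.get 8 (.pred (.var 39)))) ;;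
    .assign 41 (.succ (.get 8 (.pred (.var 39)))) ;; rerootProg)

theorem run_bfs {s : Mem} {N : Net} {X : ArcGraph} (hs : Static s N) (hr : Rep s N X)
    (hred : ∀ v, ¬ X.Red v) :
    Run bfsProg s fun t s' => (s'.var 9 = 0 ∧ X.A = ∅ ∨ s'.var 9 ≠ 0 ∧ HasCycle s' X fun B =>
      B.length ≤ 2 * Nat.log 2 N.n + 2 ∧ X.Thin (B.map X.own).toFinset) ∧
      t ≤ 500 * (N.n + N.m) + 500 := by
  have hcard : X.A.card ≤ N.n := by
    rw [← Finset.card_range N.n]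
    exact Finset.card_le_card fun v hv => Finset.mem_range.2 (hr.A_lt v hv)
  unfold bfsProg
  simp only [run_seq, run_assign]
  refine Run.forBound 20 (N := N.n) (fun i s₁ => (s₁.var 34 = 0 → ∀ v < i, v ∉ X.A) ∧
    (s₁.var 34 ≠ 0 → s₁.var 34 - 1 ∈ X.A)) rfl rfl (by decide) (by simpa using hs.n) (by simp)
    (by simp) ?_ ?_
  · rintro i s₁ ⟨h1, h2⟩ hf hx hi
    have e10 : s₁.arr 10 = s.arr 10 := hf.arr 10 rfl
    have hal := hr.alive i hi
    rw [run_ite]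
    constructor
    · intro hb
      have hb : i ∉ X.A := fun h => hal.2 h (by simpa [hx, e10] using hb)
      rw [run_skip]
      refine ⟨⟨fun h0 v hv => ?_, by simpa using h2⟩, by simp⟩
      rcases Nat.lt_succ_iff_lt_or_eq.1 hv with hv | rfl
      · exact h1 (by simpa using h0) v hv
      · exact hb
    · intro hb
      have hb : i ∈ X.A := hal.1 (by simpa [hx, e10] using hb)
      rw [run_assign]
      exact ⟨⟨by simp, by simp [hx, hb]⟩, by simp⟩
  · rintro t₁ s₁ ⟨h1, h2⟩ hf hx ht₁
    have e9 : s₁.var 9 = 0 := by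
      rw [hf.var 9 rfl]
      simp
    rw [run_ite]
    constructor
    · intro hb
      rw [run_skip]
      refine ⟨.inl ⟨e9, Finset.eq_empty_of_forall_notMem fun v hv =>
        h1 (by simpa using hb) v (hr.A_lt v hv) hv⟩, ?_⟩
      simp
      omega
    · intro hb
      have hroot := h2 (by simpa using hb)
      have hs₁ : Static s₁ N := by
        refine Static.of_framed ?_ hf rfl rfl rfl rfl rfl
        exact ⟨by simpa using hs.n, hs.own, hs.otw, hs.list⟩
      have hr₁ : Rep s₁ N X := hr.congr (hf.arr 8 rfl) (hf.arr 9 rfl) (hf.arr 10 rfl) (hf.arr 11 rfl)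
      simp only [run_seq, run_assign, run_store]
      refine (run_fill (by decide) s₁).mono fun t₂ s₂ hf₂ h => ?_
      obtain ⟨ht₂, h15⟩ := h
      have hs₂ := hs₁.of_framed hf₂ rfl rfl rfl rfl rfl
      have hr₂ : Rep s₂ N X :=
        hr₁.congr (hf₂.arr 8 rfl) (hf₂.arr 9 rfl) (hf₂.arr 10 rfl) (hf₂.arr 11 rfl)
      have e34 : s₂.var 34 = s₁.var 34 := hf₂.var 34 rfl
      set root := s₁.var 34 - 1 with hrt
      -- The potential sums over the vertices that have not been processed yet, so the whole search
      -- is linear.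
      refine Run.while (φ := reducePot N X.A) (fun φ s₃ => Static s₃ N ∧ Rep s₃ N X ∧
        ((s₃.var 9 = 0 ∧
          X.Search root (s₃.arr 14) (s₃.arr 15) (s₃.arr 16) (s₃.var 35) (s₃.var 36) [] ∧
          reducePot N (X.A.filter fun v => ¬ (s₃.arr 15 v ≠ 0 ∧ s₃.arr 15 v ≤ s₃.var 35)) ≤ φ) ∨
        s₃.var 9 ≠ 0 ∧ Closes s₃ X (s₃.var 20) ∧ φ = 0)) ?_ ?_ ?_
      · refine ⟨⟨by simpa using hs₂.n, hs₂.own, hs₂.otw, hs₂.list⟩, hr₂.congr rfl rfl rfl rfl,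
          .inl ⟨?_, ?_, Finset.sum_le_sum_of_subset (Finset.filter_subset _ _)⟩⟩
        · simpa using (hf₂.var 9 rfl).trans e9
        · simp only [setVar_arr, setArr_arr, setArr_var, setVar_var, Expr.eval, e34, Nat.reduceEqDiff,
            if_true, if_false, ← hrt]
          refine Search.init hroot (by simp) (fun v hv => ?_) (by simp)
          rw [Function.update_apply, h15 v, hs₁.n, if_pos (hr.A_lt v hv)]
      · rintro φ s₃ ⟨hs₃, hr₃, h⟩ hf₃ hb
        have hb9 : s₃.var 9 = 0 := by simpa using hb
        obtain ⟨-, hS, hφ⟩ := h.resolve_right fun h => h.1 hb9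
        have hc := hS.count
        -- Since more than `2 * i` vertices have been found when `i` are processed, the queue never
        -- runs empty: the search can only end by closing a cycle.
        obtain ⟨hvA, hvis⟩ := hS.queue (s₃.var 35) (by simp at hc; omega)
        set v := s₃.arr 16 (s₃.var 35) with hvdef
        have hpot := reducePot_erase N (A := X.A.filter fun v =>
          ¬ (s₃.arr 15 v ≠ 0 ∧ s₃.arr 15 v ≤ s₃.var 35)) (v := v)
          (Finset.mem_filter.2 ⟨hvA, by omega⟩)
        simp only [run_seq, run_assign]
        refine (run_visit (N := N) (X := X) (root := root) (i := s₃.var 35) ?_ ?_ ?_ ?_ ?_ ?_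
          ?_).mono fun t₄ s₄ hf₄ h => ?_
        · exact ⟨by simpa using hs₃.n, hs₃.own, hs₃.otw, hs₃.list⟩
        · exact hr₃.congr rfl rfl rfl rfl
        · simpa using hS
        · simpa using hb9
        · simpa using hvA
        · simpa using hvis
        · exact hred _
        obtain ⟨h1, h2, ht₄⟩ := h
        have hs₄ : Static s₄ N := by
          refine Static.of_framed ?_ hf₄ rfl rfl rfl rfl rfl
          exact ⟨by simpa using hs₃.n, hs₃.own, hs₃.otw, hs₃.list⟩
        have hr₄ : Rep s₄ N X := hr₃.congr (hf₄.arr 8 rfl) (hf₄.arr 9 rfl) (hf₄.arr 10 rfl)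
          (hf₄.arr 11 rfl)
        have e35 : s₄.var 35 = s₃.var 35 := by
          rw [hf₄.var 35 rfl]
          simp
        have e20 : s₄.var 20 = v := by
          rw [hf₄.var 20 rfl]
          simp [hvdef]
        have ht₄' : t₄ ≤ 100 * (N.adj v).length + 100 := by simpa using ht₄
        rcases h1 with ⟨h9, hS'⟩ | ⟨h9, hcl⟩
        · refine ⟨_, ⟨⟨by simpa using hs₄.n, hs₄.own, hs₄.otw, hs₄.list⟩,
            hr₄.congr rfl rfl rfl rfl, .inl ⟨by simpa using h9, by simpa [e35] using hS', le_rfl⟩⟩, ?_⟩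
          have hsub : (X.A.filter fun u => ¬ (s₄.arr 15 u ≠ 0 ∧ s₄.arr 15 u ≤ s₃.var 35 + 1)) ⊆
              (X.A.filter fun u => ¬ (s₃.arr 15 u ≠ 0 ∧ s₃.arr 15 u ≤ s₃.var 35)).erase v := by
            intro u hu
            rw [Finset.mem_filter] at hu
            rw [Finset.mem_erase, Finset.mem_filter]
            refine ⟨?_, hu.1, fun h => hu.2 ?_⟩
            · rintro rfl
              refine hu.2 ?_
              rw [h2 v (by simp [hvis]), setVar_arr, hvis]
              omega
            · rw [h2 u (by simpa using h.1), setVar_arr]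
              omega
          have hle : reducePot N (X.A.filter fun u =>
              ¬ (s₄.arr 15 u ≠ 0 ∧ s₄.arr 15 u ≤ s₃.var 35 + 1)) ≤ _ :=
            Finset.sum_le_sum_of_subset hsub
          simp only [setVar_var, setVar_arr, Expr.eval, e35, if_true, Test.cost, Expr.cost]
          change _ ≤ reducePot N _ at hle
          omega
        · refine ⟨0, ⟨⟨by simpa using hs₄.n, hs₄.own, hs₄.otw, hs₄.list⟩,
            hr₄.congr rfl rfl rfl rfl, .inr ⟨by simpa using h9, ?_, rfl⟩⟩, ?_⟩
          · have : Closes s₄ X v := by simpa using hcl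
            simpa [e20, e35] using this.congr (s' := s₄.setVar 35 (s₃.var 35 + 1)) rfl rfl rfl (by simp)
          · simp only [Test.cost, Expr.cost]
            omega
      · rintro t₃ φ s₃ ⟨hs₃, hr₃, h⟩ hf₃ hb ht₃
        have hb9 : s₃.var 9 ≠ 0 := by simpa using hb
        obtain ⟨-, ⟨root, i, e, D, a, hS, haL, hav, hvis, haD, hpar, hvt, h39⟩, rfl⟩ :=
          h.resolve_left fun h => hb9 h.1
        rw [← hav] at hvis hpar
        obtain ⟨l, hl, hnd, hlL, B, hB, hB1, hB2, hB3, hB4⟩ := hS.exists_cycle haL hvis haD hpar hvt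
        have htw : s₃.arr 8 a = X.tw a := hr₃.tw a haL
        have htgt : s₃.arr 4 (X.tw a) = X.tgt a := by rw [hs₃.own, ← hr₃.own]; rfl
        refine (run_reroot (N := N) (X := X) (l := l) ?_ ?_ ?_ ?_ hlL).mono fun t₄ s₄ hf₄ h => ?_
        · exact ⟨by simpa using hs₃.n, hs₃.own, hs₃.otw, hs₃.list⟩
        · exact hr₃.congr rfl rfl rfl rfl
        · simpa [h39, htw, htgt] using hl
        · simpa [h39, htw, htgt] using hnd
        obtain ⟨h14, ht₄⟩ := h
        refine ⟨.inr ⟨?_, B, hB, fun b hb => ?_, fun b hb => ?_, hB3.trans ?_, hB4⟩, ?_⟩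
        · rw [hf₄.var 9 rfl]
          simpa using hb9
        · rw [hf₄.var 5 rfl, hB1 b hb, hav]
          simp
        · rw [h14, ← hB2 b hb]
          simp [h39, htw, htgt]
        · have := Nat.log_mono_right (b := 2) hcard
          omega
        · have h1 : l.length + 1 ≤ N.n := by
            have hsub : (X.tgt a :: l.map X.tgt) ⊆ List.range N.n := by
              intro v hv
              rw [List.mem_range]
              rcases List.mem_cons.1 hv with rfl | hv
              · exact hr.A_lt _ (tgt_mem haL)
              · obtain ⟨b, hb, rfl⟩ := List.mem_map.1 hv
                exact hr.A_lt _ (tgt_mem (hlL b hb))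
            simpa using (hnd.subperm hsub).length_le
          have h2 : reducePot N X.A ≤ 100 * N.m + 200 * N.n := reducePot_le hr
          have h3 : t₃ ≤ reducePot N X.A + 3 := by simpa using ht₃
          have h4 : t₂ ≤ 9 * N.n + 5 := hs₁.n ▸ ht₂
          simp only [Test.cost, Expr.cost]
          have h5 : t₁ + t₂ + t₃ + t₄ + 100 ≤ 500 * (N.n + N.m) + 500 := by
            have h6 : t₁ ≤ (20 + 6) * N.n + 3 := ht₁
            have h7 : t₄ ≤ 40 * l.length + 50 := ht₄
            clear ht₁ ht₄ ht₂ ht₃ hpar hvt hvis h39 h15 hl hrt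
            omega
          refine le_trans ?_ h5
          clear * -
          omega

end RAM

/-! ### Edge sets without short cycles, and the girth. -/

namespace ArcGraph

variable {X : ArcGraph}

/-- If the twin of `b` were in the list, it would start where the successor of `b` starts, and thus
be that successor. It therefore suffices to exclude immediate returns, a condition that can be
checked on explicit short lists. -/
theorem isArcCycle_of {B : List ℕ} (hne : B ≠ []) (hL : ∀ b ∈ B, b ∈ X.L)
    (hch : ∀ b ∈ B.head?, (B ++ [b]).IsChain fun x y => X.tgt x = X.own y ∧ X.tw x ≠ y)
    (hn : (B.map X.own).Nodup) : X.IsArcCycle B := by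
  refine ⟨hL, fun b hb => (hch b hb).imp fun _ _ h => h.1, hne, hn, fun b hb htb => ?_⟩
  obtain ⟨h0, hh⟩ : ∃ h0, B.head? = some h0 := by
    cases B with
    | nil => exact absurd rfl hne
    | cons a B => exact ⟨a, rfl⟩
  have hc := hch h0 hh
  have hh0 : h0 ∈ B := List.mem_of_head? hh
  obtain ⟨d, r, hdr⟩ := List.append_of_mem hb
  obtain ⟨c, r', hcr⟩ : ∃ c r', r ++ [h0] = c :: r' := by
    cases r with
    | nil => exact ⟨h0, [], rfl⟩
    | cons c r => exact ⟨c, r ++ [h0], rfl⟩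
  have hcB : c ∈ B := by
    have : c ∈ r ++ [h0] := by rw [hcr]; simp
    rcases List.mem_append.1 this with h | h
    · rw [hdr]
      simp [h]
    · rw [List.mem_singleton.1 h]
      exact hh0
  have e : B ++ [h0] = d ++ b :: c :: r' := by
    rw [← hcr, hdr]
    simp
  rw [e] at hc
  have h2 := (List.isChain_append.1 hc).2.1
  rw [List.isChain_cons_cons] at h2
  exact h2.1.2 (List.inj_on_of_nodup_map hn htb hcB h2.1.1)

/-- The arc or its twin is in the list. -/
def InT (X : ArcGraph) (T : List ℕ) (a : ℕ) : Prop := a ∈ T ∨ X.tw a ∈ T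

theorem InT.tw {T : List ℕ} {a : ℕ} (ha : a ∈ X.L) (h : X.InT T a) : X.InT T (X.tw a) := by
  rcases h with h | h
  · exact .inr (by rwa [X.tw_tw a ha])
  · exact .inl h

theorem InT.append {T : List ℕ} {a : ℕ} (h : X.InT T a) (T' : List ℕ) : X.InT (T ++ T') a :=
  h.imp (fun h => by simp [h]) fun h => by simp [h]

/-- The edges in `T` do not form a cycle of length at most `g`. -/
def NoShort (X : ArcGraph) (T : List ℕ) (g : ℕ) : Prop :=
  ∀ B, X.IsArcCycle B → (∀ b ∈ B, X.InT T b) → g < B.length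

/-- A walk from `x` to `y`. -/
def IsArcWalk (X : ArcGraph) : ℕ → List ℕ → ℕ → Prop
  | x, [], y => x = y
  | x, b :: B, y => X.own b = x ∧ IsArcWalk X (X.tgt b) B y

theorem IsArcWalk.append {x y z : ℕ} {B B' : List ℕ} (h : X.IsArcWalk x B y)
    (h' : X.IsArcWalk y B' z) : X.IsArcWalk x (B ++ B') z := by
  induction B generalizing x with
  | nil =>
    obtain rfl : x = y := h
    exact h'
  | cons b B ih => exact ⟨h.1, ih h.2⟩

theorem isArcWalk_of_isChain {B : List ℕ} {c : ℕ}
    (h : (B ++ [c]).IsChain fun x y => X.tgt x = X.own y) :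
    ∀ b ∈ (B ++ [c]).head?, X.IsArcWalk (X.own b) B (X.own c) := by
  induction B with
  | nil => simp [IsArcWalk]
  | cons a B ih =>
    intro b hb
    obtain rfl : a = b := by simpa using hb
    rw [List.cons_append, List.isChain_cons] at h
    refine ⟨rfl, ?_⟩
    obtain ⟨b', hb'⟩ : ∃ b', (B ++ [c]).head? = some b' := by cases B <;> simp
    have := ih h.2 b' hb'
    rwa [h.1 b' hb']

/-- The distances from some vertex along the edges in `T`. -/
def IsDist (X : ArcGraph) (T : List ℕ) (dist : ℕ → ℕ) : Prop :=
  ∀ a ∈ X.L, X.InT T a → dist (X.own a) ≠ 0 →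
    dist (X.tgt a) ≠ 0 ∧ dist (X.tgt a) ≤ dist (X.own a) + 1

/-- Only this one-sided estimate is needed to exclude short cycles; the stored numbers need not be
shown to be exact distances. -/
theorem IsDist.walk {T : List ℕ} {dist : ℕ → ℕ} (h : X.IsDist T dist) {x y : ℕ} {B : List ℕ}
    (hB : X.IsArcWalk x B y) (hL : ∀ b ∈ B, b ∈ X.L ∧ X.InT T b) (hx : dist x ≠ 0) :
    dist y ≠ 0 ∧ dist y ≤ dist x + B.length := by
  induction B generalizing x with
  | nil =>
    obtain rfl : x = y := hB
    exact ⟨hx, by simp⟩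
  | cons b B ih =>
    obtain ⟨rfl, hB⟩ := hB
    obtain ⟨h1, h2⟩ := hL b (by simp)
    obtain ⟨h3, h4⟩ := h b h1 h2 hx
    obtain ⟨h5, h6⟩ := ih hB (fun b' hb' => hL b' (by simp [hb'])) h3
    refine ⟨h5, ?_⟩
    simp only [List.length_cons]
    omega

theorem IsDist.walk_back {T : List ℕ} {dist : ℕ → ℕ} (h : X.IsDist T dist) {x y : ℕ} {B : List ℕ}
    (hB : X.IsArcWalk x B y) (hL : ∀ b ∈ B, b ∈ X.L ∧ X.InT T b) (hy : dist y ≠ 0) :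
    dist x ≠ 0 ∧ dist x ≤ dist y + B.length := by
  induction B generalizing x with
  | nil =>
    obtain rfl : x = y := hB
    exact ⟨hy, by simp⟩
  | cons b B ih =>
    obtain ⟨rfl, hB⟩ := hB
    obtain ⟨h1, h2⟩ := hL b (by simp)
    obtain ⟨h5, h6⟩ := ih hB (fun b' hb' => hL b' (by simp [hb']))
    obtain ⟨h3, h4⟩ := h (X.tw b) (X.tw_mem b h1) (h2.tw h1) h5
    rw [tgt_tw h1] at h3 h4
    change _ ≤ dist (X.tgt b) + 1 at h4
    refine ⟨h3, ?_⟩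
    simp only [List.length_cons]
    omega

/-- A cycle through the new edge consists of it and a walk in `T` between its ends. As the stored
distance starts at 1, not at 0, that walk has at least `g` arcs. -/
theorem NoShort.add {T : List ℕ} {g : ℕ} (h : X.NoShort T g) {p : ℕ} {dist : ℕ → ℕ}
    (hd : X.IsDist T dist) (hp : dist (X.own p) = 1)
    (hq : dist (X.tgt p) = 0 ∨ g < dist (X.tgt p)) (hpL : p ∈ X.L) : X.NoShort (T ++ [p]) g := by
  intro B hB hBT
  by_cases hall : ∀ b ∈ B, X.InT T b
  · exact h B hB hall
  push Not at hall
  obtain ⟨b, hb, hbT⟩ := hall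
  have hbp : b = p ∨ b = X.tw p := by
    rcases hBT b hb with h1 | h1
    · rw [List.mem_append, List.mem_singleton] at h1
      rcases h1 with h1 | h1
      · exact absurd (.inl h1) hbT
      · exact .inl h1
    · rw [List.mem_append, List.mem_singleton] at h1
      rcases h1 with h1 | h1
      · exact absurd (.inr h1) hbT
      · exact .inr (by rw [← h1, X.tw_tw b (hB.mem b hb)])
  obtain ⟨d, r, rfl⟩ := List.append_of_mem hb
  have hrest : ∀ c ∈ r ++ d, c ∈ X.L ∧ X.InT T c := by
    intro c hc
    have hcB : c ∈ d ++ b :: r := by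
      simp only [List.mem_append, List.mem_cons] at hc ⊢
      tauto
    refine ⟨hB.mem c hcB, ?_⟩
    have hne : c ≠ b := by
      rintro rfl
      have h1 := hB.nodup.of_map
      rw [List.nodup_append, List.nodup_cons] at h1
      rcases List.mem_append.1 hc with hc | hc
      · exact h1.2.1.1 hc
      · exact h1.2.2 c hc c (by simp) rfl
    have hne' : c ≠ X.tw b := by
      rintro rfl
      exact hB.tw_notMem b hb hcB
    have h1 := hBT c hcB
    have hcp : c ≠ p ∧ X.tw c ≠ p := by
      rcases hbp with rfl | rfl
      · exact ⟨hne, fun h => hne' (by rw [← h, X.tw_tw c (hB.mem c hcB)])⟩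
      · rw [X.tw_tw p hpL] at hne'
        exact ⟨hne', fun h => hne (by rw [← h, X.tw_tw c (hB.mem c hcB)])⟩
    rcases h1 with h1 | h1
    · rw [List.mem_append, List.mem_singleton] at h1
      exact .inl (h1.resolve_right hcp.1)
    · rw [List.mem_append, List.mem_singleton] at h1
      exact .inr (h1.resolve_right hcp.2)
  have hwalk : X.IsArcWalk (X.tgt b) (r ++ d) (X.own b) := by
    obtain ⟨h0, hh⟩ : ∃ h0, (d ++ b :: r).head? = some h0 := by cases d <;> simp
    have hc := hB.chain h0 hh
    rw [List.append_assoc] at hc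
    have h1 := (List.isChain_append.1 hc).2.1
    rw [List.cons_append, List.isChain_cons] at h1
    have h2 : X.IsArcWalk (X.tgt b) r (X.own h0) := by
      obtain ⟨b', hb'⟩ : ∃ b', (r ++ [h0]).head? = some b' := by cases r <;> simp
      rw [h1.1 b' hb']
      exact isArcWalk_of_isChain h1.2 b' hb'
    refine h2.append ?_
    have h3 : (d ++ [b]).IsChain fun x y => X.tgt x = X.own y := by
      have : d ++ (b :: r ++ [h0]) = (d ++ [b]) ++ (r ++ [h0]) := by simp
      rw [this] at hc
      exact (List.isChain_append.1 hc).1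
    refine isArcWalk_of_isChain h3 h0 ?_
    cases d <;> simpa using hh
  have hlen : (d ++ b :: r).length = (r ++ d).length + 1 := by
    simp
    omega
  rcases hbp with rfl | rfl
  · have := hd.walk_back hwalk hrest (by omega)
    omega
  · rw [tgt_tw hpL] at hwalk
    have := hd.walk hwalk hrest (by omega)
    change dist (X.tgt p) ≠ 0 ∧ dist (X.tgt p) ≤ _ at this
    omega

theorem exists_arcs {V : List ℕ} {z : ℕ}
    (h : (V ++ [z]).IsChain fun a b => 1 ≤ X.mg.mult s(a, b)) :
    ∃ B, B.map X.own = V ∧ (∀ b ∈ B, b ∈ X.L) ∧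
      ∀ c, X.own c = z → (B ++ [c]).IsChain fun x y => X.tgt x = X.own y := by
  induction V with
  | nil => exact ⟨[], rfl, by simp, by simp⟩
  | cons v V ih =>
    rw [List.cons_append, List.isChain_cons] at h
    obtain ⟨B, h1, h2, h3⟩ := ih h.2
    obtain ⟨w, hw⟩ : ∃ w, (V ++ [z]).head? = some w := by cases V <;> simp
    have h4 := h.1 w hw
    obtain ⟨a, ha, hav, haw⟩ := exists_arc (X := X) (u := v) (v := w) (by omega)
    refine ⟨a :: B, by simp [hav, h1], fun b hb => ?_, fun c hc => ?_⟩
    · rcases List.mem_cons.1 hb with rfl | hb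
      · exact ha
      · exact h2 b hb
    · rw [List.cons_append, List.isChain_cons]
      refine ⟨fun y hy => ?_, h3 c hc⟩
      cases B with
      | nil =>
        obtain rfl : c = y := by simpa using hy
        subst h1
        obtain rfl : z = w := by simpa using hw
        rw [haw, hc]
      | cons b B =>
        obtain rfl : b = y := by simpa using hy
        subst h1
        have : X.own b = w := by simpa using hw
        rw [haw, this]

theorem forall_of_isChain {R : ℕ → ℕ → Prop} {P : ℕ → Prop} {l : List ℕ} (hl : l.IsChain R)
    (hP : ∀ x ∈ l, ∀ y ∈ l, R x y → P x → P y) (h : ∀ x ∈ l.head?, P x) : ∀ x ∈ l, P x := by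
  induction l with
  | nil => simp
  | cons a l ih =>
    rw [List.isChain_cons] at hl
    intro x hx
    rcases List.mem_cons.1 hx with rfl | hx
    · exact h x (by simp)
    · refine ih hl.2 (fun x hx y hy => hP x (by simp [hx]) y (by simp [hy])) (fun y hy => ?_) x hx
      exact hP a (by simp) y (List.mem_cons_of_mem _ (List.mem_of_head? hy)) (hl.1 y hy)
        (h a (by simp))

/-- If an arc and its twin were both present, each would have to follow the other, as vertices are
distinct; the whole closed list would then consist of these two arcs. -/
theorem isArcCycle_of_three {B : List ℕ} (hL : ∀ b ∈ B, b ∈ X.L)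
    (hch : ∀ b ∈ B.head?, (B ++ [b]).IsChain fun x y => X.tgt x = X.own y)
    (hn : (B.map X.own).Nodup) (h3 : 3 ≤ B.length) : X.IsArcCycle B := by
  have hne : B ≠ [] := by
    rintro rfl
    simp at h3
  refine ⟨hL, hch, hne, hn, fun b hb htb => ?_⟩
  obtain ⟨h0, hh⟩ : ∃ h0, B.head? = some h0 := by
    cases B with
    | nil => exact absurd rfl hne
    | cons a B => exact ⟨a, rfl⟩
  have hc := hch h0 hh
  have hh0 : h0 ∈ B := List.mem_of_head? hh
  have hmem : ∀ x ∈ B ++ [h0], x ∈ B := by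
    intro x hx
    rcases List.mem_append.1 hx with hx | hx
    · exact hx
    · rwa [List.mem_singleton.1 hx]
  have hinj := List.inj_on_of_nodup_map hn
  have hP : ∀ x ∈ B, ∀ y ∈ B, X.tgt x = X.own y → x = b ∨ x = X.tw b → y = b ∨ y = X.tw b := by
    rintro x hx y hy hxy (rfl | rfl)
    · exact .inr (hinj hy htb hxy.symm)
    · rw [tgt_tw (hL b hb)] at hxy
      exact .inl (hinj hy hb hxy.symm)
  obtain ⟨d, r, hdr⟩ := List.append_of_mem hb
  have h1 : ∀ x ∈ b :: (r ++ [h0]), x = b ∨ x = X.tw b := by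
    have e : B ++ [h0] = d ++ (b :: (r ++ [h0])) := by rw [hdr]; simp
    refine forall_of_isChain (R := fun x y => X.tgt x = X.own y) ?_ (fun x hx y hy => ?_) (by simp)
    · rw [e] at hc
      exact (List.isChain_append.1 hc).2.1
    · refine hP x (hmem x ?_) y (hmem y ?_)
      · rw [e]
        exact List.mem_append_right _ hx
      · rw [e]
        exact List.mem_append_right _ hy
  have h2 : ∀ x ∈ B ++ [h0], x = b ∨ x = X.tw b := by
    refine forall_of_isChain hc (fun x hx y hy => hP x (hmem x hx) y (hmem y hy)) fun x hx => ?_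
    have : h0 = x := by
      cases B with
      | nil => simp at hb
      | cons a B => simp_all
    rw [← this]
    exact h1 h0 (by simp)
  have hsub : B ⊆ [b, X.tw b] := fun x hx => by simpa using h2 x (by simp [hx])
  have := (hn.of_map.subperm hsub).length_le
  simp at this
  omega

theorem girth_gt {g : ℕ} (h : ∀ B, X.IsArcCycle B → g < B.length) : (g : ℕ∞) < X.mg.girth := by
  have key : ∀ c, X.mg.IsCycle c → g < c.length := by
    intro c hc
    match c, hc with
    | [v], hc =>
      have hc : 1 ≤ X.mg.mult s(v, v) := hc
      obtain ⟨a, ha, h1, h2⟩ := exists_arc (X := X) (u := v) (v := v) (by omega)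
      refine h [a] (isArcCycle_of (by simp) (by simpa using ha) ?_ (by simp))
      simp [h1, h2, X.tw_ne a ha]
    | [u, v], hc =>
      obtain ⟨huv, hc⟩ := hc
      obtain ⟨a, ha, b, hb, hab, h1, h2, h3, h4⟩ := exists_two_arcs hc
      -- The second arc is reversed, so that the two arcs form a closed walk.
      refine h [a, X.tw b] (isArcCycle_of (by simp) ?_ ?_ ?_)
      · simp [ha, X.tw_mem b hb]
      · have h5 : X.own (X.tw b) = v := h4
        have h6 : X.tw a ≠ X.tw b := fun h => hab (tw_inj ha hb h)
        have h7 : b ≠ a := hab.symm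
        simp [h1, h2, h5, h6, tgt_tw hb, h3, X.tw_tw b hb, h7]
      · have h5 : X.own (X.tw b) = v := h4
        simp [h1, h5, huv]
    | u :: v :: w :: l, hc =>
      obtain ⟨hn, hch⟩ := hc
      obtain ⟨B, h1, h2, h3⟩ := exists_arcs (X := X) (V := u :: v :: w :: l) (z := u) hch
      rw [← h1, List.length_map]
      refine h B (isArcCycle_of_three h2 (fun b hb => h3 b ?_) (by rw [h1]; exact hn) ?_)
      · cases B with
        | nil => simp at hb
        | cons a B =>
          obtain rfl : a = b := by simpa using hb
          simp only [List.map_cons, List.cons.injEq] at h1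
          exact h1.1
      · rw [← List.length_map (f := X.own), h1]
        simp
  have : ((g + 1 : ℕ) : ℕ∞) ≤ X.mg.girth :=
    le_iInf₂ fun c hc => by exact_mod_cast key c hc
  exact lt_of_lt_of_le (by exact_mod_cast Nat.lt_succ_self g) this

/-- Girth above 2 means that there are no loops or multiple edges. Any step is then an elimination,
which needs a vertex of degree at most 2. -/
theorem not_reduceStep {g : ℕ} (hg : 2 ≤ g) (h : ∀ B, X.IsArcCycle B → g < B.length)
    (hred : ∀ v, ¬ X.Red v) (K : Multigraph ℕ) : ¬ Multigraph.ReduceStep X.mg K := by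
  intro hK
  have hbad : ¬ X.mg.Bad := fun hb => by
    have h1 := hb.girth_le
    have h2 := girth_gt h
    have h3 := lt_of_lt_of_le h2 h1
    have : g < 2 := by exact_mod_cast h3
    omega
  obtain ⟨v, l, hE⟩ := hK.elimStep hbad
  have hv : v ∉ X.nbrs v := by
    rw [mem_nbrs]
    rintro ⟨a, ha, h1, h2⟩
    have h3 := mult_pos ha
    rw [h1, h2, hE.nbrs, Multiset.count_eq_zero_of_notMem hE.notMem] at h3
    omega
  refine hred v ⟨hE.mem, hv, ?_⟩
  have : X.nbrs v = l := Multiset.ext.2 fun u => by rw [← mult_eq_count hv, hE.nbrs]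
  rw [← card_nbrs, this]
  exact hE.card_le

end ArcGraph

/-! ### Counting around `F` in a graph without short cycles. -/

namespace ArcGraph

variable {X : ArcGraph} {T : List ℕ} {g : ℕ}

theorem NoShort.ne_loop (h : X.NoShort T g) (hg : 1 ≤ g) {a : ℕ} (ha : a ∈ X.L) (haT : X.InT T a) :
    X.own a ≠ X.tgt a := by
  intro hl
  have := h [a] (isArcCycle_of (by simp) (by simpa using ha)
    (by simp [hl.symm, X.tw_ne a ha]) (by simp)) (by simpa using haT)
  simp at this
  omega

theorem NoShort.unique (h : X.NoShort T g) (hg : 2 ≤ g) {a b : ℕ} (ha : a ∈ X.L) (haT : X.InT T a)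
    (hb : b ∈ X.L) (hbT : X.InT T b) (h1 : X.own a = X.own b) (h2 : X.tgt a = X.tgt b) : a = b := by
  by_contra hab
  have hl := h.ne_loop (by omega) ha haT
  have h5 : X.own (X.tw b) = X.tgt a := h2.symm
  have h6 : X.tw a ≠ X.tw b := fun h => hab (tw_inj ha hb h)
  have := h [a, X.tw b] (isArcCycle_of (by simp) (by simp [ha, X.tw_mem b hb])
    (by simp [h5, h6, tgt_tw hb, h1, X.tw_tw b hb, Ne.symm hab]) (by simp [h5, hl])) (by
      simp [haT, hbT.tw hb])
  simp at this
  omega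

/-- Without cycles of length 2 an arc is determined by the ordered pair of its ends. -/
theorem NoShort.length_le (h : X.NoShort T g) (hg : 2 ≤ g) (hT : T.Nodup) (hTL : ∀ a ∈ T, a ∈ X.L)
    {V : Finset ℕ} (hV : ∀ a ∈ X.L, X.InT T a → X.own a ∈ V) : T.length ≤ V.card ^ 2 := by
  rw [← List.toFinset_card_of_nodup hT, sq, ← Finset.card_product]
  refine Finset.card_le_card_of_injOn (fun a => (X.own a, X.tgt a)) (fun a ha => ?_) ?_
  · have ha : a ∈ T := by simpa using ha
    have haL := hTL a ha
    exact Finset.mk_mem_product (hV a haL (.inl ha))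
      (hV (X.tw a) (X.tw_mem a haL) (InT.tw haL (.inl ha)))
  · intro a ha b hb hab
    have ha : a ∈ T := by simpa using ha
    have hb : b ∈ T := by simpa using hb
    simp only [Prod.mk.injEq] at hab
    exact h.unique hg (hTL a ha) (.inl ha) (hTL b hb) (.inl hb) hab.1 hab.2

variable {F : ℕ → Prop}

/-- Two edges in `T` lead from `v` to `F`. -/
def Twice (X : ArcGraph) (F : ℕ → Prop) (T : List ℕ) (v : ℕ) : Prop :=
  ∃ p ∈ X.L, ∃ q ∈ X.L, X.InT T p ∧ X.InT T q ∧ p ≠ q ∧ X.own p = v ∧ X.own q = v ∧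
    F (X.tgt p) ∧ F (X.tgt q)

theorem Twice.mono {T' : List ℕ} {v : ℕ} (h : X.Twice F T v)
    (hT : ∀ b ∈ X.L, X.InT T b → X.InT T' b) : X.Twice F T' v := by
  obtain ⟨p, hp, q, hq, h1, h2, h⟩ := h
  exact ⟨p, hp, q, hq, hT p hp h1, hT q hq h2, h⟩

-- Two such vertices with the same pair of neighbours in `F` would lie on a cycle of length 4, so
-- they are told apart by this pair.
open scoped Classical in
theorem NoShort.card_twice (h : X.NoShort T g) (hg : 4 ≤ g) :
    (X.A.filter fun v => ¬ F v ∧ X.Twice F T v).card ≤ (X.A.filter F).card ^ 2 := by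
  have hch : ∀ v, ∃ p q, X.Twice F T v → p ∈ X.L ∧ q ∈ X.L ∧ X.InT T p ∧ X.InT T q ∧ p ≠ q ∧
      X.own p = v ∧ X.own q = v ∧ F (X.tgt p) ∧ F (X.tgt q) := by
    intro v
    by_cases hv : X.Twice F T v
    · obtain ⟨p, hp, q, hq, h⟩ := hv
      exact ⟨p, q, fun _ => ⟨hp, hq, h⟩⟩
    · exact ⟨0, 0, fun h => absurd h hv⟩
  choose p q hpq using hch
  rw [sq, ← Finset.card_product]
  refine Finset.card_le_card_of_injOn (fun v => (X.tgt (p v), X.tgt (q v))) (fun v hv => ?_) ?_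
  · obtain ⟨h1, -, h2⟩ := Finset.mem_filter.1 hv
    obtain ⟨e1, e2, e3, e4, e5, e6, e7, e8, e9⟩ := hpq v h2
    exact Finset.mk_mem_product (Finset.mem_filter.2 ⟨tgt_mem e1, e8⟩)
      (Finset.mem_filter.2 ⟨tgt_mem e2, e9⟩)
  · intro v hv w hw hvw
    obtain ⟨-, hvF, hv⟩ := Finset.mem_filter.1 hv
    obtain ⟨-, hwF, hw⟩ := Finset.mem_filter.1 hw
    obtain ⟨e1, e2, e3, e4, e5, e6, e7, e8, e9⟩ := hpq v hv
    obtain ⟨d1, d2, d3, d4, d5, d6, d7, d8, d9⟩ := hpq w hw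
    simp only [Prod.mk.injEq] at hvw
    obtain ⟨hx, hy⟩ := hvw
    by_contra hne
    have hxy : X.tgt (p v) ≠ X.tgt (q v) := fun h' =>
      e5 (h.unique (by omega) e1 e3 e2 e4 (by rw [e6, e7]) h')
    have o1 : X.own (X.tw (p w)) = X.tgt (p v) := hx.symm
    have o2 : X.own (X.tw (q v)) = X.tgt (q v) := rfl
    have n1 : X.tw (p v) ≠ X.tw (p w) := fun h' => hne (by rw [← e6, tw_inj e1 d1 h', d6])
    have n2 : X.tw (q w) ≠ X.tw (q v) := fun h' => hne (by rw [← e7, ← tw_inj d2 e2 h', d7])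
    have m1 : v ≠ X.tgt (p v) := fun h' => hvF (h' ▸ e8)
    have m2 : v ≠ X.tgt (q v) := fun h' => hvF (h' ▸ e9)
    have m3 : w ≠ X.tgt (p v) := fun h' => hwF (h' ▸ e8)
    have m4 : w ≠ X.tgt (q v) := fun h' => hwF (h' ▸ e9)
    have := h [p v, X.tw (p w), q w, X.tw (q v)] (isArcCycle_of (by simp)
      (by simp [e1, d2, X.tw_mem _ d1, X.tw_mem _ e2])
      (by simp [o1, o2, n1, n2, tgt_tw d1, tgt_tw e2, e6, e7, d6, d7, X.tw_tw _ d1, X.tw_tw _ e2,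
        d5, e5.symm, hy])
      (by simp [e6, o1, d7, o2, m1, m2, hne, m3.symm, hxy, m4]))
      (by simp [e3, d4, d3.tw d1, e4.tw e2])
    simp at this
    omega

/-- The arc `a` belongs to a path of three edges in `T` that starts and ends in `F` (with `f`
giving an arc to `F`). -/
def Middle (X : ArcGraph) (F : ℕ → Prop) (f : ℕ → ℕ) (T : List ℕ) (a : ℕ) : Prop :=
  a ∈ X.L ∧ X.InT T a ∧ ∀ v, v = X.own a ∨ v = X.tgt a →
    ¬ F v ∧ f v ∈ X.L ∧ X.InT T (f v) ∧ X.own (f v) = v ∧ F (X.tgt (f v))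

variable {f : ℕ → ℕ}

theorem Middle.tw {a : ℕ} (h : X.Middle F f T a) : X.Middle F f T (X.tw a) := by
  refine ⟨X.tw_mem a h.1, h.2.1.tw h.1, fun v hv => h.2.2 v ?_⟩
  rw [tgt_tw h.1] at hv
  exact hv.symm

theorem Middle.mono {T' : List ℕ} {a : ℕ} (h : X.Middle F f T a)
    (hT : ∀ b ∈ X.L, X.InT T b → X.InT T' b) : X.Middle F f T' a :=
  ⟨h.1, hT a h.1 h.2.1, fun v hv => by
    obtain ⟨h1, h2, h3, h4⟩ := h.2.2 v hv
    exact ⟨h1, h2, hT _ h2 h3, h4⟩⟩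

/-- Otherwise the common start, the two other ends and their common neighbour in `F` form a cycle of
length 4. -/
theorem NoShort.middle_aux (h : X.NoShort T g) (hg : 6 ≤ g) {a b : ℕ} (ha : X.Middle F f T a)
    (hb : X.Middle F f T b) (hy : X.tgt (f (X.tgt a)) = X.tgt (f (X.tgt b)))
    (h1 : X.own a = X.own b) : a = b := by
  obtain ⟨aL, aT, ha⟩ := ha
  obtain ⟨bL, bT, hb⟩ := hb
  obtain ⟨v1, v2, v3, v4, v5⟩ := ha _ (.inl rfl)
  obtain ⟨w1, w2, w3, w4, w5⟩ := ha _ (.inr rfl)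
  obtain ⟨z1, z2, z3, z4, z5⟩ := hb _ (.inr rfl)
  by_contra hab
  have h2 : X.tgt a ≠ X.tgt b := fun h2 => hab (h.unique (by omega) aL aT bL bT h1 h2)
  have hla := h.ne_loop (by omega) aL aT
  have hlb := h.ne_loop (by omega) bL bT
  have o1 : X.own (X.tw (f (X.tgt b))) = X.tgt (f (X.tgt a)) := hy.symm
  have o2 : X.own (X.tw b) = X.tgt b := rfl
  have n1 : X.tw a ≠ f (X.tgt a) := fun h' => v1 (by rw [← tgt_tw aL, h']; exact w5)
  have n2 : X.tw (f (X.tgt a)) ≠ X.tw (f (X.tgt b)) := fun h' =>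
    h2 (by rw [← w4, tw_inj w2 z2 h', z4])
  have n3 : f (X.tgt b) ≠ X.tw b := fun h' => v1 (by rw [h1, ← tgt_tw bL, ← h']; exact z5)
  have m1 : X.own a ≠ X.tgt (f (X.tgt a)) := fun h' => v1 (h' ▸ w5)
  have m2 : X.tgt a ≠ X.tgt (f (X.tgt a)) := fun h' => w1 (h' ▸ w5)
  have m3 : X.tgt b ≠ X.tgt (f (X.tgt a)) := fun h' => z1 (h' ▸ w5)
  have m4 : X.own a ≠ X.tgt b := h1 ▸ hlb
  have := h [a, f (X.tgt a), X.tw (f (X.tgt b)), X.tw b] (isArcCycle_of (by simp)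
    (by simp [aL, w2, X.tw_mem _ z2, X.tw_mem _ bL])
    (by simp [w4, o1, o2, n1, n2, n3, tgt_tw z2, z4, tgt_tw bL, h1, X.tw_tw _ z2, X.tw_tw _ bL,
      Ne.symm hab])
    (by simp [w4, o1, o2, hla, m1, m2, m3.symm, m4, h2]))
    (by simp [aT, w3, z3.tw z2, bT.tw bL])
  simp at this
  omega

/-- Equal ends in `F` would give a triangle. -/
theorem NoShort.middle_ne (h : X.NoShort T g) (hg : 6 ≤ g) {a : ℕ} (ha : X.Middle F f T a) :
    X.tgt (f (X.own a)) ≠ X.tgt (f (X.tgt a)) := by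
  obtain ⟨aL, aT, ha⟩ := ha
  obtain ⟨v1, v2, v3, v4, v5⟩ := ha _ (.inl rfl)
  obtain ⟨w1, w2, w3, w4, w5⟩ := ha _ (.inr rfl)
  intro hxy
  have hla := h.ne_loop (by omega) aL aT
  have o1 : X.own (X.tw (f (X.own a))) = X.tgt (f (X.tgt a)) := hxy
  have n1 : X.tw a ≠ f (X.tgt a) := fun h' => v1 (by rw [← tgt_tw aL, h']; exact w5)
  have n2 : X.tw (f (X.tgt a)) ≠ X.tw (f (X.own a)) := fun h' =>
    hla (by rw [← w4, tw_inj w2 v2 h', v4])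
  have n3 : f (X.own a) ≠ a := fun h' => w1 (by rw [← h']; exact v5)
  have m1 : X.own a ≠ X.tgt (f (X.tgt a)) := fun h' => v1 (h' ▸ w5)
  have m2 : X.tgt a ≠ X.tgt (f (X.tgt a)) := fun h' => w1 (h' ▸ w5)
  have := h [a, f (X.tgt a), X.tw (f (X.own a))] (isArcCycle_of (by simp)
    (by simp [aL, w2, X.tw_mem _ v2])
    (by simp [w4, o1, n1, n2, n3, tgt_tw v2, v4, X.tw_tw _ v2])
    (by simp [w4, o1, hla, m1, m2]))
    (by simp [aT, w3, v3.tw v2])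
  simp at this
  omega

/-- If the arcs share the start or the target, `NoShort.middle_aux` applies. Otherwise the two paths
of three edges between the same vertices of `F` form a cycle of length 6; the start of one arc is
not the target of the other, since the ends in `F` differ by `NoShort.middle_ne`. This is the place
that needs `g ≥ 6`. -/
theorem NoShort.middle_unique (h : X.NoShort T g) (hg : 6 ≤ g) {a b : ℕ} (ha : X.Middle F f T a)
    (hb : X.Middle F f T b) (hx : X.tgt (f (X.own a)) = X.tgt (f (X.own b)))
    (hy : X.tgt (f (X.tgt a)) = X.tgt (f (X.tgt b))) : a = b := by
  have hxy := h.middle_ne hg ha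
  by_cases h1 : X.own a = X.own b
  · exact h.middle_aux hg ha hb hy h1
  by_cases h2 : X.tgt a = X.tgt b
  · refine tw_inj ha.1 hb.1 (h.middle_aux hg ha.tw hb.tw ?_ h2)
    rw [tgt_tw ha.1, tgt_tw hb.1]
    exact hx
  by_contra hab
  obtain ⟨aL, aT, ha⟩ := ha
  obtain ⟨bL, bT, hb⟩ := hb
  obtain ⟨v1, v2, v3, v4, v5⟩ := ha _ (.inl rfl)
  obtain ⟨w1, w2, w3, w4, w5⟩ := ha _ (.inr rfl)
  obtain ⟨u1, u2, u3, u4, u5⟩ := hb _ (.inl rfl)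
  obtain ⟨z1, z2, z3, z4, z5⟩ := hb _ (.inr rfl)
  have hla := h.ne_loop (by omega) aL aT
  have hlb := h.ne_loop (by omega) bL bT
  have o1 : X.own (X.tw (f (X.tgt b))) = X.tgt (f (X.tgt a)) := hy.symm
  have o2 : X.own (X.tw b) = X.tgt b := rfl
  have o3 : X.own (X.tw (f (X.own a))) = X.tgt (f (X.own b)) := hx
  have n1 : X.tw a ≠ f (X.tgt a) := fun h' => v1 (by rw [← tgt_tw aL, h']; exact w5)
  have n2 : X.tw (f (X.tgt a)) ≠ X.tw (f (X.tgt b)) := fun h' =>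
    h2 (by rw [← w4, tw_inj w2 z2 h', z4])
  have n3 : f (X.tgt b) ≠ X.tw b := fun h' => u1 (by rw [← tgt_tw bL, ← h']; exact z5)
  have n4 : b ≠ f (X.own b) := fun h' => z1 (by rw [h']; exact u5)
  have n5 : X.tw (f (X.own b)) ≠ X.tw (f (X.own a)) := fun h' =>
    h1 (by rw [← v4, ← tw_inj u2 v2 h', u4])
  have n6 : f (X.own a) ≠ a := fun h' => w1 (by rw [← h']; exact v5)
  have m1 : ∀ v, ¬ F v → v ≠ X.tgt (f (X.tgt a)) := fun v hv h' => hv (h' ▸ w5)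
  have m2 : ∀ v, ¬ F v → v ≠ X.tgt (f (X.own b)) := fun v hv h' => hv (h' ▸ u5)
  have m3 : X.own a ≠ X.tgt b := fun h' => hxy (by rw [h', hy])
  have m4 : X.tgt a ≠ X.own b := fun h' => hxy (by rw [h', hx])
  have m5 : X.tgt (f (X.tgt a)) ≠ X.tgt (f (X.own b)) := fun h' => hxy (by rw [h', hx])
  have := h [a, f (X.tgt a), X.tw (f (X.tgt b)), X.tw b, f (X.own b), X.tw (f (X.own a))]
    (isArcCycle_of (by simp)
      (by simp [aL, w2, u2, X.tw_mem _ z2, X.tw_mem _ bL, X.tw_mem _ v2])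
      (by simp [w4, o1, o2, o3, n1, n2, n3, n4, n5, n6, tgt_tw z2, z4, tgt_tw bL, tgt_tw v2, u4, v4,
        X.tw_tw _ z2, X.tw_tw _ bL, X.tw_tw _ v2])
      (by simp [w4, o1, o2, o3, u4, hla, m1 _ v1, m1 _ w1, (m1 _ z1).symm, (m1 _ u1).symm, m2 _ v1,
        m2 _ w1, m2 _ z1, m2 _ u1, m3, m4, m5, h1, h2, hlb.symm]))
    (by simp [aT, w3, u3, z3.tw z2, bT.tw bL, v3.tw v2])
  simp at this
  omega

open scoped Classical in
theorem NoShort.card_middle (h : X.NoShort T g) (hg : 6 ≤ g) :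
    (X.L.filter fun a => X.Middle F f T a).card ≤ (X.A.filter F).card ^ 2 := by
  rw [sq, ← Finset.card_product]
  refine Finset.card_le_card_of_injOn (fun a => (X.tgt (f (X.own a)), X.tgt (f (X.tgt a))))
    (fun a ha => ?_) ?_
  · obtain ⟨-, h1⟩ := Finset.mem_filter.1 ha
    obtain ⟨-, v2, -, -, v5⟩ := h1.2.2 _ (.inl rfl)
    obtain ⟨-, w2, -, -, w5⟩ := h1.2.2 _ (.inr rfl)
    exact Finset.mk_mem_product (Finset.mem_filter.2 ⟨tgt_mem v2, v5⟩)
      (Finset.mem_filter.2 ⟨tgt_mem w2, w5⟩)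
  · intro a ha b hb hab
    obtain ⟨-, ha⟩ := Finset.mem_filter.1 ha
    obtain ⟨-, hb⟩ := Finset.mem_filter.1 hb
    simp only [Prod.mk.injEq] at hab
    exact h.middle_unique hg ha hb hab.1 hab.2

theorem card_arcs_le (Y : Finset ℕ) :
    (X.L.filter fun a => X.own a ∈ Y ∧ X.tgt a ∈ Y).card ≤ 2 * X.mg.edgesIn Y := by
  rw [Multigraph.edgesIn, Finset.mul_sum, Finset.card_eq_sum_card_fiberwise (t := Y.sym2)
    (f := fun a => s(X.own a, X.tgt a))]
  · refine Finset.sum_le_sum fun e _ => ?_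
    rw [two_mul_mult]
    refine Finset.card_le_card fun a ha => ?_
    rw [Finset.mem_filter, Finset.mem_filter] at ha
    exact mem_arcsOf.2 ⟨ha.1.1, ha.2⟩
  · intro a ha
    have ha := (Finset.mem_filter.1 ha).2
    simpa using ha

open scoped Classical in
/-- A reduced graph without loops is small if it is sparse outside `F`, few vertices have two edges
to `F`, and few edges join neighbours of `F`. -/
theorem card_le_of_sparse {r : ℕ} (hS : X.mg.Sparse (X.A.filter F)) (hred : ∀ v, ¬ X.Red v)
    (hloop : ∀ a ∈ X.L, X.own a ≠ X.tgt a)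
    (h1 : (X.A.filter fun v => ¬ F v ∧ 2 ≤ ((X.arcsAt v).filter fun a => F (X.tgt a)).card).card ≤ r)
    (h2 : (X.L.filter fun a => ∀ v, v = X.own a ∨ v = X.tgt a →
      ¬ F v ∧ ∃ b ∈ X.L, X.own b = v ∧ F (X.tgt b)).card ≤ r) :
    X.A.card ≤ (X.A.filter F).card + 7 * r := by
  set N := X.A.filter fun v => ¬ F v with hN
  have hAN : X.A.card = (X.A.filter F).card + N.card :=
    (Finset.card_filter_add_card_filter_not _).symm
  set dF := fun v => ((X.arcsAt v).filter fun a => F (X.tgt a)).card with hdF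
  set dN := fun v => ((X.arcsAt v).filter fun a => ¬ F (X.tgt a)).card with hdN
  have hdeg : ∀ v ∈ N, 3 ≤ dF v + dN v := by
    intro v hv
    have h3 : dF v + dN v = X.deg v := Finset.card_filter_add_card_filter_not _
    have h4 := hred v
    rw [h3]
    by_contra hlt
    refine h4 ⟨(Finset.mem_filter.1 hv).1, fun hl => ?_, by omega⟩
    obtain ⟨a, ha, e1, e2⟩ := mem_nbrs.1 hl
    exact hloop a ha (e1.trans e2.symm)
  -- The vertices outside `F` are split according to whether they have no arc, one arc or at least
  -- two arcs to `F`.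
  set U := N.filter fun v => dF v = 0 with hU
  set W := N.filter fun v => dF v = 1 with hW
  set Z := N.filter fun v => 2 ≤ dF v with hZ
  have hsplit : ∀ φ : ℕ → ℕ, ∑ v ∈ N, φ v = ∑ v ∈ U, φ v + ∑ v ∈ W, φ v + ∑ v ∈ Z, φ v := by
    intro φ
    have e : ∀ (p : ℕ → Prop) [DecidablePred p], ∑ v ∈ N.filter p, φ v = ∑ v ∈ N, if p v then φ v else 0 :=
      fun p _ => Finset.sum_filter _ _
    rw [hU, hW, hZ, e, e, e, ← Finset.sum_add_distrib, ← Finset.sum_add_distrib]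
    refine Finset.sum_congr rfl fun v _ => ?_
    rcases Nat.lt_or_ge (dF v) 2 with h | h
    · interval_cases dF v <;> simp
    · simp [h, show dF v ≠ 0 by omega, show dF v ≠ 1 by omega]
  have hcard : N.card = U.card + W.card + Z.card := by
    have := hsplit fun _ => 1
    simpa using this
  have hZr : Z.card ≤ r := by
    refine le_trans (Finset.card_le_card fun v hv => ?_) h1
    obtain ⟨hv, h3⟩ := Finset.mem_filter.1 hv
    obtain ⟨hv, h4⟩ := Finset.mem_filter.1 hv
    exact Finset.mem_filter.2 ⟨hv, h4, h3⟩
  set R := X.L.filter fun a => X.own a ∈ N ∧ X.tgt a ∈ N with hR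
  have hdNR : ∀ V ⊆ N, (R.filter fun a => X.own a ∈ V).card = ∑ v ∈ V, dN v := by
    intro V hV
    rw [Finset.card_eq_sum_card_fiberwise (f := X.own) (t := V)]
    · refine Finset.sum_congr rfl fun v hv => ?_
      rw [hdN]
      congr 1
      ext a
      simp only [Finset.mem_filter, hR, mem_arcsAt, hN]
      constructor
      · rintro ⟨⟨⟨e1, e2, e3⟩, e4⟩, e5⟩
        exact ⟨⟨e1, e5⟩, e3.2⟩
      · rintro ⟨⟨e1, rfl⟩, e3⟩
        have := Finset.mem_filter.1 (hV hv)
        exact ⟨⟨⟨e1, this, tgt_mem e1, e3⟩, hv⟩, rfl⟩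
    · intro a ha
      exact (Finset.mem_filter.1 ha).2
  have hRsum : R.card = ∑ v ∈ N, dN v := by
    rw [← hdNR N subset_rfl]
    congr 1
    exact (Finset.filter_true_of_mem fun a ha => (Finset.mem_filter.1 ha).2.1).symm
  have hR2 : R.card ≤ 2 * N.card := by
    refine (card_arcs_le N).trans (Nat.mul_le_mul_left 2 (hS N (Finset.filter_subset _ _) ?_))
    rw [Finset.disjoint_left]
    intro v hv hv'
    exact (Finset.mem_filter.1 hv).2 (Finset.mem_filter.1 hv').2
  have hUN : U ⊆ N := Finset.filter_subset _ _
  have htU : (R.filter fun a => X.tgt a ∈ U).card ≤ (R.filter fun a => X.own a ∈ U).card := by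
    refine Finset.card_le_card_of_injOn X.tw (fun a ha => ?_) fun a ha b hb hab => ?_
    · obtain ⟨h3, h4⟩ := Finset.mem_filter.1 ha
      obtain ⟨h3, h5, h6⟩ := Finset.mem_filter.1 h3
      exact Finset.mem_filter.2 ⟨Finset.mem_filter.2
        ⟨X.tw_mem a h3, h6, by rw [tgt_tw h3]; exact h5⟩, h4⟩
    · exact tw_inj (Finset.mem_filter.1 (Finset.mem_filter.1 ha).1).1
        (Finset.mem_filter.1 (Finset.mem_filter.1 hb).1).1 hab
  -- An arc outside `F` either has an end in `U`, or joins two neighbours of `F`; there are at most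
  -- `r` arcs of the second kind.
  have hRle : R.card ≤ r + 2 * ∑ v ∈ U, dN v := by
    have hsub : R ⊆ (X.L.filter fun a => ∀ v, v = X.own a ∨ v = X.tgt a →
        ¬ F v ∧ ∃ b ∈ X.L, X.own b = v ∧ F (X.tgt b)) ∪
        ((R.filter fun a => X.own a ∈ U) ∪ R.filter fun a => X.tgt a ∈ U) := by
      intro a ha
      obtain ⟨h3, h5, h6⟩ := Finset.mem_filter.1 ha
      have hout : ∀ v ∈ N, v ∉ U → ¬ F v ∧ ∃ b ∈ X.L, X.own b = v ∧ F (X.tgt b) := by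
        intro v hv hvU
        refine ⟨(Finset.mem_filter.1 hv).2, ?_⟩
        have : dF v ≠ 0 := fun h0 => hvU (Finset.mem_filter.2 ⟨hv, h0⟩)
        obtain ⟨b, hb⟩ := Finset.card_ne_zero.1 this
        obtain ⟨hb, hbF⟩ := Finset.mem_filter.1 hb
        exact ⟨b, (mem_arcsAt.1 hb).1, (mem_arcsAt.1 hb).2, hbF⟩
      simp only [Finset.mem_union]
      by_cases h7 : X.own a ∈ U
      · exact .inr (.inl (Finset.mem_filter.2 ⟨ha, h7⟩))
      by_cases h8 : X.tgt a ∈ U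
      · exact .inr (.inr (Finset.mem_filter.2 ⟨ha, h8⟩))
      refine .inl (Finset.mem_filter.2 ⟨h3, ?_⟩)
      rintro v (rfl | rfl)
      · exact hout _ h5 h7
      · exact hout _ h6 h8
    have h3 := Finset.card_le_card hsub
    have h4 := Finset.card_union_le (X.L.filter fun a => ∀ v, v = X.own a ∨ v = X.tgt a →
        ¬ F v ∧ ∃ b ∈ X.L, X.own b = v ∧ F (X.tgt b))
        ((R.filter fun a => X.own a ∈ U) ∪ R.filter fun a => X.tgt a ∈ U)
    have h5 := Finset.card_union_le (R.filter fun a => X.own a ∈ U) (R.filter fun a => X.tgt a ∈ U)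
    have h6 := hdNR U hUN
    omega
  have hsU : 3 * U.card ≤ ∑ v ∈ U, dN v := by
    rw [mul_comm, ← smul_eq_mul]
    refine Finset.card_nsmul_le_sum _ _ _ fun v hv => ?_
    obtain ⟨hv, h0⟩ := Finset.mem_filter.1 hv
    have := hdeg v hv
    omega
  have hsW : 2 * W.card ≤ ∑ v ∈ W, dN v := by
    rw [mul_comm, ← smul_eq_mul]
    refine Finset.card_nsmul_le_sum _ _ _ fun v hv => ?_
    obtain ⟨hv, h0⟩ := Finset.mem_filter.1 hv
    have := hdeg v hv
    omega
  -- Let `s` be the sum of `dN` over `U`. From `s + 2|W| ≤ |R| ≤ 2|N|` follows `s ≤ 2|U| + 2r`. With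
  -- `3|U| ≤ s` this gives `|U| ≤ 2r` and `s ≤ 6r`. Finally `2|W| ≤ |R| - s ≤ r + s ≤ 7r`, so `|N| ≤
  -- 2r + 3.5r + r`.
  have := hsplit dN
  omega

end ArcGraph

/-! ### Distances along the table, layer by layer. -/

namespace ArcGraph

variable {X : ArcGraph} {T : List ℕ} {u r d c K : ℕ} {par dist : ℕ → ℕ} {seen : ℕ → Prop}

/-- The ends of the edges in `T`. -/
def ends (X : ArcGraph) (T : List ℕ) : Finset ℕ := (T.flatMap fun a => [X.own a, X.tgt a]).toFinset

theorem card_ends_le (T : List ℕ) : (X.ends T).card ≤ 2 * T.length := by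
  refine (List.toFinset_card_le _).trans ?_
  simp [List.length_flatMap, mul_comm]

theorem InT.tgt_mem_ends {a : ℕ} (h : X.InT T a) : X.tgt a ∈ X.ends T := by
  simp only [ends, List.mem_toFinset, List.mem_flatMap]
  rcases h with h | h
  · exact ⟨a, h, by simp⟩
  · exact ⟨X.tw a, h, by simp [tgt]⟩

/-- A search by layers along the edges in `T` that starts at `u`: `dist` holds the distances (plus
1), `d` is the current layer, and `c` tells whether the next layer is nonempty. -/
structure Layer (X : ArcGraph) (T : List ℕ) (u r : ℕ) (par dist : ℕ → ℕ) (d c K : ℕ)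
    (seen : ℕ → Prop) : Prop where
  dist_root : dist u = 1
  par_root : par u = r
  le : ∀ v ∈ X.A, dist v ≤ d + c
  parent : ∀ v ∈ X.A, dist v ≠ 0 → v ≠ u → ∃ p ∈ X.L, X.InT T p ∧ par v = p + 1 ∧ X.own p = v ∧
    dist (X.tgt p) ≠ 0 ∧ dist (X.tgt p) < dist v
  closed : ∀ a ∈ X.L, X.InT T a → dist (X.own a) ≠ 0 →
    (dist (X.own a) < d ∨ dist (X.own a) = d ∧ seen a) →
    dist (X.tgt a) ≠ 0 ∧ dist (X.tgt a) ≤ dist (X.own a) + 1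
  -- `K` bounds the number of further layers: each of them reaches some end of an edge of `T` for
  -- the first time.
  count : ((X.ends T).filter fun v => dist v = 0).card + c ≤ K

theorem Layer.init (hd : ∀ v ∈ X.A, dist v = if v = u then 1 else 0) (hu : u ∈ X.A)
    (hp : par u = r) (hK : 2 * T.length ≤ K) : X.Layer T u r par dist 1 0 K fun _ => False where
  dist_root := by simp [hd u hu]
  par_root := hp
  le v hv := by
    rw [hd v hv]
    split_ifs <;> simp
  parent v hv h0 hvu := by simp [hd v hv, hvu] at h0
  closed a ha _ h0 h := by
    rcases h with h | h
    · omega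
    · exact h.2.elim
  count := by
    have h1 := Finset.card_filter_le (X.ends T) fun v => dist v = 0
    have h2 := card_ends_le (X := X) T
    omega

/-- No stored distance exceeds `d + c ≤ d + 1`, so a target that has been reached already satisfies
the estimate. -/
theorem Layer.skip (h : X.Layer T u r par dist d c K seen) {e : ℕ} (hc : c ≤ 1)
    (he : e ∈ X.L → dist (X.own e) = d → dist (X.tgt e) ≠ 0) :
    X.Layer T u r par dist d c K fun a => seen a ∨ a = e where
  dist_root := h.dist_root
  par_root := h.par_root
  le := h.le
  parent := h.parent
  closed a ha haT h0 ha' := by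
    rcases ha' with h1 | ⟨h1, h2 | rfl⟩
    · exact h.closed a ha haT h0 (.inl h1)
    · exact h.closed a ha haT h0 (.inr ⟨h1, h2⟩)
    · have := h.le _ (tgt_mem ha)
      exact ⟨he ha h1, by omega⟩
  count := h.count

theorem Layer.relax (h : X.Layer T u r par dist d c K seen) {e : ℕ} (heL : e ∈ X.L)
    (heT : X.InT T e) (hc : c ≤ 1) (hd : 1 ≤ d) (h1 : dist (X.own e) = d)
    (h2 : dist (X.tgt e) = 0) :
    X.Layer T u r (Function.update par (X.tgt e) (X.tw e + 1))
      (Function.update dist (X.tgt e) (d + 1)) d 1 K fun a => seen a ∨ a = e := by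
  have hup : ∀ (f : ℕ → ℕ) (x v : ℕ), dist v ≠ 0 → Function.update f (X.tgt e) x v = f v :=
    fun f x v h0 => Function.update_of_ne (by rintro rfl; exact h0 h2) _ _
  have hu : dist u ≠ 0 := by rw [h.dist_root]; simp
  refine ⟨?_, ?_, fun v hv => ?_, fun v hv h0 hvu => ?_, fun a ha haT h0 ha' => ?_, ?_⟩
  · rw [hup _ _ _ hu, h.dist_root]
  · rw [hup _ _ _ hu, h.par_root]
  · rw [Function.update_apply]
    split_ifs
    · exact le_rfl
    · have := h.le v hv
      omega
  · by_cases hvt : v = X.tgt e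
    · subst hvt
      refine ⟨X.tw e, X.tw_mem e heL, heT.tw heL, by simp, rfl, ?_⟩
      rw [tgt_tw heL, hup _ _ _ (by omega), Function.update_self]
      omega
    · rw [Function.update_of_ne hvt] at h0 ⊢
      obtain ⟨p, p1, p2, p3, p4, p5, p6⟩ := h.parent v hv h0 hvu
      rw [Function.update_of_ne hvt]
      exact ⟨p, p1, p2, p3, p4, by rwa [hup _ _ _ p5], by rwa [hup _ _ _ p5]⟩
  · by_cases hat : X.own a = X.tgt e
    · rw [hat, Function.update_self] at ha'
      omega
    rw [Function.update_of_ne hat] at h0 ha' ⊢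
    by_cases hae : a = e
    · subst hae
      simp
      omega
    · obtain ⟨h3, h4⟩ := h.closed a ha haT h0 (ha'.imp_right fun h => ⟨h.1, h.2.resolve_right hae⟩)
      rw [hup _ _ _ h3]
      exact ⟨h3, h4⟩
  · have hlt : ((X.ends T).filter fun v => Function.update dist (X.tgt e) (d + 1) v = 0).card <
        ((X.ends T).filter fun v => dist v = 0).card := by
      refine Finset.card_lt_card ⟨fun v hv => ?_, fun hsub => ?_⟩
      · obtain ⟨h3, h4⟩ := Finset.mem_filter.1 hv
        refine Finset.mem_filter.2 ⟨h3, ?_⟩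
        rw [Function.update_apply] at h4
        split_ifs at h4 with h5
        exact h4
      · have := hsub (Finset.mem_filter.2 ⟨heT.tgt_mem_ends, h2⟩)
        simp at this
    have := h.count
    omega

theorem Layer.next (h : X.Layer T u r par dist d 1 (K + 1) seen)
    (hp : ∀ a ∈ X.L, X.InT T a → seen a) :
    X.Layer T u r par dist (d + 1) 0 K fun _ => False where
  dist_root := h.dist_root
  par_root := h.par_root
  le := h.le
  parent := h.parent
  closed a ha haT h0 h' := by
    refine h.closed a ha haT h0 ?_
    rcases h' with h' | h'
    · rcases Nat.lt_succ_iff_lt_or_eq.1 h' with h' | h'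
      · exact .inl h'
      · exact .inr ⟨h', hp a ha haT⟩
    · exact h'.2.elim
  count := by
    have := h.count
    omega

theorem Layer.isDist (h : X.Layer T u r par dist d 0 K seen)
    (hp : ∀ a ∈ X.L, X.InT T a → seen a) : X.IsDist T dist := by
  intro a ha haT h0
  refine h.closed a ha haT h0 ?_
  have := h.le _ (X.own_mem a ha)
  rcases Nat.lt_or_ge (dist (X.own a)) d with h1 | h1
  · exact .inl h1
  · exact .inr ⟨by omega, hp a ha haT⟩

end ArcGraph

namespace RAM

open ArcGraph

/-- Follow the arc in register 52 from the current layer. -/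
def relaxProg : Prog :=
  .ite (.eq (.get 21 (.get 4 (.var 52))) (.var 50))
    (.ite (.eq (.get 21 (.get 4 (.get 8 (.var 52)))) (.const 0))
      (.store 21 (.get 4 (.get 8 (.var 52))) (.succ (.var 50)) ;;
        .store 14 (.get 4 (.get 8 (.var 52))) (.succ (.get 8 (.var 52))) ;;
        .assign 51 (.const 1))
      .skip)
    .skip

theorem run_relax {s : Mem} {N : Net} {X : ArcGraph} {T : List ℕ} {u r d K e : ℕ}
    {seen : ℕ → Prop} (hs : Static s N) (hr : Rep s N X)
    (hL : X.Layer T u r (s.arr 14) (s.arr 21) d (s.var 51) K seen) (hd : 1 ≤ d)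
    (h50 : s.var 50 = d) (hc : s.var 51 ≤ 1) (h52 : s.var 52 = e) (he : e ∈ X.L)
    (heT : X.InT T e) :
    Run relaxProg s fun t s' => X.Layer T u r (s'.arr 14) (s'.arr 21) d (s'.var 51) K
      (fun a => seen a ∨ a = e) ∧ s'.var 51 ≤ 1 ∧ t ≤ 30 := by
  have htw : s.arr 8 e = X.tw e := hr.tw e he
  have h4 : ∀ a, s.arr 4 a = X.own a := fun a => by rw [hs.own, hr.own]
  have htgt : X.own (X.tw e) = X.tgt e := rfl
  unfold relaxProg
  rw [run_ite]
  constructor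
  · intro hb
    have hb : s.arr 21 (X.own e) = d := by simpa [h52, h4, h50] using hb
    rw [run_ite]
    constructor
    · intro hb'
      have hb' : s.arr 21 (X.tgt e) = 0 := by simpa [h52, h4, htw, htgt] using hb'
      simp only [run_seq, run_store, run_assign]
      refine ⟨?_, by simp, by simp⟩
      simpa [h52, htw, h4, h50, htgt] using hL.relax he heT hc hd hb hb'
    · intro hb'
      have hb' : s.arr 21 (X.tgt e) ≠ 0 := by simpa [h52, h4, htw, htgt] using hb'
      rw [run_skip]
      exact ⟨hL.skip hc fun _ _ => hb', hc, by simp⟩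
  · intro hb
    have hb : s.arr 21 (X.own e) ≠ d := by simpa [h52, h4, h50] using hb
    rw [run_skip]
    exact ⟨hL.skip hc fun _ h => absurd h hb, hc, by simp⟩

/-- The memory holds the list `T` of edges without short cycles in array 20; array 18 marks its
arcs, and array 21 is zero away from its ends. -/
structure Table (s : Mem) (X : ArcGraph) (T : List ℕ) (g : ℕ) : Prop where
  eq : slice (s.arr 20) 0 (s.var 45) = T
  mem : ∀ a ∈ T, a ∈ X.L
  nodup : T.Nodup
  ins : ∀ a ∈ X.L, s.arr 18 a ≠ 0 ↔ X.InT T a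
  dist : ∀ v ∈ X.A, s.arr 21 v ≠ 0 → ∃ a ∈ X.L, X.InT T a ∧ X.own a = v
  short : X.NoShort T g

theorem Table.length {s : Mem} {X : ArcGraph} {T : List ℕ} {g : ℕ} (h : Table s X T g) :
    T.length = s.var 45 := by
  rw [← h.eq, length_slice, Nat.sub_zero]

theorem Table.congr {s s' : Mem} {X : ArcGraph} {T : List ℕ} {g : ℕ} (h : Table s X T g)
    (h20 : s'.arr 20 = s.arr 20) (h45 : s'.var 45 = s.var 45) (h18 : s'.arr 18 = s.arr 18)
    (h21 : s'.arr 21 = s.arr 21) : Table s' X T g :=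
  ⟨by rw [h20, h45]; exact h.eq, h.mem, h.nodup, by rw [h18]; exact h.ins,
    by rw [h21]; exact h.dist, h.short⟩

/-- Search by layers along the edges in the table, from the vertex in register 47. -/
def layersProg : Prog :=
  .assign 50 (.const 1) ;; .assign 51 (.const 1) ;;
  .while (.lt (.const 0) (.var 51))
    (.assign 51 (.const 0) ;; .assign 49 (.const 0) ;;
      Prog.for 49 45
        (.assign 52 (.get 20 (.var 49)) ;; relaxProg ;;
          .assign 52 (.get 8 (.get 20 (.var 49))) ;; relaxProg) ;;
      .assign 50 (.succ (.var 50)))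

theorem run_layers {s : Mem} {N : Net} {X : ArcGraph} {T : List ℕ} {u r : ℕ} (hs : Static s N)
    (hr : Rep s N X) (hT : slice (s.arr 20) 0 (s.var 45) = T) (hTL : ∀ a ∈ T, a ∈ X.L)
    (hu : u ∈ X.A) (hp : s.arr 14 u = r) (hd : ∀ v ∈ X.A, s.arr 21 v = if v = u then 1 else 0) :
    Run layersProg s fun t s' => (∃ d K seen, X.Layer T u r (s'.arr 14) (s'.arr 21) d 0 K seen) ∧
      X.IsDist T (s'.arr 21) ∧ t ≤ 300 * (T.length + 1) ^ 2 := by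
  have hlen : T.length = s.var 45 := by rw [← hT, length_slice, Nat.sub_zero]
  unfold layersProg
  simp only [run_seq, run_assign]
  -- There are at most `2 * T.length` ends, hence at most one more round than that, and a round
  -- passes once through the table.
  refine Run.while (φ := (2 * T.length + 1) * (100 * T.length + 30))
    (fun φ s₁ => (s₁.var 51 ≠ 0 ∧ ∃ K, 1 ≤ s₁.var 50 ∧
      X.Layer T u r (s₁.arr 14) (s₁.arr 21) (s₁.var 50) 0 K (fun _ => False) ∧
      φ = (K + 1) * (100 * T.length + 30)) ∨
      (s₁.var 51 = 0 ∧ (∃ d K seen, X.Layer T u r (s₁.arr 14) (s₁.arr 21) d 0 K seen) ∧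
        X.IsDist T (s₁.arr 21) ∧ φ = 0)) ?_ ?_ ?_
  · exact .inl ⟨by simp, 2 * T.length, by simp, by simpa using Layer.init hd hu hp le_rfl, rfl⟩
  · rintro φ s₁ h hf hb
    have h51 : s₁.var 51 ≠ 0 := by
      have : 0 < s₁.var 51 := by simpa using hb
      omega
    obtain ⟨-, K, h50, hL, rfl⟩ := h.resolve_right fun h => h51 h.1
    have hs₁ : Static s₁ N := by
      refine Static.of_framed ?_ hf rfl rfl rfl rfl rfl
      exact ⟨by simpa using hs.n, hs.own, hs.otw, hs.list⟩
    have hr₁ : Rep s₁ N X := hr.congr (hf.arr 8 rfl) (hf.arr 9 rfl) (hf.arr 10 rfl) (hf.arr 11 rfl)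
    have e20 : s₁.arr 20 = s.arr 20 := hf.arr 20 rfl
    have e45 : s₁.var 45 = T.length := by
      rw [hf.var 45 rfl, hlen]
      simp
    simp only [run_seq, run_assign]
    refine Run.forBound 80 (N := T.length) (fun i s₂ => s₂.var 51 ≤ 1 ∧
      X.Layer T u r (s₂.arr 14) (s₂.arr 21) (s₁.var 50) (s₂.var 51) K
        (fun a => ∃ j < i, a = s.arr 20 j ∨ a = X.tw (s.arr 20 j))) rfl rfl (by decide)
      (by simpa using e45) (by simp) ?_ ?_ ?_
    · simp only [setVar_var, setVar_arr, if_true, Expr.eval, Nat.reduceEqDiff, if_false,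
        Nat.not_lt_zero, false_and, exists_false]
      exact ⟨by simp, hL⟩
    · rintro i s₂ ⟨hc, hL₂⟩ hf₂ hx hi
      have haT : s.arr 20 i ∈ T := by
        rw [← hT]
        exact mem_slice.2 ⟨i, Nat.zero_le _, by omega, rfl⟩
      have haL := hTL _ haT
      have f20 : s₂.arr 20 = s.arr 20 := (hf₂.arr 20 rfl).trans e20
      have f50 : s₂.var 50 = s₁.var 50 := by
        rw [hf₂.var 50 rfl]
        simp
      have hs₂ : Static s₂ N := by
        refine Static.of_framed ?_ hf₂ rfl rfl rfl rfl rfl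
        exact ⟨by simpa using hs₁.n, hs₁.own, hs₁.otw, hs₁.list⟩
      have hr₂ : Rep s₂ N X :=
        hr₁.congr (hf₂.arr 8 rfl) (hf₂.arr 9 rfl) (hf₂.arr 10 rfl) (hf₂.arr 11 rfl)
      simp only [run_seq, run_assign]
      refine (run_relax (N := N) (X := X) (T := T) (u := u) (r := r) (d := s₁.var 50) (K := K)
        (e := s.arr 20 i) (seen := fun a => ∃ j < i, a = s.arr 20 j ∨ a = X.tw (s.arr 20 j))
        ?_ ?_ ?_ h50 ?_ ?_ ?_ haL (.inl haT)).mono fun t₃ s₃ hf₃ h => ?_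
      · exact ⟨by simpa using hs₂.n, hs₂.own, hs₂.otw, hs₂.list⟩
      · exact hr₂.congr rfl rfl rfl rfl
      · simpa using hL₂
      · simpa using f50
      · simpa using hc
      · simp [f20, hx]
      obtain ⟨hL₃, hc₃, ht₃⟩ := h
      have hs₃ : Static s₃ N := by
        refine Static.of_framed ?_ hf₃ rfl rfl rfl rfl rfl
        exact ⟨by simpa using hs₂.n, hs₂.own, hs₂.otw, hs₂.list⟩
      have hr₃ : Rep s₃ N X :=
        hr₂.congr (hf₃.arr 8 rfl) (hf₃.arr 9 rfl) (hf₃.arr 10 rfl) (hf₃.arr 11 rfl)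
      have g20 : s₃.arr 20 = s.arr 20 := (hf₃.arr 20 rfl).trans f20
      have g50 : s₃.var 50 = s₁.var 50 := by
        rw [hf₃.var 50 rfl]
        simpa using f50
      have g49 : s₃.var 49 = i := by
        rw [hf₃.var 49 rfl]
        simpa using hx
      refine (run_relax (N := N) (X := X) (T := T) (u := u) (r := r) (d := s₁.var 50) (K := K)
        (e := X.tw (s.arr 20 i))
        (seen := fun a => (∃ j < i, a = s.arr 20 j ∨ a = X.tw (s.arr 20 j)) ∨ a = s.arr 20 i)
        ?_ ?_ ?_ h50 ?_ ?_ ?_ (X.tw_mem _ haL) (InT.tw haL (.inl haT))).mono fun t₄ s₄ hf₄ h => ?_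
      · exact ⟨by simpa using hs₃.n, hs₃.own, hs₃.otw, hs₃.list⟩
      · exact hr₃.congr rfl rfl rfl rfl
      · simpa using hL₃
      · simpa using g50
      · simpa using hc₃
      · simp [g20, g49, hr₃.tw _ haL]
      obtain ⟨hL₄, hc₄, ht₄⟩ := h
      refine ⟨⟨by simpa using hc₄, ?_⟩, ?_⟩
      · have hproc : (fun a => ∃ j < i + 1, a = s.arr 20 j ∨ a = X.tw (s.arr 20 j)) = fun a =>
            ((∃ j < i, a = s.arr 20 j ∨ a = X.tw (s.arr 20 j)) ∨ a = s.arr 20 i) ∨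
              a = X.tw (s.arr 20 i) := by
          ext a
          constructor
          · rintro ⟨j, hj, h⟩
            rcases Nat.lt_succ_iff_lt_or_eq.1 hj with hj | rfl
            · exact .inl (.inl ⟨j, hj, h⟩)
            · rcases h with h | h
              · exact .inl (.inr h)
              · exact .inr h
          · rintro ((⟨j, hj, h⟩ | h) | h)
            · exact ⟨j, by omega, h⟩
            · exact ⟨i, by omega, .inl h⟩
            · exact ⟨i, by omega, .inr h⟩
        rw [hproc]
        simpa using hL₄
      · simp only [Expr.cost]
        omega
    · rintro t₂ s₂ ⟨hc, hL₂⟩ hf₂ hx ht₂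
      have f50 : s₂.var 50 = s₁.var 50 := by
        rw [hf₂.var 50 rfl]
        simp
      have hproc : ∀ a ∈ X.L, X.InT T a →
          ∃ j < T.length, a = s.arr 20 j ∨ a = X.tw (s.arr 20 j) := by
        intro a ha haT
        rcases haT with h | h
        · rw [← hT] at h
          obtain ⟨j, -, hj, rfl⟩ := mem_slice.1 h
          exact ⟨j, by omega, .inl rfl⟩
        · rw [← hT] at h
          obtain ⟨j, -, hj, hja⟩ := mem_slice.1 h
          exact ⟨j, by omega, .inr (by rw [hja, X.tw_tw a ha])⟩
      by_cases h0 : s₂.var 51 = 0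
      · rw [h0] at hL₂
        refine ⟨0, .inr ⟨by simpa using h0, ⟨_, _, _, hL₂⟩, hL₂.isDist hproc, rfl⟩, ?_⟩
        simp only [Test.cost, Expr.cost, Nat.add_mul]
        omega
      · have h1 : s₂.var 51 = 1 := by omega
        rw [h1] at hL₂
        obtain ⟨K, rfl⟩ : ∃ K', K = K' + 1 := ⟨K - 1, by have := hL₂.count; omega⟩
        refine ⟨_, .inl ⟨by simpa using h0, K, by simp, ?_, rfl⟩, ?_⟩
        · simpa [f50] using hL₂.next hproc
        · simp only [Test.cost, Expr.cost, Nat.add_mul]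
          omega
  · rintro t φ s₁ h hf hb ht
    obtain ⟨-, h1, h2, rfl⟩ := h.resolve_left fun h => by
      simp at hb
      exact h.1 hb
    refine ⟨h1, h2, ?_⟩
    simp only [Test.cost, Expr.cost] at ht ⊢
    nlinarith

end RAM

/-! ### Inserting an edge into the table. -/

namespace RAM

open ArcGraph

/-- Reset array 21 at the ends of the edges in the table. -/
def clearProg : Prog :=
  .assign 49 (.const 0) ;;
  Prog.for 49 45
    (.store 21 (.get 4 (.get 20 (.var 49))) (.const 0) ;;
      .store 21 (.get 4 (.get 8 (.get 20 (.var 49)))) (.const 0))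

/-- Resetting the whole of array 21 would cost `n` steps for every insertion. Since it can be
nonzero only at ends of edges in the table, time linear in the table suffices. -/
theorem run_clear {s : Mem} {N : Net} {X : ArcGraph} {T : List ℕ} {g : ℕ} (hs : Static s N)
    (hr : Rep s N X) (hT : Table s X T g) :
    Run clearProg s fun t s' => (∀ v ∈ X.A, s'.arr 21 v = 0) ∧ t ≤ 30 * T.length + 10 := by
  have h4 : ∀ a, s.arr 4 a = X.own a := fun a => by rw [hs.own, hr.own]
  have hmem : ∀ j < T.length, s.arr 20 j ∈ T := fun j hj => by
    rw [hT.length] at hj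
    rw [← hT.eq]
    exact mem_slice.2 ⟨j, Nat.zero_le _, hj, rfl⟩
  unfold clearProg
  rw [run_seq, run_assign]
  refine Run.forBound 20 (N := T.length) (fun i s₁ => ∀ v ∈ X.A, s₁.arr 21 v ≠ 0 →
    ∃ j, i ≤ j ∧ j < T.length ∧ (v = X.own (s.arr 20 j) ∨ v = X.tgt (s.arr 20 j)))
    rfl rfl (by decide) (by simp [hT.length]) (by simp) ?_ ?_ ?_
  · intro v hv h0
    obtain ⟨a, haL, ha, rfl⟩ := hT.dist v hv (by simpa using h0)
    rcases ha with ha | ha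
    · rw [← hT.eq] at ha
      obtain ⟨j, -, hj, rfl⟩ := mem_slice.1 ha
      exact ⟨j, by simp, by rwa [hT.length], .inl rfl⟩
    · rw [← hT.eq] at ha
      obtain ⟨j, -, hj, hja⟩ := mem_slice.1 ha
      exact ⟨j, by simp, by rwa [hT.length], .inr (by rw [hja, tgt_tw haL])⟩
  · intro i s₁ hI hf hx hi
    have e4 : s₁.arr 4 = s.arr 4 := hf.arr 4 rfl
    have e8 : s₁.arr 8 = s.arr 8 := hf.arr 8 rfl
    have e20 : s₁.arr 20 = s.arr 20 := hf.arr 20 rfl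
    have htw := hr.tw _ (hT.mem _ (hmem i hi))
    simp only [run_seq, run_store]
    refine ⟨fun v hv h0 => ?_, by simp⟩
    simp only [setVar_arr, setArr_arr, if_true, Expr.eval, setArr_var, hx, e4, e8, e20, h4,
      Nat.reduceEqDiff, if_false, htw, Function.update_apply] at h0
    change (if v = X.tgt (s.arr 20 i) then _ else _) ≠ 0 at h0
    split_ifs at h0 with c1 c2
    · exact absurd rfl h0
    · exact absurd rfl h0
    · obtain ⟨j, h1, h2, h3⟩ := hI v hv h0
      refine ⟨j, ?_, h2, h3⟩
      rcases Nat.lt_or_eq_of_le h1 with h1 | rfl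
      · exact h1
      · exact absurd h3 (not_or.2 ⟨c2, c1⟩)
  · intro t s' hI hf hx ht
    refine ⟨fun v hv => ?_, ?_⟩
    · by_contra h0
      obtain ⟨j, h1, h2, -⟩ := hI v hv h0
      omega
    · simp only [Expr.cost]
      omega

/-- Add the edge of the arc in register 46 to the table. -/
def insertProg : Prog :=
  .store 20 (.var 45) (.var 46) ;; .assign 45 (.succ (.var 45)) ;;
  .store 18 (.var 46) (.const 1) ;; .store 18 (.get 8 (.var 46)) (.const 1)

theorem run_insert {s : Mem} {N : Net} {X : ArcGraph} {T : List ℕ} {a g : ℕ}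
    (hr : Rep s N X) (h20 : slice (s.arr 20) 0 (s.var 45) = T) (hmem : ∀ a ∈ T, a ∈ X.L)
    (hnd : T.Nodup) (hins : ∀ a ∈ X.L, s.arr 18 a ≠ 0 ↔ X.InT T a)
    (hdist : ∀ v ∈ X.A, s.arr 21 v ≠ 0 → ∃ b ∈ X.L, X.InT (T ++ [a]) b ∧ X.own b = v)
    (h46 : s.var 46 = a) (ha : a ∈ X.L) (haT : ¬ X.InT T a) (hsh : X.NoShort (T ++ [a]) g) :
    Run insertProg s fun t s' => Table s' X (T ++ [a]) g ∧ s'.var 9 = s.var 9 ∧ t ≤ 13 := by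
  have htw := hr.tw a ha
  unfold insertProg
  simp only [run_seq, run_store, run_assign]
  refine ⟨⟨?_, ?_, ?_, ?_, ?_, hsh⟩, by simp, by simp⟩
  · simp only [setArr_arr, setArr_var, setVar_var, setVar_arr, Expr.eval, if_true,
      Nat.reduceEqDiff, if_false, h46]
    rw [slice_update, h20]
  · intro b hb
    rcases List.mem_append.1 hb with hb | hb
    · exact hmem b hb
    · rwa [List.mem_singleton.1 hb]
  · rw [List.nodup_append]
    refine ⟨hnd, by simp, ?_⟩
    rintro b hb c hc rfl
    rw [List.mem_singleton.1 hc] at hb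
    exact haT (.inl hb)
  · intro b hb
    have h1 := hins b hb
    simp only [setArr_arr, setArr_var, setVar_var, setVar_arr, Expr.eval, if_true,
      Nat.reduceEqDiff, if_false, h46, htw, Function.update_apply]
    have h2 : X.InT (T ++ [a]) b ↔ X.InT T b ∨ b = a ∨ b = X.tw a := by
      have : X.tw b = a ↔ b = X.tw a :=
        ⟨fun h => by rw [← h, X.tw_tw b hb], fun h => by rw [h, X.tw_tw a ha]⟩
      simp only [InT, List.mem_append, List.mem_singleton, this]
      tauto
    rw [h2, ← h1]
    split_ifs <;> simp_all
  · intro v hv h0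
    exact hdist v hv (by simpa using h0)

/-- Add the edge of the arc in register 46 to the table, unless it closes a short cycle. -/
def tryProg : Prog :=
  .ite (.eq (.var 9) (.const 0))
    (.ite (.eq (.get 18 (.var 46)) (.const 0))
      (clearProg ;; .assign 47 (.get 4 (.var 46)) ;; .assign 48 (.get 4 (.get 8 (.var 46))) ;;
        .store 21 (.var 47) (.const 1) ;; .store 14 (.var 47) (.succ (.var 46)) ;; layersProg ;;
        .ite (.eq (.get 21 (.var 48)) (.const 0)) insertProg
          -- Distances are stored plus 1, so the number compared with `g` is the length of the cycle
          -- that the new edge would close.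
          (.ite (.lt (.var 2) (.get 21 (.var 48))) insertProg
            (.assign 9 (.const 1) ;; .assign 5 (.var 48))))
      .skip)
    .skip

/-- The time that remains when the table holds `T` and has room for `E` edges. -/
def tryPot (E : ℕ) (T : List ℕ) : ℕ := (E + 1 - T.length) * (400 * (E + 2) ^ 2)

theorem tryPot_append {E : ℕ} {T : List ℕ} (a : ℕ) (h : T.length ≤ E) :
    tryPot E T = tryPot E (T ++ [a]) + 400 * (E + 2) ^ 2 := by
  unfold tryPot
  rw [List.length_append, List.length_singleton,
    show E + 1 - T.length = E + 1 - (T.length + 1) + 1 by omega, Nat.succ_mul]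

/-- Either the table is filled with a list that satisfies `P`, or a cycle of length at most `g`
was found; `φ` is the remaining time. -/
def Probe (s : Mem) (X : ArcGraph) (g E : ℕ) (P : List ℕ → Prop) (φ : ℕ) : Prop :=
  (s.var 9 = 0 ∧ ∃ T, Table s X T g ∧ P T ∧ φ = tryPot E T) ∨
    (s.var 9 ≠ 0 ∧ HasCycle s X (fun B => B.length ≤ g) ∧ φ = 0)

theorem Probe.mono {s : Mem} {X : ArcGraph} {g E φ : ℕ} {P Q : List ℕ → Prop}
    (h : Probe s X g E P φ) (hPQ : ∀ T, Table s X T g → P T → Q T) : Probe s X g E Q φ :=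
  h.imp_left fun ⟨h0, T, h1, h2, h3⟩ => ⟨h0, T, h1, hPQ T h1 h2, h3⟩

theorem Probe.congr {s s' : Mem} {X : ArcGraph} {g E φ : ℕ} {P : List ℕ → Prop}
    (h : Probe s X g E P φ) (v9 : s'.var 9 = s.var 9) (v5 : s'.var 5 = s.var 5)
    (v45 : s'.var 45 = s.var 45) (a14 : s'.arr 14 = s.arr 14) (a18 : s'.arr 18 = s.arr 18)
    (a20 : s'.arr 20 = s.arr 20) (a21 : s'.arr 21 = s.arr 21) : Probe s' X g E P φ := by
  refine h.imp (fun ⟨h0, T, h1, h2⟩ => ⟨v9.trans h0, T, h1.congr a20 v45 a18 a21, h2⟩)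
    fun ⟨h0, h1, h2⟩ => ⟨v9.trans_ne h0, ?_, h2⟩
  unfold HasCycle
  rwa [v5, a14]

/-- The parent pointers lead from the target of `a` to its start within the table. The pointer at
the start was set to `a` itself, so following the pointers runs round the whole cycle. It is simple
because `a` is not in the table. -/
theorem Layer.hasCycle {s : Mem} {X : ArcGraph} {T : List ℕ} {a d K g : ℕ} {seen : ℕ → Prop}
    (h : X.Layer T (X.own a) (a + 1) (s.arr 14) (s.arr 21) d 0 K seen) (ha : a ∈ X.L)
    (haT : ¬ X.InT T a) (h0 : s.arr 21 (X.tgt a) ≠ 0) (hg : s.arr 21 (X.tgt a) ≤ g)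
    (h5 : s.var 5 = X.tgt a) : HasCycle s X fun B => B.length ≤ g := by
  have hstep : ∀ v, (v ∈ X.A ∧ s.arr 21 v ≠ 0) → v ≠ X.own a → s.arr 14 v - 1 ∈ X.L ∧
      X.own (s.arr 14 v - 1) = v ∧ (X.tgt (s.arr 14 v - 1) ∈ X.A ∧
        s.arr 21 (X.tgt (s.arr 14 v - 1)) ≠ 0) ∧
      s.arr 21 (X.tgt (s.arr 14 v - 1)) - 1 < s.arr 21 v - 1 := by
    intro v hv hva
    obtain ⟨p, h1, -, h3, h4, h5, h6⟩ := h.parent v hv.1 hv.2 hva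
    simp only [h3, Nat.add_sub_cancel]
    exact ⟨h1, h4, ⟨tgt_mem h1, h5⟩, by omega⟩
  have hne : X.tgt a ≠ X.own a → s.arr 14 (X.tgt a) - 1 ≠ X.tw a := by
    intro hne hf
    obtain ⟨p, h1, h2, h3, -⟩ := h.parent _ (tgt_mem ha) h0 hne
    simp only [h3, Nat.add_sub_cancel] at hf
    subst hf
    have := h2.tw h1
    rw [X.tw_tw a ha] at this
    exact haT this
  obtain ⟨B, h1, h2, h3, h4⟩ := exists_isArcCycle (X := X) (c := a)
    (S := fun v => v ∈ X.A ∧ s.arr 21 v ≠ 0) (f := fun v => s.arr 14 v - 1)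
    (rank := fun v => s.arr 21 v - 1) ha hstep ⟨tgt_mem ha, h0⟩
    ⟨X.own_mem a ha, by rw [h.dist_root]; simp⟩ hne (by simp [h.par_root])
  refine ⟨B, h1, fun b hb => (h2 b hb).trans h5.symm, fun b hb => ?_, by omega⟩
  obtain ⟨h6, h7, h8⟩ := h3 b hb
  by_cases hba : X.own b = X.own a
  · rw [hba] at h6 ⊢
    rw [h.par_root] at h6 ⊢
    omega
  · obtain ⟨p, -, -, h9, -⟩ := h.parent _ h7 h8 hba
    rw [h9] at h6 ⊢
    omega

theorem run_try {s : Mem} {N : Net} {X : ArcGraph} {g E φ a : ℕ} {P : List ℕ → Prop}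
    (hs : Static s N) (hr : Rep s N X) (h : Probe s X g E P φ) (hg : s.var 2 = g)
    (hE : ∀ T, Table s X T g → P T → T.length ≤ E) (h46 : s.var 46 = a) (ha : a ∈ X.L) :
    Run tryProg s fun t s' => ∃ φ', Probe s' X g E
      (fun T' => X.InT T' a ∧ ∃ T, P T ∧ (T' = T ∨ T' = T ++ [a])) φ' ∧ t + φ' ≤ φ + 30 := by
  have h4 : ∀ a, s.arr 4 a = X.own a := fun a => by rw [hs.own, hr.own]
  have htw := hr.tw a ha
  have htgt : X.own (X.tw a) = X.tgt a := rfl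
  unfold tryProg
  rw [run_ite]
  rcases h with ⟨h0, T, hT, hPT, rfl⟩ | ⟨h0, hc, rfl⟩
  swap
  · refine ⟨fun hb => absurd (by simpa using hb) h0, fun _ => ?_⟩
    rw [run_skip]
    exact ⟨0, .inr ⟨h0, hc, rfl⟩, by simp⟩
  refine ⟨fun _ => ?_, fun hb => absurd (by simpa using h0) hb⟩
  have hTE := hE T hT hPT
  rw [run_ite]
  constructor
  swap
  · intro hb
    have haT : X.InT T a := (hT.ins a ha).1 (by simpa [h46] using hb)
    rw [run_skip]
    refine ⟨_, .inl ⟨h0, T, hT, ⟨haT, T, hPT, .inl rfl⟩, rfl⟩, ?_⟩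
    simp only [Test.cost, Expr.cost]
    omega
  intro hb
  have haT : ¬ X.InT T a := fun h => (hT.ins a ha).2 h (by simpa [h46] using hb)
  rw [run_seq]
  refine (run_clear hs hr hT).mono fun t₁ s₁ hf₁ h => ?_
  obtain ⟨hz, ht₁⟩ := h
  have hs₁ : Static s₁ N := hs.of_framed hf₁ rfl rfl rfl rfl rfl
  have hr₁ : Rep s₁ N X := hr.congr (hf₁.arr 8 rfl) (hf₁.arr 9 rfl) (hf₁.arr 10 rfl) (hf₁.arr 11 rfl)
  have e4 : s₁.arr 4 = s.arr 4 := hf₁.arr 4 rfl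
  have e8 : s₁.arr 8 = s.arr 8 := hf₁.arr 8 rfl
  have e46 : s₁.var 46 = a := (hf₁.var 46 rfl).trans h46
  simp only [run_seq, run_assign, run_store]
  refine (run_layers (N := N) (X := X) (T := T) (u := X.own a) (r := a + 1)
    ?_ ?_ ?_ hT.mem (X.own_mem a ha) ?_ ?_).mono fun t₂ s₂ hf₂ h => ?_
  · exact ⟨by simpa using hs₁.n, hs₁.own, hs₁.otw, hs₁.list⟩
  · exact hr₁.congr rfl rfl rfl rfl
  · simpa [hf₁.arr 20 rfl, hf₁.var 45 rfl] using hT.eq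
  · simp [e4, e46, h4]
  · intro v hv
    simp [e4, e46, h4, Function.update_apply, hz v hv]
  obtain ⟨⟨d, K, seen, hL⟩, hd, ht₂⟩ := h
  have hs₂ : Static s₂ N := by
    refine Static.of_framed ?_ hf₂ rfl rfl rfl rfl rfl
    exact ⟨by simpa using hs₁.n, hs₁.own, hs₁.otw, hs₁.list⟩
  have hr₂ : Rep s₂ N X :=
    hr₁.congr (hf₂.arr 8 rfl) (hf₂.arr 9 rfl) (hf₂.arr 10 rfl) (hf₂.arr 11 rfl)
  have f46 : s₂.var 46 = a := by
    rw [hf₂.var 46 rfl]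
    simpa using e46
  have f48 : s₂.var 48 = X.tgt a := by
    rw [hf₂.var 48 rfl]
    simp [e4, e8, e46, h4, htw, htgt]
  have f2 : s₂.var 2 = g := by
    rw [hf₂.var 2 rfl]
    simp [hf₁.var 2 rfl, hg]
  have f9 : s₂.var 9 = 0 := by
    rw [hf₂.var 9 rfl]
    simp [hf₁.var 9 rfl, h0]
  -- Resetting takes at most `30 * E + 10` steps and the layers at most `300 * (E + 1) ^ 2`, so the
  -- price of one insertion covers them.
  have ht : t₁ + t₂ + 100 ≤ 400 * (E + 2) ^ 2 := by
    have h1 : (T.length + 1) ^ 2 ≤ (E + 1) ^ 2 := Nat.pow_le_pow_left (by omega) 2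
    have h2 : (E + 2) ^ 2 = (E + 1) ^ 2 + 2 * E + 3 := by ring
    have h3 : E + 1 ≤ (E + 1) ^ 2 := Nat.le_self_pow (by simp) _
    omega
  have hpot := tryPot_append a hTE
  have hins : ∀ n, X.NoShort (T ++ [a]) g → n + 13 ≤ 400 * (E + 2) ^ 2 + 30 →
      Run insertProg s₂ fun t s' => ∃ φ', Probe s' X g E
        (fun T' => X.InT T' a ∧ ∃ T, P T ∧ (T' = T ∨ T' = T ++ [a])) φ' ∧
          n + t + φ' ≤ tryPot E T + 30 := by
    intro n hsh hn
    refine (run_insert (N := N) (X := X) (T := T) (a := a) (g := g) hr₂ ?_ hT.mem hT.nodup ?_ ?_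
      f46 ha haT hsh).mono fun t₃ s₃ hf₃ h => ?_
    · rw [hf₂.arr 20 rfl, hf₂.var 45 rfl]
      simpa [hf₁.arr 20 rfl, hf₁.var 45 rfl] using hT.eq
    · rw [hf₂.arr 18 rfl]
      simpa [hf₁.arr 18 rfl] using hT.ins
    · intro v hv hv0
      by_cases hva : v = X.own a
      · exact ⟨a, ha, .inl (by simp), hva.symm⟩
      · obtain ⟨p, h1, h2, -, h3, -⟩ := hL.parent v hv hv0 hva
        exact ⟨p, h1, h2.append _, h3⟩
    · obtain ⟨h1, h2, h3⟩ := h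
      exact ⟨_, .inl ⟨h2.trans f9, _, h1, ⟨.inl (by simp), T, hPT, .inr rfl⟩, rfl⟩, by omega⟩
  rw [run_ite]
  constructor
  · intro hb
    have hb : s₂.arr 21 (X.tgt a) = 0 := by simpa [f48] using hb
    refine (hins (t₁ + t₂ + 50) (hT.short.add hd hL.dist_root (.inl hb) ha) (by omega)).mono
      fun t₃ s₃ _ h => ?_
    obtain ⟨φ', h1, h2⟩ := h
    refine ⟨φ', h1, ?_⟩
    simp only [Test.cost, Expr.cost]
    omega
  · intro hb
    have hb : s₂.arr 21 (X.tgt a) ≠ 0 := by simpa [f48] using hb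
    rw [run_ite]
    constructor
    · intro hb'
      have hb' : g < s₂.arr 21 (X.tgt a) := by simpa [f48, f2] using hb'
      refine (hins (t₁ + t₂ + 50) (hT.short.add hd hL.dist_root (.inr hb') ha) (by omega)).mono
        fun t₃ s₃ _ h => ?_
      obtain ⟨φ', h1, h2⟩ := h
      refine ⟨φ', h1, ?_⟩
      simp only [Test.cost, Expr.cost]
      omega
    · intro hb'
      have hb' : s₂.arr 21 (X.tgt a) ≤ g := by simpa [f48, f2] using hb'
      simp only [run_seq, run_assign]
      refine ⟨0, .inr ⟨by simp, ?_, rfl⟩, ?_⟩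
      · refine Layer.hasCycle (d := d) (K := K) (seen := seen) (T := T) (a := a) ?_ ha haT ?_ ?_ ?_
        · simpa using hL
        · simpa using hb
        · simpa using hb'
        · simpa using f48
      · simp only [Test.cost, Expr.cost]
        omega

end RAM

/-! ### Keeping the table small. -/

namespace ArcGraph

variable {X : ArcGraph} {T T' : List ℕ} {a : ℕ} {F W W' : ℕ → Prop}

/-- The list `T'` represents the edges in `T` and the edge of `a`. -/
def Adds (X : ArcGraph) (T T' : List ℕ) (a : ℕ) : Prop :=
  ∀ b ∈ X.L, X.InT T' b ↔ X.InT T b ∨ b = a ∨ b = X.tw a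

theorem Adds.mono (h : X.Adds T T' a) : ∀ b ∈ X.L, X.InT T b → X.InT T' b :=
  fun b hb hT => (h b hb).2 (.inl hT)

theorem Adds.self (h : X.Adds T T' a) (ha : a ∈ X.L) : X.InT T' a := (h a ha).2 (.inr (.inl rfl))

theorem adds_of (ha : a ∈ X.L) (haT : X.InT T' a) (h : T' = T ∨ T' = T ++ [a]) :
    X.Adds T T' a := by
  intro b hb
  constructor
  · intro h'
    rcases h with rfl | rfl
    · exact .inl h'
    · simp only [InT, List.mem_append, List.mem_singleton] at h' ⊢
      rcases h' with (h' | h') | (h' | h')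
      · exact .inl (.inl h')
      · exact .inr (.inl h')
      · exact .inl (.inr h')
      · exact .inr (.inr (by rw [← h', X.tw_tw b hb]))
  · rintro (h' | rfl | rfl)
    · rcases h with rfl | rfl
      · exact h'
      · exact h'.append _
    · exact haT
    · exact haT.tw ha

/-- A vertex that may be an end of an edge in `T`. -/
def Good (X : ArcGraph) (F : ℕ → Prop) (T : List ℕ) (W : ℕ → Prop) (v : ℕ) : Prop :=
  F v ∨ X.Twice F T v ∨ W v

/-- All ends of the edges in `T` are good. -/
def Shape (X : ArcGraph) (F : ℕ → Prop) (T : List ℕ) (W : ℕ → Prop) : Prop :=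
  ∀ b ∈ X.L, X.InT T b → X.Good F T W (X.own b)

theorem Shape.adds (h : X.Shape F T W) (hT : X.Adds T T' a) (ha : a ∈ X.L)
    (hW : ∀ v, W v → X.Good F T' W' v) (h1 : X.Good F T' W' (X.own a))
    (h2 : X.Good F T' W' (X.tgt a)) : X.Shape F T' W' := by
  intro b hb hbT
  rcases (hT b hb).1 hbT with hbT | rfl | rfl
  · rcases h b hb hbT with h | h | h
    · exact .inl h
    · exact .inr (.inl (h.mono hT.mono))
    · exact hW _ h
  · exact h1
  · exact h2

-- The ends of the edges lie in `F`, among the at most `f ^ 2` vertices with two edges to `F`, or in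
-- `W`; and the number of edges is at most the square of the number of ends.
open scoped Classical in
theorem Shape.length_le {g f w : ℕ} (h : X.Shape F T W) (hT : X.NoShort T g) (hg : 6 ≤ g)
    (hnd : T.Nodup) (hTL : ∀ a ∈ T, a ∈ X.L) (hF : (X.A.filter F).card ≤ f)
    (hW : (X.A.filter W).card ≤ w) : T.length ≤ (f + f ^ 2 + w) ^ 2 := by
  refine (hT.length_le (by omega) hnd hTL (V := X.A.filter F ∪
    (X.A.filter fun v => ¬ F v ∧ X.Twice F T v) ∪ X.A.filter W) fun a ha haT => ?_).trans ?_
  · have := h a ha haT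
    have hA := X.own_mem a ha
    simp only [Finset.mem_union, Finset.mem_filter]
    unfold Good at this
    tauto
  · refine Nat.pow_le_pow_left ((Finset.card_union_le _ _).trans (Nat.add_le_add
      ((Finset.card_union_le _ _).trans (Nat.add_le_add hF ?_)) hW)) 2
    exact (hT.card_twice (by omega)).trans (Nat.pow_le_pow_left hF 2)

end ArcGraph

/-! ### A loop over all arcs of the current graph. -/

namespace RAM

open ArcGraph

/-- Run `p` for every arc of the current graph: register 55 holds the vertex at which the arc
starts, and register 54 the arc plus 1. -/
def forArcs (p : Prog) : Prog :=
  .assign 55 (.const 0) ;;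
  Prog.for 55 0 (.ite (.eq (.get 10 (.var 55)) (.const 0)) .skip
    (Prog.each 54 7 (.get 6 (.var 55)) (.ite (.eq (.get 9 (.pred (.var 54))) (.const 0)) p .skip)))

/-- What the body of a loop over the arcs must not write. -/
structure ReadOnly (p : Prog) : Prop where
  var : ∀ x, x = 0 ∨ x = 54 ∨ x = 55 → p.wv x = false
  arr : ∀ x, 4 ≤ x → x ≤ 11 → p.wa x = false

/-- The set `D` collects the arcs that have been treated. `hset` is needed because the loop changes
its own registers 54 and 55. Beyond its potential the body may spend `c` steps per arc. -/
theorem run_forArcs {s : Mem} {N : Net} {X : ArcGraph} {p : Prog} {φ : ℕ} (c : ℕ)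
    (I : Finset ℕ → ℕ → Mem → Prop) (hp : ReadOnly p) (hs : Static s N) (hr : Rep s N X)
    (hset : ∀ D φ s x m, x = 54 ∨ x = 55 → I D φ s → I D φ (s.setVar x m)) (h0 : I ∅ φ s)
    (hbody : ∀ a ∈ X.L, ∀ D φ s₁, I D φ s₁ → Static s₁ N → Rep s₁ N X → Framed (forArcs p) s s₁ →
      s₁.var 54 = a + 1 → s₁.var 55 = X.own a →
      Run p s₁ fun t s₂ => ∃ φ', I (insert a D) φ' s₂ ∧ t + φ' ≤ φ + c)
    {Q : ℕ → Mem → Prop}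
    (hpost : ∀ t D φ' s', I D φ' s' → X.L ⊆ D → Static s' N → Rep s' N X →
      Framed (forArcs p) s s' → t + φ' ≤ φ + (c + 60) * (N.n + N.m) + 10 → Q t s') :
    Run (forArcs p) s Q := by
  have w : ∀ x, x = 0 ∨ 4 ≤ x ∧ x ≤ 11 →
      (forArcs p).wa x = p.wa x ∧ ((forArcs p).wv 0 = false) := by
    intro x hx
    simp [forArcs, Prog.for, Prog.each, Prog.wa, Prog.wv, hp.var 0 (.inl rfl)]
  have wa : ∀ x, 4 ≤ x → x ≤ 11 → (forArcs p).wa x = false := fun x h1 h2 =>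
    (w x (.inr ⟨h1, h2⟩)).1.trans (hp.arr x h1 h2)
  have w0 : (forArcs p).wv 0 = false := (w 0 (.inl rfl)).2
  have hst : ∀ s₁, Framed (forArcs p) s s₁ → Static s₁ N := fun s₁ hf =>
    hs.of_framed hf w0 (wa 4 (by simp) (by simp)) (wa 5 (by simp) (by simp))
      (wa 6 (by simp) (by simp)) (wa 7 (by simp) (by simp))
  have hre : ∀ s₁, Framed (forArcs p) s s₁ → Rep s₁ N X := fun s₁ hf =>
    hr.congr (hf.arr 8 (wa 8 (by simp) (by simp))) (hf.arr 9 (wa 9 (by simp) (by simp)))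
      (hf.arr 10 (wa 10 (by simp) (by simp))) (hf.arr 11 (wa 11 (by simp) (by simp)))
  have hfr : ∀ q s₁ m, (∀ x, q.wv x = true → (forArcs p).wv x = true) →
      (∀ x, q.wa x = true → (forArcs p).wa x = true) → Framed q (s.setVar 55 m) s₁ →
      Framed (forArcs p) s s₁ := by
    intro q s₁ m h1 h2 hf
    refine ⟨fun x hx => ?_, fun x hx => ?_⟩
    · rw [hf.var x (by by_contra h; simp [h1 x (by simpa using h)] at hx)]
      have : x ≠ 55 := by rintro rfl; simp [forArcs, Prog.wv] at hx
      simp [this]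
    · exact hf.arr x (by by_contra h; simp [h2 x (by simpa using h)] at hx)
  have hp54 := hp.var 54 (by simp)
  have hp55 := hp.var 55 (by simp)
  conv => enter [1]; unfold forArcs
  rw [run_seq, run_assign]
  refine Run.for (N := N.n)
    (φ := φ + 40 * N.n + (c + 60) * ∑ v ∈ Finset.Ico 0 N.n, (N.adj v).length)
    (fun i Φ s₁ => ∃ D φ₁, I D φ₁ s₁ ∧ (∀ a ∈ X.L, X.own a < i → a ∈ D) ∧
      Φ = φ₁ + 40 * (N.n - i) + (c + 60) * ∑ v ∈ Finset.Ico i N.n, (N.adj v).length)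
    (by simp [Prog.wv, Prog.each, hp55]) (by simp [Prog.wv, Prog.each, hp.var 0 (.inl rfl)])
    (by decide) (by simpa using hs.n) (by simp)
    ⟨∅, φ, hset _ _ _ _ _ (.inr rfl) h0, by simp, by simp⟩ ?_ ?_
  · rintro i Φ s₁ ⟨D, φ₁, hI, hD, rfl⟩ hf hx hi
    have hf' : Framed (forArcs p) s s₁ := hfr _ _ _ (fun x h => by
      simp only [forArcs, Prog.wv, Bool.or_eq_true]; exact .inr h) (fun x h => by
      simp only [forArcs, Prog.wa, Bool.or_eq_true]; exact .inr h) hf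
    have hs₁ := hst s₁ hf'
    have hr₁ := hre s₁ hf'
    have hal := hr₁.alive i hi
    have hsum : ∑ v ∈ Finset.Ico i N.n, (N.adj v).length =
        (N.adj i).length + ∑ v ∈ Finset.Ico (i + 1) N.n, (N.adj v).length :=
      Finset.sum_eq_sum_Ico_succ_bot hi _
    have hsub : N.n - i = N.n - (i + 1) + 1 := by omega
    rw [run_ite]
    constructor
    · intro hb
      have hb : i ∉ X.A := fun h => hal.2 h (by simpa [hx] using hb)
      rw [run_skip]
      refine ⟨_, ⟨D, φ₁, hset _ _ _ _ _ (.inr rfl) hI, fun a ha hai => ?_, rfl⟩, ?_⟩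
      · rcases Nat.lt_succ_iff_lt_or_eq.1 hai with h | rfl
        · exact hD a ha h
        · exact absurd (X.own_mem a ha) hb
      · simp only [Test.cost, Expr.cost, hsum, hsub, Nat.mul_add]
        omega
    · intro hb
      have hiA : i ∈ X.A := hal.1 (by simpa [hx] using hb)
      refine Run.each (φ := φ₁ + (c + 60) * (N.adj i).length) (l := N.adj i)
        (fun r Φ s₂ => ∃ D φ₂, I D φ₂ s₂ ∧ (∀ a ∈ X.L, X.own a < i → a ∈ D) ∧
          (∀ a ∈ X.L, X.own a = i → a ∉ r → a ∈ D) ∧ Φ = φ₂ + (c + 60) * r.length)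
        (by simp [Prog.wv, hp54]) (by simp [Prog.wa, hp.arr 7]) ?_
        ⟨D, φ₁, hset _ _ _ _ _ (.inl rfl) hI, hD, fun a ha h1 h2 => ?_, rfl⟩ ?_ ?_
      · simpa [hx] using hs₁.list i hi
      · exact absurd ((hr₁.mem_adj hi).2 ⟨hr₁.L_lt a ha, h1⟩) h2
      · rintro a r Φ s₂ ⟨D, φ₂, hI, hD1, hD2, rfl⟩ hf₂ hx₂ ⟨d, hd⟩
        have hf₂' : Framed (forArcs p) s s₂ := by
          refine hf'.trans ⟨fun x hx => hf₂.var x ?_, fun x hx => hf₂.arr x ?_⟩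
          · by_contra h
            simp only [Bool.not_eq_false] at h
            simp [forArcs, Prog.wv, Prog.for, h] at hx
          · by_contra h
            simp only [Bool.not_eq_false] at h
            simp [forArcs, Prog.wa, Prog.for, h] at hx
        have hs₂ := hst s₂ hf₂'
        have hr₂ := hre s₂ hf₂'
        have ha : a ∈ N.adj i := by simp [hd]
        obtain ⟨ham, hai⟩ := (hr₂.mem_adj hi).1 ha
        have hx55 : s₂.var 55 = i := by
          rw [hf₂.var 55 (by simp [Prog.each, Prog.wv, hp55])]
          exact hx
        have hlive := hr₂.live a ham (by rw [← hr.own, hai]; exact hiA)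
        have hD2' : ∀ b ∈ X.L, X.own b = i → b ∉ r → b ∈ D ∨ b = a := by
          intro b hb hbi hbr
          by_cases hba : b = a
          · exact .inr hba
          · exact .inl (hD2 b hb hbi (by simp [hba, hbr]))
        rw [run_ite]
        constructor
        · intro hb
          have haL : a ∈ X.L := hlive.1 (by simpa [hx₂] using hb)
          refine (hbody a haL D φ₂ s₂ hI hs₂ hr₂ hf₂' hx₂ (by rw [hx55, hai])).mono
            fun t s₃ hf₃ h => ?_
          obtain ⟨φ', hI', ht⟩ := h
          refine ⟨_, ⟨insert a D, φ', hset _ _ _ _ _ (.inl rfl) hI', fun b hb hbi => ?_,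
            fun b hb hbi hbr => ?_, rfl⟩, ?_⟩
          · exact Finset.mem_insert_of_mem (hD1 b hb hbi)
          · exact Finset.mem_insert.2 (hD2' b hb hbi hbr).symm
          · simp only [Test.cost, Expr.cost, List.length_cons, Nat.mul_succ]
            omega
        · intro hb
          have haL : a ∉ X.L := fun h => hb (by simpa [hx₂] using hlive.2 h)
          rw [run_skip]
          refine ⟨_, ⟨D, φ₂, hset _ _ _ _ _ (.inl rfl) hI, hD1, fun b hb hbi hbr => ?_, rfl⟩, ?_⟩
          · rcases hD2' b hb hbi hbr with h | rfl
            · exact h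
            · exact absurd hb haL
          · simp only [Test.cost, Expr.cost, List.length_cons, Nat.mul_succ]
            omega
      · rintro t Φ s₂ ⟨D, φ₂, hI, hD1, hD2, hΦ⟩ hf₂ ht
        refine ⟨_, ⟨D, φ₂, hset _ _ _ _ _ (.inr rfl) hI, fun b hb hbi => ?_, rfl⟩, ?_⟩
        · rcases Nat.lt_succ_iff_lt_or_eq.1 hbi with h | rfl
          · exact hD1 b hb h
          · exact hD2 b hb rfl (by simp)
        · simp only [Expr.cost] at ht
          simp only [List.length_nil, Nat.mul_zero] at hΦ
          simp only [Test.cost, Expr.cost, hsum, hsub, Nat.mul_add]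
          omega
  · rintro t Φ s' ⟨D, φ', hI, hD, rfl⟩ hf hx ht
    have hf' : Framed (forArcs p) s s' := hfr _ _ _ (fun x h => by
      simp only [forArcs, Prog.wv, Bool.or_eq_true]; exact .inr h) (fun x h => by
      simp only [forArcs, Prog.wa, Bool.or_eq_true]; exact .inr h) hf
    have hr' := hre s' hf'
    refine hpost _ D φ' s' hI (fun a ha => hD a ha ?_) (hst s' hf') hr' hf' ?_
    · exact hr'.A_lt _ (X.own_mem a ha)
    · have h1 := N.sum_length
      rw [← Finset.range_eq_Ico, h1] at ht
      have h2 : 40 * N.n ≤ (c + 60) * N.n := Nat.mul_le_mul_right _ (by omega)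
      simp only [Expr.cost, Nat.mul_add]
      omega

end RAM

/-! ### The passes that look for short cycles near `F`. -/

namespace ArcGraph

variable {X : ArcGraph} {T T' : List ℕ} {a b : ℕ} {F : ℕ → Prop} {fa : ℕ → ℕ}

/-- If the arc `b` leads to `F`, then it is the arc stored in `fa`, or two edges in `T` lead from
its start to `F`. -/
def First (X : ArcGraph) (F : ℕ → Prop) (T : List ℕ) (fa : ℕ → ℕ) (b : ℕ) : Prop :=
  X.own b ≠ X.tgt b ∧ (¬ F (X.own b) → F (X.tgt b) →
    fa (X.own b) ≠ 0 ∧ (fa (X.own b) = b + 1 ∨ X.Twice F T (X.own b)))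

theorem First.mono (h : X.First F T fa b) (hT : ∀ b ∈ X.L, X.InT T b → X.InT T' b) :
    X.First F T' fa b :=
  ⟨h.1, fun h1 h2 => ⟨(h.2 h1 h2).1, (h.2 h1 h2).2.imp_right fun h => h.mono hT⟩⟩

/-- The vertices at which the middle edge of a path of three edges in `T` starts. -/
def AtMiddle (X : ArcGraph) (F : ℕ → Prop) (T : List ℕ) (fa : ℕ → ℕ) (v : ℕ) : Prop :=
  ∃ c, X.Middle F (fun v => fa v - 1) T c ∧ X.own c = v

theorem AtMiddle.mono {v : ℕ} (h : X.AtMiddle F T fa v)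
    (hT : ∀ b ∈ X.L, X.InT T b → X.InT T' b) : X.AtMiddle F T' fa v :=
  h.imp fun _ h => ⟨h.1.mono hT, h.2⟩

-- The places `x` and `y` are for the ends of the arc whose path is being inserted.
open scoped Classical in
theorem card_atMiddle {g f : ℕ} (hT : X.NoShort T g) (hg : 6 ≤ g) (hF : (X.A.filter F).card ≤ f)
    (x y : ℕ) : (X.A.filter fun v => X.AtMiddle F T fa v ∨ v = x ∨ v = y).card ≤ f ^ 2 + 2 := by
  refine (Finset.card_le_card (t := ((X.L.filter fun a =>
    X.Middle F (fun v => fa v - 1) T a).image X.own) ∪ {x, y}) fun v hv => ?_).trans ?_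
  · obtain ⟨-, hv⟩ := Finset.mem_filter.1 hv
    rw [Finset.mem_union, Finset.mem_insert, Finset.mem_singleton, Finset.mem_image]
    refine hv.imp_left ?_
    rintro ⟨c, h1, h2⟩
    exact ⟨c, Finset.mem_filter.2 ⟨h1.1, h1⟩, h2⟩
  · refine (Finset.card_union_le _ _).trans (Nat.add_le_add (Finset.card_image_le.trans ?_)
      Finset.card_le_two)
    exact (hT.card_middle hg).trans (Nat.pow_le_pow_left hF 2)

/-- If both ends of the arc `b` are joined to `F`, then `b` is the middle of a path in `T`. -/
def Second (X : ArcGraph) (F : ℕ → Prop) (T : List ℕ) (fa : ℕ → ℕ) (b : ℕ) : Prop :=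
  ¬ F (X.own b) → ¬ F (X.tgt b) → fa (X.own b) ≠ 0 → fa (X.tgt b) ≠ 0 →
    X.Middle F (fun v => fa v - 1) T b

theorem Second.mono (h : X.Second F T fa b) (hT : ∀ b ∈ X.L, X.InT T b → X.InT T' b) :
    X.Second F T' fa b :=
  fun h1 h2 h3 h4 => (h h1 h2 h3 h4).mono hT

-- Of two arcs from a vertex to `F` at most one is the stored one, so the other shows that the table
-- contains two edges from that vertex to `F`. Likewise every arc between neighbours of `F` is a
-- middle in the table. As the table has no short cycle, both kinds number at most `f ^ 2`, which is
-- what `card_le_of_sparse` requires.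
open scoped Classical in
theorem card_le_of_first_second {g f : ℕ} (hT : X.NoShort T g) (hg : 6 ≤ g)
    (hS : X.mg.Sparse (X.A.filter F)) (hred : ∀ v, ¬ X.Red v) (hF : (X.A.filter F).card ≤ f)
    (h1 : ∀ b ∈ X.L, X.First F T fa b) (h2 : ∀ b ∈ X.L, X.Second F T fa b) :
    X.A.card ≤ f + 7 * f ^ 2 := by
  have hf2 : (X.A.filter F).card ^ 2 ≤ f ^ 2 := Nat.pow_le_pow_left hF 2
  refine (card_le_of_sparse (r := f ^ 2) hS hred (fun a ha => (h1 a ha).1) ?_ ?_).trans (by omega)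
  · refine (Finset.card_le_card fun v hv => ?_).trans ((hT.card_twice (F := F) (by omega)).trans hf2)
    obtain ⟨hvA, hvF, hv⟩ := Finset.mem_filter.1 hv
    refine Finset.mem_filter.2 ⟨hvA, hvF, ?_⟩
    obtain ⟨a, ha, b, hb, hab⟩ := Finset.one_lt_card.1 hv
    rw [Finset.mem_filter, mem_arcsAt] at ha hb
    obtain ⟨⟨ha, rfl⟩, ha'⟩ := ha
    obtain ⟨⟨hb, hba⟩, hb'⟩ := hb
    rcases ((h1 a ha).2 hvF ha').2 with h3 | h3
    · rcases ((h1 b hb).2 (hba ▸ hvF) hb').2 with h4 | h4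
      · rw [hba, h3] at h4
        omega
      · rwa [hba] at h4
    · exact h3
  · refine (Finset.card_le_card fun a ha => ?_).trans
      ((hT.card_middle (F := F) (f := fun v => fa v - 1) hg).trans hf2)
    obtain ⟨haL, ha⟩ := Finset.mem_filter.1 ha
    have h3 : ∀ v, v = X.own a ∨ v = X.tgt a → ¬ F v ∧ fa v ≠ 0 := by
      intro v hv
      obtain ⟨h4, b, hb, rfl, h5⟩ := ha v hv
      exact ⟨h4, ((h1 b hb).2 h4 h5).1⟩
    exact Finset.mem_filter.2 ⟨haL, h2 a haL (h3 _ (.inl rfl)).1 (h3 _ (.inr rfl)).1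
      (h3 _ (.inl rfl)).2 (h3 _ (.inr rfl)).2⟩

end ArcGraph

namespace RAM

open ArcGraph

/-- Add the edge of an arc to the table, unless it closes a short cycle. -/
def tryArc (e : Expr) : Prog := .assign 46 e ;; tryProg

theorem run_tryArc {s : Mem} {N : Net} {X : ArcGraph} {g E φ a : ℕ} {P : List ℕ → Prop} {e : Expr}
    (hs : Static s N) (hr : Rep s N X) (h : Probe s X g E P φ) (hg : s.var 2 = g)
    (hE : ∀ T, Table s X T g → P T → T.length ≤ E) (he : e.eval s = a) (ha : a ∈ X.L)
    (hc : e.cost ≤ 9) :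
    Run (tryArc e) s fun t s' => ∃ φ', Probe s' X g E (fun T' => ∃ T, P T ∧ X.Adds T T' a) φ' ∧
      t + φ' ≤ φ + 40 := by
  unfold tryArc
  rw [run_seq, run_assign]
  refine (run_try (N := N) (X := X) (g := g) (E := E) (φ := φ) (a := a) (P := P) ?_ ?_ ?_ ?_ ?_ ?_
    ha).mono fun t s₁ _ h' => ?_
  · exact ⟨by simpa using hs.n, hs.own, hs.otw, hs.list⟩
  · exact hr.congr rfl rfl rfl rfl
  · exact h.congr (by simp) (by simp) (by simp) rfl rfl rfl rfl
  · simpa using hg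
  · exact fun T hT => hE T (hT.congr rfl (by simp) rfl rfl)
  · simpa using he
  · obtain ⟨φ', h1, h2⟩ := h'
    refine ⟨φ', h1.mono ?_, by omega⟩
    rintro T' - ⟨h3, T, h4, h5⟩
    exact ⟨T, h4, adds_of ha h3 h5⟩

/-- The first pass: find loops, and two edges from a vertex to `F`. -/
def passOne : Prog :=
  .ite (.eq (.get 4 (.get 8 (.pred (.var 54)))) (.var 55)) (tryArc (.pred (.var 54)))
    (.ite (.eq (.get 13 (.var 55)) (.const 0))
      (.ite (.eq (.get 13 (.get 4 (.get 8 (.pred (.var 54))))) (.const 0)) .skip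
        (.ite (.eq (.get 19 (.var 55)) (.const 0)) (.store 19 (.var 55) (.var 54))
          (.ite (.eq (.get 19 (.var 55)) (.var 54)) .skip
            (tryArc (.pred (.get 19 (.var 55))) ;; tryArc (.pred (.var 54))))))
      .skip)

/-- The invariant of the first pass. -/
def InvOne (X : ArcGraph) (F : ℕ → Prop) (g E : ℕ) (D : Finset ℕ) (φ : ℕ) (s : Mem) : Prop :=
  (∀ v ∈ X.A, s.arr 19 v ≠ 0 → s.arr 19 v - 1 ∈ X.L ∧ X.own (s.arr 19 v - 1) = v ∧
    F (X.tgt (s.arr 19 v - 1))) ∧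
  Probe s X g E (fun T => X.Shape F T (fun _ => False) ∧
    ∀ b ∈ D, b ∈ X.L → X.First F T (s.arr 19) b) φ

/-- This size accommodates the ends of edges during the two passes, at most `f + f ^ 2 + (f ^ 2 +
2)`, as well as the `f + 7 f ^ 2` vertices of the whole graph in the last pass. -/
theorem sq_le_room {f E x : ℕ} (hE : 64 * (f + 1) ^ 4 ≤ E) (hx : x ≤ f + 7 * f ^ 2 + 2) :
    x ^ 2 ≤ E := by
  have h1 : x ≤ 8 * (f + 1) ^ 2 := by nlinarith
  calc x ^ 2 ≤ (8 * (f + 1) ^ 2) ^ 2 := Nat.pow_le_pow_left h1 2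
    _ = 64 * (f + 1) ^ 4 := by ring
    _ ≤ E := hE

open scoped Classical in
theorem run_passOne {s : Mem} {N : Net} {X : ArcGraph} {F : ℕ → Prop} {g E f φ a : ℕ}
    {D : Finset ℕ} (hs : Static s N) (hr : Rep s N X) (hg : s.var 2 = g) (h6 : 6 ≤ g)
    (hF : ∀ v, s.arr 13 v ≠ 0 ↔ F v) (hf : (X.A.filter F).card ≤ f)
    (hE : 64 * (f + 1) ^ 4 ≤ E) (hI : InvOne X F g E D φ s) (ha : a ∈ X.L)
    (h54 : s.var 54 = a + 1) (h55 : s.var 55 = X.own a) :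
    Run passOne s fun t s' => ∃ φ', InvOne X F g E (insert a D) φ' s' ∧ t + φ' ≤ φ + 200 := by
  obtain ⟨hfa, hP⟩ := hI
  have h4 : ∀ a, s.arr 4 a = X.own a := fun a => by rw [hs.own, hr.own]
  have htgt : s.arr 4 (s.arr 8 (s.var 54 - 1)) = X.tgt a := by
    rw [h54, Nat.add_sub_cancel, hr.tw a ha, h4]
    rfl
  have hroom : ∀ (W : ℕ → Prop) (T : List ℕ), (∀ x y, W x → W y → x = y) → X.NoShort T g →
      T.Nodup → (∀ a ∈ T, a ∈ X.L) → X.Shape F T W → T.length ≤ E := by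
    intro W T hW h1 h2 h3 h4
    refine (h4.length_le (w := 1) h1 h6 h2 h3 hf ?_).trans (sq_le_room hE (by omega))
    exact Finset.card_le_one.2 fun x hx y hy =>
      hW x y (Finset.mem_filter.1 hx).2 (Finset.mem_filter.1 hy).2
  have hmono : ∀ {φ' : ℕ} {s' : Mem}, s'.arr 19 = s.arr 19 → (Probe s' X g E (fun T =>
      X.Shape F T (fun _ => False) ∧ (∀ b ∈ D, b ∈ X.L → X.First F T (s.arr 19) b) ∧
        X.First F T (s.arr 19) a) φ') → InvOne X F g E (insert a D) φ' s' := by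
    intro φ' s' h19 h
    rw [InvOne, h19]
    refine ⟨hfa, h.mono ?_⟩
    rintro T - ⟨h1, h2, h3⟩
    refine ⟨h1, fun b hb => ?_⟩
    rcases Finset.mem_insert.1 hb with rfl | hb
    · exact fun _ => h3
    · exact h2 b hb
  have hE0 : ∀ T, Table s X T g → X.Shape F T (fun _ => False) ∧
      (∀ b ∈ D, b ∈ X.L → X.First F T (s.arr 19) b) → T.length ≤ E := fun T hT h =>
    hroom _ T (by simp) hT.short hT.nodup hT.mem h.1
  unfold passOne
  rw [run_ite]
  constructor
  · intro hb
    have hb : X.tgt a = X.own a := by simpa [htgt, h55] using hb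
    refine (run_tryArc hs hr hP hg hE0 (a := a) (by simp [h54]) ha (by simp)).mono
      fun t s' hf h => ?_
    obtain ⟨φ', h1, h2⟩ := h
    refine ⟨φ', hmono (hf.arr 19 rfl) (h1.mono ?_), by simp only [Test.cost, Expr.cost]; omega⟩
    -- A loop in the table would be a cycle of length 1, so its insertion must have ended with a
    -- cycle.
    rintro T' hT' ⟨T, -, h4⟩
    exact absurd hb.symm (hT'.short.ne_loop (by omega) ha (h4.self ha))
  intro hb
  have hne : X.own a ≠ X.tgt a := fun h => hb (by simp [htgt, h55, h])
  have hskip : ∀ n, n ≤ 200 → (¬ F (X.own a) → F (X.tgt a) → s.arr 19 (X.own a) = a + 1) →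
      ∃ φ', InvOne X F g E (insert a D) φ' s ∧ n + φ' ≤ φ + 200 := by
    intro n hn h
    refine ⟨φ, hmono rfl (hP.mono ?_), by omega⟩
    rintro T - ⟨h1, h2⟩
    exact ⟨h1, h2, hne, fun h3 h4 => ⟨by rw [h h3 h4]; simp, .inl (h h3 h4)⟩⟩
  rw [run_ite]
  constructor
  swap
  · intro hb
    have hb : F (X.own a) := (hF _).1 (by simpa [h55] using hb)
    rw [run_skip]
    exact hskip _ (by simp) fun h => absurd hb h
  intro hb
  have hvF : ¬ F (X.own a) := fun h => (hF _).2 h (by simpa [h55] using hb)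
  rw [run_ite]
  constructor
  · intro hb
    have hb : ¬ F (X.tgt a) := fun h => (hF _).2 h (by simpa [htgt] using hb)
    rw [run_skip]
    exact hskip _ (by simp) fun _ h => absurd h hb
  intro hb
  have hwF : F (X.tgt a) := (hF _).1 (by simpa [htgt] using hb)
  rw [run_ite]
  constructor
  · intro hb
    have hb : s.arr 19 (X.own a) = 0 := by simpa [h55] using hb
    rw [run_store]
    have e19 : (s.setArr 19 (Expr.eval s (.var 55)) (Expr.eval s (.var 54))).arr 19 =
        Function.update (s.arr 19) (X.own a) (a + 1) := by simp [h54, h55]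
    refine ⟨φ, ⟨fun v hv => ?_, ?_⟩, by simp only [Test.cost, Expr.cost]; omega⟩
    · rw [e19, Function.update_apply]
      split_ifs with h
      · exact fun _ => ⟨ha, h.symm, hwF⟩
      · exact hfa v hv
    · rw [e19]
      refine (hP.congr (by simp) (by simp) (by simp) (by simp) (by simp) (by simp)
        (by simp)).mono ?_
      rintro T - ⟨h1, h2⟩
      refine ⟨h1, fun b hbD hbL => ?_⟩
      by_cases hba : b = a
      · subst hba
        exact ⟨hne, fun _ _ => by simp⟩
      · have h3 := h2 b ((Finset.mem_insert.1 hbD).resolve_left hba) hbL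
        refine ⟨h3.1, fun h4 h5 => ?_⟩
        have h6 := h3.2 h4 h5
        have h7 : X.own b ≠ X.own a := fun h => h6.1 (h ▸ hb)
        rwa [Function.update_of_ne h7]
  intro hb
  have hv0 : s.arr 19 (X.own a) ≠ 0 := by simpa [h55] using hb
  obtain ⟨hpL, hpo, hpF⟩ := hfa _ (X.own_mem a ha) hv0
  rw [run_ite]
  constructor
  · intro hb
    have hb : s.arr 19 (X.own a) = a + 1 := by simpa [h55, h54] using hb
    rw [run_skip]
    exact hskip _ (by simp) fun _ _ => hb
  intro hb
  have hva : s.arr 19 (X.own a) ≠ a + 1 := by simpa [h55, h54] using hb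
  rw [run_seq]
  refine (run_tryArc hs hr hP hg hE0 (a := s.arr 19 (X.own a) - 1) (by simp [h55]) hpL
    (by simp)).mono fun t₁ s₁ hf₁ h => ?_
  obtain ⟨φ₁, hP₁, ht₁⟩ := h
  have hs₁ : Static s₁ N := hs.of_framed hf₁ rfl rfl rfl rfl rfl
  have hr₁ : Rep s₁ N X := hr.congr (hf₁.arr 8 rfl) (hf₁.arr 9 rfl) (hf₁.arr 10 rfl) (hf₁.arr 11 rfl)
  -- Between the two insertions `X.own a` is an end in the table without having two edges to `F`
  -- there; it is the one exception that `W` allows.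
  refine (run_tryArc (a := a) hs₁ hr₁ (hP₁.mono (Q := fun T' => X.Shape F T' (· = X.own a) ∧
    (∀ b ∈ D, b ∈ X.L → X.First F T' (s.arr 19) b) ∧ X.InT T' (s.arr 19 (X.own a) - 1)) ?_)
    ((hf₁.var 2 rfl).trans hg) ?_ ?_ ha (by simp)).mono fun t₂ s₂ hf₂ h => ?_
  · rintro T' - ⟨T, ⟨h1, h2⟩, h3⟩
    exact ⟨h1.adds h3 hpL (fun _ h => h.elim) (.inr (.inr hpo)) (.inl hpF),
      fun b hb hbL => (h2 b hb hbL).mono h3.mono, h3.self hpL⟩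
  · rintro T hT ⟨h, -⟩
    exact hroom _ T (fun x y hx hy => hx.trans hy.symm) hT.short hT.nodup hT.mem h
  · simp [hf₁.var 54 rfl, h54]
  · obtain ⟨φ₂, hP₂, ht₂⟩ := h
    refine ⟨φ₂, hmono ((hf₂.arr 19 rfl).trans (hf₁.arr 19 rfl)) (hP₂.mono ?_), ?_⟩
    · rintro T' - ⟨T, ⟨h1, h2, h3⟩, h4⟩
      have h5 : X.Twice F T' (X.own a) := ⟨a, ha, _, hpL, h4.self ha, h4.mono _ hpL h3,
        by omega, rfl, hpo, hwF, hpF⟩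
      refine ⟨h1.adds h4 ha ?_ (.inr (.inl h5)) (.inl hwF),
        fun b hb hbL => (h2 b hb hbL).mono h4.mono, hne, fun _ _ => ⟨hv0, .inr h5⟩⟩
      rintro v rfl
      exact .inr (.inl h5)
    · simp only [Test.cost, Expr.cost]
      omega

/-- The second pass: find paths of three edges that start and end in `F`. -/
def passTwo : Prog :=
  .ite (.eq (.get 13 (.var 55)) (.const 0))
    (.ite (.eq (.get 13 (.get 4 (.get 8 (.pred (.var 54))))) (.const 0))
      (.ite (.eq (.get 19 (.var 55)) (.const 0)) .skip
        (.ite (.eq (.get 19 (.get 4 (.get 8 (.pred (.var 54))))) (.const 0)) .skip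
          (tryArc (.pred (.get 19 (.var 55))) ;;
            tryArc (.pred (.get 19 (.get 4 (.get 8 (.pred (.var 54)))))) ;;
            tryArc (.pred (.var 54)))))
      .skip)
    .skip

/-- The invariant of the second pass. -/
def InvTwo (X : ArcGraph) (F : ℕ → Prop) (fa : ℕ → ℕ) (g E : ℕ) (D : Finset ℕ) (φ : ℕ)
    (s : Mem) : Prop :=
  Probe s X g E (fun T => X.Shape F T (X.AtMiddle F T fa) ∧
    (∀ b ∈ X.L, X.First F T fa b) ∧ ∀ b ∈ D, b ∈ X.L → X.Second F T fa b) φ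

open scoped Classical in
theorem run_passTwo {s : Mem} {N : Net} {X : ArcGraph} {F : ℕ → Prop} {g E f φ a : ℕ}
    {D : Finset ℕ} (hs : Static s N) (hr : Rep s N X) (hg : s.var 2 = g) (h6 : 6 ≤ g)
    (hF : ∀ v, s.arr 13 v ≠ 0 ↔ F v) (hf : (X.A.filter F).card ≤ f)
    (hE : 64 * (f + 1) ^ 4 ≤ E)
    (hfa : ∀ v ∈ X.A, s.arr 19 v ≠ 0 → s.arr 19 v - 1 ∈ X.L ∧ X.own (s.arr 19 v - 1) = v ∧
      F (X.tgt (s.arr 19 v - 1)))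
    (hI : InvTwo X F (s.arr 19) g E D φ s) (ha : a ∈ X.L)
    (h54 : s.var 54 = a + 1) (h55 : s.var 55 = X.own a) :
    Run passTwo s fun t s' => ∃ φ', InvTwo X F (s.arr 19) g E (insert a D) φ' s' ∧
      t + φ' ≤ φ + 200 := by
  set fa := s.arr 19 with hfadef
  have h4 : ∀ a, s.arr 4 a = X.own a := fun a => by rw [hs.own, hr.own]
  have htgt : s.arr 4 (s.arr 8 (s.var 54 - 1)) = X.tgt a := by
    rw [h54, Nat.add_sub_cancel, hr.tw a ha, h4]
    rfl
  have hins : ∀ T, (∀ b ∈ D, b ∈ X.L → X.Second F T fa b) → X.Second F T fa a →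
      ∀ b ∈ insert a D, b ∈ X.L → X.Second F T fa b := by
    intro T h1 h2 b hb
    rcases Finset.mem_insert.1 hb with rfl | hb
    · exact fun _ => h2
    · exact h1 b hb
  have hskip : ∀ n, n ≤ 200 → (¬ F (X.own a) → ¬ F (X.tgt a) → fa (X.own a) ≠ 0 →
      fa (X.tgt a) ≠ 0 → False) →
      ∃ φ', InvTwo X F fa g E (insert a D) φ' s ∧ n + φ' ≤ φ + 200 := by
    intro n hn h
    refine ⟨φ, hI.mono ?_, by omega⟩
    rintro T - ⟨h1, h2, h3⟩
    exact ⟨h1, h2, hins T h3 fun h4 h5 h6 h7 => (h h4 h5 h6 h7).elim⟩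
  unfold passTwo
  rw [run_ite]
  constructor
  swap
  · intro hb
    have hb : F (X.own a) := (hF _).1 (by simpa [h55] using hb)
    rw [run_skip]
    exact hskip _ (by simp) fun h => absurd hb h
  intro hb
  have hvF : ¬ F (X.own a) := fun h => (hF _).2 h (by simpa [h55] using hb)
  rw [run_ite]
  constructor
  swap
  · intro hb
    have hb : F (X.tgt a) := (hF _).1 (by simpa [htgt] using hb)
    rw [run_skip]
    exact hskip _ (by simp) fun _ h => absurd hb h
  intro hb
  have hwF : ¬ F (X.tgt a) := fun h => (hF _).2 h (by simpa [htgt] using hb)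
  rw [run_ite]
  constructor
  · intro hb
    have hb : fa (X.own a) = 0 := by simpa [h55] using hb
    rw [run_skip]
    exact hskip _ (by simp) fun _ _ h => absurd hb h
  intro hb
  have hv0 : fa (X.own a) ≠ 0 := by simpa [h55] using hb
  rw [run_ite]
  constructor
  · intro hb
    have hb : fa (X.tgt a) = 0 := by simpa [htgt] using hb
    rw [run_skip]
    exact hskip _ (by simp) fun _ _ _ h => absurd hb h
  intro hb
  have hw0 : fa (X.tgt a) ≠ 0 := by simpa [htgt] using hb
  obtain ⟨hpL, hpo, hpF⟩ := hfa _ (X.own_mem a ha) hv0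
  obtain ⟨hqL, hqo, hqF⟩ := hfa _ (tgt_mem ha) hw0
  set p := fa (X.own a) - 1 with hp
  set q := fa (X.tgt a) - 1 with hq
  -- While the three edges of a path are being inserted, the ends of `a` need not belong to a
  -- complete path yet.
  let W : List ℕ → ℕ → Prop := fun T v => X.AtMiddle F T fa v ∨ v = X.own a ∨ v = X.tgt a
  have hroom : ∀ T, X.NoShort T g → T.Nodup → (∀ a ∈ T, a ∈ X.L) → X.Shape F T (W T) →
      T.length ≤ E := fun T h1 h2 h3 h4 =>
    (h4.length_le (w := f ^ 2 + 2) h1 h6 h2 h3 hf (by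
      convert card_atMiddle (fa := fa) h1 h6 hf (X.own a) (X.tgt a))).trans
      (sq_le_room hE (by omega))
  let P : List ℕ → Prop := fun T => X.Shape F T (W T) ∧ (∀ b ∈ X.L, X.First F T fa b) ∧
    ∀ b ∈ D, b ∈ X.L → X.Second F T fa b
  have hadd : ∀ {T T' c}, X.Adds T T' c → c ∈ X.L → P T → X.Good F T' (W T') (X.own c) →
      X.Good F T' (W T') (X.tgt c) → P T' := by
    intro T T' c h hc hT h1 h2
    exact ⟨hT.1.adds h hc (fun v hv => .inr (.inr (hv.imp_left fun hv => hv.mono h.mono))) h1 h2,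
      fun b hb => (hT.2.1 b hb).mono h.mono, fun b hb hbL => (hT.2.2 b hb hbL).mono h.mono⟩
  simp only [run_seq]
  refine (run_tryArc hs hr (hI.mono (Q := P) ?_) hg (fun T hT h => hroom T hT.short hT.nodup hT.mem
    h.1) (a := p) (by simp [h55, hp, hfadef]) hpL (by simp)).mono fun t₁ s₁ hf₁ h => ?_
  · rintro T - ⟨h1, h2, h3⟩
    refine ⟨fun b hb hbT => ?_, h2, h3⟩
    exact (h1 b hb hbT).imp_right fun h => h.imp_right Or.inl
  obtain ⟨φ₁, hP₁, ht₁⟩ := h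
  have hs₁ : Static s₁ N := hs.of_framed hf₁ rfl rfl rfl rfl rfl
  have hr₁ : Rep s₁ N X := hr.congr (hf₁.arr 8 rfl) (hf₁.arr 9 rfl) (hf₁.arr 10 rfl) (hf₁.arr 11 rfl)
  refine (run_tryArc (a := q) hs₁ hr₁ (hP₁.mono (Q := fun T' => P T' ∧ X.InT T' p) ?_)
    ((hf₁.var 2 rfl).trans hg) (fun T hT h => hroom T hT.short hT.nodup hT.mem h.1.1) ?_ hqL
    (by simp)).mono fun t₂ s₂ hf₂ h => ?_
  · rintro T' - ⟨T, h1, h2⟩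
    exact ⟨hadd h2 hpL h1 (.inr (.inr (.inr (.inl hpo)))) (.inl hpF), h2.self hpL⟩
  · have e : s₁.arr 4 (s₁.arr 8 (s₁.var 54 - 1)) = X.tgt a := by
      rw [hf₁.arr 4 rfl, hf₁.arr 8 rfl, hf₁.var 54 rfl, htgt]
    simp [e, hf₁.arr 19 rfl, hq, hfadef]
  obtain ⟨φ₂, hP₂, ht₂⟩ := h
  have hs₂ : Static s₂ N := hs₁.of_framed hf₂ rfl rfl rfl rfl rfl
  have hr₂ : Rep s₂ N X :=
    hr₁.congr (hf₂.arr 8 rfl) (hf₂.arr 9 rfl) (hf₂.arr 10 rfl) (hf₂.arr 11 rfl)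
  refine (run_tryArc (a := a) hs₂ hr₂ (hP₂.mono (Q := fun T' => P T' ∧ X.InT T' p ∧ X.InT T' q) ?_)
    ((hf₂.var 2 rfl).trans ((hf₁.var 2 rfl).trans hg))
    (fun T hT h => hroom T hT.short hT.nodup hT.mem h.1.1) ?_ ha (by simp)).mono
    fun t₃ s₃ hf₃ h => ?_
  · rintro T' - ⟨T, ⟨h1, h2⟩, h3⟩
    exact ⟨hadd h3 hqL h1 (.inr (.inr (.inr (.inr hqo)))) (.inl hqF), h3.mono p hpL h2,
      h3.self hqL⟩
  · simp [hf₂.var 54 rfl, hf₁.var 54 rfl, h54]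
  obtain ⟨φ₃, hP₃, ht₃⟩ := h
  refine ⟨φ₃, hP₃.mono ?_, by simp only [Test.cost, Expr.cost]; omega⟩
  rintro T' - ⟨T, ⟨h1, h2, h3⟩, h4⟩
  have hmid : X.Middle F (fun v => fa v - 1) T' a := by
    refine ⟨ha, h4.self ha, fun v hv => ?_⟩
    rcases hv with rfl | rfl
    · exact ⟨hvF, hpL, h4.mono p hpL h2, hpo, hpF⟩
    · exact ⟨hwF, hqL, h4.mono q hqL h3, hqo, hqF⟩
  have g1 : X.Good F T' (X.AtMiddle F T' fa) (X.own a) := .inr (.inr ⟨a, hmid, rfl⟩)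
  have g2 : X.Good F T' (X.AtMiddle F T' fa) (X.tgt a) := .inr (.inr ⟨X.tw a, hmid.tw, rfl⟩)
  refine ⟨h1.1.adds h4 ha (fun v hv => ?_) g1 g2, fun b hb => (h1.2.1 b hb).mono h4.mono,
    hins T' (fun b hb hbL => (h1.2.2 b hb hbL).mono h4.mono) fun _ _ _ _ => hmid⟩
  rcases hv with hv | rfl | rfl
  · exact .inr (.inr (hv.mono h4.mono))
  · exact g1
  · exact g2

end RAM

/-! ### The search for a short cycle. -/

namespace RAM

open ArcGraph

/-- Find a cycle of length at most the number in register 2, for a set `F` (marked in array 13)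
that meets every cycle. -/
def shortProg : Prog :=
  .assign 9 (.const 0) ;; .assign 45 (.const 0) ;; fill 49 4 18 0 ;; fill 49 0 19 0 ;;
  fill 49 0 21 0 ;; forArcs passOne ;; forArcs passTwo ;; forArcs (tryArc (.pred (.var 54)))

theorem Probe.setVar {X : ArcGraph} {g E φ x m : ℕ} {P : List ℕ → Prop} {s : Mem}
    (hx : x = 54 ∨ x = 55) (h : Probe s X g E P φ) : Probe (s.setVar x m) X g E P φ := by
  rcases hx with rfl | rfl <;>
    exact h.congr (by simp) (by simp) (by simp) rfl rfl rfl rfl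

-- If the first two passes meet no short cycle, the reduced graph has at most `f + 7 f ^ 2`
-- vertices, and the table has room for all its edges. A third pass inserts them all; if it
-- succeeds, every cycle lies in the table and is long.
open scoped Classical in
theorem run_short {s : Mem} {N : Net} {X : ArcGraph} {F : ℕ → Prop} {g E f : ℕ}
    (hs : Static s N) (hr : Rep s N X) (hred : ∀ v, ¬ X.Red v) (hm : s.var 4 = N.m)
    (hg : s.var 2 = g) (h6 : 6 ≤ g) (hF : ∀ v, s.arr 13 v ≠ 0 ↔ F v)
    (hS : X.mg.Sparse (X.A.filter F)) (hf : (X.A.filter F).card ≤ f)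
    (hE : 64 * (f + 1) ^ 4 ≤ E) :
    Run shortProg s fun t s' =>
      (s'.var 9 = 0 ∧ (∀ B, X.IsArcCycle B → g < B.length) ∨
        s'.var 9 ≠ 0 ∧ HasCycle s' X fun B => B.length ≤ g) ∧
      t ≤ 900 * (N.n + N.m) + 400 * (E + 2) ^ 3 + 200 := by
  unfold shortProg
  simp only [run_seq, run_assign]
  refine (run_fill (by decide) _).mono fun t₁ s₁ hf₁ h => ?_
  obtain ⟨ht₁, h18⟩ := h
  refine (run_fill (by decide) s₁).mono fun t₂ s₂ hf₂ h => ?_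
  obtain ⟨ht₂, h19⟩ := h
  refine (run_fill (by decide) s₂).mono fun t₃ s₃ hf₃ h => ?_
  obtain ⟨ht₃, h21⟩ := h
  have a18 : s₃.arr 18 = s₁.arr 18 := (hf₃.arr 18 rfl).trans (hf₂.arr 18 rfl)
  have a19 : s₃.arr 19 = s₂.arr 19 := hf₃.arr 19 rfl
  have v0₁ : s₁.var 0 = N.n := by
    rw [hf₁.var 0 rfl]
    simpa using hs.n
  have v0₂ : s₂.var 0 = N.n := (hf₂.var 0 rfl).trans v0₁
  have hs₁ : Static s₁ N := by
    refine Static.of_framed ?_ hf₁ rfl rfl rfl rfl rfl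
    exact ⟨by simpa using hs.n, hs.own, hs.otw, hs.list⟩
  have hs₃ := (hs₁.of_framed hf₂ rfl rfl rfl rfl rfl).of_framed hf₃ rfl rfl rfl rfl rfl
  have hr₁ : Rep s₁ N X := hr.congr (hf₁.arr 8 rfl) (hf₁.arr 9 rfl) (hf₁.arr 10 rfl) (hf₁.arr 11 rfl)
  have hr₂ : Rep s₂ N X :=
    hr₁.congr (hf₂.arr 8 rfl) (hf₂.arr 9 rfl) (hf₂.arr 10 rfl) (hf₂.arr 11 rfl)
  have hr₃ : Rep s₃ N X :=
    hr₂.congr (hf₃.arr 8 rfl) (hf₃.arr 9 rfl) (hf₃.arr 10 rfl) (hf₃.arr 11 rfl)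
  have v9 : s₃.var 9 = 0 := by
    rw [hf₃.var 9 rfl, hf₂.var 9 rfl, hf₁.var 9 rfl]
    simp
  have v45 : s₃.var 45 = 0 := by
    rw [hf₃.var 45 rfl, hf₂.var 45 rfl, hf₁.var 45 rfl]
    simp
  have v2 : s₃.var 2 = g := by
    rw [hf₃.var 2 rfl, hf₂.var 2 rfl, hf₁.var 2 rfl]
    simpa using hg
  have a13 : s₃.arr 13 = s.arr 13 := by
    rw [hf₃.arr 13 rfl, hf₂.arr 13 rfl, hf₁.arr 13 rfl]
    rfl
  have hT : Table s₃ X [] g := by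
    refine ⟨by rw [v45, slice_self], by simp, List.nodup_nil, fun a ha => ?_, fun v hv h => ?_,
      fun B hB hBT => ?_⟩
    · rw [a18, h18, if_pos]
      · simp [InT]
      · simpa [hm] using hr.L_lt a ha
    · rw [h21, if_pos] at h
      · exact absurd rfl h
      · rw [v0₂]
        exact hr.A_lt v hv
    · obtain ⟨b, hb⟩ := List.exists_mem_of_ne_nil _ hB.ne_nil
      simpa [InT] using hBT b hb
  have hI₁ : InvOne X F g E ∅ (tryPot E []) s₃ := by
    refine ⟨fun v hv h => ?_, .inl ⟨v9, [], hT, ⟨fun b _ h => ?_, by simp⟩, rfl⟩⟩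
    · rw [a19, h19, if_pos] at h
      · exact absurd rfl h
      · rw [v0₁]
        exact hr.A_lt v hv
    · simp [InT] at h
  refine run_forArcs 200 (InvOne X F g E) ⟨by rintro x (rfl | rfl | rfl) <;> rfl,
    by intro x h1 h2; interval_cases x <;> rfl⟩ hs₃ hr₃ ?_ hI₁ ?_ ?_
  · rintro D φ s x m hx ⟨h1, h2⟩
    exact ⟨h1, h2.setVar hx⟩
  · intro a ha D φ s hI hs hr hf' h54 h55
    exact run_passOne hs hr ((hf'.var 2 rfl).trans v2) h6
      (fun v => by rw [hf'.arr 13 rfl, a13, hF]) hf hE hI ha h54 h55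
  intro t₄ D φ₄ s₄ hI₄ hD hs₄ hr₄ hf₄ ht₄
  obtain ⟨hfa, hP₄⟩ := hI₄
  have b13 : s₄.arr 13 = s.arr 13 := (hf₄.arr 13 rfl).trans a13
  have b2 : s₄.var 2 = g := (hf₄.var 2 rfl).trans v2
  have hI₄' : InvTwo X F (s₄.arr 19) g E ∅ φ₄ s₄ := by
    refine hP₄.mono ?_
    rintro T - ⟨h1, h2⟩
    refine ⟨fun b hb hbT => ?_, fun b hb => h2 b (hD hb) hb, by simp⟩
    exact (h1 b hb hbT).imp_right fun h => h.imp_right False.elim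
  refine run_forArcs 200 (fun D φ s => InvTwo X F (s₄.arr 19) g E D φ s)
    ⟨by rintro x (rfl | rfl | rfl) <;> rfl,
    by intro x h1 h2; interval_cases x <;> rfl⟩ hs₄ hr₄ ?_ hI₄' ?_ ?_
  · exact fun D φ s x m hx h => Probe.setVar hx h
  · intro a ha D φ s hI hs hr hf' h54 h55
    have c19 : s.arr 19 = s₄.arr 19 := hf'.arr 19 rfl
    rw [← c19] at hfa hI ⊢
    exact run_passTwo hs hr ((hf'.var 2 rfl).trans b2) h6
      (fun v => by rw [hf'.arr 13 rfl, b13, hF]) hf hE hfa hI ha h54 h55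
  intro t₅ D₅ φ₅ s₅ hI₅ hD₅ hs₅ hr₅ hf₅ ht₅
  have c2 : s₅.var 2 = g := (hf₅.var 2 rfl).trans b2
  refine run_forArcs 200 (fun D φ s => Probe s X g E
    (fun T => X.A.card ≤ f + 7 * f ^ 2 ∧ ∀ b ∈ D, b ∈ X.L → X.InT T b) φ)
    ⟨by rintro x (rfl | rfl | rfl) <;> rfl,
    by intro x h1 h2; interval_cases x <;> rfl⟩ hs₅ hr₅ ?_ (hI₅.mono ?_) ?_ ?_
  · exact fun D φ s x m hx h => Probe.setVar hx h
  · rintro T hT ⟨-, h1, h2⟩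
    exact ⟨card_le_of_first_second hT.short h6 hS hred hf h1 fun b hb => h2 b (hD₅ hb) hb, by simp⟩
  · intro a ha D φ s hI hs hr hf' h54 h55
    refine (run_tryArc hs hr hI ((hf'.var 2 rfl).trans c2) ?_ (a := a) (by simp [h54]) ha
      (by simp)).mono fun t s' _ h => ?_
    · rintro T hT ⟨h1, -⟩
      exact (hT.short.length_le (by omega) hT.nodup hT.mem fun a ha _ => X.own_mem a ha).trans
        (sq_le_room hE (by omega))
    · obtain ⟨φ', h1, h2⟩ := h
      refine ⟨φ', h1.mono ?_, by omega⟩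
      rintro T' - ⟨T, ⟨h3, h4⟩, h5⟩
      refine ⟨h3, fun b hb hbL => ?_⟩
      rcases Finset.mem_insert.1 hb with rfl | hb
      · exact h5.self hbL
      · exact h5.mono b hbL (h4 b hb hbL)
  intro t₆ D₆ φ₆ s₆ hI₆ hD₆ _ _ hf₆ ht₆
  refine ⟨hI₆.imp ?_ ?_, ?_⟩
  · rintro ⟨h0, T, hT, ⟨-, h1⟩, -⟩
    exact ⟨h0, fun B hB => hT.short B hB fun b hb => h1 b (hD₆ (hB.mem b hb)) (hB.mem b hb)⟩
  · rintro ⟨h0, h1, -⟩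
    exact ⟨h0, h1⟩
  · have hpot : tryPot E [] ≤ 400 * (E + 2) ^ 3 := by
      have : (E + 1) * (400 * (E + 2) ^ 2) ≤ (E + 2) * (400 * (E + 2) ^ 2) :=
        Nat.mul_le_mul_right _ (by omega)
      calc tryPot E [] = (E + 1) * (400 * (E + 2) ^ 2) := rfl
        _ ≤ (E + 2) * (400 * (E + 2) ^ 2) := this
        _ = 400 * (E + 2) ^ 3 := by ring
    have g1 : t₁ ≤ 9 * N.m + 5 := by simpa [hm] using ht₁
    rw [v0₁] at ht₂
    rw [v0₂] at ht₃
    simp only [Expr.cost]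
    omega

end RAM

/-! ### Building the arcs from the adjacency lists, up to a bound. -/

namespace RAM

open ArcGraph

/-- The edges that are listed at `v` and not at a smaller vertex, unless the list starts too
late. -/
def edgesAt (st ad : ℕ → ℕ) (M v : ℕ) : List (Sym2 ℕ) :=
  if st v < M then ((slice ad (st v) (st (v + 1))).filter (v ≤ ·)).map fun u => s(v, u) else []

theorem count_edges {v x y : ℕ} (h : x ≤ y) (l : List ℕ) :
    ((l.filter (v ≤ ·)).map fun u => s(v, u)).count s(x, y) = if v = x then l.count y else 0 := by
  induction l with
  | nil => simp
  | cons u l ih =>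
    by_cases hu : v ≤ u
    · rw [List.filter_cons_of_pos (by simpa using hu), List.map_cons, List.count_cons, ih,
        List.count_cons]
      by_cases hvx : v = x
      · subst hvx
        simp only [beq_iff_eq, Sym2.eq_iff, if_true, true_and]
        split_ifs <;> omega
      · have : ¬ (s(v, u) = s(x, y)) := by
          rw [Sym2.eq_iff]
          omega
        simp [hvx, this]
    · rw [List.filter_cons_of_neg (by simpa using hu), ih, List.count_cons]
      by_cases hvx : v = x
      · have : u ≠ y := by omega
        simp [this]
      · simp [hvx]

theorem count_edgesAt {st ad : ℕ → ℕ} {M n x y : ℕ} (h : x ≤ y) :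
    ((List.range n).flatMap (edgesAt st ad M)).count s(x, y) =
      if x < n ∧ st x < M then (slice ad (st x) (st (x + 1))).count y else 0 := by
  induction n with
  | zero => simp
  | succ n ih =>
    rw [List.range_succ, List.flatMap_append, List.count_append, ih]
    simp only [List.flatMap_cons, List.flatMap_nil, List.append_nil, edgesAt]
    by_cases hn : n = x
    · subst hn
      split_ifs with h1 h2 h3 <;> first | omega | simp_all [count_edges h]
    · split_ifs with h1 h2 h3 <;> first | omega | simp [count_edges h, hn]

/-- The linked lists of the arcs `0, …, m - 1` at the vertices `0, …, n - 1`. -/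
structure Lists (n m : ℕ) (own head next : ℕ → ℕ) (adj : ℕ → List ℕ) : Prop where
  list : ∀ v < n, LinkedList next (head v) (adj v)
  nodup : ∀ v < n, (adj v).Nodup
  mem : ∀ v < n, ∀ a, a ∈ adj v ↔ a < m ∧ own a = v

theorem LinkedList.congr {next next' : ℕ → ℕ} {l : List ℕ} (h : ∀ a ∈ l, next' a = next a) {i : ℕ}
    (hl : LinkedList next i l) : LinkedList next' i l := by
  induction l generalizing i with
  | nil => exact hl
  | cons a l ih =>
    refine ⟨hl.1, ?_⟩
    rw [h a (by simp)]
    exact ih (fun b hb => h b (by simp [hb])) hl.2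

theorem Lists.add {n m x : ℕ} {own head next : ℕ → ℕ} {adj : ℕ → List ℕ}
    (h : Lists n m own head next adj) (hx : x < n) :
    Lists n (m + 1) (Function.update own m x) (Function.update head x (m + 1))
      (Function.update next m (head x)) (Function.update adj x (m :: adj x)) := by
  have hm : ∀ v < n, m ∉ adj v := fun v hv hmem => by
    have := ((h.mem v hv m).1 hmem).1
    omega
  have hl : ∀ v < n, LinkedList (Function.update next m (head x)) (head v) (adj v) := fun v hv =>
    (h.list v hv).congr fun a ha => Function.update_of_ne (by rintro rfl; exact hm v hv ha) _ _
  refine ⟨fun v hv => ?_, fun v hv => ?_, fun v hv a => ?_⟩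
  · by_cases hvx : v = x
    · subst hvx
      simp only [Function.update_self]
      exact ⟨rfl, by simpa using hl v hv⟩
    · simpa [hvx] using hl v hv
  · by_cases hvx : v = x
    · subst hvx
      simpa using ⟨hm v hv, h.nodup v hv⟩
    · simpa [hvx] using h.nodup v hv
  · have h1 := h.mem v hv a
    simp only [Function.update_apply]
    by_cases ham : a = m
    · subst ham
      have := hm v hv
      split_ifs with h2 <;> simp_all [eq_comm]
    · have h3 : a < m + 1 ↔ a < m := by omega
      split_ifs with h2
      · rw [h2] at h1
        simp [ham, h1, h2, h3]
      · rw [h1, h3]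

/-- The memory holds the `m` arcs of the edges in `P`. -/
structure Built (s : Mem) (n m : ℕ) (P : List (Sym2 ℕ)) (adj : ℕ → List ℕ) : Prop where
  size : s.var 4 = m
  own_lt : ∀ a < m, s.arr 4 a < n
  otw : ∀ a < m, s.arr 5 a < m ∧ s.arr 5 (s.arr 5 a) = a ∧ s.arr 5 a ≠ a
  tw : ∀ a < m, s.arr 8 a = s.arr 5 a ∧ s.arr 9 a = 0 ∧ s.arr 12 a = 0
  lists : Lists n m (s.arr 4) (s.arr 6) (s.arr 7) adj
  count : ∀ e, ((Finset.range m).filter fun a => s(s.arr 4 a, s.arr 4 (s.arr 5 a)) = e).card =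
    2 * P.count e
  deg : ∀ v < n, s.arr 11 v = (adj v).length + P.count s(v, v)

theorem Built.congr {s s' : Mem} {n m : ℕ} {P : List (Sym2 ℕ)} {adj : ℕ → List ℕ}
    (h : Built s n m P adj) (h4 : s'.var 4 = s.var 4)
    (ha : ∀ x, 4 ≤ x → x ≤ 12 → s'.arr x = s.arr x) : Built s' n m P adj := by
  refine ⟨h4.trans h.size, ?_, ?_, ?_, ?_, ?_, ?_⟩ <;>
    simp only [ha 4 (by simp) (by simp), ha 5 (by simp) (by simp), ha 6 (by simp) (by simp),
      ha 7 (by simp) (by simp), ha 8 (by simp) (by simp), ha 9 (by simp) (by simp),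
      ha 11 (by simp) (by simp), ha 12 (by simp) (by simp)]
  exacts [h.own_lt, h.otw, h.tw, h.lists, h.count, h.deg]

/-- Add an edge between the vertices in the registers 55 and 57. -/
def addEdge : Prog :=
  -- The stored degree of a loop is 3: its two arcs count below, and one more is added here as
  -- `Rep.deg_loop` demands.
  .ite (.eq (.var 55) (.var 57)) (.store 11 (.var 55) (.succ (.get 11 (.var 55)))) .skip ;;
  .store 4 (.var 4) (.var 55) ;; .store 4 (.succ (.var 4)) (.var 57) ;;
  .store 5 (.var 4) (.succ (.var 4)) ;; .store 5 (.succ (.var 4)) (.var 4) ;;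
  .store 8 (.var 4) (.succ (.var 4)) ;; .store 8 (.succ (.var 4)) (.var 4) ;;
  .store 9 (.var 4) (.const 0) ;; .store 9 (.succ (.var 4)) (.const 0) ;;
  .store 12 (.var 4) (.const 0) ;; .store 12 (.succ (.var 4)) (.const 0) ;;
  .store 7 (.var 4) (.get 6 (.var 55)) ;; .store 6 (.var 55) (.succ (.var 4)) ;;
  .store 7 (.succ (.var 4)) (.get 6 (.var 57)) ;; .store 6 (.var 57) (.succ (.succ (.var 4))) ;;
  .store 11 (.var 55) (.succ (.get 11 (.var 55))) ;;
  .store 11 (.var 57) (.succ (.get 11 (.var 57))) ;; .assign 4 (.succ (.succ (.var 4)))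

theorem run_addEdge {s : Mem} {n m v u : ℕ} {P : List (Sym2 ℕ)} {adj : ℕ → List ℕ}
    (h : Built s n m P adj) (hv : s.var 55 = v) (hu : s.var 57 = u) (hvn : v < n) (hun : u < n) :
    Run addEdge s fun t s' => (∃ adj', Built s' n (m + 2) (P ++ [s(v, u)]) adj') ∧ t ≤ 100 := by
  have hite : Run (.ite (.eq (.var 55) (.var 57)) (.store 11 (.var 55) (.succ (.get 11 (.var 55))))
      .skip) s fun t s' => s'.arr 11 = (fun w => s.arr 11 w + if w = v ∧ v = u then 1 else 0) ∧
        t ≤ 20 := by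
    rw [run_ite, run_store, run_skip]
    refine ⟨fun hb => ⟨?_, by simp⟩, fun hb => ⟨?_, by simp⟩⟩
    · have hb : v = u := by simpa [hv, hu] using hb
      ext w
      simp [hv, hb, Function.update_apply]
      split_ifs with h <;> simp [h]
    · have hb : v ≠ u := by simpa [hv, hu] using hb
      simp [hb]
  unfold addEdge
  rw [run_seq]
  refine hite.mono fun t₁ s₁ hf₁ h1 => ?_
  obtain ⟨h11, ht₁⟩ := h1
  simp only [run_seq, run_store, run_assign]
  have hm : s.var 4 = m := h.size
  have hup : ∀ (f : ℕ → ℕ) (x y : ℕ) {a}, a < m →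
      Function.update (Function.update f m x) (m + 1) y a = f a := fun f x y a ha => by
    rw [Function.update_of_ne (by omega), Function.update_of_ne (by omega)]
  refine ⟨⟨Function.update (Function.update adj v (m :: adj v)) u ((m + 1) ::
    Function.update adj v (m :: adj v) u), ?_, ?_, ?_, ?_, ?_, ?_, ?_⟩, by simp; omega⟩
  all_goals simp only [setVar_var, setVar_arr, setArr_var, setArr_arr, Expr.eval, if_true, if_false,
    Nat.reduceEqDiff, hf₁.var 4 rfl, hf₁.var 55 rfl, hf₁.var 57 rfl, hf₁.arr 4 rfl, hf₁.arr 5 rfl,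
    hf₁.arr 6 rfl, hf₁.arr 7 rfl, hf₁.arr 8 rfl, hf₁.arr 9 rfl, hf₁.arr 12 rfl, hm, hv, hu]
  · intro a ha
    have := h.own_lt a
    simp only [Function.update_apply]
    split_ifs <;> omega
  · intro a ha
    obtain ha | rfl | rfl : a < m ∨ a = m ∨ a = m + 1 := by omega
    · obtain ⟨h1, h2, h3⟩ := h.otw a ha
      rw [hup _ _ _ ha, hup _ _ _ h1]
      exact ⟨by omega, h2, h3⟩
    · simp
    · simp
  · intro a ha
    have := h.tw a
    simp only [Function.update_apply]
    split_ifs <;> omega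
  · exact (h.lists.add hvn).add hun
  · intro e
    rw [Finset.range_add_one, Finset.range_add_one, Finset.filter_insert, Finset.filter_insert,
      List.count_append, List.count_singleton]
    have hold : ((Finset.range m).filter fun a =>
        s(Function.update (Function.update (s.arr 4) m v) (m + 1) u a,
          Function.update (Function.update (s.arr 4) m v) (m + 1) u
            (Function.update (Function.update (s.arr 5) m (m + 1)) (m + 1) m a)) = e) =
        (Finset.range m).filter fun a => s(s.arr 4 a, s.arr 4 (s.arr 5 a)) = e := by
      refine Finset.filter_congr fun a ha => ?_
      have h1' := Finset.mem_range.1 ha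
      rw [hup _ _ _ h1', hup _ _ _ h1', hup _ _ _ (h.otw a h1').1]
    rw [hold]
    have hc := h.count e
    simp only [Function.update_self, Function.update_of_ne (show m ≠ m + 1 by omega)]
    rw [Sym2.eq_swap (a := u)]
    by_cases he : s(v, u) = e
    · rw [if_pos he, if_pos he, Finset.card_insert_of_notMem (by simp),
        Finset.card_insert_of_notMem (by simp), if_pos (by simpa using he), hc]
      omega
    · rw [if_neg he, if_neg he, if_neg (by simpa using he), hc, add_zero]
  · intro w hw
    have hd := h.deg w hw
    rw [List.count_append, List.count_singleton]
    have he : (s(v, u) = s(w, w)) ↔ (w = v ∧ v = u) := by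
      rw [Sym2.eq_iff]
      omega
    simp only [h11, Function.update_apply, beq_iff_eq, he]
    by_cases hwu : w = u
    · subst hwu
      by_cases hwv : w = v
      · subst hwv
        simp [hd]
        omega
      · simp [hwv, hd]
        omega
    · by_cases hwv : w = v
      · subst hwv
        simp [hwu, hd]
        omega
      · simp [hwu, hwv, hd]

/-- Set up the memory for the graph in the input (or a dense subgraph of it, if there are too many
edges). -/
def buildProg : Prog :=
  fill 55 0 6 0 ;; fill 55 0 10 1 ;; fill 55 0 11 0 ;; fill 55 0 13 0 ;; .assign 4 (.const 0) ;;
  .assign 55 (.const 0) ;;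
  Prog.for 55 0 (.ite (.lt (.get 0 (.var 55)) (.var 3))
    (.assign 56 (.get 0 (.var 55)) ;; .assign 58 (.get 0 (.succ (.var 55))) ;;
      Prog.for 56 58 (.assign 57 (.get 1 (.var 56)) ;;
        .ite (.lt (.var 57) (.var 55)) .skip addEdge))
    .skip)

/-- A list that starts before position `M` is read to its end, which lies before `M + d`. The number
of arcs and the time are therefore governed by `M`, not by the number of edges of the graph. -/
theorem run_build {s : Mem} {n M d : ℕ} (h0 : s.var 0 = n) (h3 : s.var 3 = M)
    (hmono : ∀ v < n, s.arr 0 v ≤ s.arr 0 (v + 1)) (hd : ∀ v < n, s.arr 0 (v + 1) ≤ s.arr 0 v + d)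
    (hlt : ∀ v < n, ∀ j, s.arr 0 v ≤ j → j < s.arr 0 (v + 1) → s.arr 1 j < n) :
    Run buildProg s fun t s' => (∃ m adj,
      Built s' n m ((List.range n).flatMap (edgesAt (s.arr 0) (s.arr 1) M)) adj) ∧
      (∀ v < n, s'.arr 10 v = 1 ∧ s'.arr 13 v = 0) ∧ s'.var 4 ≤ 2 * (M + d) ∧
      t ≤ 200 * (M + d + n) + 200 := by
  unfold buildProg
  simp only [run_seq]
  refine (run_fill (by decide) s).mono fun t₁ s₁ hf₁ h => ?_
  obtain ⟨ht₁, h6⟩ := h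
  refine (run_fill (by decide) s₁).mono fun t₂ s₂ hf₂ h => ?_
  obtain ⟨ht₂, h10⟩ := h
  refine (run_fill (by decide) s₂).mono fun t₃ s₃ hf₃ h => ?_
  obtain ⟨ht₃, h11⟩ := h
  refine (run_fill (by decide) s₃).mono fun t₄ s₄ hf₄ h => ?_
  obtain ⟨ht₄, h13⟩ := h
  have e₁ : s₁.var 0 = n := (hf₁.var 0 rfl).trans h0
  have e₂ : s₂.var 0 = n := (hf₂.var 0 rfl).trans e₁
  have e₃ : s₃.var 0 = n := (hf₃.var 0 rfl).trans e₂
  have e₄ : s₄.var 0 = n := (hf₄.var 0 rfl).trans e₃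
  have e3 : s₄.var 3 = M := by
    rw [hf₄.var 3 rfl, hf₃.var 3 rfl, hf₂.var 3 rfl, hf₁.var 3 rfl, h3]
  have a0 : s₄.arr 0 = s.arr 0 := by
    rw [hf₄.arr 0 rfl, hf₃.arr 0 rfl, hf₂.arr 0 rfl, hf₁.arr 0 rfl]
  have a1 : s₄.arr 1 = s.arr 1 := by
    rw [hf₄.arr 1 rfl, hf₃.arr 1 rfl, hf₂.arr 1 rfl, hf₁.arr 1 rfl]
  have a6 : s₄.arr 6 = s₁.arr 6 := by rw [hf₄.arr 6 rfl, hf₃.arr 6 rfl, hf₂.arr 6 rfl]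
  have a10 : s₄.arr 10 = s₂.arr 10 := by rw [hf₄.arr 10 rfl, hf₃.arr 10 rfl]
  have a11 : s₄.arr 11 = s₃.arr 11 := hf₄.arr 11 rfl
  simp only [run_assign]
  set st := s.arr 0 with hst
  set ad := s.arr 1 with had
  refine Run.for (N := n) (φ := 130 * (M + d - st 0) + 40 * n)
    (fun v φ s' => (∃ m adj, Built s' n m ((List.range v).flatMap (edgesAt st ad M)) adj) ∧
      s'.var 4 ≤ 2 * st v ∧ s'.var 4 ≤ 2 * (M + d) ∧ φ = 130 * (M + d - st v) + 40 * (n - v)) rfl rfl (by decide) (by simp [e₄]) (by simp)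
    ⟨⟨0, fun _ => [], by simp, by simp, by simp, by simp, ?_,
      fun e => by rw [Finset.range_zero, Finset.filter_empty]; rfl, fun v hv => ?_⟩, ?_, ?_, ?_⟩ ?_ ?_
  · refine ⟨fun v hv => ?_, fun _ _ => List.nodup_nil, by simp⟩
    simp [LinkedList, a6, h6, h0, hv]
  · simp [a11, h11, e₂, hv]
  · simp
  · simp
  · simp
  · rintro v φ s₅ ⟨⟨m, adj, hB⟩, hm1, hm2, rfl⟩ hf₅ hx hv
    have b0 : s₅.arr 0 = st := (hf₅.arr 0 rfl).trans a0
    have b1 : s₅.arr 1 = ad := (hf₅.arr 1 rfl).trans a1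
    have b3 : s₅.var 3 = M := by
      rw [hf₅.var 3 rfl]
      simpa using e3
    have hP : (List.range (v + 1)).flatMap (edgesAt st ad M) =
        (List.range v).flatMap (edgesAt st ad M) ++ edgesAt st ad M v := by
      rw [List.range_succ, List.flatMap_append]
      simp
    have hm := hmono v hv
    rw [run_ite]
    constructor
    swap
    · intro hb
      have hb : ¬ st v < M := by simpa [hx, b0, b3] using hb
      rw [run_skip]
      refine ⟨_, ⟨⟨m, adj, ?_⟩, by simp; omega, by simpa using hm2, rfl⟩,
        by simp only [Test.cost, Expr.cost]; omega⟩
      rw [hP, edgesAt, if_neg hb, List.append_nil]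
      exact hB.congr (by simp) fun _ _ _ => rfl
    · intro hb
      have hb : st v < M := by simpa [hx, b0, b3] using hb
      have hdv := hd v hv
      simp only [run_seq, run_assign]
      refine Run.for (N := st (v + 1)) (φ := 120 * (st (v + 1) - st v))
        (fun j φ s' => (∃ m adj, Built s' n m ((List.range v).flatMap (edgesAt st ad M) ++
          ((slice ad (st v) j).filter (v ≤ ·)).map fun u => s(v, u)) adj) ∧ st v ≤ j ∧ s'.var 4 ≤ 2 * j ∧
          φ = 120 * (st (v + 1) - j)) rfl rfl (by decide) (by simp [hx, b0]) (by simp [hx, b0, hm])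
        ⟨⟨m, adj, ?_⟩, by simp [hx, b0], by simpa [hx, b0] using hm1, by simp [hx, b0]⟩ ?_ ?_
      · simp only [setVar_var, Expr.eval, hx, b0, if_true, Nat.reduceEqDiff, if_false, slice_self,
          List.filter_nil, List.map_nil, List.append_nil]
        exact hB.congr (by simp) fun _ _ _ => rfl
      · rintro j φ s₆ ⟨⟨m, adj, hB⟩, hj, hmj, rfl⟩ hf₆ hx₆ hjlt
        have c1 : s₆.arr 1 = ad := (hf₆.arr 1 rfl).trans b1
        have c55 : s₆.var 55 = v := by
          rw [hf₆.var 55 rfl]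
          simpa using hx
        simp only [run_seq, run_assign]
        rw [slice_succ ad hj, List.filter_append, List.map_append, ← List.append_assoc, run_ite]
        constructor
        · intro hb'
          have hb' : ad j < v := by simpa [hx₆, c1, c55] using hb'
          rw [run_skip]
          refine ⟨_, ⟨⟨m, adj, ?_⟩, by omega, by simp; omega, rfl⟩,
            by simp only [Test.cost, Expr.cost]; omega⟩
          rw [List.filter_singleton]
          have := hB.congr (s' := (s₆.setVar 57 (s₆.arr 1 (s₆.var 56))).setVar 56 (j + 1)) (by simp)
            fun _ _ _ => rfl
          simpa [hb'.not_ge] using this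
        · intro hb'
          have hb' : v ≤ ad j := by simpa [hx₆, c1, c55] using hb'
          have hB₁ := hB.congr (s' := s₆.setVar 57 (Expr.eval s₆ (.get 1 (.var 56)))) (by simp)
            fun _ _ _ => rfl
          refine (run_addEdge (v := v) (u := ad j) hB₁ (by simpa using c55) (by simp [hx₆, c1]) hv
            (hlt v hv j hj hjlt)).mono fun t s₇ _ h => ?_
          obtain ⟨⟨adj', hB'⟩, ht⟩ := h
          have h7 : s₇.var 4 = s₆.var 4 + 2 := by rw [hB'.size, hB.size]
          refine ⟨_, ⟨⟨m + 2, adj', ?_⟩, by omega, by simp [h7]; omega, rfl⟩,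
            by simp only [Test.cost, Expr.cost]; omega⟩
          rw [List.filter_singleton]
          have := hB'.congr (s' := s₇.setVar 56 (j + 1)) (by simp) fun _ _ _ => rfl
          simpa [hb'] using this
      · rintro t φ s₆ ⟨⟨m, adj, hB⟩, -, hmj, rfl⟩ hf₆ hx₆ ht
        refine ⟨_, ⟨⟨m, adj, ?_⟩, by simpa using hmj, by simp; omega, rfl⟩, ?_⟩
        swap
        · simp only [Test.cost, Expr.cost]
          omega
        rw [hP, edgesAt, if_pos hb]
        exact hB.congr (by simp) fun _ _ _ => rfl
  · rintro t φ s' ⟨hB, -, hm, rfl⟩ hf' hx ht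
    refine ⟨hB, fun v hv => ⟨?_, ?_⟩, hm, ?_⟩
    · rw [hf'.arr 10 rfl, setVar_arr, setVar_arr, a10, h10, if_pos (by rwa [e₁])]
    · rw [hf'.arr 13 rfl, setVar_arr, setVar_arr, h13, if_pos (by rwa [e₃])]
    · simp only [Expr.cost]
      omega

end RAM

/-! ### The input graph, whole or truncated. -/

namespace ArcGraph

theorem mult_le (X : ArcGraph) (u v : ℕ) :
    X.mg.mult s(u, v) ≤ ((X.arcsAt u).filter fun a => X.tgt a = v).card := by
  have h : X.arcsOf s(u, v) ⊆ ((X.arcsAt u).filter fun a => X.tgt a = v) ∪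
      ((X.arcsAt u).filter fun a => X.tgt a = v).image X.tw := by
    intro a ha
    obtain ⟨ha, he⟩ := mem_arcsOf.1 ha
    rw [Finset.mem_union, Finset.mem_filter, Finset.mem_image]
    rcases Sym2.eq_iff.1 he with ⟨h1, h2⟩ | ⟨h1, h2⟩
    · exact .inl ⟨mem_arcsAt.2 ⟨ha, h1⟩, h2⟩
    · exact .inr ⟨X.tw a, Finset.mem_filter.2 ⟨mem_arcsAt.2 ⟨X.tw_mem a ha, h2⟩,
        (tgt_tw ha).trans h1⟩, X.tw_tw a ha⟩
  have h1 := (Finset.card_le_card h).trans (Finset.card_union_le _ _)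
  have h2 := Finset.card_image_le (s := (X.arcsAt u).filter fun a => X.tgt a = v) (f := X.tw)
  have h3 := two_mul_mult (X := X) s(u, v)
  omega

theorem sum_mult_le (X : ArcGraph) (v : ℕ) (S : Finset ℕ) :
    ∑ u ∈ S, X.mg.mult s(v, u) ≤ (X.arcsAt v).card := by
  refine (Finset.sum_le_sum fun u _ => X.mult_le v u).trans ?_
  rw [← Finset.card_biUnion fun a _ b _ hab => Finset.disjoint_left.2 fun c hc hd =>
    hab ((Finset.mem_filter.1 hc).2.symm.trans (Finset.mem_filter.1 hd).2)]
  exact Finset.card_le_card fun a ha => by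
    obtain ⟨u, -, h⟩ := Finset.mem_biUnion.1 ha
    exact (Finset.mem_filter.1 h).1

end ArcGraph

namespace RAM

open ArcGraph

/-- The memory holds the arcs `N`, and the current graph `X` has all of them. -/
structure Fresh (s : Mem) (N : Net) (X : ArcGraph) : Prop where
  static : Static s N
  rep : Rep s N X
  size : s.var 4 = N.m
  verts : X.A = Finset.range N.n
  arcs : X.L = Finset.range N.m
  tw : X.tw = N.otw
  paths : X.Paths N.m N.otw (s.arr 12) fun _ => False

theorem Built.fresh {s : Mem} {n m : ℕ} {P : List (Sym2 ℕ)} {adj : ℕ → List ℕ}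
    (h : Built s n m P adj) (h0 : s.var 0 = n) (h10 : ∀ v < n, s.arr 10 v = 1) :
    ∃ N X, N.n = n ∧ Fresh s N X ∧ ∀ e, X.mg.mult e = P.count e := by
  let N : Net := ⟨n, m, s.arr 4, s.arr 5, adj, h.own_lt, h.lists.nodup, h.lists.mem⟩
  let X : ArcGraph := ⟨Finset.range n, Finset.range m, s.arr 4, s.arr 5,
    fun a ha => Finset.mem_range.2 (h.own_lt a (Finset.mem_range.1 ha)),
    fun a ha => Finset.mem_range.2 (h.otw a (Finset.mem_range.1 ha)).1,
    fun a ha => (h.otw a (Finset.mem_range.1 ha)).2.1,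
    fun a ha => (h.otw a (Finset.mem_range.1 ha)).2.2⟩
  have hmult : ∀ e, X.mg.mult e = P.count e := fun e => by
    have h1 := two_mul_mult (X := X) e
    have h2 : (X.arcsOf e).card = 2 * P.count e := h.count e
    omega
  have hdeg : ∀ v < n, X.deg v = (adj v).length := fun v hv => by
    rw [← List.toFinset_card_of_nodup (h.lists.nodup v hv), ArcGraph.deg]
    congr 1
    ext a
    rw [mem_arcsAt, List.mem_toFinset, h.lists.mem v hv]
    exact and_congr_left fun _ => Finset.mem_range
  have hz : ∀ a < m, s.arr 12 a = 0 := fun a ha => (h.tw a ha).2.2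
  refine ⟨N, X, rfl, ⟨⟨h0, rfl, rfl, h.lists.list⟩, ⟨rfl, fun v hv => Finset.mem_range.1 hv,
    fun a ha => Finset.mem_range.1 ha, fun v hv => ?_, fun a ha _ => ?_, fun a ha => ?_,
    fun v hv hvA => absurd (Finset.mem_range.2 hv) hvA, fun v hv hl => ?_, fun v hv hl => ?_⟩,
    h.size, rfl, rfl, rfl, ⟨⟨fun a ha => (h.otw a ha).1, fun a ha => (h.otw a ha).2.1,
      fun a ha => (h.otw a ha).2.2, ?_, ?_, ?_, ?_, fun a ha _ _ h' => absurd (hz a ha) h'⟩,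
      fun a ha => Finset.mem_range.1 ha, fun a ha => hz a (Finset.mem_range.1 ha),
      fun a ha h' => absurd (hz a ha) h', fun a _ => ⟨[], rfl, by simp⟩, fun _ _ => id⟩⟩, hmult⟩
  · rw [h10 v hv]
    exact ⟨fun _ => Finset.mem_range.2 hv, fun _ => one_ne_zero⟩
  · exact ⟨fun _ => Finset.mem_range.2 ha, fun _ => (h.tw a ha).2.1⟩
  · exact (h.tw a (Finset.mem_range.1 ha)).1
  · have hv := Finset.mem_range.1 hv
    rw [h.deg v hv, hdeg v hv, ← hmult]
    by_contra h1
    obtain ⟨a, ha, h2⟩ := exists_arc (X := X) (u := v) (v := v) (by omega)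
    exact hl (mem_nbrs.2 ⟨a, ha, h2⟩)
  · have hv := Finset.mem_range.1 hv
    obtain ⟨a, ha, h1, h2⟩ := mem_nbrs.1 hl
    have h3 := mult_pos ha
    rw [h1, h2, hmult] at h3
    rw [h.deg v hv, hdeg v hv]
    omega
  all_goals
    intro a ha b hb
    have := hz a ha
    omega

/-- If every list starts before `M`, the whole graph is built. Otherwise consider the first vertex
whose list is omitted. All vertices before it have at least their full number of arcs, as an edge to
a smaller vertex has been read there. These are at least `M` arcs, and `exists_dense` applies. -/
theorem run_start {s₀ s : Mem} {n k g M : ℕ} {G : Multigraph ℕ} (hin : IsInput s₀ n k g G)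
    (hG : G.verts = Finset.range n) (hG2 : ∀ e, G.mult e ≤ 2) (h0 : s.var 0 = n)
    (h3 : s.var 3 = M) (ha0 : s.arr 0 = s₀.arr 0) (ha1 : s.arr 1 = s₀.arr 1) :
    Run buildProg s fun t s' => (∃ N X, N.n = n ∧ Fresh s' N X ∧ N.m ≤ 2 * (M + 2 * n) ∧
      IsPart G N.m X.own N.otw ∧
      (∀ u v, (X.L.filter fun a => X.own a = u ∧ X.own (N.otw a) = v).card ≤ 4) ∧
      ((∀ v < n, s₀.arr 0 v < M) → X.mg = G) ∧
      ((¬ ∀ v < n, s₀.arr 0 v < M) → ∀ D, 2 * D * n < M → X.Dense N.otw D)) ∧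
      (∀ v < n, s'.arr 13 v = 0) ∧ t ≤ 200 * (M + 3 * n) + 200 := by
  have hlt : ∀ v < n, ∀ u ∈ slice (s.arr 1) (s.arr 0 v) (s.arr 0 (v + 1)), u ∈ Finset.range n := by
    intro v hv u hu
    rw [ha0, ha1, ← List.count_pos_iff, hin.adj v hv u] at hu
    exact hG ▸ G.mem_verts s(v, u) (by omega) u (by simp)
  have hlen : ∀ v < n, s.arr 0 (v + 1) - s.arr 0 v = ∑ u ∈ Finset.range n, G.mult s(v, u) := by
    intro v hv
    rw [← length_slice (s.arr 1), ← Multiset.coe_card,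
      ← Multiset.sum_count_eq_card fun u hu => hlt v hv u (by simpa using hu)]
    refine Finset.sum_congr rfl fun u _ => ?_
    rw [Multiset.coe_count, ha0, ha1, hin.adj v hv u]
  have hmono : ∀ v < n, s.arr 0 v ≤ s.arr 0 (v + 1) := fun v hv => by
    rw [ha0]
    exact hin.start_mono v hv
  -- As multiplicities are at most 2, a list has at most `2 * n` entries.
  refine (run_build (d := 2 * n) h0 h3 hmono (fun v hv => ?_) fun v hv j h1 h2 =>
    Finset.mem_range.1 (hlt v hv _ (mem_slice.2 ⟨j, h1, h2, rfl⟩))).mono fun t s' hf h => ?_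
  · have h1 := hlen v hv
    have h2 : ∑ u ∈ Finset.range n, G.mult s(v, u) ≤ ∑ u ∈ Finset.range n, 2 :=
      Finset.sum_le_sum fun u _ => hG2 _
    rw [Finset.sum_const, Finset.card_range, smul_eq_mul] at h2
    omega
  obtain ⟨⟨m, adj, hB⟩, h1, h2, h4⟩ := h
  obtain ⟨N, X, rfl, hX, hmult⟩ := hB.fresh ((hf.var 0 rfl).trans h0) fun v hv => (h1 v hv).1
  have hm : ∀ x y, x ≤ y → x < N.n → s.arr 0 x < M → X.mg.mult s(x, y) = G.mult s(x, y) := by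
    intro x y h5 h6 h7
    rw [hmult, count_edgesAt h5, if_pos ⟨h6, h7⟩, ha0, ha1, hin.adj x h6]
  have hle : ∀ e, X.mg.mult e ≤ G.mult e := by
    have : ∀ x y, x ≤ y → X.mg.mult s(x, y) ≤ G.mult s(x, y) := by
      intro x y hxy
      by_cases h5 : x < N.n ∧ s.arr 0 x < M
      · exact (hm x y hxy h5.1 h5.2).le
      · rw [hmult, count_edgesAt hxy, if_neg h5]
        exact Nat.zero_le _
    intro e
    induction e with
    | _ x y =>
      rcases le_total x y with h5 | h5
      · exact this x y h5
      · rw [Sym2.eq_swap]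
        exact this y x h5
  have htw : ∀ a, X.own (N.otw a) = X.tgt a := fun a => by rw [← hX.tw]; rfl
  have hL : ∀ a, a < N.m ↔ a ∈ X.L := fun a => by rw [hX.arcs, Finset.mem_range]
  refine ⟨⟨N, X, rfl, hX, by rw [← hX.size]; exact h2, ⟨fun a ha => ?_, fun a ha b hb hab hab' h => ?_⟩,
    fun u v => ?_, fun hall => ?_, fun hall D hD => ?_⟩, fun v hv => (h1 v hv).2, by omega⟩
  · rw [htw]
    exact (mult_pos ((hL a).1 ha)).trans (hle _)
  · rw [htw, htw] at h
    rw [htw]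
    rw [← hX.tw] at hab'
    exact (two_le_mult ((hL a).1 ha) ((hL b).1 hb) hab hab' h).trans (hle _)
  -- The bound is 4 rather than 2 because of loops: a double loop has four arcs from its vertex to
  -- itself.
  · simp only [htw]
    have h5 : (X.L.filter fun a => X.own a = u ∧ X.tgt a = v) ⊆ X.arcsOf s(u, v) := fun a ha => by
      obtain ⟨h6, h7, h8⟩ := Finset.mem_filter.1 ha
      exact mem_arcsOf.2 ⟨h6, by rw [h7, h8]⟩
    have h6 := Finset.card_le_card h5
    have h7 := two_mul_mult (X := X) s(u, v)
    have h8 := hle s(u, v)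
    have h9 := hG2 s(u, v)
    omega
  · rw [← ha0] at hall
    refine Multigraph.ext_of (hX.verts.trans hG.symm) fun e => ?_
    have : ∀ x y, x ≤ y → X.mg.mult s(x, y) = G.mult s(x, y) := by
      intro x y hxy
      by_cases h5 : x < N.n
      · exact hm x y hxy h5 (hall x h5)
      · refine le_antisymm (hle _) (le_of_eq_of_le ?_ (Nat.zero_le _))
        by_contra h6
        exact h5 (Finset.mem_range.1 (hG ▸ G.mem_verts s(x, y) h6 x (by simp)))
    induction e with
    | _ x y =>
      rcases le_total x y with h5 | h5
      · exact this x y h5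
      · rw [Sym2.eq_swap]
        exact this y x h5
  · rw [← ha0] at hall
    push Not at hall
    have hfind := Nat.find_spec hall
    have hmin : ∀ v < Nat.find hall, s.arr 0 v < M := fun v hv => by
      have h5 := Nat.find_min hall hv
      by_contra h6
      exact h5 ⟨hv.trans hfind.1, not_lt.1 h6⟩
    have hsum : ∀ v ≤ Nat.find hall, s.arr 0 v ≤ (X.L.filter fun a => X.own a < v).card := by
      intro v
      induction v with
      | zero => intro _; rw [ha0, hin.start_zero]; exact Nat.zero_le _
      | succ v ih =>
        intro hv
        have hvn : v < N.n := by omega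
        have h5 : (X.L.filter fun a => X.own a < v + 1) =
            (X.L.filter fun a => X.own a < v) ∪ X.arcsAt v := by
          ext a
          rw [Finset.mem_union, Finset.mem_filter, Finset.mem_filter, mem_arcsAt,
            Nat.lt_succ_iff_lt_or_eq]
          tauto
        have h6 : s.arr 0 (v + 1) - s.arr 0 v ≤ (X.arcsAt v).card := by
          rw [hlen v hvn]
          refine (Finset.sum_le_sum fun u _ => ?_).trans (X.sum_mult_le v (Finset.range N.n))
          have hvM := hmin v (by omega)
          rcases le_total v u with h7 | h7
          · exact (hm v u h7 hvn hvM).ge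
          · rw [Sym2.eq_swap, hm u v h7 (by omega) (hmin u (by omega))]
        rw [h5, Finset.card_union_of_disjoint]
        · have := ih (by omega)
          omega
        · rw [Finset.disjoint_left]
          intro a ha hb
          have := (Finset.mem_filter.1 ha).2
          have := (mem_arcsAt.1 hb).2
          omega
    refine exists_dense ?_ fun a _ => by rw [hX.tw]
    rw [hX.verts, Finset.card_range]
    exact hD.trans_le (hfind.2.trans ((hsum _ le_rfl).trans (Finset.card_filter_le _ _)))

end RAM

/-! ### Collecting disjoint cycles in successive reduced graphs. -/

namespace RAM

open ArcGraph Multigraph Relation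

/-- Collect vertex-disjoint cycles that `fp` finds, until there are as many as register 1 says or
`fp` finds no cycle; array 17 holds the vertices of the cycles in the reduced graphs. -/
def phaseProg (fp : Prog) : Prog :=
  .assign 6 (.const 0) ;; .assign 7 (.const 0) ;; .assign 8 (.const 0) ;;
  .store 2 (.const 0) (.const 0) ;; .assign 10 (.const 1) ;;
  .while (.lt (.const 0) (.var 10))
    (reduceProg ;; fp ;;
      .ite (.eq (.var 9) (.const 0)) (.assign 10 (.const 0))
        (emitProg ;; .ite (.eq (.var 6) (.var 1)) (.assign 10 (.const 0)) .skip))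

/-- The first `i` lists in the output are disjoint cycles whose vertices are in `U`. -/
structure Cycles (s : Mem) (G : Multigraph ℕ) (i : ℕ) (U : ℕ → Prop) : Prop where
  ptr : s.arr 2 i = s.var 7
  le : ∀ j ≤ i, s.arr 2 j ≤ s.var 7
  isCycle : ∀ j < i, G.IsCycle (outList s j)
  mem : ∀ j < i, ∀ v ∈ outList s j, U v
  disjoint : ∀ j < i, ∀ l < j, (outList s j).Disjoint (outList s l)

theorem Cycles.congr {s s' : Mem} {G : Multigraph ℕ} {i : ℕ} {U : ℕ → Prop} (h : Cycles s G i U)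
    (h7 : s'.var 7 = s.var 7) (h2 : s'.arr 2 = s.arr 2) (h3 : s'.arr 3 = s.arr 3) :
    Cycles s' G i U := by
  have ho : ∀ j, outList s' j = outList s j := fun j => by rw [outList, h2, h3, outList]
  refine ⟨by rw [h2, h7, h.ptr], by rw [h2, h7]; exact h.le, ?_, ?_, ?_⟩ <;> simp only [ho]
  exacts [h.isCycle, h.mem, h.disjoint]

theorem Cycles.add {s s' : Mem} {G : Multigraph ℕ} {i : ℕ} {U : ℕ → Prop} {W : List ℕ}
    (h : Cycles s G i U) (h2 : s'.arr 2 = Function.update (s.arr 2) (i + 1) (s'.var 7))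
    (h3 : slice (s'.arr 3) 0 (s'.var 7) = slice (s.arr 3) 0 (s.var 7) ++ W) (hW : G.IsCycle W)
    (hU : ∀ v ∈ W, ¬ U v) : Cycles s' G (i + 1) fun v => U v ∨ v ∈ W := by
  have hlen : s'.var 7 = s.var 7 + W.length := by
    have := congrArg List.length h3
    simpa [length_slice] using this
  have hold : ∀ j ≤ i, s'.arr 2 j = s.arr 2 j := fun j hj => by
    rw [h2, Function.update_of_ne (by omega)]
  have hnew : s'.arr 2 (i + 1) = s'.var 7 := by rw [h2, Function.update_self]
  have ho : ∀ j < i, outList s' j = outList s j := fun j hj => by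
    have h5 := h.le (j + 1) hj
    rw [outList, hold j hj.le, hold (j + 1) hj, outList,
      slice_eq_take_drop _ (h5.trans (hlen ▸ Nat.le_add_right _ _)), slice_eq_take_drop _ h5, h3]
    by_cases hle : s.arr 2 j ≤ s.arr 2 (j + 1)
    · rw [List.drop_append_of_le_length (by simpa [length_slice] using hle.trans h5),
        List.take_append_of_le_length (by simp [length_slice]; omega)]
    · rw [show s.arr 2 (j + 1) - s.arr 2 j = 0 by omega, List.take_zero, List.take_zero]
  have hlast : outList s' i = W := by
    rw [outList, hold i le_rfl, hnew, h.ptr, slice_eq_take_drop _ le_rfl, h3,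
      List.drop_left' (by simp [length_slice]), hlen, Nat.add_sub_cancel_left, List.take_length]
  refine ⟨hnew, fun j hj => ?_, fun j hj => ?_, fun j hj v => ?_, fun j hj l hl => ?_⟩
  · rcases Nat.le_succ_iff.1 hj with hj | rfl
    · rw [hold j hj, hlen]
      exact (h.le j hj).trans (Nat.le_add_right _ _)
    · exact hnew.le
  · rcases Nat.lt_succ_iff_lt_or_eq.1 hj with hj | rfl
    · rw [ho j hj]
      exact h.isCycle j hj
    · rwa [hlast]
  · rcases Nat.lt_succ_iff_lt_or_eq.1 hj with hj | rfl
    · rw [ho j hj]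
      exact fun hv => .inl (h.mem j hj v hv)
    · rw [hlast]
      exact .inr
  · rcases Nat.lt_succ_iff_lt_or_eq.1 hj with hj | rfl
    · rw [ho j hj, ho l (by omega)]
      exact h.disjoint j hj l hl
    · rw [hlast, ho l hl]
      exact fun v h1 h2 => hU v h1 (h.mem l hl v h2)

/-- What the phases do not change. -/
structure Kept (s s' : Mem) : Prop where
  var : ∀ x < 5, s'.var x = s.var x
  arr : ∀ x < 2, s'.arr x = s.arr x

/-- What a program that looks for a cycle must not write. -/
structure Finder (fp : Prog) : Prop where
  var : ∀ x ∈ [0, 1, 2, 3, 4, 6, 7, 8, 10], fp.wv x = false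
  arr : ∀ x ∈ [0, 1, 2, 3, 4, 5, 6, 7, 8, 9, 10, 11, 12, 13, 17], fp.wa x = false

/-- The current graph `X` results from the graph `X₀` when the `i` cycles found so far are deleted
and the graph is reduced; `K` is a further property. -/
structure Phase (s₀ s : Mem) (N : Net) (X₀ X : ArcGraph) (G : Multigraph ℕ) (r i : ℕ)
    (K : ℕ → ArcGraph → (ℕ → ℕ) → Prop) : Prop where
  static : Static s N
  rep : Rep s N X
  kept : Kept s₀ s
  count : s.var 6 = i
  extra : K i X (s.arr 13)
  steps : ReflTransGen ElimStep
    (X₀.mg.deleteVerts (slice (s.arr 17) 0 (s.var 8)).toFinset) X.mg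
  lt : ∀ v ∈ slice (s.arr 17) 0 (s.var 8), v < N.n
  size : s.var 8 ≤ r * i
  cycles : ∃ U, X.Paths N.m N.otw (s.arr 12) U ∧ Cycles s G i U

/-- Both phases are instances. `K` is a property of the current graph that reduction preserves and
that may weaken with every deleted cycle, `p` is what the search `fp` guarantees for its cycle, and
`R` is what is known when it finds none. The lifts avoid the set `U` of vertices used before, hence
they are disjoint, and the deleted vertices can be moved in front of all eliminations. -/
theorem run_phase {s : Mem} {N : Net} {X₀ : ArcGraph} {G : Multigraph ℕ} {fp : Prog}
    {k r c : ℕ} {K : ℕ → ArcGraph → (ℕ → ℕ) → Prop} {R : ArcGraph → Prop}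
    {p : ArcGraph → List ℕ → Prop} (hfp : Finder fp) (hX : Fresh s N X₀) (h1 : s.var 1 = k)
    (hk : 0 < k) (hG : IsPart G N.m X₀.own N.otw) (hK : ∀ i, Invariant fun X _ F => K i X F)
    (hkill : ∀ i X F B, i < k → K i X F → X.IsArcCycle B → p X B →
      B.length ≤ r ∧ K (i + 1) (X.kill (B.map X.own).toFinset) F)
    (h0 : K 0 X₀ (s.arr 13))
    (hrun : ∀ i X s', Static s' N → Rep s' N X → Kept s s' → (∀ v, ¬ X.Red v) → K i X (s'.arr 13) →
      Run fp s' fun t s'' => (s''.var 9 = 0 ∧ R X ∨ s''.var 9 ≠ 0 ∧ HasCycle s'' X (p X)) ∧ t ≤ c) :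
    Run (phaseProg fp) s fun t s' => (Kept s s' ∧ ((s'.var 6 = k ∧ ∃ U, Cycles s' G k U) ∨
      s'.var 6 ≠ k ∧ ∃ i X, i < k ∧ Phase s s' N X₀ X G r i K ∧ R X ∧ ∀ v, ¬ X.Red v)) ∧
      t ≤ k * (600 * (N.n + N.m) + c + 600) + 30 := by
  unfold phaseProg
  simp only [run_seq, run_assign, run_store]
  refine Run.while (φ := k * (600 * (N.n + N.m) + c + 600))
    (fun φ s' => (s'.var 10 ≠ 0 ∧ ∃ i X, i < k ∧ Phase s s' N X₀ X G r i K ∧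
        φ = (k - i) * (600 * (N.n + N.m) + c + 600)) ∨
      s'.var 10 = 0 ∧ (Kept s s' ∧ ((s'.var 6 = k ∧ ∃ U, Cycles s' G k U) ∨
      s'.var 6 ≠ k ∧ ∃ i X, i < k ∧ Phase s s' N X₀ X G r i K ∧ R X ∧ ∀ v, ¬ X.Red v)) ∧ φ = 0)
    ?_ ?_ ?_
  · refine .inl ⟨by simp, 0, X₀, hk, ⟨⟨by simpa using hX.static.n, hX.static.own, hX.static.otw,
      hX.static.list⟩, hX.rep.congr rfl rfl rfl rfl, ⟨fun x hx => ?_, fun x hx => ?_⟩, by simp,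
      h0, ?_, ?_, by simp, _, hX.paths, ⟨by simp, ?_, by simp, by simp, by simp⟩⟩, by simp⟩
    · interval_cases x <;> simp
    · interval_cases x <;> simp
    · simp [slice_self, deleteVerts_empty, ReflTransGen.refl]
    · simp [slice_self]
    · intro j hj
      obtain rfl : j = 0 := by omega
      simp
  · rintro φ s₁ h - hb
    have h10 : s₁.var 10 ≠ 0 := by
      have : 0 < s₁.var 10 := by simpa using hb
      omega
    obtain ⟨-, i, X, hik, hP, rfl⟩ := h.resolve_right fun h => h10 h.1
    obtain ⟨U, hU, hC⟩ := hP.cycles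
    set S := slice (s₁.arr 17) 0 (s₁.var 8) with hS
    have hpot : (k - i) * (600 * (N.n + N.m) + c + 600) =
        (k - (i + 1)) * (600 * (N.n + N.m) + c + 600) + (600 * (N.n + N.m) + c + 600) := by
      rw [← Nat.succ_mul]
      congr 1
      omega
    -- Reduction preserves `K`, the paths behind the edges and the derivation of the current graph
    -- simultaneously.
    have hJ : Invariant fun X mate F => K i X F ∧ X.Paths N.m N.otw mate U ∧
        ReflTransGen ElimStep (X₀.mg.deleteVerts S.toFinset) X.mg :=
      ⟨fun X mate F v ⟨j1, j2, j3⟩ hv hd => ⟨(hK i).kill X mate F v j1 hv hd, j2.kill _,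
        j3.tail (elimStep_kill hv hd)⟩, fun X mate F v p q h ⟨j1, j2, j3⟩ =>
        ⟨(hK i).suppress X mate F v p q h j1, j2.suppress h, j3.tail ⟨_, _, elim_suppress h⟩⟩⟩
    simp only [run_seq]
    refine (run_reduce hJ hP.static hP.rep ⟨hP.extra, hU, hP.steps⟩).mono fun t₂ s₂ hf₂ h => ?_
    obtain ⟨hs₂, ⟨Y, hr₂, ⟨hKY, hUY, hsteps⟩, hred⟩, ht₂⟩ := h
    have hk₂ : Kept s s₂ := ⟨fun x hx => by
      rw [← hP.kept.var x hx]; interval_cases x <;> exact hf₂.var _ rfl, fun x hx => by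
      rw [← hP.kept.arr x hx]; interval_cases x <;> exact hf₂.arr _ rfl⟩
    have hC₂ : Cycles s₂ G i U := hC.congr (hf₂.var 7 rfl) (hf₂.arr 2 rfl) (hf₂.arr 3 rfl)
    refine (hrun i Y s₂ hs₂ hr₂ hk₂ hred hKY).mono fun t₃ s₃ hf₃ h => ?_
    obtain ⟨hfound, ht₃⟩ := h
    have hvar : ∀ x ∈ [0, 1, 2, 3, 4, 6, 7, 8, 10], s₃.var x = s₂.var x := fun x hx =>
      hf₃.var x (hfp.var x hx)
    have harr : ∀ x ∈ [0, 1, 2, 3, 4, 5, 6, 7, 8, 9, 10, 11, 12, 13, 17], s₃.arr x = s₂.arr x :=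
      fun x hx => hf₃.arr x (hfp.arr x hx)
    have hs₃ : Static s₃ N := hs₂.of_framed hf₃ (hfp.var 0 (by simp)) (hfp.arr 4 (by simp))
      (hfp.arr 5 (by simp)) (hfp.arr 6 (by simp)) (hfp.arr 7 (by simp))
    have hr₃ : Rep s₃ N Y := hr₂.congr (harr 8 (by simp)) (harr 9 (by simp)) (harr 10 (by simp))
      (harr 11 (by simp))
    have hk₃ : Kept s s₃ := ⟨fun x hx => by
      rw [← hk₂.var x hx]; exact hvar x (by interval_cases x <;> simp), fun x hx => by
      rw [← hk₂.arr x hx]; exact harr x (by interval_cases x <;> simp)⟩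
    have hC₃ : Cycles s₃ G i U :=
      hC₂.congr (hvar 7 (by simp)) (harr 2 (by simp)) (harr 3 (by simp))
    have h6 : s₃.var 6 = i := by rw [hvar 6 (by simp), hf₂.var 6 rfl, hP.count]
    have h8 : s₃.var 8 = s₁.var 8 := by rw [hvar 8 (by simp), hf₂.var 8 rfl]
    have h17 : s₃.arr 17 = s₁.arr 17 := by rw [harr 17 (by simp), hf₂.arr 17 rfl]
    have hS₃ : slice (s₃.arr 17) 0 (s₃.var 8) = S := by rw [h17, h8]
    have hP₃ : Phase s s₃ N X₀ Y G r i K := ⟨hs₃, hr₃, hk₃, h6, by rwa [harr 13 (by simp)],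
      by rwa [hS₃], by rw [hS₃]; exact hP.lt, by rw [h8]; exact hP.size, U,
      by rwa [harr 12 (by simp)], hC₃⟩
    rw [run_ite]
    constructor
    · intro hb
      have hb : s₃.var 9 = 0 := by simpa using hb
      have hR := (hfound.resolve_right fun h => h.1 hb).2
      rw [run_assign]
      refine ⟨0, .inr ⟨by simp, ⟨⟨fun x hx => ?_, hk₃.arr⟩, .inr ⟨by simp [h6]; omega, i, Y, hik,
        ⟨⟨by simpa using hs₃.n, hs₃.own, hs₃.otw, hs₃.list⟩, hr₃.congr rfl rfl rfl rfl,
        ⟨fun x hx => ?_, hk₃.arr⟩, by simpa using h6, hP₃.extra, by simpa using hP₃.steps,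
        by simpa using hP₃.lt, by simpa using hP₃.size, U, by rwa [setVar_arr, harr 12 (by simp)],
        hC₃.congr (by simp) rfl rfl⟩, hR, hred⟩⟩, rfl⟩, ?_⟩
      · rw [← hk₃.var x hx, setVar_var, if_neg (by omega)]
      · rw [← hk₃.var x hx, setVar_var, if_neg (by omega)]
      · simp only [Test.cost, Expr.cost, hpot]
        omega
    · intro hb
      have hb : s₃.var 9 ≠ 0 := by simpa using hb
      obtain ⟨B, hB, hhead, hpar, hpB⟩ := (hfound.resolve_left fun h => hb h.1).2
      obtain ⟨lf, hlf⟩ := hUY.exists_liftFun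
      have e12 : s₃.arr 12 = s₂.arr 12 := harr 12 (by simp)
      obtain ⟨hBr, hKB⟩ := hkill i Y _ B hik hKY hB hpB
      have hown : Y.own = X₀.own := hr₂.own.trans hX.rep.own.symm
      simp only [run_seq]
      refine (run_emit hs₃ hr₃ (by rwa [e12]) (by rwa [e12]) hB hhead hpar).mono fun t₄ s₄ hf₄ h => ?_
      obtain ⟨hs₄, hr₄, a3, a17, v6, a2, ht₄⟩ := h
      have hk₄ : Kept s s₄ := ⟨fun x hx => by
        rw [← hk₃.var x hx]; interval_cases x <;> exact hf₄.var _ rfl, fun x hx => by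
        rw [← hk₃.arr x hx]; interval_cases x <;> exact hf₄.arr _ rfl⟩
      rw [h6] at v6 a2
      rw [hS₃] at a17
      have hC₄ := hC₃.add a2 a3 (hB.isCycle hUY hlf (by rwa [hown]))
        (hUY.expand_not hlf hB.mem)
      have hv8 : s₄.var 8 = s₁.var 8 + B.length := by
        have := congrArg List.length a17
        simpa [hS, length_slice] using this
      have hvA : ∀ v ∈ B.map Y.own, v ∈ Y.A := by
        intro v hv
        obtain ⟨b, hb, rfl⟩ := List.mem_map.1 hv
        exact Y.own_mem b (hB.mem b hb)
      have hk1 : s₄.var 1 = k := (hk₄.var 1 (by simp)).trans h1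
      have hP₄ : Phase s s₄ N X₀ (Y.kill (B.map Y.own).toFinset) G r (i + 1) K := by
        refine ⟨hs₄, hr₄, hk₄, v6, ?_, ?_, fun v hv => ?_, ?_, _, ?_, hC₄⟩
        · rw [hf₄.arr 13 rfl, harr 13 (by simp)]
          exact hKB
        · rw [a17, List.toFinset_append, ← deleteVerts_deleteVerts, mg_kill]
          refine elimSteps_deleteVerts hsteps fun v hv => ?_
          exact hvA v (List.mem_toFinset.1 hv)
        · rw [a17, List.mem_append] at hv
          exact hv.elim (hP.lt v) fun hv => hr₂.A_lt v (hvA v hv)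
        · rw [hv8, Nat.mul_succ]
          exact Nat.add_le_add hP.size hBr
        · rw [hf₄.arr 12 rfl, e12]
          exact hUY.kill_cycle hlf hB.mem
      have htime : t₂ + (t₃ + (t₄ + 50)) ≤ 600 * (N.n + N.m) + c + 600 := by omega
      rw [run_ite]
      constructor
      · intro hb'
        have hb' : i + 1 = k := by simpa [v6, hk1] using hb'
        rw [run_assign]
        refine ⟨0, .inr ⟨by simp, ⟨⟨fun x hx => ?_, hk₄.arr⟩, .inl ⟨by simpa [v6] using hb', _,
          by rw [← hb']; exact hC₄.congr (by simp) rfl rfl⟩⟩, rfl⟩, ?_⟩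
        · rw [← hk₄.var x hx, setVar_var, if_neg (by omega)]
        · simp only [Test.cost, Expr.cost, hpot]
          omega
      · intro hb'
        have hb' : i + 1 ≠ k := by simpa [v6, hk1] using hb'
        rw [run_skip]
        refine ⟨_, .inl ⟨?_, i + 1, _, by omega, hP₄, rfl⟩, ?_⟩
        · rw [hf₄.var 10 rfl, hvar 10 (by simp), hf₂.var 10 rfl]
          exact h10
        · simp only [Test.cost, Expr.cost, hpot]
          omega
  · rintro t φ s' h - hb ht
    have hb : s'.var 10 = 0 := by simpa using hb
    obtain ⟨-, h2, rfl⟩ := h.resolve_left fun h => h.1 hb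
    refine ⟨h2, ?_⟩
    simp only [Test.cost, Expr.cost] at ht ⊢
    omega

end RAM

/-! ### The two phases. -/

namespace RAM

open ArcGraph Multigraph Relation

theorem invariant_thin {N : Net} {D : ℕ} {full : Prop} (hD : 3 ≤ D) :
    Invariant fun X _ _ => (∀ u v, (X.L.filter fun a => X.own a = u ∧
      X.own (N.otw a) = v).card ≤ 4) ∧ (¬ full → X.Dense N.otw D) := by
  refine ⟨fun X mate F v ⟨h1, h2⟩ _ hd => ⟨fun u w => ?_, fun h => (h2 h).kill_of_deg (by omega)⟩,
    fun X mate F v p q h ⟨h1, h2⟩ => ⟨fun u w => ?_, fun hf => (h2 hf).suppress hD h⟩⟩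
  · exact (Finset.card_le_card (Finset.filter_subset_filter _ fun a ha =>
      (mem_kill_L.1 ha).1)).trans (h1 u w)
  · exact (Finset.card_le_card (Finset.filter_subset_filter _ fun a ha =>
      (mem_suppress_L.1 ha).1)).trans (h1 u w)

theorem finder_bfsProg : Finder bfsProg := ⟨by decide, by decide⟩

/-- The search fails on the empty graph only. So if fewer than `k` cycles are found, the graph
without their vertices is eliminated completely, hence sparse. In a truncated graph this cannot
happen, as the dense part outlives fewer than `k` deletions. -/
theorem run_phase_bfs {s : Mem} {N : Net} {X₀ : ArcGraph} {G : Multigraph ℕ} {k : ℕ} {full : Prop}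
    (hX : Fresh s N X₀) (h1 : s.var 1 = k) (hk : 0 < k) (hG : IsPart G N.m X₀.own N.otw)
    (hm : ∀ u v, (X₀.L.filter fun a => X₀.own a = u ∧ X₀.own (N.otw a) = v).card ≤ 4)
    (hd : ¬ full → X₀.Dense N.otw (24 * k + 3)) :
    Run (phaseProg bfsProg) s fun t s' => (Kept s s' ∧ ((s'.var 6 = k ∧ ∃ U, Cycles s' G k U) ∨
      s'.var 6 ≠ k ∧ full ∧ X₀.mg.Sparse (slice (s'.arr 17) 0 (s'.var 8)).toFinset ∧
        s'.var 8 ≤ (2 * Nat.log 2 N.n + 2) * k)) ∧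
      t ≤ k * (1100 * (N.n + N.m) + 1100) + 30 := by
  refine (run_phase (c := 500 * (N.n + N.m) + 500) (r := 2 * Nat.log 2 N.n + 2) (R := fun X => X.A = ∅)
    (p := fun X B => B.length ≤ 2 * Nat.log 2 N.n + 2 ∧ X.Thin (B.map X.own).toFinset)
    (K := fun i X _ => (∀ u v, (X.L.filter fun a => X.own a = u ∧
      -- Every thin cycle costs 24; the remaining 3 protect the dense part from the reduction rules.
      X.own (N.otw a) = v).card ≤ 4) ∧ (¬ full → X.Dense N.otw (24 * (k - i) + 3)))
    finder_bfsProg hX h1 hk hG (fun i => invariant_thin (by omega)) ?_ ⟨hm, hd⟩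
    fun i X s' hs hr _ hred _ => run_bfs hs hr hred).mono fun t s' hf h => ?_
  · rintro i X F B hik ⟨h1, h2⟩ - ⟨h3, h4⟩
    refine ⟨h3, fun u v => ?_, fun hfull => ?_⟩
    · exact (Finset.card_le_card (Finset.filter_subset_filter _ fun a ha =>
        (mem_kill_L.1 ha).1)).trans (h1 u v)
    · have := h2 hfull
      rw [show 24 * (k - i) + 3 = 24 * (k - (i + 1)) + 3 + 24 by omega] at this
      exact this.kill (by omega) h4 h1
  · obtain ⟨⟨hk', h⟩, ht⟩ := h
    refine ⟨⟨hk', h.imp_right ?_⟩, ht.trans ?_⟩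
    · rintro ⟨h6, i, X, hik, hP, hA, -⟩
      refine ⟨h6, ?_, ?_, ?_⟩
      · by_contra hfull
        obtain ⟨Q, hQ, ⟨q, hq⟩, -⟩ := hP.extra.2 hfull
        have := hQ hq
        rw [hA] at this
        exact absurd this (Finset.notMem_empty _)
      · refine (sparse_of_elimSteps hP.steps fun Y hY _ => ?_).of_deleteVerts
        have : Y ⊆ X.A := hY
        rw [hA, Finset.subset_empty] at this
        subst this
        simp [edgesIn]
      · exact hP.size.trans (Nat.mul_le_mul_left _ hik.le)
    · refine Nat.add_le_add_right (Nat.mul_le_mul_left _ ?_) _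
      omega

/-- The marks form a set of at most `f` vertices that makes the rest of the graph sparse. -/
def Marked (f : ℕ) (X : ArcGraph) (F : ℕ → ℕ) : Prop :=
  ∃ T ⊆ X.A, (∀ v ∈ X.A, F v ≠ 0 ↔ v ∈ T) ∧ T.card ≤ f ∧ X.mg.Sparse T

theorem Marked.kill {f : ℕ} {X : ArcGraph} {F : ℕ → ℕ} (h : Marked f X F) (C : Finset ℕ) :
    Marked f (X.kill C) F := by
  obtain ⟨T, hT, hF, hc, hS⟩ := h
  refine ⟨T \ C, Finset.sdiff_subset_sdiff hT le_rfl, fun v hv => ?_,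
    (Finset.card_le_card Finset.sdiff_subset).trans hc, ?_⟩
  · obtain ⟨hv, hC⟩ := Finset.mem_sdiff.1 hv
    rw [hF v hv, Finset.mem_sdiff, and_iff_left hC]
  · rw [mg_kill]
    refine fun Y hY hd => hS.deleteVerts C Y hY (Finset.disjoint_left.2 fun a ha haT => ?_)
    exact Finset.disjoint_left.1 hd ha (Finset.mem_sdiff.2 ⟨haT, (Finset.mem_sdiff.1 (hY ha)).2⟩)

/-- Without the marked vertex `v`, the new edge might violate sparsity. Marking one of its ends
excludes it, and the number of marks does not grow. -/
theorem Marked.suppress {f v p q : ℕ} {X : ArcGraph} {F : ℕ → ℕ} (hF : Marked f X F)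
    (h : X.CanSuppress v p q) : Marked f (X.suppress h) (newMarks F v (X.tgt p)) := by
  obtain ⟨T, hT, hF, hc, hS⟩ := hF
  by_cases hv : F v = 0
  · have hvT : v ∉ T := fun hvT => (hF v h.mem).2 hvT hv
    refine ⟨T, fun u hu => Finset.mem_erase.2 ⟨?_, hT hu⟩, fun u hu => ?_, hc,
      (elim_suppress h).sparse (Finset.erase_subset _ _) (fun hv => absurd hv hvT) hS⟩
    · rintro rfl
      exact hvT hu
    · rw [newMarks, if_pos hv, hF u (Finset.mem_of_mem_erase hu)]
  · have hvT : v ∈ T := (hF v h.mem).1 hv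
    refine ⟨insert (X.tgt p) (T.erase v), fun u hu => ?_, fun u hu => ?_, ?_,
      (elim_suppress h).sparse (Finset.subset_insert _ _) (fun _ _ => ⟨X.tgt p, ?_,
        Finset.mem_insert_self _ _⟩) hS⟩
    · rcases Finset.mem_insert.1 hu with rfl | hu
      · exact Finset.mem_erase.2 ⟨h.tgt_ne.1, tgt_mem h.mem_left.1⟩
      · exact Finset.erase_subset_erase _ hT hu
    · obtain ⟨huv, hu⟩ := Finset.mem_erase.1 hu
      rw [newMarks, if_neg hv, Function.update_apply, Finset.mem_insert, Finset.mem_erase,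
        and_iff_right huv, ← hF u hu]
      split_ifs with hup <;> simp [hup]
    · refine (Finset.card_insert_le _ _).trans ?_
      rwa [Finset.card_erase_add_one hvT]
    · rw [nbrs_eq h]
      simp

theorem finder_shortProg : Finder shortProg := ⟨by decide, by decide⟩

theorem run_phase_short {s : Mem} {N : Net} {X₀ : ArcGraph} {G : Multigraph ℕ} {k g f : ℕ}
    (hX : Fresh s N X₀) (h1 : s.var 1 = k) (hk : 0 < k) (h2 : s.var 2 = g) (h6 : 6 ≤ g)
    (hG : IsPart G N.m X₀.own N.otw) (hF : Marked f X₀ (s.arr 13)) :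
    Run (phaseProg shortProg) s fun t s' => (Kept s s' ∧ ((s'.var 6 = k ∧ ∃ U, Cycles s' G k U) ∨
      s'.var 6 ≠ k ∧ (∀ v ∈ slice (s'.arr 17) 0 (s'.var 8), v < N.n) ∧ s'.var 8 < g * k ∧
        s'.var 8 ≤ N.n * k ∧ ∃ H, (X₀.mg.deleteVerts (slice (s'.arr 17) 0 (s'.var 8)).toFinset).IsReduce H ∧
          (g : ℕ∞) < H.girth)) ∧
      t ≤ k * (1500 * (N.n + N.m) + 400 * (64 * (f + 1) ^ 4 + 2) ^ 3 + 800) + 30 := by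
  -- The bound `g` on the cycle lengths yields `|S| < g * k`; the bound `N.n` keeps the time for
  -- copying `S` independent of `g`.
  refine (run_phase (c := 900 * (N.n + N.m) + 400 * (64 * (f + 1) ^ 4 + 2) ^ 3 + 200) (r := min g N.n)
    (R := fun X => ∀ B, X.IsArcCycle B → g < B.length) (p := fun X B => B.length ≤ g)
    (K := fun _ X F => Marked f X F ∧ X.A ⊆ Finset.range N.n) finder_shortProg hX h1 hk hG
    (fun i => ⟨fun X mate F v ⟨hX, hA⟩ _ _ => ⟨hX.kill _, Finset.sdiff_subset.trans hA⟩,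
      fun X mate F v p q h ⟨hX, hA⟩ => ⟨hX.suppress h, (Finset.erase_subset _ _).trans hA⟩⟩)
    (fun i X F B _ ⟨hX, hA⟩ hc hB => ⟨le_min hB ?_, hX.kill _, Finset.sdiff_subset.trans hA⟩)
    ⟨hF, hX.verts.le⟩ fun i X s' hs hr hk' hred ⟨hM, _⟩ => ?_).mono fun t s' hf h => ?_
  · rw [← List.length_map X.own, ← List.toFinset_card_of_nodup hc.nodup, ← Finset.card_range N.n]
    refine Finset.card_le_card fun v hv => hA ?_
    obtain ⟨b, hb, rfl⟩ := List.mem_map.1 (List.mem_toFinset.1 hv)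
    exact X.own_mem b (hc.mem b hb)
  · obtain ⟨T, hT, hFT, hc, hS⟩ := hM
    have hfil : ∀ inst : DecidablePred fun v => s'.arr 13 v ≠ 0,
        X.A.filter (fun v => s'.arr 13 v ≠ 0) = T := fun inst => by
      ext v
      rw [Finset.mem_filter]
      exact ⟨fun h => (hFT v h.1).1 h.2, fun h => ⟨hT h, (hFT v (hT h)).2 h⟩⟩
    exact run_short (F := fun v => s'.arr 13 v ≠ 0) (f := f) hs hr hred
      ((hk'.var 4 (by simp)).trans hX.size) ((hk'.var 2 (by simp)).trans h2) h6 (fun v => Iff.rfl)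
      (by rwa [hfil]) (by rwa [hfil]) le_rfl
  · obtain ⟨⟨hk', h⟩, ht⟩ := h
    refine ⟨⟨hk', h.imp_right ?_⟩, ht.trans ?_⟩
    · rintro ⟨h6', i, X, hik, hP, hR, hred⟩
      refine ⟨h6', hP.lt, hP.size.trans_lt ?_, hP.size.trans (Nat.mul_le_mul
        (min_le_right _ _) hik.le), X.mg,
        ⟨?_, not_reduceStep (by omega) hR hred⟩, girth_gt hR⟩
      · exact (Nat.mul_le_mul_right _ (min_le_left _ _)).trans_lt
          (Nat.mul_lt_mul_of_pos_left hik (by omega))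
      exact ReflTransGen.mono (fun _ _ h => ElimStep.reduceStep h) _ _ hP.steps
    · refine Nat.add_le_add_right (Nat.mul_le_mul_left _ ?_) _
      omega

end RAM

/-! ### The main program and its running time. -/

namespace RAM

open ArcGraph Multigraph Relation

theorem eval_succ_iterate (s : Mem) (e : Expr) (c : ℕ) :
    (Expr.succ^[c] e).eval s = e.eval s + c := by
  induction c with
  | zero => rfl
  | succ c ih => rw [Function.iterate_succ_apply', Expr.eval, ih, add_assoc]

theorem cost_succ_iterate (e : Expr) (c : ℕ) : (Expr.succ^[c] e).cost = e.cost + c := by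
  induction c with
  | zero => rfl
  | succ c ih => rw [Function.iterate_succ_apply', Expr.cost, ih, add_assoc]

/-- Compute a bound for the number of edges in a graph without `k` disjoint cycles. -/
def boundProg : Prog :=
  .assign 3 (.const 0) ;; .assign 61 (.const 0) ;;
  Prog.for 61 0 (.assign 62 (.const 0) ;;
    -- There is no multiplication, so `64 * k * n` is obtained by `n * k` additions of 64.
    Prog.for 62 1 (.assign 3 (Expr.succ^[64] (.var 3))))

theorem run_bound {s : Mem} {n k : ℕ} (h0 : s.var 0 = n) (h1 : s.var 1 = k) :
    Run boundProg s fun t s' => s'.var 3 = 64 * k * n ∧ t ≤ (80 * k + 20) * n + 20 := by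
  unfold boundProg
  simp only [run_seq, run_assign]
  refine Run.forBound (80 * k + 10) (N := n) (fun i s => s.var 3 = 64 * k * i) rfl rfl (by decide)
    (by simpa using h0) (by simp) (by simp) ?_ ?_
  · intro i s₁ hi hf hx hlt
    have hk : s₁.var 1 = k := by
      rw [hf.var 1 rfl]
      simpa using h1
    rw [run_seq, run_assign]
    refine Run.forBound 67 (N := k) (fun j s => s.var 3 = 64 * k * i + 64 * j) rfl rfl (by decide)
      (by simpa using hk) (by simp) (by simpa using hi) ?_ ?_
    · intro j s₂ hj _ _ _
      rw [run_assign, cost_succ_iterate, eval_succ_iterate]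
      refine ⟨?_, by simp⟩
      simp only [Expr.eval, setVar_var, hj]
      simp
      omega
    · intro t s₂ hj _ _ ht
      refine ⟨?_, ?_⟩
      · simp only [setVar_var, hj]
        simp
        ring
      · simp only [Expr.cost]
        omega
  · intro t s' h _ _ ht
    refine ⟨h, ?_⟩
    simp only [Expr.cost]
    have : (80 * k + 10 + 6) * n ≤ (80 * k + 20) * n := Nat.mul_le_mul_right _ (by omega)
    omega

/-- Mark the vertices in array 17. -/
def markProg : Prog :=
  .assign 63 (.const 0) ;; Prog.for 63 8 (.store 13 (.get 17 (.var 63)) (.const 1))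

theorem mem_slice_succ {f : ℕ → ℕ} {i v : ℕ} :
    v ∈ slice f 0 (i + 1) ↔ v ∈ slice f 0 i ∨ v = f i := by
  rw [slice_succ _ (Nat.zero_le _), List.mem_append, List.mem_singleton]

theorem run_mark {s : Mem} {n : ℕ} (h : ∀ v < n, s.arr 13 v = 0) :
    Run markProg s fun t s' => (∀ v < n, s'.arr 13 v ≠ 0 ↔ v ∈ slice (s.arr 17) 0 (s.var 8)) ∧
      t ≤ 20 * s.var 8 + 5 := by
  unfold markProg
  rw [run_seq, run_assign]
  refine Run.forBound 4 (N := s.var 8)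
    (fun i s' => ∀ v < n, s'.arr 13 v ≠ 0 ↔ v ∈ slice (s.arr 17) 0 i) rfl rfl (by decide)
    (by simp) (by simp) ?_ ?_ ?_
  · intro v hv
    simp [slice_self, h v hv]
  · intro i s₁ hi hf hx _
    have h17 : s₁.arr 17 = s.arr 17 := hf.arr 17 rfl
    rw [run_store]
    refine ⟨fun v hv => ?_, by simp⟩
    rw [mem_slice_succ, ← hi v hv]
    simp only [setVar_arr, setArr_arr, Expr.eval, hx, h17, if_true, Function.update_apply]
    split_ifs with hvi <;> simp [hvi]
  · intro t s' hi _ _ ht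
    refine ⟨hi, ?_⟩
    simp only [Expr.cost]
    omega

/-- Copy array 17 to the output. -/
def copyProg : Prog :=
  .assign 63 (.const 0) ;; Prog.for 63 8 (.store 3 (.var 63) (.get 17 (.var 63)))

theorem run_copy (s : Mem) :
    Run copyProg s fun t s' => slice (s'.arr 3) 0 (s.var 8) = slice (s.arr 17) 0 (s.var 8) ∧
      t ≤ 20 * s.var 8 + 5 := by
  unfold copyProg
  rw [run_seq, run_assign]
  refine Run.forBound 4 (N := s.var 8) (fun i s' => ∀ j < i, s'.arr 3 j = s.arr 17 j) rfl rfl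
    (by decide) (by simp) (by simp) (by simp) ?_ ?_
  · intro i s₁ hi hf hx _
    have h17 : s₁.arr 17 = s.arr 17 := hf.arr 17 rfl
    rw [run_store]
    refine ⟨fun j hj => ?_, by simp⟩
    simp only [setVar_arr, setArr_arr, Expr.eval, hx, h17, if_true, Function.update_apply]
    split_ifs with hji
    · rw [hji]
    · exact hi j (by omega)
  · intro t s' hi _ _ ht
    refine ⟨slice_congr fun j _ hj => hi j hj, ?_⟩
    simp only [Expr.cost]
    omega

theorem Fresh.of_framed {s s' : Mem} {N : Net} {X : ArcGraph} (h : Fresh s N X)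
    (hf : Framed markProg s s') : Fresh s' N X :=
  ⟨h.static.of_framed hf rfl rfl rfl rfl rfl, h.rep.congr (hf.arr 8 rfl) (hf.arr 9 rfl)
    (hf.arr 10 rfl) (hf.arr 11 rfl), (hf.var 4 rfl).trans h.size, h.verts, h.arcs, h.tw, by
    rw [hf.arr 12 rfl]
    exact h.paths⟩

/-- Find disjoint cycles or a small set `S`. -/
def mainProg : Prog :=
  boundProg ;; buildProg ;; phaseProg bfsProg ;;
  .ite (.eq (.var 6) (.var 1)) (.assign 0 (.const 1))
    (buildProg ;; markProg ;; phaseProg shortProg ;;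
      .ite (.eq (.var 6) (.var 1)) (.assign 0 (.const 1))
        (copyProg ;; .assign 1 (.var 8) ;; .assign 0 (.const 0)))

theorem Cycles.answersCycles {s : Mem} {G : Multigraph ℕ} {k : ℕ} {U : ℕ → Prop}
    (h : Cycles s G k U) (h0 : s.var 0 = 1) : AnswersCycles s k G := by
  refine ⟨h0, h.isCycle, fun i hi j hj hij => ?_⟩
  rcases lt_or_gt_of_ne hij with hlt | hlt
  · exact (h.disjoint j hj i hlt).symm
  · exact h.disjoint i hi j hlt

/-- A bound for the running time. -/
def timeBound (n k : ℕ) : ℕ :=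
  let m := 2 * (64 * k * n + 2 * n)
  let f := (2 * Nat.log 2 n + 2) * k
  (80 * k + 20) * n + 2 * (200 * (64 * k * n + 3 * n) + 200) + k * (1100 * (n + m) + 1100) +
    20 * f + k * (1500 * (n + m) + 400 * (64 * (f + 1) ^ 4 + 2) ^ 3 + 800) + 20 * (n * k) + 200

theorem run_main {s : Mem} {n k g : ℕ} {G : Multigraph ℕ} (hk : 0 < k) (hg : 6 < g)
    (hG : G.verts = Finset.range n) (hG2 : ∀ e, G.mult e ≤ 2) (hin : IsInput s n k g G) :
    Run mainProg s fun t s' => (AnswersCycles s' k G ∨ AnswersSet s' k g G) ∧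
      t ≤ timeBound n k := by
  set f := (2 * Nat.log 2 n + 2) * k with hf
  unfold mainProg
  simp only [run_seq]
  refine (run_bound hin.var_zero hin.var_one).mono fun t₁ s₁ hf₁ h => ?_
  obtain ⟨h3, ht₁⟩ := h
  refine (run_start hin hG hG2 ((hf₁.var 0 rfl).trans hin.var_zero) h3 (hf₁.arr 0 rfl)
    (hf₁.arr 1 rfl)).mono fun t₂ s₂ hf₂ h => ?_
  obtain ⟨⟨N, X, hn, hX, hm, hp, hmul, hfull, hdense⟩, -, ht₂⟩ := h
  have h1₂ : s₂.var 1 = k := by rw [hf₂.var 1 rfl, hf₁.var 1 rfl, hin.var_one]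
  have hd : (¬ ∀ v < n, s.arr 0 v < 64 * k * n) → X.Dense N.otw (24 * k + 3) := fun h => by
    refine hdense h _ ?_
    have hn0 : 0 < n := by
      by_contra h0
      exact h fun v hv => by omega
    -- The factor 64 is chosen for this: `2 * (24 * k + 3) < 64 * k` whenever `k ≥ 1`.
    exact Nat.mul_lt_mul_of_pos_right (by omega) hn0
  refine (run_phase_bfs hX h1₂ hk hp hmul hd).mono fun t₃ s₃ _ h => ?_
  obtain ⟨⟨hk₃, h⟩, ht₃⟩ := h
  rw [hn] at h ht₃
  have h1₃ : s₃.var 1 = k := (hk₃.var 1 (by simp)).trans h1₂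
  rw [run_ite]
  have T₃ : t₃ ≤ k * (1100 * (n + 2 * (64 * k * n + 2 * n)) + 1100) + 30 :=
    ht₃.trans (Nat.add_le_add_right (Nat.mul_le_mul_left _ (by omega)) _)
  constructor
  · intro hb
    have hb : s₃.var 6 = k := by simpa [h1₃] using hb
    obtain ⟨-, U, hC⟩ := h.resolve_right fun h => h.1 hb
    rw [run_assign]
    refine ⟨.inl (Cycles.answersCycles (s := s₃.setVar 0 1) (hC.congr (by simp) rfl rfl)
      (by simp)), ?_⟩
    simp only [timeBound, Test.cost, Expr.cost]
    omega
  · intro hb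
    have hb : s₃.var 6 ≠ k := by simpa [h1₃] using hb
    obtain ⟨-, hlt, hS, h8⟩ := h.resolve_left fun h => hb h.1
    rw [← hf] at h8
    have v₃ : ∀ x < 5, x ≠ 4 → s₃.var x = s₁.var x := fun x hx h4 => by
      rw [hk₃.var x hx]
      interval_cases x <;> first | exact hf₂.var _ rfl | exact absurd rfl h4
    have a₃ : ∀ x < 2, s₃.arr x = s.arr x := fun x hx => by
      rw [hk₃.arr x hx]
      interval_cases x <;> exact (hf₂.arr _ rfl).trans (hf₁.arr _ rfl)
    simp only [run_seq]
    -- The first phase has consumed its copy of the graph; the second one needs a fresh copy, with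
    -- the cycle vertices of the first phase as marks.
    refine (run_start hin hG hG2 ((v₃ 0 (by simp) (by simp)).trans
      ((hf₁.var 0 rfl).trans hin.var_zero)) ((v₃ 3 (by simp) (by simp)).trans h3)
      (a₃ 0 (by simp)) (a₃ 1 (by simp))).mono fun t₄ s₄ hf₄ h => ?_
    obtain ⟨⟨N', X', hn', hX', hm', hp', -, hfull', -⟩, h13, ht₄⟩ := h
    rw [hfull hlt] at hS
    refine (run_mark h13).mono fun t₅ s₅ hf₅ h => ?_
    obtain ⟨h13, ht₅⟩ := h
    rw [hf₄.var 8 rfl, hf₄.arr 17 rfl] at h13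
    rw [hf₄.var 8 rfl] at ht₅
    have hM : Marked f X' (s₅.arr 13) := by
      set S := slice (s₃.arr 17) 0 (s₃.var 8)
      refine ⟨X'.A ∩ S.toFinset, Finset.inter_subset_left, fun v hv => ?_, ?_, ?_⟩
      · rw [Finset.mem_inter, and_iff_right hv, List.mem_toFinset]
        rw [hX'.verts, hn', Finset.mem_range] at hv
        exact h13 v hv
      · refine (Finset.card_le_card Finset.inter_subset_right).trans
          ((List.toFinset_card_le _).trans ?_)
        rw [length_slice]
        exact h8
      · rw [hfull' hlt]
        have hXA : X'.A = G.verts := by rw [hX'.verts, hn', hG]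
        refine fun Y hY hd => hS Y hY (Finset.disjoint_left.2 fun a ha haS => ?_)
        exact Finset.disjoint_left.1 hd ha (Finset.mem_inter.2 ⟨hXA ▸ hY ha, haS⟩)
    have v₅ : ∀ x ∈ [1, 2], s₅.var x = s.var x := fun x hx => by
      have : s₅.var x = s₃.var x := by
        fin_cases hx <;> exact (hf₅.var _ rfl).trans (hf₄.var _ rfl)
      rw [this]
      fin_cases hx <;> exact (v₃ _ (by simp) (by simp)).trans (hf₁.var _ rfl)
    have h1₅ : s₅.var 1 = k := (v₅ 1 (by simp)).trans hin.var_one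
    refine (run_phase_short (hX'.of_framed hf₅) h1₅ hk ((v₅ 2 (by simp)).trans hin.var_two) hg.le
      hp' hM).mono fun t₆ s₆ _ h => ?_
    obtain ⟨⟨hk₆, h⟩, ht₆⟩ := h
    rw [hn', hfull' hlt] at h
    rw [hn'] at ht₆
    have T₆ : t₆ ≤ k * (1500 * (n + 2 * (64 * k * n + 2 * n)) +
        400 * (64 * (f + 1) ^ 4 + 2) ^ 3 + 800) + 30 :=
      ht₆.trans (Nat.add_le_add_right (Nat.mul_le_mul_left _ (by omega)) _)
    have h1₆ : s₆.var 1 = k := (hk₆.var 1 (by simp)).trans h1₅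
    rw [run_ite]
    constructor
    · intro hb
      have hb : s₆.var 6 = k := by simpa [h1₆] using hb
      obtain ⟨-, U, hC⟩ := h.resolve_right fun h => h.1 hb
      rw [run_assign]
      refine ⟨.inl (Cycles.answersCycles (s := s₆.setVar 0 1) (hC.congr (by simp) rfl rfl)
        (by simp)), ?_⟩
      simp only [timeBound, Test.cost, Expr.cost, ← hf]
      omega
    · intro hb
      have hb : s₆.var 6 ≠ k := by simpa [h1₆] using hb
      obtain ⟨-, hn₆, hsize, hsize', H, hH, hgirth⟩ := h.resolve_left fun h => hb h.1
      simp only [run_seq]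
      refine (run_copy s₆).mono fun t₇ s₇ hf₇ h => ?_
      obtain ⟨hcopy, ht₇⟩ := h
      simp only [run_assign]
      have hout : outSet ((s₇.setVar 1 (s₇.var 8)).setVar 0 0) =
          (slice (s₆.arr 17) 0 (s₆.var 8)).toFinset := by
        rw [← hcopy, outSet]
        simp [hf₇.var 8 rfl]
      refine ⟨.inr ⟨by simp, ?_⟩, ?_⟩
      · simp only [Expr.eval]
        rw [hout]
        -- One reduction with large girth is known; confluence carries this over to every order of
        -- the rules.
        refine ⟨fun v hv => ?_, ?_, fun H' hH' => hH.girth_lt (by omega) hH' hgirth⟩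
        · rw [hG, Finset.mem_range]
          exact hn₆ v (List.mem_toFinset.1 hv)
        · refine (List.toFinset_card_le _).trans_lt ?_
          rw [length_slice]
          exact hsize
      · simp only [timeBound, Test.cost, Expr.cost, ← hf]
        omega

/-- For `q = ⌊log n / 12⌋` one has `log n + 1 ≤ 12 (q + 1) ≤ 12 * 2 ^ q`, and `2 ^ (12 q) ≤ n`. -/
theorem log_add_one_pow_le {n : ℕ} (hn : 0 < n) : (Nat.log 2 n + 1) ^ 12 ≤ 12 ^ 12 * n := by
  have h1 : Nat.log 2 n + 1 ≤ 12 * 2 ^ (Nat.log 2 n / 12) := by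
    have : Nat.log 2 n / 12 < 2 ^ (Nat.log 2 n / 12) := Nat.lt_two_pow_self
    omega
  calc (Nat.log 2 n + 1) ^ 12 ≤ (12 * 2 ^ (Nat.log 2 n / 12)) ^ 12 := Nat.pow_le_pow_left h1 _
    _ = 12 ^ 12 * 2 ^ (Nat.log 2 n / 12 * 12) := by rw [mul_pow, ← pow_mul]
    _ ≤ 12 ^ 12 * n := Nat.mul_le_mul_left _ ((Nat.pow_le_pow_right (by omega)
        (Nat.div_mul_le_self _ _)).trans (Nat.pow_log_le_self 2 hn.ne'))

/-- Filling a table of size of order `f ^ 4` costs its cube, of order `f ^ 12`, with `f` of order `k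
log n`. At most `k` tables make `k ^ 13 (log n) ^ 12`, where the logarithms are absorbed by one
factor `n`. All other terms are at most of order `k ^ 2 n`. -/
theorem exists_timeBound : ∃ A, ∀ n k, 0 < n → 0 < k → timeBound n k ≤ A * k ^ 13 * n := by
  obtain ⟨D, hD⟩ : ∃ D, D = 400 * 66 ^ 3 * (3 ^ 12 * 12 ^ 12) := ⟨_, rfl⟩
  refine ⟨1000000 + D, fun n k hn hk => ?_⟩
  have hkn : 0 < k * n := Nat.mul_pos hk hn
  have hk2 : k * n ≤ k * (k * n) := Nat.le_mul_of_pos_left _ hk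
  have hk13 : k * (k * n) ≤ k ^ 13 * n := by
    rw [← mul_assoc, ← sq]
    exact Nat.mul_le_mul_right _ (Nat.pow_le_pow_right hk (by omega))
  have hn1 : n ≤ k * n := Nat.le_mul_of_pos_left _ hk
  have hk1 : k ≤ k * n := Nat.le_mul_of_pos_right _ hn
  have hlog : Nat.log 2 n * k ≤ k * n := by
    rw [mul_comm]
    exact Nat.mul_le_mul_left _ (Nat.log_le_self 2 n)
  have hE : 400 * (64 * ((2 * Nat.log 2 n + 2) * k + 1) ^ 4 + 2) ^ 3 ≤ D * (k ^ 12 * n) := by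
    set x := (2 * Nat.log 2 n + 2) * k + 1 with hx
    have hx1 : 1 ≤ x ^ 4 := Nat.one_le_pow _ _ (by omega)
    have hx2 : x ≤ 3 * (Nat.log 2 n + 1) * k := by
      have : 1 ≤ (Nat.log 2 n + 1) * k := Nat.mul_pos (by omega) hk
      rw [mul_assoc, show x = 2 * ((Nat.log 2 n + 1) * k) + 1 by rw [hx]; ring]
      omega
    calc 400 * (64 * x ^ 4 + 2) ^ 3 ≤ 400 * (66 * x ^ 4) ^ 3 :=
          Nat.mul_le_mul_left _ (Nat.pow_le_pow_left (by omega) _)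
      _ = 400 * 66 ^ 3 * x ^ 12 := by rw [mul_pow, ← pow_mul, mul_assoc]
      _ ≤ 400 * 66 ^ 3 * (3 * (Nat.log 2 n + 1) * k) ^ 12 :=
          Nat.mul_le_mul_left _ (Nat.pow_le_pow_left hx2 _)
      _ = 400 * 66 ^ 3 * (3 ^ 12 * (Nat.log 2 n + 1) ^ 12 * k ^ 12) := by rw [mul_pow, mul_pow]
      _ ≤ 400 * 66 ^ 3 * (3 ^ 12 * (12 ^ 12 * n) * k ^ 12) :=
          Nat.mul_le_mul_left _ (Nat.mul_le_mul_right _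
            (Nat.mul_le_mul_left _ (log_add_one_pow_le hn)))
      _ = D * (k ^ 12 * n) := by rw [hD]; ring
  have hE' := Nat.mul_le_mul_left k hE
  obtain ⟨E, hEd⟩ : ∃ E, E = 400 * (64 * ((2 * Nat.log 2 n + 2) * k + 1) ^ 4 + 2) ^ 3 := ⟨_, rfl⟩
  rw [← hEd] at hE'
  have e1 : k * (D * (k ^ 12 * n)) = D * (k ^ 13 * n) := by ring
  rw [e1] at hE'
  calc timeBound n k ≤ 350000 * (k * (k * n)) + 50000 * (k * n) + 1000 + k * E := by
        have h : timeBound n k = 332800 * (k * (k * n)) + 38700 * (k * n) + 40 * (Nat.log 2 n * k) +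
            1220 * n + 1940 * k + 600 + k * E := by
          simp only [timeBound, ← hEd]
          ring
        omega
    _ ≤ _ := by
      rw [mul_assoc, add_mul]
      omega

end RAM

theorem lemma2 :
    ∃ (P : RAM.Prog) (C : ℕ), ∀ (n k g : ℕ) (G : Multigraph ℕ),
      0 < n → 0 < k → 6 < g → G.verts = Finset.range n → (∀ e, G.mult e ≤ 2) →
      ∀ s : RAM.Mem, RAM.IsInput s n k g G →
        ∃ (t : ℕ) (s' : RAM.Mem), RAM.Exec P s t s' ∧ t ≤ C * k ^ C * n ∧
          (RAM.AnswersCycles s' k G ∨ RAM.AnswersSet s' k g G) := by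
  obtain ⟨A, hA⟩ := RAM.exists_timeBound
  -- A single constant serves as the factor, at least `A`, and as the exponent, at least 13.
  refine ⟨RAM.mainProg, A + 13, fun n k g G hn hk hg hG hG2 s hin => ?_⟩
  obtain ⟨t, s', he, h, ht⟩ := RAM.run_main hk hg hG hG2 hin
  refine ⟨t, s', he, (ht.trans (hA n k hn hk)).trans (Nat.mul_le_mul_right _ ?_), h⟩
  exact Nat.mul_le_mul (Nat.le_add_right _ _) (Nat.pow_le_pow_right hk (Nat.le_add_left _ _))
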